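/- **Setting.** Let $T=\mathbb R/\mathbb Z=[0,1[$ be the unit circle, $h(\beta)=2\beta \bmod 1$, and let $\beta_1\beta_2$ be the chord of the unit disk with ends $\beta_1,\beta_2\in T$; $h(\beta_1\beta_2)=h(\beta_1)h(\beta_2)$, and iterates include the $0$-th one. The length of a chord is the length of the shorter arc between its ends. Two chords *cross* if they are different and meet in the open disk. A chord $C$ is *behind* a chord $B$ of length less than $\frac12$ if some point of $C$ lies in the smaller open part of the disk cut off by $B$ and none in the bigger one. $C$ is *between* two different non-crossing chords $B_1,B_2$ if it lies in the closed part of the disk bounded by $B_1,B_2$ and is different from both; $S_3$ *separates* $S_1,S_2$ if $S_3$ is between $S_1,S_2$ but $S_2$ is not between $S_1,S_3$. Arcs $]a,b[$ are taken counter-clockwise. *Parameter lamination.* $\mathcal B_*$ is the set of periodic leaves of the quadratic minor lamination: non-degenerate chords $S=\alpha\gamma$ whose ends both have exact period $m>1$ under $h$ (the period of $S$), whose iterates do not cross each other and do not cross the diameters $\frac\alpha2\frac{\alpha+1}2$, $\frac\gamma2\frac{\gamma+1}2$. (Equivalently, $\alpha,\gamma$ are the two periodic external angles of the root of a hyperbolic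 component of period $m>1$ of the Mandelbrot set.) $B\in\mathcal B_*$ is *visible* from $S\in\mathcal B_*$ if $B$ is behind $S$ and no leaf of $\mathcal B_*$ of period less than that of $B$ separates $S,B$; it is *immediately visible* if it is behind $S$ and no leaf of $\mathcal B_*$ at all separates $S,B$. *Dynamic lamination.* Let $S\in\mathcal B_*$ have period $m$. Let $\dot S=h^{m-1}(S)$ and let $\ddot S$ be its image under $\beta\mapsto\beta+\frac12$. $\mathcal B_*(S)$ is the set of chords $R$ such that some iterate of $R$ is $S$, no iterate of $R$ is longer than $\dot S,\ddot S$ or crosses one of them, and no iterate of $R$ between $\dot S$ and $\ddot S$ has an end in common with them; $\mathcal B(S)$ is $\mathcal B_*(S)$ together with its non-degenerate accumulation chords. Let $\alpha$ be the smaller end of $S$ in $[0,1[$. For $R\in\mathcal B_*(S)$, $L_0(R)$ and $L_1(R)$ are the preimages of $R$ in $\mathcal B_*(S)$ with at least one end in $]\frac\alpha2,\frac{\alpha+1}2[$, respectively in $]\frac{\alpha+1}2,\frac\alpha2[$, and $L_{w_1\dots w_k}=L_{w_1}\circ\dots\circ L_{w_k}$. Let $e\in\{0,1\}$ be the symbol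 with $\ddot S=L_e(S)$, and $\mathbf v=v_1\dots v_{m-1}$ the word with $S=L_{\mathbf v}(\dot S)$. A *dynamic pair* is a pair $(S_1,S_2)$ with $S_1$ not shorter than $S_2$ and $\{S_1,S_2\}=\{L_{\mathbf w0}(S),L_{\mathbf w1}(S)\}$ for a $0$-$1$-word $\mathbf w$ not ending with $\mathbf v$; its *Step* is the least $n$ with $h^n(S_1)=h^n(S_2)=S$. The pair is *visible* from a leaf $R$ if $S_2$ is behind $R$ and there is no dynamic pair $(Q_1,Q_2)$ of smaller Step such that $Q_1=R$ or $Q_1$ separates $R,S_1$. The *critical value gap* of $\mathcal B(S)$ is the gap bounded by $S$ and lying behind $S$. For $B\in\mathcal B_*$ immediately visible from $S$ and of period $qm$, $q\ge2$, let $R_B$ be the boundary leaf of this gap that is first mapped to $S$ after $(q-1)m$ iterates, lies behind $B$, and has behind it every leaf of $\mathcal B_*$ that is behind $B$ and visible from $S$. The *kneading sequence* of $\beta\in T$ is $s_1s_2\dots$ with $s_i=0$ if $h^{i-1}(\beta)\in\,]\frac\beta2,\frac{\beta+1}2[$, $s_i=1$ if $h^{i-1}(\beta)\in\,]\frac{\beta+1}2,\frac\beta2[$,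 and $s_i=*$ otherwise. A chord has a given kneading sequence if both its ends have it. $\overline{\mathbf w}$ denotes $\mathbf w\mathbf w\mathbf w\dots$. **Statement.** Let $S\in\mathcal B_*$ be of period $m$, let $\mathbf v,e$ belong to $S$ as above, let $B\in\mathcal B_*$ be immediately visible from $S$ and of period $qm$ for some $q\ge2$, and let $(S_1,S_2)$ be a dynamic pair in $\mathcal B_*(S)$ visible from $R_B$ and of Step $jm+k\ge2$, with $j<q$ and $0\le k<m$. Then: (i) $j=q-2$ or $j=q-1$, and $k\neq0$. (ii) $S_1$ has kneading sequence $(\mathbf ve)^jv_1v_2\dots v_k\overline{\mathbf v(1-e)}$, and $S_2$ has kneading sequence $(\mathbf ve)^jv_1v_2\dots v_{k-1}(1-v_k)\overline{\mathbf v(1-e)}$. (iii) There is a unique leaf $Q\in\mathcal B_*$ of period $jm+k$ between $S_1$ and $S_2$. It has kneading sequence $\overline{(\mathbf ve)^jv_1v_2\dots v_{k-1}*}$, it is visible from $S$ and separates $S_1$ and $S_2$, and it is the only leaf of $\mathcal B_*$ visible from $S$ that separates $S_1$ and $S_2$. -/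

import Mathlib

namespace QuadLam

noncomputable section

open Filter Topology

/-! ### Angles, arcs and chords -/

/-- The circle `ℝ/ℤ` of angles. -/
abbrev Angle : Type := UnitAddCircle

/-- The representative of an angle in `[0,1)`. -/
def rep (x : Angle) : ℝ := (AddCircle.equivIco (1 : ℝ) 0 x : ℝ)

/-- Angle doubling. -/
def dbl (x : Angle) : Angle := x + x

/-- The angle `α/2`, for `α` represented in `[0,1)`. -/
def half (x : Angle) : Angle := ((rep x / 2 : ℝ) : Angle)

/-- The angle `1/2`; thus `(α+1)/2` is `half α + oneHalf`. -/
def oneHalf : Angle := ((1 / 2 : ℝ) : Angle)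

/-- The counter-clockwise distance from `a` to `x`, an element of `[0,1)`. -/
def ccw (a x : Angle) : ℝ := rep (x - a)

/-- The open arc `]a,b[`, taken counter-clockwise. -/
def openArc (a b : Angle) : Set Angle := {x | 0 < ccw a x ∧ ccw a x < ccw a b}

/-- The closed arc `[a,b]`, taken counter-clockwise. -/
def closedArc (a b : Angle) : Set Angle := {x | ccw a x ≤ ccw a b}

/-- A chord of the unit disk, given by the unordered pair of its ends. -/
abbrev Chord : Type := Sym2 Angle

/-- The action of angle doubling on chords. -/
def dblC : Chord → Chord := Sym2.map dbl

/-- The length of a chord: the length of the shorter arc between its ends (the metric of `ℝ/ℤ`). -/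
def chordLength : Chord → ℝ := Sym2.lift ⟨fun a b => dist a b, fun a b => dist_comm a b⟩

/-- The diameter with ends `α/2` and `(α+1)/2`. -/
def diameter (x : Angle) : Chord := s(half x, half x + oneHalf)

/-- Two chords cross: they are different and meet in the open disk, i.e. the ends of `C` lie
strictly on different sides of `B`. -/
def Crosses (B C : Chord) : Prop :=
  ∃ a b c d, B = s(a, b) ∧ C = s(c, d) ∧ c ∈ openArc a b ∧ d ∈ openArc b a

/-- `C` is behind `B` (which is shorter than `1/2`): no point of `C` is in the bigger open part of
the disk cut by `B`, and some point of `C` is in the smaller open part. -/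
def Behind (C B : Chord) : Prop :=
  ∃ a b, B = s(a, b) ∧ ccw a b < 1 / 2 ∧
    (∀ x ∈ C, x ∈ closedArc a b) ∧ ∃ x ∈ C, x ∈ openArc a b

/-- The chord `C` is between the different, non-crossing chords `B₁`, `B₂`: it lies in the closed
part of the disk bounded by `B₁` and `B₂` and is different from both. Here `[a,b]` is the side of
`B₁` containing `B₂`, and `[c,d]` is the side of `B₂` containing `B₁`. -/
def Between (C B₁ B₂ : Chord) : Prop :=
  C ≠ B₁ ∧ C ≠ B₂ ∧ B₁ ≠ B₂ ∧
    ∃ a b c d, B₁ = s(a, b) ∧ B₂ = s(c, d) ∧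
      c ∈ closedArc a b ∧ d ∈ closedArc a b ∧ a ∈ closedArc c d ∧ b ∈ closedArc c d ∧
      ∀ x ∈ C, x ∈ closedArc a b ∧ x ∈ closedArc c d

/-- `S₃` separates `S₁` and `S₂`. -/
def Separates (S₃ S₁ S₂ : Chord) : Prop := Between S₃ S₁ S₂ ∧ ¬ Between S₂ S₁ S₃

/-! ### The parameter laminations -/

/-- The non-degenerate leaves of the quadratic minor lamination: the iterates of `S` do not cross
each other, and they do not cross the diameters defined by the two ends of `S`. -/
def IsMinorLeaf (S : Chord) : Prop :=
  ¬ S.IsDiag ∧ (∀ i j : ℕ, ¬ Crosses (dblC^[i] S) (dblC^[j] S)) ∧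
    ∀ i : ℕ, ∀ x ∈ S, ¬ Crosses (dblC^[i] S) (diameter x)

/-- `S` is a periodic parameter leaf of period `m > 1`. -/
def IsParamLeaf (m : ℕ) (S : Chord) : Prop :=
  1 < m ∧ IsMinorLeaf S ∧ ∀ x ∈ S, Function.minimalPeriod dbl x = m

/-- `B` is immediately visible from `S`. -/
def ImmediatelyVisible (S B : Chord) : Prop :=
  Behind B S ∧ ∀ p C, IsParamLeaf p C → ¬ Separates C S B

/-- The periodic parameter leaf `B` of period `n` is visible from `S`. -/
def Visible (S : Chord) (n : ℕ) (B : Chord) : Prop :=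
  Behind B S ∧ ∀ p C, IsParamLeaf p C → p < n → ¬ Separates C S B

/-! ### The dynamic laminations of a periodic parameter leaf `S` of period `m` -/

/-- The preimage of `S` with periodic ends, which is the iterate of order `m - 1` of `S`. -/
def dotLeaf (m : ℕ) (S : Chord) : Chord := dblC^[m - 1] S

/-- The preimage of `S` with preperiodic ends, antipodal to `dotLeaf m S`. -/
def ddotLeaf (m : ℕ) (S : Chord) : Chord := Sym2.map (fun x => x + oneHalf) (dotLeaf m S)

/-- The generating dynamic lamination of `S`. -/
def genLam (m : ℕ) (S : Chord) : Set Chord :=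
  {R | (∃ i : ℕ, dblC^[i] R = S) ∧ ∀ i : ℕ,
    chordLength (dblC^[i] R) ≤ chordLength (dotLeaf m S) ∧
    chordLength (dblC^[i] R) ≤ chordLength (ddotLeaf m S) ∧
    ¬ Crosses (dblC^[i] R) (dotLeaf m S) ∧ ¬ Crosses (dblC^[i] R) (ddotLeaf m S) ∧
    (Between (dblC^[i] R) (dotLeaf m S) (ddotLeaf m S) →
      ∀ x ∈ dblC^[i] R, x ∉ dotLeaf m S ∧ x ∉ ddotLeaf m S)}

/-- `C` is a non-degenerate accumulation chord of `A`: the limit of a converging sequence of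
mutually different elements of `A`. -/
def IsAccChord (A : Set Chord) (C : Chord) : Prop :=
  ∃ (u : ℕ → Angle × Angle) (c d : Angle), C = s(c, d) ∧ c ≠ d ∧
    (∀ n, s((u n).1, (u n).2) ∈ A) ∧
    Function.Injective (fun n => s((u n).1, (u n).2)) ∧ Tendsto u atTop (𝓝 (c, d))

/-- The entire dynamic lamination of `S`. -/
def entireLam (m : ℕ) (S : Chord) : Set Chord :=
  genLam m S ∪ {C | IsAccChord (genLam m S) C}

/-- The open arc carrying the symbol `s` for the angle `α`: `]α/2,(α+1)/2[` for the symbol `0`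
(`false`) and `](α+1)/2,α/2[` for the symbol `1` (`true`). -/
def symbolArc (x : Angle) (s : Bool) : Set Angle :=
  if s then openArc (half x + oneHalf) (half x) else openArc (half x) (half x + oneHalf)

/-- The arc carrying the symbol `s`, formed with the smaller end (in `[0,1)`) of `S`. -/
def sideArc (S : Chord) (s : Bool) : Set Angle :=
  {y | ∃ a b, S = s(a, b) ∧ rep a ≤ rep b ∧ y ∈ symbolArc a s}

/-- `IsL m S w R R'` means `R' = L_w(R)`, where `L_s(R)` is the preimage of `R` in the dynamic
lamination of `S` with at least one end in the open arc carrying `s`, and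
`L_{w₁w₂…w_k} = L_{w₁} ∘ L_{w₂} ∘ ⋯ ∘ L_{w_k}`. -/
def IsL (m : ℕ) (S : Chord) : List Bool → Chord → Chord → Prop
  | [], R, R' => R' = R
  | s :: w, R, R' => ∃ R₁, IsL m S w R R₁ ∧ R' ∈ genLam m S ∧ dblC R' = R₁ ∧
      ∃ x ∈ R', x ∈ sideArc S s

/-- `e` is the symbol with `ddotLeaf m S = L_e(S)`. -/
def IsSymbolE (m : ℕ) (S : Chord) (e : Bool) : Prop := IsL m S [e] S (ddotLeaf m S)

/-- `v` is the word of length `m - 1` with `S = L_v(dotLeaf m S)`. -/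
def IsWordV (m : ℕ) (S : Chord) (v : List Bool) : Prop :=
  v.length = m - 1 ∧ IsL m S v (dotLeaf m S) S

/-- `R ≠ S` is a boundary leaf of the critical value gap, i.e. of the gap of the entire dynamic
lamination that is bounded by `S` and lies behind `S`: the leaf `R` lies behind `S`, and no leaf of
the lamination separates it from `S`. -/
def IsBoundaryLeaf (m : ℕ) (S R : Chord) : Prop :=
  R ∈ entireLam m S ∧ Behind R S ∧ ∀ X ∈ entireLam m S, ¬ Separates X S R

/-- `R` is the boundary leaf `R_B` of the critical value gap assigned to a leaf `B` of period
`q * m` that is immediately visible from `S`. -/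
def IsRB (m : ℕ) (S : Chord) (q : ℕ) (B R : Chord) : Prop :=
  IsBoundaryLeaf m S R ∧
  (dblC^[(q - 1) * m] R = S ∧ ∀ i < (q - 1) * m, dblC^[i] R ≠ S) ∧
  Behind R B ∧
  ∀ p C, IsParamLeaf p C → Behind C B → Visible S p C → Behind C R

/-- `(S₁, S₂)` is a dynamic pair of `S`, where `v` is the word assigned to `S`. -/
def IsDynamicPair (m : ℕ) (S : Chord) (v : List Bool) (S₁ S₂ : Chord) : Prop :=
  chordLength S₂ ≤ chordLength S₁ ∧
    ∃ (w : List Bool) (b : Bool), ¬ v <:+ w ∧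
      IsL m S (w ++ [b]) S S₁ ∧ IsL m S (w ++ [!b]) S S₂

/-- `n` is the step of `(S₁, S₂)`. -/
def IsStep (S S₁ S₂ : Chord) (n : ℕ) : Prop :=
  IsLeast {i : ℕ | dblC^[i] S₁ = S ∧ dblC^[i] S₂ = S} n

/-- The dynamic pair `(S₁, S₂)` of step `n` is visible from `R`. -/
def PairVisible (m : ℕ) (S : Chord) (v : List Bool) (R S₁ S₂ : Chord) (n : ℕ) : Prop :=
  Behind S₂ R ∧ ¬ ∃ Q₁ Q₂ i, IsDynamicPair m S v Q₁ Q₂ ∧ IsStep S Q₁ Q₂ i ∧ i < n ∧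
    (Q₁ = R ∨ Separates Q₁ R S₁)

/-! ### Kneading sequences -/

open Classical in
/-- The kneading sequence of an angle, indexed from `0`; `none` is the symbol `∗`. -/
def kneading (x : Angle) (n : ℕ) : Option Bool :=
  if dbl^[n] x ∈ symbolArc x false then some false
  else if dbl^[n] x ∈ symbolArc x true then some true
  else none

/-- `σ` is the kneading sequence of the chord `B`: that of its ends. -/
def HasKneading (B : Chord) (σ : ℕ → Option Bool) : Prop := ∀ x ∈ B, kneading x = σ

/-- The sequence that starts with the word `u` and continues with the word `p` repeated for ever
(`p` is not empty). -/
def wordThenRepeat (u p : List (Option Bool)) (n : ℕ) : Option Bool :=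
  if n < u.length then u.getD n none else p.getD ((n - u.length) % p.length) none

/-- The word `(ve)^j`. -/
def powWord (v : List Bool) (e : Bool) (j : ℕ) : List Bool := (List.replicate j (v ++ [e])).flatten

/-- A word over `{0,1}` as a word over `{0,1,∗}`. -/
def symWord (w : List Bool) : List (Option Bool) := w.map some

end

end QuadLam

/-!
Angles are handled through the coordinate `ccw o x`, the length of the counter-clockwise arc from
`o` to `x`. In these terms a leaf `S = s(α, γ)`, with smaller arc `[α, γ]`, is described by
`QuadLam.Leaf`: all iterates of its two ends avoid the open arc, and the ends have a common
itinerary `κ` relative to every angle behind the leaf (`QuadLam.Leaf.mem`); over one period, `κ` is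
the word `v` followed by the symbol `!e`.

*Parameter leaves.* An angle behind a leaf never has the itinerary of the leaf relative to itself
(`QuadLam.Leaf.not_mem_self`), and if it has this itinerary relative to another angle behind the
leaf, then it is close to one of the ends (`QuadLam.Leaf.near_of_mem`). Conversely, pull an arc
back along a word whose last symbol is the wrong one for the ends of the arc. The pull-back
contains the arc, so that iterating it yields an arc bounded by two fixed points of `h^t`
(`QuadLam.exists_fixed_arc`), and these span a parameter leaf of period at most `t`
(`QuadLam.exists_isParamLeaf_of_fixed_arc`). Apply this at the first place where the itinerary of a
leaf behind `S` deviates from the tuned sequence `v e v e …`: either there is none before the last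
entry, or a leaf of smaller period separates the given leaf from `S`
(`QuadLam.Leaf.tuned_or_exists_separating`). Visible leaves therefore follow the tuned sequence up
to the last entry of their period, and the immediately visible leaf `B` follows it throughout
(`QuadLam.Leaf.tuned_of_immediatelyVisible`).

*Dynamic pairs.* The four preimages of the ends of `S` cut the circle into two lobes, which are the
preimages of the bigger arc, and two strips between them, which are the preimages of the smaller
arc. The two chords of a dynamic pair are `s(c₁, d₂)` and `s(c₂, d₁)`, where `h^n` maps the arcs
`[c₁, c₂]` and `[d₁, d₂]` onto the two strips and `n + 1` is the Step (`QuadLam.StripPair`). The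
boundary leaf `R_B` follows the tuned sequence as well, staying in the lobes except at the returns
(`QuadLam.Leaf.boundaryOrbit`). A visible pair stays in the same pieces as `R_B` up to the time
`n`: otherwise a chord that bounds the lobe it leaves could be pulled back to a dynamic pair of
smaller Step that hides it (`QuadLam.Leaf.sixTogether_of_visible`). At the time `n` the iterate of
`R_B` surrounds both strips, so it is at least as long as `S`, and it remains so until the next
return. A return other than the last one takes place inside a strip, where there is no room for
such a chord; hence (i) (`QuadLam.Leaf.last_return`). The lobes visited by the four ends are now
known, which gives (ii) (`QuadLam.VisiblePair.kneading_pair`).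

*The leaf between the two chords.* The iterate `h^(n+1)` maps each of the arcs `[c₁, c₂]` and
`[d₁, d₂]` linearly onto `[α, γ]`, which contains both of them. So there is one fixed point of
`h^(n+1)` in each, and these two are the ends of a parameter leaf of period `n + 1`
(`QuadLam.VisiblePair.isParamLeaf_fixedPair`), the only one in that place
(`QuadLam.VisiblePair.eq_of_between`). It is visible: a leaf of smaller period that separated it
from `S` would either separate `B` from `S`, or contradict `QuadLam.Leaf.not_mem_self`
(`QuadLam.VisiblePair.visible_fixedPair`). Any other visible leaf that separates the two chords has
a greater period; its iterate of order `n + 1` is a chord between it and `S`, and following this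
nesting up to the end of its period or up to the next return of `S` leads to a contradiction
(`QuadLam.VisiblePair.eq_of_visible`).
-/


namespace QuadLam

open Filter Topology

/-! ### Angles in coordinates -/

lemma rep_coe (t : ℝ) : rep ((t : ℝ) : Angle) = Int.fract t := by
  simp [rep]

lemma coe_rep (x : Angle) : ((rep x : ℝ) : Angle) = x := by
  simp [rep]

lemma rep_nonneg (x : Angle) : 0 ≤ rep x := by
  rw [← coe_rep x, rep_coe]; exact Int.fract_nonneg _

lemma rep_lt_one (x : Angle) : rep x < 1 := by
  rw [← coe_rep x, rep_coe]; exact Int.fract_lt_one _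

lemma ccw_nonneg (a x : Angle) : 0 ≤ ccw a x := rep_nonneg _

lemma ccw_lt_one (a x : Angle) : ccw a x < 1 := rep_lt_one _

lemma add_ccw (a x : Angle) : a + ((ccw a x : ℝ) : Angle) = x := by
  rw [ccw, coe_rep]; abel

lemma ccw_add (a : Angle) (t : ℝ) : ccw a (a + (t : Angle)) = Int.fract t := by
  rw [ccw, add_sub_cancel_left, rep_coe]

lemma ccw_add_of_lt (a : Angle) {t : ℝ} (h0 : 0 ≤ t) (h1 : t < 1) :
    ccw a (a + (t : Angle)) = t := by
  rw [ccw_add, Int.fract_eq_self.2 ⟨h0, h1⟩]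

@[simp] lemma ccw_self (a : Angle) : ccw a a = 0 := by
  simpa using ccw_add a 0

lemma ccw_inj {a x y : Angle} (h : ccw a x = ccw a y) : x = y := by
  rw [← add_ccw a x, h, add_ccw]

lemma ccw_eq_zero {a x : Angle} : ccw a x = 0 ↔ x = a :=
  ⟨fun h => ccw_inj (h.trans (ccw_self a).symm), fun h => by rw [h, ccw_self]⟩

lemma ccw_pos {a x : Angle} : 0 < ccw a x ↔ x ≠ a := by
  rw [← not_iff_not, not_lt, not_not, ← ccw_eq_zero]
  exact ⟨fun h => le_antisymm h (ccw_nonneg _ _), fun h => h.le⟩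

/-- Change of the base point of the counter-clockwise coordinate. -/
lemma ccw_base (o x y : Angle) :
    ccw x y = if ccw o x ≤ ccw o y then ccw o y - ccw o x else ccw o y - ccw o x + 1 := by
  have h0 := ccw_nonneg o x
  have h1 := ccw_lt_one o x
  have h2 := ccw_nonneg o y
  have h3 := ccw_lt_one o y
  have e : y = x + ((ccw o y - ccw o x : ℝ) : Angle) := calc
    y = o + (ccw o y : Angle) := (add_ccw o y).symm
    _ = (o + (ccw o x : Angle)) + ((ccw o y - ccw o x : ℝ) : Angle) := by
      rw [AddCircle.coe_sub]; abel
    _ = _ := by rw [add_ccw]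
  split_ifs with h
  · conv_lhs => rw [e]
    rw [ccw_add_of_lt] <;> linarith
  · have e' : y = x + ((ccw o y - ccw o x + 1 : ℝ) : Angle) := by
      conv_lhs => rw [e]
      simp
    conv_lhs => rw [e']
    rw [ccw_add_of_lt] <;> linarith

lemma ccw_dbl (o x : Angle) :
    ccw (dbl o) (dbl x) = if ccw o x < 1 / 2 then 2 * ccw o x else 2 * ccw o x - 1 := by
  have h0 := ccw_nonneg o x
  have h1 := ccw_lt_one o x
  have e : dbl x = dbl o + ((2 * ccw o x : ℝ) : Angle) := by
    conv_lhs => rw [← add_ccw o x]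
    simp only [dbl, two_mul, AddCircle.coe_add]; abel
  split_ifs with h
  · rw [e, ccw_add_of_lt] <;> linarith
  · have e' : dbl x = dbl o + ((2 * ccw o x - 1 : ℝ) : Angle) := by
      rw [e, AddCircle.coe_sub, AddCircle.coe_period, sub_zero]
    rw [e', ccw_add_of_lt] <;> linarith

lemma ccw_rev {x y : Angle} (h : x ≠ y) : ccw y x = 1 - ccw x y := by
  have := ccw_base x y x
  have h2 := ccw_pos.2 h.symm
  rw [this, ccw_self, if_neg (by linarith)]; ring

lemma ccw_add_oneHalf (a x : Angle) :
    ccw a (x + oneHalf) = if ccw a x < 1 / 2 then ccw a x + 1 / 2 else ccw a x - 1 / 2 := by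
  have h0 := ccw_nonneg a x
  have h1 := ccw_lt_one a x
  have e : x + oneHalf = a + ((ccw a x + 1 / 2 : ℝ) : Angle) := by
    conv_lhs => rw [← add_ccw a x]
    rw [oneHalf, AddCircle.coe_add]; abel
  split_ifs with h
  · rw [e, ccw_add_of_lt] <;> linarith
  · have e' : x + oneHalf = a + ((ccw a x - 1 / 2 : ℝ) : Angle) := by
      rw [e, show ccw a x + 1 / 2 = ccw a x - 1 / 2 + 1 by ring]
      rw [AddCircle.coe_add _ (ccw a x - 1/2) 1]; simp
    rw [e', ccw_add_of_lt] <;> linarith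

@[simp] lemma ccw_self_add_oneHalf (a : Angle) : ccw a (a + oneHalf) = 1 / 2 := by
  rw [ccw_add_oneHalf, ccw_self]; norm_num

lemma oneHalf_add_oneHalf : oneHalf + oneHalf = 0 := by
  rw [oneHalf, ← AddCircle.coe_add, show (1 / 2 + 1 / 2 : ℝ) = 1 by norm_num]
  exact AddCircle.coe_period 1

@[simp] lemma add_oneHalf_add_oneHalf (x : Angle) : x + oneHalf + oneHalf = x := by
  rw [add_assoc, oneHalf_add_oneHalf, add_zero]

@[simp] lemma dbl_add_oneHalf (x : Angle) : dbl (x + oneHalf) = dbl x := by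
  rw [dbl, dbl, add_add_add_comm, oneHalf_add_oneHalf, add_zero]

@[simp] lemma dbl_half (x : Angle) : dbl (half x) = x := by
  rw [dbl, half, ← AddCircle.coe_add, add_halves, coe_rep]

lemma dbl_add (x : Angle) (t : ℝ) : dbl (x + (t : Angle)) = dbl x + ((2 * t : ℝ) : Angle) := by
  simp only [dbl, two_mul, AddCircle.coe_add]; abel

lemma dbl_eq_dbl {x y : Angle} (h : dbl x = dbl y) : y = x ∨ y = x + oneHalf := by
  have h1 := ccw_dbl x y
  rw [h, ccw_self] at h1
  split_ifs at h1 with h2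
  · left; exact ccw_eq_zero.1 (by linarith)
  · right; apply ccw_inj (a := x)
    rw [ccw_add_oneHalf]; simp; linarith

lemma dist_eq (x y : Angle) : dist x y = min (ccw x y) (1 - ccw x y) := by
  have h0 := ccw_nonneg x y
  have h1 := ccw_lt_one x y
  have e : y - x = ((ccw x y : ℝ) : Angle) := by rw [ccw, coe_rep]
  rw [dist_comm, dist_eq_norm, e, UnitAddCircle.norm_eq]
  rw [abs_sub_round_eq_min, Int.fract_eq_self.2 ⟨h0, h1⟩]

lemma chordLength_mk (x y : Angle) : chordLength s(x, y) = min (ccw x y) (1 - ccw x y) :=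
  dist_eq x y

lemma dblC_mk (x y : Angle) : dblC s(x, y) = s(dbl x, dbl y) := rfl

lemma dblC_iter (n : ℕ) (x y : Angle) : dblC^[n] s(x, y) = s(dbl^[n] x, dbl^[n] y) := by
  induction n with
  | zero => rfl
  | succ n ih => rw [Function.iterate_succ_apply', ih, Function.iterate_succ_apply',
      Function.iterate_succ_apply', dblC_mk]

lemma iter_add (n : ℕ) (x : Angle) (t : ℝ) :
    dbl^[n] (x + (t : Angle)) = dbl^[n] x + ((2 ^ n * t : ℝ) : Angle) := by
  induction n with
  | zero => simp
  | succ n ih => rw [Function.iterate_succ_apply', ih, Function.iterate_succ_apply', dbl_add]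
                 congr 2; ring

lemma ccw_iter (n : ℕ) (x y : Angle) :
    ccw (dbl^[n] x) (dbl^[n] y) = Int.fract (2 ^ n * ccw x y) := by
  conv_lhs => rw [← add_ccw x y, iter_add, ccw_add]

lemma ccw_iter_of_lt {n : ℕ} {x y : Angle} (h : 2 ^ n * ccw x y < 1) :
    ccw (dbl^[n] x) (dbl^[n] y) = 2 ^ n * ccw x y := by
  rw [ccw_iter, Int.fract_eq_self.2 ⟨by have := ccw_nonneg x y; positivity, h⟩]

lemma mem_openArc {a b x : Angle} : x ∈ openArc a b ↔ 0 < ccw a x ∧ ccw a x < ccw a b := Iff.rfl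

lemma mem_closedArc {a b x : Angle} : x ∈ closedArc a b ↔ ccw a x ≤ ccw a b := Iff.rfl

lemma mem_symbolArc_false {β x : Angle} :
    x ∈ symbolArc β false ↔ 0 < ccw (half β) x ∧ ccw (half β) x < 1 / 2 := by
  simp [symbolArc, mem_openArc]

lemma mem_symbolArc_true {β x : Angle} :
    x ∈ symbolArc β true ↔ 1 / 2 < ccw (half β) x := by
  have h0 := ccw_nonneg (half β) x
  have h1 := ccw_lt_one (half β) x
  have h2 := ccw_base (half β) (half β + oneHalf) x
  have h3 := ccw_base (half β) (half β + oneHalf) (half β)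
  rw [ccw_self_add_oneHalf] at h2 h3
  rw [ccw_self] at h3
  simp only [symbolArc, mem_openArc, if_true]
  grind

/-- `y` lies strictly between `x` and `z` in the counter-clockwise cyclic order. -/
def Sb (x y z : Angle) : Prop := 0 < ccw x y ∧ ccw x y < ccw x z

lemma symbolArc_unique {β x : Angle} {s t : Bool} (h : x ∈ symbolArc β s)
    (h' : x ∈ symbolArc β t) : s = t := by
  cases s <;> cases t <;> simp only [mem_symbolArc_false, mem_symbolArc_true] at h h' <;> grind

/-- Doubling preserves the cyclic order of points in a half circle. -/
lemma sb_dbl_iff {o x y z : Angle} (hx : ccw o x < 1 / 2) (hy : ccw o y < 1 / 2)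
    (hz : ccw o z < 1 / 2) : Sb (dbl x) (dbl y) (dbl z) ↔ Sb x y z := by
  have h1 := ccw_dbl o x
  have h2 := ccw_dbl o y
  have h3 := ccw_dbl o z
  have := ccw_base (dbl o) (dbl x) (dbl y)
  have := ccw_base (dbl o) (dbl x) (dbl z)
  have := ccw_base o x y
  have := ccw_base o x z
  have := ccw_nonneg o x
  have := ccw_nonneg o y
  have := ccw_nonneg o z
  unfold Sb
  grind

/-- The start of the half circle with symbol `s`. -/
noncomputable def sideBase (β : Angle) (s : Bool) : Angle := if s then half β + oneHalf else half β

lemma mem_symbolArc_iff {β x : Angle} {s : Bool} :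
    x ∈ symbolArc β s ↔ 0 < ccw (sideBase β s) x ∧ ccw (sideBase β s) x < 1 / 2 := by
  cases s
  · simp [mem_symbolArc_false, sideBase]
  · have h0 := ccw_nonneg (half β) x
    have h1 := ccw_lt_one (half β) x
    have h2 := ccw_base (half β) (half β + oneHalf) x
    rw [ccw_self_add_oneHalf] at h2
    simp only [mem_symbolArc_true, sideBase, if_true]
    grind

@[simp] lemma dbl_sideBase (β : Angle) (s : Bool) : dbl (sideBase β s) = β := by
  cases s <;> simp [sideBase]

lemma sideBase_not (β : Angle) (s : Bool) : sideBase β (!s) = sideBase β s + oneHalf := by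
  cases s <;> simp [sideBase]

lemma sb_dbl_symbolArc {β x y z : Angle} {s : Bool} (hx : x ∈ symbolArc β s)
    (hy : y ∈ symbolArc β s) (hz : z ∈ symbolArc β s) :
    Sb (dbl x) (dbl y) (dbl z) ↔ Sb x y z := by
  rw [mem_symbolArc_iff] at hx hy hz
  exact sb_dbl_iff hx.2 hy.2 hz.2

lemma sb_iter {β x y z : Angle} {n : ℕ} {κ : ℕ → Bool}
    (hx : ∀ i < n, dbl^[i] x ∈ symbolArc β (κ i)) (hy : ∀ i < n, dbl^[i] y ∈ symbolArc β (κ i))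
    (hz : ∀ i < n, dbl^[i] z ∈ symbolArc β (κ i)) :
    Sb (dbl^[n] x) (dbl^[n] y) (dbl^[n] z) ↔ Sb x y z := by
  induction n with
  | zero => rfl
  | succ n ih =>
    simp only [Function.iterate_succ_apply']
    rw [sb_dbl_symbolArc (hx n (by lia)) (hy n (by lia)) (hz n (by lia))]
    exact ih (fun i hi => hx i (by lia)) (fun i hi => hy i (by lia)) (fun i hi => hz i (by lia))

/-! ### Coordinates of a periodic parameter leaf -/

lemma crosses_mk {a b x y : Angle} :
    Crosses s(a, b) s(x, y) ↔ (Sb a x b ∧ Sb b y a) ∨ (Sb a y b ∧ Sb b x a) := by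
  constructor
  · rintro ⟨a', b', c, d, h1, h2, h3, h4⟩
    rw [Sym2.eq_iff] at h1 h2
    simp only [mem_openArc] at h3 h4
    unfold Sb
    grind
  · rintro (⟨h1, h2⟩ | ⟨h1, h2⟩)
    · exact ⟨a, b, x, y, rfl, rfl, h1, h2⟩
    · exact ⟨a, b, y, x, rfl, Sym2.eq_swap, h1, h2⟩

/-- The coordinates, measured from a preimage of `c`, of a preimage of `β`. -/
lemma ccw_of_dbl {u b c β : Angle} (hu : dbl u = c) (hb : dbl b = β) :
    ccw u b = ccw c β / 2 ∨ ccw u b = ccw c β / 2 + 1 / 2 := by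
  have := ccw_dbl u b
  rw [hu, hb] at this
  grind

lemma iter_injOn {p : ℕ} {x y : Angle} (hp : 0 < p) (hx : dbl^[p] x = x) (hy : dbl^[p] y = y)
    {i : ℕ} (h : dbl^[i] x = dbl^[i] y) : x = y := by
  have hx' : Function.IsPeriodicPt dbl p x := hx
  have hy' : Function.IsPeriodicPt dbl p y := hy
  have h1 : dbl^[i * p] x = dbl^[i * p] y := by
    have : i * p = (i * p - i) + i := by
      have : i ≤ i * p := Nat.le_mul_of_pos_right _ hp
      omega
    rw [this, Function.iterate_add_apply, Function.iterate_add_apply, h]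
  rwa [(hx'.const_mul i).eq, (hy'.const_mul i).eq] at h1

/-- The coordinates of a periodic parameter leaf `s(c, d)` of period `p`, whose smaller arc is
`[c, d]`. Its iterates are measured from the preimage `h^(p-1)(c)` of `c`; the letter `e` is that of
the half circle starting there, and `κ` is the sequence of the sides on which the iterates lie. -/
structure Leaf (p : ℕ) (c d : Angle) (e : Bool) (κ : ℕ → Bool) : Prop where
  lt : ccw c d < 1 / 2
  pos : 0 < ccw c d
  one_lt : 1 < p
  per : ∀ x, x = c ∨ x = d → Function.minimalPeriod dbl x = p
  out : ∀ x, x = c ∨ x = d → ∀ i, ¬ Sb c (dbl^[i] x) d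
  pred : ccw (dbl^[p - 1] c) (dbl^[p - 1] d) = ccw c d / 2 + 1 / 2
  rep_lt : rep c < rep d
  letter : sideBase c e = dbl^[p - 1] c
  last : κ (p - 1) = !e
  sym_add : ∀ i, κ (i + p) = κ i
  side_eq : ∀ x, x = c ∨ x = d → ∀ i, κ i = e →
    ccw c d / 2 ≤ ccw (dbl^[p - 1] c) (dbl^[i] x) ∧ ccw (dbl^[p - 1] c) (dbl^[i] x) ≤ 1 / 2
  side_ne : ∀ x, x = c ∨ x = d → ∀ i, κ i ≠ e →
    ccw (dbl^[p - 1] c) (dbl^[i] x) = 0 ∨ 1 / 2 + ccw c d / 2 ≤ ccw (dbl^[p - 1] c) (dbl^[i] x)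

lemma chordLength_dbl (x y : Angle) :
    chordLength s(dbl x, dbl y) = 2 * chordLength s(x, y) ∨
      chordLength s(dbl x, dbl y) = 1 - 2 * chordLength s(x, y) := by
  rw [chordLength_mk, chordLength_mk]
  have := ccw_dbl x y
  have := ccw_lt_one x y
  have := ccw_nonneg x y
  grind

lemma diameter_eq {u z : Angle} (hu : dbl u = z) : diameter z = s(u, u + oneHalf) := by
  rw [diameter]
  rcases dbl_eq_dbl ((dbl_half z).trans hu.symm) with h | h
  · rw [h]
  · rw [h, add_oneHalf_add_oneHalf, Sym2.eq_swap]

/-- A chord that does not cross the diameter with ends `u` and `u + 1/2` has its ends in one of the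
two closed half circles. -/
lemma not_crosses_diameter {u x y z : Angle} (hu : dbl u = z)
    (h : ¬ Crosses s(x, y) (diameter z)) :
    (ccw u x ≤ 1 / 2 ∧ ccw u y ≤ 1 / 2) ∨
      ((ccw u x = 0 ∨ 1 / 2 ≤ ccw u x) ∧ (ccw u y = 0 ∨ 1 / 2 ≤ ccw u y)) := by
  rw [diameter_eq hu, crosses_mk] at h
  simp only [Sb] at h
  have h0 := ccw_self_add_oneHalf u
  have := ccw_base u x y
  have := ccw_base u y x
  have h1 := ccw_base u x u
  have h2 := ccw_base u y u
  have h3 := ccw_base u x (u + oneHalf)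
  have h4 := ccw_base u y (u + oneHalf)
  have := ccw_nonneg u x
  have := ccw_nonneg u y
  have := ccw_lt_one u x
  have := ccw_lt_one u y
  rw [ccw_self] at h1 h2
  rw [h0] at h3 h4
  clear hu
  grind

/-- A chord with an end behind `s(c, d)` that does not cross it lies behind it, and so is shorter. -/
lemma chordLength_lt_of_sb {c d x y : Angle} (hlt : ccw c d < 1 / 2) (hx : Sb c x d)
    (h : ¬ Crosses s(c, d) s(x, y)) : chordLength s(x, y) < ccw c d := by
  rw [crosses_mk] at h
  rw [chordLength_mk]
  simp only [Sb] at *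
  have h0 := ccw_base c x y
  have := ccw_base c d y
  have h1 := ccw_base c d c
  rw [ccw_self] at h1
  have := ccw_nonneg c y
  have := ccw_lt_one c y
  grind

/-- If `x`, `y` are joined by a chord that avoids both diameters of the ends of `s(c, d)`, is not
shorter than `s(c, d)`, and whose image has no end in `]c, d[`, then `x` and `y` lie in the same one
of the two closed arcs into which the preimages of `]c, d[` divide the circle. -/
lemma same_closed_side {u c d x y : Angle} (hu : dbl u = c) (hpos : 0 < ccw c d)
    (hlt : ccw c d < 1 / 2) (hxy : ccw c d ≤ chordLength s(x, y))
    (hx : ¬ Sb c (dbl x) d) (hy : ¬ Sb c (dbl y) d)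
    (hc : ¬ Crosses s(x, y) (diameter c)) (hd : ¬ Crosses s(x, y) (diameter d)) :
    ((ccw c d / 2 ≤ ccw u x ∧ ccw u x ≤ 1 / 2) ∧ (ccw c d / 2 ≤ ccw u y ∧ ccw u y ≤ 1 / 2)) ∨
    ((ccw u x = 0 ∨ 1 / 2 + ccw c d / 2 ≤ ccw u x) ∧
      (ccw u y = 0 ∨ 1 / 2 + ccw c d / 2 ≤ ccw u y)) := by
  obtain ⟨w, hw, hw'⟩ : ∃ w, dbl w = d ∧ ccw u w = ccw c d / 2 := by
    refine ⟨u + ((ccw c d / 2 : ℝ) : Angle), ?_, ccw_add_of_lt _ (by linarith) (by linarith)⟩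
    rw [dbl_add, hu, mul_div_cancel₀ _ (two_ne_zero), add_ccw]
  have hc := not_crosses_diameter hu hc
  have hd := not_crosses_diameter hw hd
  rw [chordLength_mk] at hxy
  have h1 := ccw_dbl u x
  have h2 := ccw_dbl u y
  rw [hu] at h1 h2
  simp only [Sb, h1, h2] at hx hy
  have := ccw_base u x y
  have h3 := ccw_base u w x
  have h4 := ccw_base u w y
  rw [hw'] at h3 h4
  have := ccw_nonneg u x
  have := ccw_nonneg u y
  have := ccw_lt_one u x
  have := ccw_lt_one u y
  clear h1 h2 hw hw' hu
  grind (splits := 25)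

/-- As long as the angle `0` is not in between, the diameter of `β` turns half as fast as `β`; the
symbol of a half circle does not change. -/
lemma sideBase_add {c β : Angle} (h : rep c ≤ rep β) (s : Bool) :
    sideBase β s = sideBase c s + ((ccw c β / 2 : ℝ) : Angle) := by
  have h1 : rep β = rep c + ccw c β := by
    have := rep_nonneg c
    have := rep_lt_one β
    rw [ccw, ← coe_rep c, ← coe_rep β, ← AddCircle.coe_sub, rep_coe, rep_coe, rep_coe,
      Int.fract_eq_self.2 ⟨rep_nonneg c, rep_lt_one c⟩,
      Int.fract_eq_self.2 ⟨rep_nonneg β, rep_lt_one β⟩, Int.fract_eq_self.2 ⟨by linarith, by linarith⟩]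
    ring
  have h2 : half β = half c + ((ccw c β / 2 : ℝ) : Angle) := by
    rw [half, half, ← AddCircle.coe_add, h1]; congr 1; ring
  cases s
  · simpa [sideBase] using h2
  · simp only [sideBase, if_true, h2]; abel

/-- A chord whose smaller arc contains the angle `0` crosses the diameter of its first end. -/
lemma rep_lt_of_not_crosses {c d : Angle} (hlt : ccw c d < 1 / 2) (hpos : 0 < ccw c d)
    (hd : d ≠ 0) (h : ¬ Crosses s(c, d) (diameter c)) : rep c < rep d := by
  by_contra hcon
  apply h
  have e : ∀ x : Angle, rep x = ccw 0 x := fun x => by rw [ccw, sub_zero]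
  have hd' := ccw_pos.2 hd
  have hh : ccw 0 (half c) = ccw 0 c / 2 := by
    have h0 := ccw_nonneg 0 c
    have h1 := ccw_lt_one 0 c
    have := ccw_add_of_lt 0 (t := ccw 0 c / 2) (by linarith) (by linarith)
    rw [zero_add] at this
    rwa [half, e]
  rw [e, e] at hcon
  have h1 := ccw_base 0 c d
  have h2 := ccw_add_oneHalf 0 (half c)
  have := ccw_base 0 c (half c)
  have := ccw_base 0 c (half c + oneHalf)
  have := ccw_base 0 d (half c)
  have := ccw_base 0 d (half c + oneHalf)
  have := ccw_base 0 d c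
  have := ccw_lt_one 0 c
  have := ccw_lt_one 0 d
  rw [diameter, crosses_mk]
  right
  simp only [Sb]
  clear h
  grind

lemma chordLength_pos {x y : Angle} (h : x ≠ y) : 0 < chordLength s(x, y) := by
  rw [chordLength_mk]
  have := ccw_lt_one x y
  have := ccw_pos.2 h.symm
  grind

/-- A chord that crosses neither of the diameters of `c` and `d` is at most as long as the preimages
of the bigger arc of `s(c, d)`. -/
lemma chordLength_le_of_half {c d x y : Angle} (hlt : ccw c d < 1 / 2)
    (hc : (ccw (half c) x ≤ 1 / 2 ∧ ccw (half c) y ≤ 1 / 2) ∨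
      ((ccw (half c) x = 0 ∨ 1 / 2 ≤ ccw (half c) x) ∧
        (ccw (half c) y = 0 ∨ 1 / 2 ≤ ccw (half c) y)))
    (hd : (ccw (half d) x ≤ 1 / 2 ∧ ccw (half d) y ≤ 1 / 2) ∨
      ((ccw (half d) x = 0 ∨ 1 / 2 ≤ ccw (half d) x) ∧
        (ccw (half d) y = 0 ∨ 1 / 2 ≤ ccw (half d) y))) :
    chordLength s(x, y) ≤ 1 / 2 - ccw c d / 2 := by
  rw [chordLength_mk]
  have h1 := ccw_of_dbl (dbl_half c) (dbl_half d)
  have h2 := ccw_base (half c) x y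
  have h3 := ccw_base (half c) (half d) x
  have h4 := ccw_base (half c) (half d) y
  have := ccw_nonneg (half c) x
  have := ccw_nonneg (half c) y
  have := ccw_lt_one (half c) x
  have := ccw_lt_one (half c) y
  have := ccw_nonneg c d
  rcases h1 with h1 | h1 <;> rw [h1] at h3 h4 <;> clear h1 <;> grind (splits := 20)

/-- A periodic minor leaf is the shortest one of its iterates. -/
lemma le_chordLength_iter {p : ℕ} {c d : Angle} (hS : IsParamLeaf p s(c, d))
    (hlt : ccw c d < 1 / 2) (i : ℕ) : ccw c d ≤ chordLength s(dbl^[i] c, dbl^[i] d) := by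
  obtain ⟨hp, ⟨hd, hcr, hdi⟩, hper⟩ := hS
  have hcd : c ≠ d := by simpa using hd
  have perc : dbl^[p] c = c := by
    have := Function.iterate_minimalPeriod (f := dbl) (x := c); rwa [hper c (by simp)] at this
  have perd : dbl^[p] d = d := by
    have := Function.iterate_minimalPeriod (f := dbl) (x := d); rwa [hper d (by simp)] at this
  have hne : ∀ i, dbl^[i] c ≠ dbl^[i] d := fun i h => hcd (iter_injOn (by lia) perc perd h)
  have up : ∀ i, chordLength s(dbl^[i] c, dbl^[i] d) ≤ 1 / 2 - ccw c d / 2 := by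
    intro i
    have hc := hdi i c (by simp)
    have hd := hdi i d (by simp)
    rw [dblC_iter] at hc hd
    have hc := not_crosses_diameter (dbl_half c) hc
    have hd := not_crosses_diameter (dbl_half d) hd
    exact chordLength_le_of_half hlt hc hd
  obtain ⟨j, -, hj⟩ := Finset.exists_min_image (Finset.range p)
    (fun i => chordLength s(dbl^[i] c, dbl^[i] d)) ⟨0, by simp; lia⟩
  have hj' : ∀ i, chordLength s(dbl^[j] c, dbl^[j] d) ≤ chordLength s(dbl^[i] c, dbl^[i] d) := by
    intro i
    have h1 : dbl^[i] c = dbl^[i % p] c := by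
      have : Function.IsPeriodicPt dbl p c := perc
      rw [this.iterate_mod_apply]
    have h2 : dbl^[i] d = dbl^[i % p] d := by
      have : Function.IsPeriodicPt dbl p d := perd
      rw [this.iterate_mod_apply]
    rw [h1, h2]
    exact hj _ (by simp; exact Nat.mod_lt _ (by lia))
  -- A shortest iterate is the image of an iterate that is at least as long, so it is obtained by
  -- the formula `1 - 2 * l` with `l ≤ 1 / 2 - ccw c d / 2`.
  refine le_trans ?_ (hj' i)
  have e : ∀ x, dbl^[p] x = x → dbl^[j] x = dbl (dbl^[j + p - 1] x) := by
    intro x hx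
    rw [← Function.iterate_succ_apply' dbl, show (j + p - 1).succ = j + p by lia,
      Function.iterate_add_apply, hx]
  have h1 := hj' (j + p - 1)
  have h2 := chordLength_pos (hne (j + p - 1))
  have h3 := up (j + p - 1)
  have h4 := chordLength_dbl (dbl^[j + p - 1] c) (dbl^[j + p - 1] d)
  rw [← e c perc, ← e d perd] at h4
  grind

lemma iterate_of_minimalPeriod {p : ℕ} {c : Angle} (h : Function.minimalPeriod dbl c = p) :
    dbl^[p] c = c := h ▸ Function.iterate_minimalPeriod

lemma IsParamLeaf.not_sb {p : ℕ} {c d : Angle} (hS : IsParamLeaf p s(c, d))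
    (hlt : ccw c d < 1 / 2) (i : ℕ) :
    ¬ Sb c (dbl^[i] c) d ∧ ¬ Sb c (dbl^[i] d) d := by
  have h1 := le_chordLength_iter hS hlt i
  have h2 := hS.2.1.2.1 0 i
  rw [dblC_iter, dblC_iter] at h2
  constructor
  · intro h
    exact absurd (chordLength_lt_of_sb hlt h h2) (not_lt.2 h1)
  · intro h
    rw [Sym2.eq_swap (a := dbl^[i] c)] at h1 h2
    exact absurd (chordLength_lt_of_sb hlt h h2) (not_lt.2 h1)

lemma dbl_zero : dbl 0 = 0 := by simp [dbl]

/-- Every periodic parameter leaf has coordinates. -/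
lemma exists_leaf {p : ℕ} {S : Chord} (hS : IsParamLeaf p S) :
    ∃ c d e κ, S = s(c, d) ∧ Leaf p c d e κ := by
  -- A leaf is no diameter, since the ends of a diameter have the same image.
  obtain ⟨c, d, hlt, rfl⟩ : ∃ c d, ccw c d < 1 / 2 ∧ S = s(c, d) := by
    induction S using Sym2.ind with | _ c d
    rcases lt_trichotomy (ccw c d) (1 / 2) with h | h | h
    · exact ⟨c, d, h, rfl⟩
    · exfalso
      have hcd : c ≠ d := by simpa using hS.2.1.1
      have hc := iterate_of_minimalPeriod (hS.2.2 c (by simp))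
      have hd := iterate_of_minimalPeriod (hS.2.2 d (by simp))
      have h1 := ccw_dbl c d
      rw [h] at h1
      have h2 : dbl d = dbl c := ccw_eq_zero.1 (by rw [h1]; norm_num)
      exact hcd (iter_injOn (i := 1) (by have := hS.1; lia) hc hd h2.symm)
    · refine ⟨d, c, ?_, Sym2.eq_swap⟩
      have := ccw_base c d c
      rw [ccw_self] at this
      grind
  have hcd : c ≠ d := by simpa using hS.2.1.1
  have hpos : 0 < ccw c d := ccw_pos.2 hcd.symm
  have hp := hS.1
  have hdi := hS.2.1.2.2
  have hper := hS.2.2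
  have perc := iterate_of_minimalPeriod (hper c (by simp))
  have perd := iterate_of_minimalPeriod (hper d (by simp))
  have hu : dbl (dbl^[p - 1] c) = c := by
    rw [← Function.iterate_succ_apply' dbl, show (p - 1).succ = p by lia, perc]
  have hud : dbl (dbl^[p - 1] d) = d := by
    rw [← Function.iterate_succ_apply' dbl, show (p - 1).succ = p by lia, perd]
  have hout := IsParamLeaf.not_sb hS hlt
  have hlen := le_chordLength_iter hS hlt
  have hd0 : d ≠ 0 := by
    rintro rfl
    have h1 := hper 0 (by simp)
    have h2 : Function.minimalPeriod dbl (0 : Angle) = 1 :=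
      Function.minimalPeriod_eq_one_iff_isFixedPt.2 dbl_zero
    lia
  have hpred : ccw (dbl^[p - 1] c) (dbl^[p - 1] d) = ccw c d / 2 + 1 / 2 := by
    -- The `(p - 1)`-st iterate is not shorter than the leaf, so it is one of the two long
    -- preimages.
    rcases ccw_of_dbl hu hud with h | h
    · have := hlen (p - 1)
      rw [chordLength_mk, h] at this
      grind
    · exact h
  have hside : ∀ i, _ := fun i => same_closed_side hu hpos hlt (hlen i)
    (by rw [← Function.iterate_succ_apply' dbl]; exact (hout (i + 1)).1)
    (by rw [← Function.iterate_succ_apply' dbl]; exact (hout (i + 1)).2)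
    (by rw [← dblC_iter]; exact hdi i c (by simp)) (by rw [← dblC_iter]; exact hdi i d (by simp))
  obtain ⟨e, he⟩ : ∃ e, sideBase c e = dbl^[p - 1] c := by
    rcases dbl_eq_dbl ((dbl_half c).trans hu.symm) with h | h
    · exact ⟨false, by simp [sideBase, h]⟩
    · exact ⟨true, by simp [sideBase, h]⟩
  have hc0 : ccw (dbl^[p - 1] c) (dbl^[p - 1] c) = 0 := ccw_self _
  -- The symbols `κ` are read off the iterates of `c`; those of `d` lie on the same sides by
  -- `hside`.
  classical
  refine ⟨c, d, e, fun i => if ccw c d / 2 ≤ ccw (dbl^[p - 1] c) (dbl^[i] c) ∧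
    ccw (dbl^[p - 1] c) (dbl^[i] c) ≤ 1 / 2 then e else !e, rfl, hlt, hpos, hp, ?_, ?_, hpred,
    rep_lt_of_not_crosses hlt hpos hd0 ?_, he, ?_, ?_, ?_, ?_⟩
  · rintro x (rfl | rfl) <;> exact hper _ (by simp)
  · rintro x (rfl | rfl) i
    exacts [(hout i).1, (hout i).2]
  · simpa using hdi 0 c (by simp)
  · rw [if_neg]; rw [hc0]; intro h; linarith [h.1]
  · intro i; simp only [Function.iterate_add_apply, perc]
  · intro x hx i hi
    have h1 : ccw c d / 2 ≤ ccw (dbl^[p - 1] c) (dbl^[i] c) ∧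
        ccw (dbl^[p - 1] c) (dbl^[i] c) ≤ 1 / 2 := by
      by_contra h
      simp only [if_neg h] at hi
      simp at hi
    rcases hside i with h | h
    · rcases hx with rfl | rfl
      exacts [h.1, h.2]
    · exfalso
      rcases h.1 with h | h <;> linarith [h1.1, h1.2]
  · intro x hx i hi
    rcases hside i with h | h
    · exact absurd (if_pos h.1) hi
    · rcases hx with rfl | rfl
      exacts [h.1, h.2]

namespace Leaf

variable {p : ℕ} {c d : Angle} {e : Bool} {κ : ℕ → Bool}

lemma rep_le (h : Leaf p c d e κ) {β : Angle} (hβ : ccw c β ≤ ccw c d) : rep c ≤ rep β := by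
  have e : ∀ x : Angle, rep x = ccw 0 x := fun x => by rw [ccw, sub_zero]
  have h1 := h.rep_lt
  have h2 := h.lt
  rw [e, e] at *
  have := ccw_base 0 c d
  have := ccw_base 0 c β
  have := ccw_nonneg 0 β
  have := ccw_nonneg 0 c
  have := ccw_lt_one 0 c
  have := ccw_lt_one 0 d
  clear h
  grind

lemma dbl_pred (h : Leaf p c d e κ) : dbl (dbl^[p - 1] c) = c := by
  rw [← h.letter, dbl_sideBase]

/-- The half circles in the coordinate measured from `h^(p-1)(c)`. -/
lemma mem_letter (h : Leaf p c d e κ) {β : Angle} (hβ : ccw c β ≤ ccw c d) {x : Angle} :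
    x ∈ symbolArc β e ↔ ccw c β / 2 < ccw (dbl^[p - 1] c) x ∧
      ccw (dbl^[p - 1] c) x < ccw c β / 2 + 1 / 2 := by
  rw [mem_symbolArc_iff, sideBase_add (h.rep_le hβ), h.letter]
  have h0 := h.lt
  have h1 := ccw_add_of_lt (dbl^[p - 1] c) (t := ccw c β / 2) (by linarith [ccw_nonneg c β])
    (by linarith)
  have := ccw_base (dbl^[p - 1] c) (dbl^[p - 1] c + ((ccw c β / 2 : ℝ) : Angle)) x
  rw [h1] at this
  have := ccw_nonneg (dbl^[p - 1] c) x
  have := ccw_lt_one (dbl^[p - 1] c) x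
  have := ccw_nonneg c β
  clear h
  grind

lemma mem_not_letter (h : Leaf p c d e κ) {β : Angle} (hβ : ccw c β ≤ ccw c d) {x : Angle} :
    x ∈ symbolArc β (!e) ↔ ccw (dbl^[p - 1] c) x < ccw c β / 2 ∨
      ccw c β / 2 + 1 / 2 < ccw (dbl^[p - 1] c) x := by
  rw [mem_symbolArc_iff, sideBase_not, sideBase_add (h.rep_le hβ), h.letter]
  have h0 := h.lt
  have h1 := ccw_add_of_lt (dbl^[p - 1] c) (t := ccw c β / 2) (by linarith [ccw_nonneg c β])
    (by linarith)
  have h2 := ccw_add_oneHalf (dbl^[p - 1] c) (dbl^[p - 1] c + ((ccw c β / 2 : ℝ) : Angle))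
  rw [h1] at h2
  have := ccw_base (dbl^[p - 1] c) (dbl^[p - 1] c + ((ccw c β / 2 : ℝ) : Angle) + oneHalf) x
  rw [h2] at this
  have := ccw_nonneg (dbl^[p - 1] c) x
  have := ccw_lt_one (dbl^[p - 1] c) x
  have := ccw_nonneg c β
  clear h h1 h2
  grind

/-- The iterates of both ends of a leaf lie on the same side for every angle behind the leaf. -/
lemma mem (h : Leaf p c d e κ) {β : Angle} (hβ : Sb c β d) {x : Angle} (hx : x = c ∨ x = d)
    (i : ℕ) : dbl^[i] x ∈ symbolArc β (κ i) := by
  have h1 := hβ.1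
  have h2 := hβ.2
  have h3 := h.lt
  by_cases hi : κ i = e
  · have := h.side_eq x hx i hi
    rw [hi, h.mem_letter hβ.2.le]
    constructor <;> linarith
  · have h4 := h.side_ne x hx i hi
    have : κ i = !e := by revert hi; cases κ i <;> cases e <;> simp
    rw [this, h.mem_not_letter hβ.2.le]
    rcases h4 with h | h
    · left; linarith
    · right; linarith

lemma iterate_eq (h : Leaf p c d e κ) {x : Angle} (hx : x = c ∨ x = d) : dbl^[p] x = x :=
  iterate_of_minimalPeriod (h.per x hx)

lemma ne (h : Leaf p c d e κ) : c ≠ d := fun h' => (ccw_pos.1 h.pos) h'.symm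

end Leaf

/-- Two chords that cross and each lie on one side cross after doubling. -/
lemma crosses_dbl {β x y z w : Angle} {s t : Bool} (hx : x ∈ symbolArc β s)
    (hy : y ∈ symbolArc β s) (hz : z ∈ symbolArc β t) (hw : w ∈ symbolArc β t)
    (h : Crosses s(x, y) s(z, w)) : Crosses s(dbl x, dbl y) s(dbl z, dbl w) := by
  have hst : s = t := by
    by_contra hst
    have : t = !s := by revert hst; cases s <;> cases t <;> simp
    subst this
    rw [mem_symbolArc_iff] at hx hy hz hw
    rw [sideBase_not] at hz hw
    have h0 := ccw_self_add_oneHalf (sideBase β s)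
    generalize sideBase β s = o at *
    have h1 := ccw_base o (o + oneHalf) z
    have h2 := ccw_base o (o + oneHalf) w
    rw [h0] at h1 h2
    rw [crosses_mk] at h
    simp only [Sb] at h
    have := ccw_base o x y
    have := ccw_base o x z
    have := ccw_base o x w
    have := ccw_base o y x
    have := ccw_base o y z
    have := ccw_base o y w
    have := ccw_nonneg o z
    have := ccw_nonneg o w
    have := ccw_lt_one o z
    have := ccw_lt_one o w
    clear hst h0
    grind (splits := 20)
  subst hst
  rw [crosses_mk] at h ⊢
  rwa [sb_dbl_symbolArc hx hz hy, sb_dbl_symbolArc hy hw hx, sb_dbl_symbolArc hx hw hy,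
    sb_dbl_symbolArc hy hz hx]

lemma not_crosses_diameter_of_sides {c d β x y u : Angle} {s : Bool} (hu : dbl u = c)
    (hβ : Sb c β d)
    (hx : x ∈ symbolArc β s) (hy : y ∈ symbolArc β s) (hx' : ¬ Sb c (dbl x) d)
    (hy' : ¬ Sb c (dbl y) d) :
    ¬ Crosses s(x, y) (diameter c) ∧ ¬ Crosses s(x, y) (diameter d) := by
  obtain ⟨w, hw, hw'⟩ : ∃ w, dbl w = d ∧ ccw u w = ccw c d / 2 := by
    refine ⟨u + ((ccw c d / 2 : ℝ) : Angle), ?_, ccw_add_of_lt _ ?_ ?_⟩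
    · rw [dbl_add, hu, mul_div_cancel₀ _ (two_ne_zero), add_ccw]
    · linarith [ccw_nonneg c d]
    · linarith [ccw_lt_one c d]
  have h1 := ccw_dbl u x
  have h2 := ccw_dbl u y
  rw [hu] at h1 h2
  simp only [Sb, h1, h2] at hx' hy'
  rw [mem_symbolArc_iff] at hx hy
  have h3 := ccw_of_dbl hu (dbl_sideBase β s)
  generalize sideBase β s = o at *
  have h4 := ccw_base u o x
  have h5 := ccw_base u o y
  have := ccw_nonneg u x
  have := ccw_nonneg u y
  have := ccw_lt_one u x
  have := ccw_lt_one u y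
  have := ccw_lt_one c d
  have hβ1 := hβ.1
  have hβ2 := hβ.2
  rw [diameter_eq hu, diameter_eq hw, crosses_mk, crosses_mk]
  have g1 := ccw_self_add_oneHalf u
  have g2 := ccw_add_oneHalf u w
  rw [hw', if_pos (by linarith)] at g2
  have k1 := ccw_base u x u
  have k2 := ccw_base u y u
  rw [ccw_self] at k1 k2
  have k3 := ccw_base u x (u + oneHalf)
  have k4 := ccw_base u y (u + oneHalf)
  rw [g1] at k3 k4
  have k5 := ccw_base u x w
  have k6 := ccw_base u y w
  rw [hw'] at k5 k6
  have k7 := ccw_base u x (w + oneHalf)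
  have k8 := ccw_base u y (w + oneHalf)
  rw [g2] at k7 k8
  have k9 := ccw_base u x y
  have k10 := ccw_base u y x
  clear hw hw' hu h1 h2 hβ g1 g2
  simp only [Sb]
  rcases h3 with h3 | h3 <;> rw [h3] at h4 h5 <;> clear h3 <;> constructor <;> grind (splits := 30)

/-- A criterion for `s(c, d)` to be a periodic parameter leaf. -/
lemma isParamLeaf_of_sides {p : ℕ} {c d β : Angle} {κ : ℕ → Bool} (hp : 1 < p) (hβ : Sb c β d)
    (hc : Function.minimalPeriod dbl c = p) (hd : Function.minimalPeriod dbl d = p)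
    (hc' : ∀ i, ¬ Sb c (dbl^[i] c) d) (hd' : ∀ i, ¬ Sb c (dbl^[i] d) d)
    (hcs : ∀ i, dbl^[i] c ∈ symbolArc β (κ i)) (hds : ∀ i, dbl^[i] d ∈ symbolArc β (κ i)) :
    IsParamLeaf p s(c, d) := by
  have hcd : c ≠ d := by
    rintro rfl
    have := hβ.2; rw [ccw_self] at this; linarith [hβ.1]
  have perc := iterate_of_minimalPeriod hc
  have perd := iterate_of_minimalPeriod hd
  refine ⟨hp, ⟨by simpa using hcd, ?_, ?_⟩, ?_⟩
  · intro i j hij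
    have key : ∀ n, Crosses (dblC^[i + n] s(c, d)) (dblC^[j + n] s(c, d)) := by
      intro n
      induction n with
      | zero => exact hij
      | succ n ih =>
        rw [dblC_iter, dblC_iter] at *
        simp only [← add_assoc, Function.iterate_succ_apply']
        exact crosses_dbl (hcs _) (hds _) (hcs _) (hds _) ih
    have h1 := key (i * p - i)
    have h2 : i ≤ i * p := Nat.le_mul_of_pos_right _ (by lia)
    rw [show i + (i * p - i) = i * p by lia, dblC_iter, dblC_iter] at h1
    have hpc : Function.IsPeriodicPt dbl p c := perc
    have hpd : Function.IsPeriodicPt dbl p d := perd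
    rw [(hpc.const_mul i).eq, (hpd.const_mul i).eq, crosses_mk] at h1
    rcases h1 with h1 | h1
    · exact hc' _ h1.1
    · exact hd' _ h1.1
  · intro i x hx
    have hu : dbl (dbl^[p - 1] c) = c := by
      rw [← Function.iterate_succ_apply' dbl, show (p - 1).succ = p by lia, perc]
    have := not_crosses_diameter_of_sides hu hβ (hcs i) (hds i)
      (by rw [← Function.iterate_succ_apply' dbl]; exact hc' _)
      (by rw [← Function.iterate_succ_apply' dbl]; exact hd' _)
    rw [dblC_iter]
    rcases Sym2.mem_iff.1 hx with rfl | rfl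
    exacts [this.1, this.2]
  · intro x hx
    rcases Sym2.mem_iff.1 hx with rfl | rfl
    exacts [hc, hd]

/-! ### Points that share the itinerary of a leaf -/

lemma ccw_le_dbl_iff {o x y z : Angle} (hx : ccw o x < 1 / 2) (hy : ccw o y < 1 / 2)
    (hz : ccw o z < 1 / 2) :
    ccw (dbl x) (dbl y) ≤ ccw (dbl x) (dbl z) ↔ ccw x y ≤ ccw x z := by
  have h1 := ccw_dbl o x
  have h2 := ccw_dbl o y
  have h3 := ccw_dbl o z
  have := ccw_base (dbl o) (dbl x) (dbl y)
  have := ccw_base (dbl o) (dbl x) (dbl z)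
  have := ccw_base o x y
  have := ccw_base o x z
  have := ccw_nonneg o x
  have := ccw_nonneg o y
  have := ccw_nonneg o z
  grind

/-- The cyclic order of three points is preserved as long as they lie on the same side. -/
lemma ccw_le_iter_iff {β x y z : Angle} {n : ℕ} {κ : ℕ → Bool}
    (hx : ∀ i < n, dbl^[i] x ∈ symbolArc β (κ i)) (hy : ∀ i < n, dbl^[i] y ∈ symbolArc β (κ i))
    (hz : ∀ i < n, dbl^[i] z ∈ symbolArc β (κ i)) :
    ccw (dbl^[n] x) (dbl^[n] y) ≤ ccw (dbl^[n] x) (dbl^[n] z) ↔ ccw x y ≤ ccw x z := by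
  induction n with
  | zero => rfl
  | succ n ih =>
    have hx' := hx n (by lia)
    have hy' := hy n (by lia)
    have hz' := hz n (by lia)
    rw [mem_symbolArc_iff] at hx' hy' hz'
    simp only [Function.iterate_succ_apply']
    rw [ccw_le_dbl_iff hx'.2 hy'.2 hz'.2]
    exact ih (fun i hi => hx i (by lia)) (fun i hi => hy i (by lia)) (fun i hi => hz i (by lia))

/-- An arc with periodic ends whose itinerary is invariant under the shift by `t` cannot be
properly contained in its `t`-th iterate. -/
lemma eq_of_subset_iterate {β x y : Angle} {σ : ℕ → Bool} {t P : ℕ} (hP : 0 < P)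
    (hx : dbl^[P] x = x) (hy : dbl^[P] y = y) (hxs : ∀ i, dbl^[i] x ∈ symbolArc β (σ i))
    (hys : ∀ i, dbl^[i] y ∈ symbolArc β (σ i)) (hσ : ∀ i, σ (i + t) = σ i)
    (h1 : ccw (dbl^[t] x) x ≤ ccw (dbl^[t] x) y)
    (h2 : ccw (dbl^[t] x) y ≤ ccw (dbl^[t] x) (dbl^[t] y)) :
    dbl^[t] x = x ∧ dbl^[t] y = y := by
  have hxt : ∀ i, dbl^[i] (dbl^[t] x) ∈ symbolArc β (σ i) := fun i => by
    rw [← Function.iterate_add_apply, ← hσ]; exact hxs _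
  have hyt : ∀ i, dbl^[i] (dbl^[t] y) ∈ symbolArc β (σ i) := fun i => by
    rw [← Function.iterate_add_apply, ← hσ]; exact hys _
  -- The iterate of order `n` maps the two arcs in an order preserving way, so the lengths add up.
  have key : ∀ n, ccw (dbl^[n] (dbl^[t] x)) (dbl^[n] (dbl^[t] y)) =
      ccw (dbl^[n] (dbl^[t] x)) (dbl^[n] x) + ccw (dbl^[n] x) (dbl^[n] y) +
        ccw (dbl^[n] y) (dbl^[n] (dbl^[t] y)) := by
    intro n
    rw [← ccw_le_iter_iff (n := n) (fun i _ => hxt i) (fun i _ => hxs i) (fun i _ => hys i)] at h1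
    rw [← ccw_le_iter_iff (n := n) (fun i _ => hxt i) (fun i _ => hys i) (fun i _ => hyt i)] at h2
    have := ccw_base (dbl^[n] (dbl^[t] x)) (dbl^[n] x) (dbl^[n] y)
    have := ccw_base (dbl^[n] (dbl^[t] x)) (dbl^[n] y) (dbl^[n] (dbl^[t] y))
    grind
  -- The lengths of the iterates of order `k * t` do not decrease, but after `P * t` iterates the
  -- original length returns.
  have mono : ∀ k, ccw x y + ccw (dbl^[t] x) x + ccw y (dbl^[t] y) ≤
      ccw (dbl^[(k + 1) * t] x) (dbl^[(k + 1) * t] y) := by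
    intro k
    induction k with
    | zero => have := key 0; simp only [Function.iterate_zero, id] at this; simp; linarith
    | succ k ih =>
      have := key ((k + 1) * t)
      simp only [← Function.iterate_add_apply] at this
      rw [show (k + 1 + 1) * t = (k + 1) * t + t by ring]
      linarith [ccw_nonneg (dbl^[(k + 1) * t + t] x) (dbl^[(k + 1) * t] x),
        ccw_nonneg (dbl^[(k + 1) * t] y) (dbl^[(k + 1) * t + t] y)]
  have h3 := mono (P - 1)
  have hpx : Function.IsPeriodicPt dbl P x := hx
  have hpy : Function.IsPeriodicPt dbl P y := hy
  rw [show P - 1 + 1 = P by lia, (hpx.mul_const t).eq, (hpy.mul_const t).eq] at h3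
  have a1 := ccw_nonneg (dbl^[t] x) x
  have a2 := ccw_nonneg y (dbl^[t] y)
  exact ⟨(ccw_eq_zero.1 (by linarith)).symm, ccw_eq_zero.1 (by linarith)⟩

lemma iter_ccw_split {p j : ℕ} (hj : j ≤ p) (x y : Angle) (s : ℝ)
    (h : dbl^[j] x + (s : Angle) = y) : dbl^[p - j] y = dbl^[p] x + ((2 ^ (p - j) * s : ℝ) : Angle) := by
  rw [← h, iter_add, ← Function.iterate_add_apply, Nat.sub_add_cancel hj]

namespace Leaf

variable {p : ℕ} {c d : Angle} {e : Bool} {κ : ℕ → Bool}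

/-- The iterates of order less than `p` of a point close to `c` stay out of `]c, d[`. -/
lemma not_sb_of_near_left (h : Leaf p c d e κ) {y : Angle} (hy : 2 ^ p * ccw c y ≤ ccw c d)
    {j : ℕ} (hj : 0 < j) (hjp : j < p) : ¬ Sb c (dbl^[j] y) d := by
  intro hs
  have h1 : (2 : ℝ) ^ p = 2 ^ j * 2 ^ (p - j) := by rw [← pow_add]; congr 1; lia
  have h2 : (1 : ℝ) < 2 ^ (p - j) := one_lt_pow₀ (by norm_num) (by lia)
  have h0 := ccw_nonneg c y
  have h3 : 0 ≤ 2 ^ j * ccw c y := by positivity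
  have h4 : 2 ^ j * ccw c y ≤ 2 ^ p * ccw c y := by
    rw [h1]; nlinarith
  have hcy := ccw_iter_of_lt (n := j) (x := c) (y := y) (by linarith [h.lt])
  have hne : dbl^[j] c ≠ c := by
    intro hh
    have := Function.IsPeriodicPt.minimalPeriod_le (f := dbl) hj hh
    rw [h.per c (Or.inl rfl)] at this
    lia
  have hcj := h.out c (Or.inl rfl) j
  have hpos := ccw_pos.2 hne.symm
  have hlt := h.lt
  -- `c` lies in the arc from `h^j(c)` to `h^j(y)`
  have hs' : ccw (dbl^[j] c) c < 2 ^ j * ccw c y := by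
    rw [← hcy]
    rw [← hcy] at h4 h3
    have b1 := ccw_base (dbl^[j] c) c (dbl^[j] y)
    have b2 := ccw_base (dbl^[j] c) c d
    have b3 := ccw_base (dbl^[j] c) c (dbl^[j] c)
    rw [ccw_self] at b3
    unfold Sb at hs hcj
    clear h h1 h2
    grind [ccw_nonneg, ccw_lt_one]
  have h5 := iter_ccw_split hjp.le c c _ (add_ccw (dbl^[j] c) c)
  rw [h.iterate_eq (Or.inl rfl)] at h5
  have h6 : 2 ^ (p - j) * ccw (dbl^[j] c) c < ccw c d := by
    calc 2 ^ (p - j) * ccw (dbl^[j] c) c < 2 ^ (p - j) * (2 ^ j * ccw c y) := by gcongr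
      _ = 2 ^ p * ccw c y := by rw [h1]; ring
      _ ≤ _ := hy
  apply h.out c (Or.inl rfl) (p - j)
  have h7 : 0 < 2 ^ (p - j) * ccw (dbl^[j] c) c := by positivity
  rw [h5, Sb, ccw_add_of_lt _ h7.le (by linarith)]
  exact ⟨h7, h6⟩

/-- The iterates of order less than `p` of a point close to `d` stay out of `]c, d[`. -/
lemma not_sb_of_near_right (h : Leaf p c d e κ) {y : Angle} (hy : 2 ^ p * ccw y d ≤ ccw c d)
    {j : ℕ} (hj : 0 < j) (hjp : j < p) : ¬ Sb c (dbl^[j] y) d := by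
  intro hs
  have h1 : (2 : ℝ) ^ p = 2 ^ j * 2 ^ (p - j) := by rw [← pow_add]; congr 1; lia
  have h2 : (1 : ℝ) < 2 ^ (p - j) := one_lt_pow₀ (by norm_num) (by lia)
  have h0 := ccw_nonneg y d
  have h3 : 0 ≤ 2 ^ j * ccw y d := by positivity
  have h4 : 2 ^ j * ccw y d ≤ 2 ^ p * ccw y d := by
    rw [h1]; nlinarith
  have hcy := ccw_iter_of_lt (n := j) (x := y) (y := d) (by linarith [h.lt])
  have hne : dbl^[j] d ≠ d := by
    intro hh
    have := Function.IsPeriodicPt.minimalPeriod_le (f := dbl) hj hh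
    rw [h.per d (Or.inr rfl)] at this
    lia
  have hcj := h.out d (Or.inr rfl) j
  have hpos := ccw_pos.2 hne
  have hlt := h.lt
  -- `d` lies in the arc from `h^j(y)` to `h^j(d)`
  have hs' : ccw d (dbl^[j] d) < 2 ^ j * ccw y d := by
    rw [← hcy]
    rw [← hcy] at h4 h3
    have b1 := ccw_base c (dbl^[j] y) (dbl^[j] d)
    have b2 := ccw_base c d (dbl^[j] d)
    unfold Sb at hs hcj
    have := ccw_nonneg c (dbl^[j] d)
    have := ccw_lt_one c (dbl^[j] d)
    clear h h1 h2
    grind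
  have h5 : dbl^[p - j] d + ((2 ^ (p - j) * ccw d (dbl^[j] d) : ℝ) : Angle) = d := by
    have := iter_ccw_split (p := p - j) (j := 0) (by lia) d _ _ (add_ccw d (dbl^[j] d))
    rw [Nat.sub_zero, ← Function.iterate_add_apply, Nat.sub_add_cancel hjp.le,
      h.iterate_eq (Or.inr rfl)] at this
    exact this.symm
  have h6 : 2 ^ (p - j) * ccw d (dbl^[j] d) < ccw c d := by
    calc 2 ^ (p - j) * ccw d (dbl^[j] d) < 2 ^ (p - j) * (2 ^ j * ccw y d) := by gcongr
      _ = 2 ^ p * ccw y d := by rw [h1]; ring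
      _ ≤ _ := hy
  apply h.out d (Or.inr rfl) (p - j)
  have h7 : 0 < 2 ^ (p - j) * ccw d (dbl^[j] d) := by positivity
  have h8 : ccw (dbl^[p - j] d) d = 2 ^ (p - j) * ccw d (dbl^[j] d) := by
    conv_lhs => rw [← h5]
    simp only [h5]
    nth_rewrite 2 [← h5]
    exact ccw_add_of_lt _ h7.le (by linarith)
  have b1 := ccw_base c (dbl^[p - j] d) d
  have := ccw_nonneg c (dbl^[p - j] d)
  have := ccw_lt_one c (dbl^[p - j] d)
  clear h h1 h2 h5
  unfold Sb
  grind

/-- Points close to `c` have the itinerary of `c` up to the order `p - 2`. -/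
lemma mem_of_near_left (h : Leaf p c d e κ) {y β : Angle} (hβ : Sb c β d)
    (hy : 2 ^ p * ccw c y ≤ ccw c d) {i : ℕ} (hi : i + 1 < p) :
    dbl^[i] y ∈ symbolArc β (κ i) := by
  have h1 := h.mem hβ (Or.inl rfl) i
  rw [mem_symbolArc_iff] at h1 ⊢
  have h2 : (2 : ℝ) ^ i < 2 ^ p := pow_lt_pow_right₀ (by norm_num) (by lia)
  have h0 := ccw_nonneg c y
  have hl := h.lt
  have h3 : 2 ^ i * ccw c y ≤ 2 ^ p * ccw c y := by nlinarith
  have h4 := ccw_iter_of_lt (n := i) (x := c) (y := y) (by linarith)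
  by_contra hcon
  have ho := dbl_sideBase β (κ i)
  generalize sideBase β (κ i) = o at *
  have h5 : 1 / 2 - ccw o (dbl^[i] c) ≤ ccw (dbl^[i] c) (dbl^[i] y) := by
    rw [← h4] at h3
    have := ccw_base o (dbl^[i] c) (dbl^[i] y)
    clear h h2 h4
    grind [ccw_nonneg, ccw_lt_one]
  -- a point between `c` and `y` that is mapped to `β`
  have key : ∃ y', ccw c y' ≤ ccw c y ∧ dbl^[i + 1] y' = β := by
    refine ⟨c + (((1 / 2 - ccw o (dbl^[i] c)) / 2 ^ i : ℝ) : Angle), ?_, ?_⟩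
    · have h6 : (1 / 2 - ccw o (dbl^[i] c)) / 2 ^ i ≤ ccw c y := by
        rw [div_le_iff₀ (by positivity)]; linarith
      rwa [ccw_add_of_lt _ (div_nonneg (by linarith) (by positivity)) (by linarith [ccw_lt_one c y])]
    · rw [Function.iterate_succ_apply', iter_add, mul_div_cancel₀ _ (by positivity)]
      have h7 : dbl^[i] c + ((1 / 2 - ccw o (dbl^[i] c) : ℝ) : Angle) = o + oneHalf := by
        nth_rewrite 1 [← add_ccw o (dbl^[i] c)]
        rw [AddCircle.coe_sub, oneHalf]; abel
      rw [h7, dbl_add_oneHalf, ho]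
  obtain ⟨y', hy1, hy2⟩ := key
  apply h.not_sb_of_near_left (y := y') (j := i + 1) _ (by lia) (by lia)
  · rwa [hy2]
  · exact le_trans (by gcongr) hy

/-- Points close to `d` have the itinerary of `d` up to the order `p - 2`. -/
lemma mem_of_near_right (h : Leaf p c d e κ) {y β : Angle} (hβ : Sb c β d)
    (hy : 2 ^ p * ccw y d ≤ ccw c d) {i : ℕ} (hi : i + 1 < p) :
    dbl^[i] y ∈ symbolArc β (κ i) := by
  have h1 := h.mem hβ (Or.inr rfl) i
  rw [mem_symbolArc_iff] at h1 ⊢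
  have h2 : (2 : ℝ) ^ i < 2 ^ p := pow_lt_pow_right₀ (by norm_num) (by lia)
  have h0 := ccw_nonneg y d
  have hl := h.lt
  have h3 : 2 ^ i * ccw y d ≤ 2 ^ p * ccw y d := by nlinarith
  have h4 := ccw_iter_of_lt (n := i) (x := y) (y := d) (by linarith)
  by_contra hcon
  have ho := dbl_sideBase β (κ i)
  generalize sideBase β (κ i) = o at *
  have h5 : ccw o (dbl^[i] d) ≤ ccw (dbl^[i] y) (dbl^[i] d) := by
    rw [← h4] at h3
    have := ccw_base o (dbl^[i] y) (dbl^[i] d)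
    have := ccw_nonneg o (dbl^[i] y)
    clear h h2 h4
    grind [ccw_nonneg, ccw_lt_one]
  -- a point between `y` and `d` that is mapped to `β`
  have key : ∃ y', ccw y' d ≤ ccw y d ∧ dbl^[i + 1] y' = β := by
    have h6 : ccw o (dbl^[i] d) / 2 ^ i ≤ ccw y d := by
      rw [div_le_iff₀ (by positivity)]; linarith
    refine ⟨d + ((- (ccw o (dbl^[i] d) / 2 ^ i) : ℝ) : Angle), ?_, ?_⟩
    · have h7 := ccw_add_of_lt (d + ((- (ccw o (dbl^[i] d) / 2 ^ i) : ℝ) : Angle))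
        (t := ccw o (dbl^[i] d) / 2 ^ i) (div_nonneg (by linarith) (by positivity))
        (by linarith [ccw_lt_one y d])
      rw [add_assoc, ← AddCircle.coe_add, neg_add_cancel, AddCircle.coe_zero, add_zero] at h7
      rwa [h7]
    · rw [Function.iterate_succ_apply', iter_add, mul_neg, mul_div_cancel₀ _ (by positivity)]
      have h7 : dbl^[i] d + ((- ccw o (dbl^[i] d) : ℝ) : Angle) = o := by
        nth_rewrite 1 [← add_ccw o (dbl^[i] d)]
        rw [AddCircle.coe_neg]; abel
      rw [h7, ho]
  obtain ⟨y', hy1, hy2⟩ := key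
  apply h.not_sb_of_near_right (y := y') (j := i + 1) _ (by lia) (by lia)
  · rwa [hy2]
  · exact le_trans (by gcongr) hy

/-- An angle behind the leaf that has the same itinerary as the leaf, up to and including the order
`p - 1`, relative to an angle `β` behind the leaf, is very close to one of its ends. -/
lemma near_of_mem (h : Leaf p c d e κ) {y β : Angle} (hβ : Sb c β d) (hy : Sb c y d)
    (hs : ∀ i < p, dbl^[i] y ∈ symbolArc β (κ i)) :
    2 ^ p * ccw c y < ccw c β ∨ 2 ^ p * ccw y d < ccw β d := by
  have hp := h.one_lt
  have hl := h.lt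
  have hb0 := hβ.1
  have hb1 := hβ.2
  have h2 : (2 : ℝ) ^ p = 2 ^ (p - 1) * 2 := by rw [← pow_succ]; congr 1; lia
  have hlast := hs (p - 1) (by lia)
  rw [h.last, h.mem_not_letter hβ.2.le] at hlast
  have hpos : (0 : ℝ) < 2 ^ p := by positivity
  have hp1 := h.pred
  have e1 : 2 ^ p * ccw c y = 2 * (2 ^ (p - 1) * ccw c y) := by rw [h2]; ring
  have e2 : 2 ^ p * ccw y d = 2 * (2 ^ (p - 1) * ccw y d) := by rw [h2]; ring
  by_cases hA : 2 ^ p * ccw c y ≤ ccw c d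
  · left
    have h3 := ccw_iter_of_lt (n := p - 1) (x := c) (y := y) (by linarith [ccw_nonneg c y])
    rw [h3] at hlast
    rcases hlast with h | h <;> linarith
  by_cases hA' : 2 ^ p * ccw y d ≤ ccw c d
  · right
    have h3 := ccw_iter_of_lt (n := p - 1) (x := y) (y := d) (by linarith [ccw_nonneg y d])
    have h4 := ccw_base c β d
    have h5 := ccw_base (dbl^[p - 1] c) (dbl^[p - 1] y) (dbl^[p - 1] d)
    rw [h3, hp1] at h5
    have h6 := ccw_lt_one (dbl^[p - 1] c) (dbl^[p - 1] y)
    rw [e2] at hA' ⊢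
    generalize ccw (dbl^[p - 1] c) (dbl^[p - 1] y) = t at *
    clear h hs h2 h3 hA e1 e2
    grind [ccw_nonneg, ccw_lt_one]
  exfalso
  have h4 : (4 : ℝ) ≤ 2 ^ p := by
    calc (4 : ℝ) = 2 ^ 2 := by norm_num
      _ ≤ 2 ^ p := pow_le_pow_right₀ (by norm_num) hp
  -- The points `z` and `w`, at the distance `ccw c d / 2 ^ p` from the ends, shadow `c` and `d` for
  -- `p - 1` iterates. If `y` were between them, then its `(p - 1)`-st iterate would be between
  -- theirs, on the side of the other symbol.
  have q0 : 0 < ccw c d / 2 ^ p := div_pos h.pos hpos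
  have q1 : ccw c d / 2 ^ p < 1 / 4 * ccw c d + 1 / 8 := by
    rw [div_lt_iff₀ hpos]; nlinarith [h.pos]
  have q2 : ccw c d / 2 ^ p ≤ 1 / 4 * ccw c d := by
    rw [div_le_iff₀ hpos]; nlinarith [h.pos]
  have q3 : 2 ^ p * (ccw c d / 2 ^ p) = ccw c d := mul_div_cancel₀ _ hpos.ne'
  obtain ⟨z, hz⟩ : ∃ z, ccw c z = ccw c d / 2 ^ p := ⟨_, ccw_add_of_lt c q0.le (by linarith)⟩
  obtain ⟨w, hw⟩ : ∃ w, ccw c w = ccw c d - ccw c d / 2 ^ p :=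
    ⟨_, ccw_add_of_lt c (by linarith [h.pos]) (by linarith)⟩
  have hwd : ccw w d = ccw c d / 2 ^ p := by
    have := ccw_base c w d
    rw [hw] at this
    rw [this, if_pos (by linarith)]; ring
  have hord : Sb z y w := by
    have k0 : ccw c d / 2 ^ p < ccw c y := by rw [div_lt_iff₀ hpos]; linarith
    have k1 : ccw c d / 2 ^ p < ccw y d := by rw [div_lt_iff₀ hpos]; linarith
    have k2 := ccw_base c y d
    have k3 := ccw_base c z y
    have k4 := ccw_base c z w
    rw [hz] at k3 k4
    rw [hw] at k4
    have k5 := hy.2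
    have k6 := hy.1
    clear hs h
    unfold Sb
    grind
  rw [← sb_iter (β := β) (n := p - 1) (κ := κ)
    (fun i hi => h.mem_of_near_left hβ (by rw [hz, q3]) (by lia)) (fun i hi => hs i (by lia))
    (fun i hi => h.mem_of_near_right hβ (by rw [hwd, q3]) (by lia))] at hord
  have m1 := ccw_iter_of_lt (n := p - 1) (x := c) (y := z) (by rw [hz]; nlinarith)
  have m2 := ccw_iter_of_lt (n := p - 1) (x := w) (y := d) (by rw [hwd]; nlinarith)
  have m3 : 2 ^ (p - 1) * (ccw c d / 2 ^ p) = ccw c d / 2 := by rw [h2]; field_simp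
  rw [hz, m3] at m1
  rw [hwd, m3] at m2
  have m4 := ccw_base (dbl^[p - 1] c) (dbl^[p - 1] w) (dbl^[p - 1] d)
  have m5 := ccw_base (dbl^[p - 1] c) (dbl^[p - 1] z) (dbl^[p - 1] y)
  have m6 := ccw_base (dbl^[p - 1] c) (dbl^[p - 1] z) (dbl^[p - 1] w)
  rw [hp1, m2] at m4
  rw [m1] at m5 m6
  unfold Sb at hord
  clear h hs m1 m2 m3 hA hA'
  grind [ccw_nonneg, ccw_lt_one]

/-- No angle behind a leaf has, relative to itself, the itinerary of the leaf. -/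
lemma not_mem_self (h : Leaf p c d e κ) {y : Angle} (hy : Sb c y d)
    (hs : ∀ i < p, dbl^[i] y ∈ symbolArc y (κ i)) : False := by
  have h1 : (1 : ℝ) ≤ 2 ^ p := one_le_pow₀ (by norm_num)
  rcases h.near_of_mem hy hy hs with h | h
  · nlinarith [ccw_nonneg c y]
  · nlinarith [ccw_nonneg y d]

end Leaf

/-! ### Inverse branches of the doubling map -/

/-- `x` lies in the half-open half circle with symbol `s`, relative to `β`. The end `sideBase β s`
is included, so that every angle has exactly one preimage in each half circle. -/
def InHalf (β : Angle) (s : Bool) (x : Angle) : Prop := ccw (sideBase β s) x < 1 / 2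

lemma InHalf.of_mem {β x : Angle} {s : Bool} (h : x ∈ symbolArc β s) : InHalf β s x :=
  (mem_symbolArc_iff.1 h).2

lemma sb_iter_half {β x y z : Angle} {n : ℕ} {κ : ℕ → Bool}
    (hx : ∀ i < n, InHalf β (κ i) (dbl^[i] x)) (hy : ∀ i < n, InHalf β (κ i) (dbl^[i] y))
    (hz : ∀ i < n, InHalf β (κ i) (dbl^[i] z)) :
    Sb (dbl^[n] x) (dbl^[n] y) (dbl^[n] z) ↔ Sb x y z := by
  induction n with
  | zero => rfl
  | succ n ih =>
    simp only [Function.iterate_succ_apply']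
    rw [sb_dbl_iff (hx n (by lia)) (hy n (by lia)) (hz n (by lia))]
    exact ih (fun i hi => hx i (by lia)) (fun i hi => hy i (by lia)) (fun i hi => hz i (by lia))

lemma not_inHalf_not {β x : Angle} {s : Bool} (h : InHalf β s x) : ¬ InHalf β (!s) x := by
  unfold InHalf at *
  rw [sideBase_not]
  have h1 := ccw_base (sideBase β s) (sideBase β s + oneHalf) x
  rw [ccw_self_add_oneHalf] at h1
  grind [ccw_nonneg]

/-- The inverse branch of the doubling map with values in the half circle with symbol `s`. -/
noncomputable def br (β : Angle) (s : Bool) (y : Angle) : Angle :=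
  sideBase β s + ((ccw β y / 2 : ℝ) : Angle)

lemma ccw_br (β : Angle) (s : Bool) (y : Angle) : ccw (sideBase β s) (br β s y) = ccw β y / 2 :=
  ccw_add_of_lt _ (by linarith [ccw_nonneg β y]) (by linarith [ccw_lt_one β y])

lemma inHalf_br (β : Angle) (s : Bool) (y : Angle) : InHalf β s (br β s y) := by
  rw [InHalf, ccw_br]; linarith [ccw_lt_one β y]

@[simp] lemma dbl_br (β : Angle) (s : Bool) (y : Angle) : dbl (br β s y) = y := by
  rw [br, dbl_add, dbl_sideBase, mul_div_cancel₀ _ two_ne_zero, add_ccw]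

lemma InHalf.eq {β x y : Angle} {s : Bool} (hx : InHalf β s x) (hy : InHalf β s y)
    (h : dbl x = dbl y) : x = y := by
  have h1 := ccw_dbl (sideBase β s) x
  have h2 := ccw_dbl (sideBase β s) y
  unfold InHalf at hx hy
  rw [if_pos hx] at h1
  rw [if_pos hy] at h2
  rw [h] at h1
  exact ccw_inj (a := sideBase β s) (by linarith)

/-- The composition of the first `n` inverse branches prescribed by `u`. -/
noncomputable def pull (β : Angle) (u : ℕ → Bool) : ℕ → Angle → Angle
  | 0, y => y
  | n + 1, y => br β (u 0) (pull β (fun i => u (i + 1)) n y)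

lemma iter_pull (β : Angle) (u : ℕ → Bool) (n : ℕ) (y : Angle) : dbl^[n] (pull β u n y) = y := by
  induction n generalizing u with
  | zero => rfl
  | succ n ih => rw [Function.iterate_succ_apply, pull, dbl_br, ih]

lemma inHalf_pull (β : Angle) (u : ℕ → Bool) (n : ℕ) (y : Angle) {i : ℕ} (hi : i < n) :
    InHalf β (u i) (dbl^[i] (pull β u n y)) := by
  induction n generalizing u i with
  | zero => lia
  | succ n ih =>
    cases i with
    | zero => exact inHalf_br _ _ _
    | succ i =>
      rw [Function.iterate_succ_apply, pull, dbl_br]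
      exact ih (fun i => u (i + 1)) (by lia)

lemma eq_of_inHalf {β x y : Angle} {u : ℕ → Bool} {n : ℕ}
    (hx : ∀ i < n, InHalf β (u i) (dbl^[i] x)) (hy : ∀ i < n, InHalf β (u i) (dbl^[i] y))
    (h : dbl^[n] x = dbl^[n] y) : x = y := by
  induction n with
  | zero => exact h
  | succ n ih =>
    apply ih (fun i hi => hx i (by lia)) (fun i hi => hy i (by lia))
    simp only [Function.iterate_succ_apply'] at h
    exact (hx n (by lia)).eq (hy n (by lia)) h

lemma pull_iter {β x : Angle} {u : ℕ → Bool} {n : ℕ}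
    (hx : ∀ i < n, InHalf β (u i) (dbl^[i] x)) : pull β u n (dbl^[n] x) = x :=
  eq_of_inHalf (fun _ hi => inHalf_pull _ _ _ _ hi) hx (iter_pull _ _ _ _)

lemma pull_congr {β y : Angle} {u w : ℕ → Bool} {n : ℕ} (h : ∀ i < n, u i = w i) :
    pull β u n y = pull β w n y := by
  apply eq_of_inHalf (β := β) (u := u) (n := n) (fun _ hi => inHalf_pull _ _ _ _ hi)
  · intro i hi
    rw [h i hi]; exact inHalf_pull _ _ _ _ hi
  · rw [iter_pull, iter_pull]

/-- If `β` lies behind `a`, `b`, then the arc between the preimages of `a` and `b` on one side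
contains the whole other side. -/
lemma sb_br_of_inHalf {β a b x : Angle} {s : Bool} (hβ : Sb a β b) (hx : InHalf β (!s) x) :
    Sb (br β s a) x (br β s b) := by
  have h1 := ccw_br β s a
  have h2 := ccw_br β s b
  unfold InHalf at hx
  rw [sideBase_not] at hx
  generalize sideBase β s = o at *
  have h3 := ccw_base o (o + oneHalf) x
  rw [ccw_self_add_oneHalf] at h3
  have h4 := ccw_base o (br β s a) x
  have h5 := ccw_base o (br β s a) (br β s b)
  rw [h1] at h4 h5
  rw [h2] at h5
  have h6 := ccw_base β a b
  have h7 := ccw_base β a β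
  rw [ccw_self] at h7
  unfold Sb at *
  clear h1 h2
  grind [ccw_lt_one, ccw_nonneg]

lemma continuous_dbl : Continuous dbl := by unfold dbl; fun_prop

lemma isClosed_arc (o : Angle) {c : ℝ} (hc : c < 1) : IsClosed {x : Angle | ccw o x ≤ c} := by
  have : {x : Angle | ccw o x ≤ c} = (fun t : ℝ => o + (t : Angle)) '' Set.Icc 0 c := by
    ext x
    constructor
    · intro h
      exact ⟨ccw o x, ⟨ccw_nonneg _ _, h⟩, add_ccw _ _⟩
    · rintro ⟨t, ht, rfl⟩
      simp only [Set.mem_ofPred_eq]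
      rw [ccw_add_of_lt _ ht.1 (by linarith [ht.2])]
      exact ht.2
  rw [this]
  exact (isCompact_Icc.image (by fun_prop)).isClosed

lemma mem_symbolArc_of_le {β x : Angle} {s : Bool} (h : ccw (sideBase β s) x ≤ 1 / 2)
    (hx : dbl x ≠ β) : x ∈ symbolArc β s := by
  rw [mem_symbolArc_iff]
  refine ⟨ccw_pos.2 ?_, lt_of_le_of_ne h ?_⟩
  · rintro rfl; simp at hx
  · intro h1
    have : x = sideBase β s + oneHalf := ccw_inj (a := sideBase β s) (by simp [h1])
    rw [this] at hx; simp at hx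

/-- The limit of a decreasing sequence of successive preimages under `h^t` is fixed by `h^t`. -/
lemma exists_fixed_limit {F : ℝ → Angle} (hF : Continuous F) {t : ℕ} {s : ℕ → ℝ}
    (h0 : ∀ k, 0 ≤ s k) (hs : StrictAnti s) (hT : ∀ k, dbl^[t] (F (s (k + 1))) = F (s k)) :
    ∃ l, 0 ≤ l ∧ (∀ k, l < s k) ∧ dbl^[t] (F l) = F l ∧ (∀ z, (∀ k, z ≤ s k) → z ≤ l) ∧
      ∀ K : Set Angle, IsClosed K → ∀ i, (∀ k, dbl^[i] (F (s (k + 1))) ∈ K) →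
        dbl^[i] (F l) ∈ K := by
  have hb : BddBelow (Set.range s) := ⟨0, by rintro _ ⟨k, rfl⟩; exact h0 k⟩
  have hl := tendsto_atTop_ciInf hs.antitone hb
  refine ⟨_, le_ciInf h0, fun k => lt_of_le_of_lt (ciInf_le hb (k + 1)) (hs (by lia)), ?_,
    fun z hz => le_ciInf hz, ?_⟩
  · have h1 : Tendsto (fun k => dbl^[t] (F (s (k + 1)))) atTop (𝓝 (dbl^[t] (F (⨅ i, s i)))) :=
      (((continuous_dbl.iterate t).comp hF).tendsto _).comp (hl.comp (tendsto_add_atTop_nat 1))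
    simp only [hT] at h1
    exact tendsto_nhds_unique h1 ((hF.tendsto _).comp hl)
  · intro K hK i hi
    have h1 : Tendsto (fun k => dbl^[i] (F (s (k + 1)))) atTop (𝓝 (dbl^[i] (F (⨅ i, s i)))) :=
      (((continuous_dbl.iterate i).comp hF).tendsto _).comp (hl.comp (tendsto_add_atTop_nat 1))
    exact hK.mem_of_tendsto h1 (Eventually.of_forall hi)

/-- A fixed point of `h^t` in the closures of the prescribed sides lies in the open sides, since no
iterate of it is `β`. -/
lemma mem_symbolArc_of_fixed {β z : Angle} {t : ℕ} {u : ℕ → Bool} (ht : 0 < t)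
    (hu : ∀ i, u (i + t) = u i) (hβ : dbl^[t] β ≠ β) (hz : dbl^[t] z = z)
    (h : ∀ i < t, ccw (sideBase β (u i)) (dbl^[i] z) ≤ 1 / 2) (i : ℕ) :
    dbl^[i] z ∈ symbolArc β (u i) := by
  have hz' : Function.IsPeriodicPt dbl t z := hz
  have hu' : u i = u (i % t) := by
    have : Function.Periodic u t := hu
    exact (this.map_mod_nat i).symm
  rw [← hz'.iterate_mod_apply, hu']
  apply mem_symbolArc_of_le (h _ (Nat.mod_lt _ ht))
  intro hb
  apply hβ
  rw [← hb, ← Function.iterate_succ_apply' dbl, ← Function.iterate_add_apply, add_comm,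
    Function.iterate_add_apply, hz]

/-- The composition of the inverse branches prescribed by a periodic sequence `u` enlarges the arc
`[a, b]` if the last branch is the wrong one for `a` and `b`; iterating it leads to an arc
`[c, d]` whose ends have the itinerary `u`. The base points `ζ`, `ζ'` control the orientation. -/
theorem exists_fixed_arc {β a b ζ ζ' : Angle} {t : ℕ} {u : ℕ → Bool} {X : Set Angle} (ht : 0 < t)
    (hu : ∀ i, u (i + t) = u i) (hβ : Sb a β b)
    (has : ∀ i < t - 1, InHalf β (u i) (dbl^[i] a)) (hbs : ∀ i < t - 1, InHalf β (u i) (dbl^[i] b))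
    (hat : InHalf β (!u (t - 1)) (dbl^[t - 1] a)) (hbt : InHalf β (!u (t - 1)) (dbl^[t - 1] b))
    (ha : a ∈ X) (hb : b ∈ X) (hX : ∀ y, pull β u t y ∈ X)
    (h1 : Sb ζ a b) (h2 : Sb ζ b ζ')
    (HL : ∀ x ∈ X, ∀ y ∈ X, Sb ζ x y → ccw ζ y ≤ ccw ζ b → Sb ζ (pull β u t x) (pull β u t y))
    (HR : ∀ x ∈ X, ∀ y ∈ X, Sb x y ζ' → ccw x ζ' ≤ ccw a ζ' →
      Sb (pull β u t x) (pull β u t y) ζ')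
    (hfix : dbl^[t] β ≠ β) :
    ∃ c d, dbl^[t] c = c ∧ dbl^[t] d = d ∧ (∀ i, dbl^[i] c ∈ symbolArc β (u i)) ∧
      (∀ i, dbl^[i] d ∈ symbolArc β (u i)) ∧ ccw ζ c < ccw ζ a ∧ ccw d ζ' < ccw b ζ' ∧
      ∀ z, dbl^[t] z = z → (∀ i, dbl^[i] z ∈ symbolArc β (u i)) → ¬ Sb c z d := by
  -- The iterates of `a` and `b` under `g` move towards the base points, and converge to fixed
  -- points of `h^t`.
  set g := pull β u t with hg
  have hgi : ∀ y, ∀ i < t, InHalf β (u i) (dbl^[i] (g y)) := fun y i hi => inHalf_pull _ _ _ _ hi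
  have hgt : ∀ y, dbl^[t] (g y) = y := fun y => iter_pull _ _ _ _
  have hg1 : ∀ y, dbl^[t - 1] (g y) = br β (u (t - 1)) y := fun y => by
    apply (hgi y (t - 1) (by lia)).eq (inHalf_br _ _ _)
    rw [dbl_br, ← Function.iterate_succ_apply' dbl, show (t - 1).succ = t by lia, hgt]
  -- `a` and `b` lie in the arc between `g a` and `g b`
  have e1 : Sb (g a) a (g b) := by
    rw [← sb_iter_half (n := t - 1) (fun i hi => hgi a i (by lia)) has
      (fun i hi => hgi b i (by lia)), hg1, hg1]
    exact sb_br_of_inHalf hβ hat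
  have e2 : Sb (g a) b (g b) := by
    rw [← sb_iter_half (n := t - 1) (fun i hi => hgi a i (by lia)) hbs
      (fun i hi => hgi b i (by lia)), hg1, hg1]
    exact sb_br_of_inHalf hβ hbt
  have e3 : Sb ζ (g a) (g b) := HL a ha b hb h1 le_rfl
  have h3 : Sb a b ζ' := by
    have := ccw_base ζ a b
    have := ccw_base ζ a ζ'
    unfold Sb at *
    clear HL HR has hbs hat hbt hgi hgt hg1
    grind
  have e4 : Sb (g a) (g b) ζ' := HR a ha b hb h3 le_rfl
  have f1 : Sb ζ (g a) a := by
    have := ccw_base ζ (g a) a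
    have := ccw_base ζ (g a) (g b)
    unfold Sb at *
    clear HL HR has hbs hat hbt hgi hgt hg1
    grind [ccw_nonneg, ccw_lt_one]
  have f2 : Sb b (g b) ζ' := by
    have := ccw_base ζ' (g a) b
    have := ccw_base ζ' (g a) (g b)
    have := ccw_base ζ' (g a) ζ'
    have := ccw_base ζ' b (g b)
    have := ccw_base ζ' b ζ'
    have := ccw_self ζ'
    unfold Sb at *
    clear HL HR has hbs hat hbt hgi hgt hg1
    grind [ccw_nonneg, ccw_lt_one]
  -- the monotone sequences
  have gX : ∀ k, ∀ x ∈ X, g^[k] x ∈ X := by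
    intro k x hx
    cases k with
    | zero => exact hx
    | succ k => rw [Function.iterate_succ_apply']; exact hX _
  have sL : ∀ k, Sb ζ (g^[k + 1] a) (g^[k] a) ∧ ccw ζ (g^[k] a) ≤ ccw ζ a := by
    intro k
    induction k with
    | zero => exact ⟨f1, le_rfl⟩
    | succ k ih =>
      refine ⟨?_, ih.1.2.le.trans ih.2⟩
      have := HL _ (gX _ _ ha) _ (gX _ _ ha) ih.1 (ih.2.trans h1.2.le)
      simpa only [← Function.iterate_succ_apply' g] using this
  have sR : ∀ k, Sb (g^[k] b) (g^[k + 1] b) ζ' ∧ ccw (g^[k] b) ζ' ≤ ccw b ζ' := by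
    intro k
    induction k with
    | zero => exact ⟨f2, le_rfl⟩
    | succ k ih =>
      have hk : ccw (g^[k + 1] b) ζ' < ccw (g^[k] b) ζ' := by
        have := ccw_base (g^[k] b) (g^[k + 1] b) ζ'
        have := ih.1.1
        have := ih.1.2
        clear HL HR has hbs hat hbt hgi hgt hg1
        grind [ccw_nonneg, ccw_lt_one]
      refine ⟨?_, hk.le.trans ih.2⟩
      have hab : ccw b ζ' ≤ ccw a ζ' := by
        have := ccw_base a b ζ'
        have := h3.1
        have := h3.2
        clear HL HR has hbs hat hbt hgi hgt hg1
        grind [ccw_nonneg, ccw_lt_one]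
      have := HR _ (gX _ _ hb) _ (gX _ _ hb) ih.1 (ih.2.trans hab)
      simpa only [← Function.iterate_succ_apply' g] using this
  have sR' : ∀ k, ccw (g^[k + 1] b) ζ' < ccw (g^[k] b) ζ' := by
    intro k
    have := ccw_base (g^[k] b) (g^[k + 1] b) ζ'
    have := (sR k).1.1
    have := (sR k).1.2
    clear HL HR has hbs hat hbt hgi hgt hg1 sL sR
    grind [ccw_nonneg, ccw_lt_one]
  have FL : ∀ x : Angle, ζ + ((ccw ζ x : ℝ) : Angle) = x := fun x => add_ccw ζ x
  have FR : ∀ x : Angle, ζ' - ((ccw x ζ' : ℝ) : Angle) = x := fun x => by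
    nth_rewrite 1 [← add_ccw x ζ']; abel
  obtain ⟨l, hl0, hl1, hl2, hl3, hl4⟩ := exists_fixed_limit (F := fun s : ℝ => ζ + (s : Angle))
    (t := t) (s := fun k => ccw ζ (g^[k] a)) (by fun_prop) (fun k => ccw_nonneg _ _)
    (strictAnti_nat_of_succ_lt fun k => (sL k).1.2)
    (fun k => by simp only [FL, Function.iterate_succ_apply', hgt])
  obtain ⟨r, hr0, hr1, hr2, hr3, hr4⟩ := exists_fixed_limit (F := fun s : ℝ => ζ' - (s : Angle))
    (t := t) (s := fun k => ccw (g^[k] b) ζ') (by fun_prop) (fun k => ccw_nonneg _ _)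
    (strictAnti_nat_of_succ_lt fun k => sR' k)
    (fun k => by simp only [FR, Function.iterate_succ_apply', hgt])
  simp only [FL, FR] at hl4 hr4
  have hcl : ccw ζ (ζ + ((l : ℝ) : Angle)) = l :=
    ccw_add_of_lt _ hl0 ((hl1 0).trans (ccw_lt_one _ _))
  have hdr : ccw (ζ' - ((r : ℝ) : Angle)) ζ' = r := by
    have := ccw_add_of_lt (ζ' - ((r : ℝ) : Angle)) hr0 ((hr1 0).trans (ccw_lt_one _ _))
    rwa [sub_add_cancel] at this
  refine ⟨ζ + (l : Angle), ζ' - (r : Angle), hl2, hr2, ?_, ?_, ?_, ?_, ?_⟩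
  · refine mem_symbolArc_of_fixed ht hu hfix hl2 fun i hi => ?_
    refine hl4 _ (isClosed_arc _ (by norm_num)) i fun k => ?_
    rw [Function.iterate_succ_apply']
    exact (hgi _ i hi).le
  · refine mem_symbolArc_of_fixed ht hu hfix hr2 fun i hi => ?_
    refine hr4 _ (isClosed_arc _ (by norm_num)) i fun k => ?_
    rw [Function.iterate_succ_apply']
    exact (hgi _ i hi).le
  · rw [hcl]; exact hl1 0
  · rw [hdr]; exact hr1 0
  · intro z hz hzs hsb
    have hgz : g z = z := by
      have := pull_iter (β := β) (u := u) (n := t) (x := z) (fun i _ => .of_mem (hzs i))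
      rwa [hz] at this
    have zX : z ∈ X := hgz ▸ hX z
    have hl0' := hl1 0
    have hr0' := hr1 0
    simp only [Function.iterate_zero, id] at hl0' hr0'
    -- `z` is not between `a` and `b`
    have m1 : ¬ Sb a z b := by
      have m2 : ¬ Sb a (g a) b := by
        have := ccw_base ζ a (g a)
        have := ccw_base ζ a b
        unfold Sb at *
        clear HL HR has hbs hat hbt hgi hgt hg1 sL sR gX
        grind [ccw_nonneg, ccw_lt_one]
      intro m3
      apply m2
      rw [← sb_iter_half (n := t - 1) has (fun i hi => hgi a i (by lia)) hbs, hg1]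
      rw [← sb_iter_half (n := t - 1) has (fun i hi => .of_mem (hzs i)) hbs] at m3
      have q1 : InHalf β (u (t - 1)) (dbl^[t - 1] z) := .of_mem (hzs _)
      have q2 := inHalf_br β (u (t - 1)) a
      generalize br β (u (t - 1)) a = w at *
      unfold InHalf at q1 q2 hat hbt
      rw [sideBase_not] at hat hbt
      generalize sideBase β (u (t - 1)) = o at *
      have k1 := ccw_base o (o + oneHalf) (dbl^[t - 1] a)
      have k2 := ccw_base o (o + oneHalf) (dbl^[t - 1] b)
      rw [ccw_self_add_oneHalf] at k1 k2
      have := ccw_base o (dbl^[t - 1] a) (dbl^[t - 1] b)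
      have := ccw_base o (dbl^[t - 1] a) (dbl^[t - 1] z)
      have := ccw_base o (dbl^[t - 1] a) w
      clear HL HR has hbs hgi hgt hg1 sL sR gX
      unfold Sb at *
      grind [ccw_nonneg, ccw_lt_one]
    have m4 : ccw ζ z ≤ ccw ζ a → False := by
      intro hza
      have : ∀ k, ccw ζ z ≤ ccw ζ (g^[k] a) := by
        intro k
        induction k with
        | zero => exact hza
        | succ k ih =>
          rcases ih.eq_or_lt with h | h
          · have h4 := ccw_inj h
            rw [Function.iterate_succ_apply', ← h4, hgz]
          · have hz0 : 0 < ccw ζ z := by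
              have := ccw_base ζ (ζ + (l : Angle)) z
              have := ccw_base ζ (ζ + (l : Angle)) (ζ' - (r : Angle))
              have := ccw_base ζ' b (ζ' - (r : Angle))
              have := ccw_base ζ b ζ'
              have := ccw_base ζ (ζ' - (r : Angle)) ζ'
              unfold Sb at *
              clear HL HR has hbs hgi hgt hg1 sL sR gX hl3 hl4 hr3 hr4 FL FR sR' hl1 hr1
              grind [ccw_nonneg, ccw_lt_one]
            have := HL z zX _ (gX k a ha) ⟨hz0, h⟩ ((sL k).2.trans h1.2.le)
            rw [hgz, ← Function.iterate_succ_apply' g] at this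
            exact this.2.le
      have := hl3 _ this
      have := ccw_base ζ (ζ + (l : Angle)) z
      have := ccw_base ζ (ζ + (l : Angle)) (ζ' - (r : Angle))
      have := ccw_base ζ (ζ' - (r : Angle)) ζ'
      have := ccw_base ζ b ζ'
      unfold Sb at *
      clear HL HR has hbs hgi hgt hg1 sL sR gX hl3 hl4 hr3 hr4 FL FR sR' hl1 hr1
      grind [ccw_nonneg, ccw_lt_one]
    have m5 : ccw z ζ' ≤ ccw b ζ' → False := by
      intro hza
      have : ∀ k, ccw z ζ' ≤ ccw (g^[k] b) ζ' := by
        intro k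
        induction k with
        | zero => exact hza
        | succ k ih =>
          rcases ih.eq_or_lt with h | h
          · have h4 : z = g^[k] b := by rw [← FR z, h, FR]
            rw [Function.iterate_succ_apply', ← h4, hgz]
          · have hz0 : Sb (g^[k] b) z ζ' := by
              have hne : z ≠ ζ' := by
                rintro rfl
                have := ccw_base ζ (ζ + (l : Angle)) z
                have := ccw_base ζ (ζ + (l : Angle)) (z - (r : Angle))
                have := ccw_base ζ (z - (r : Angle)) z
                have := ccw_base ζ b z
                unfold Sb at *
                clear HL HR has hbs hgi hgt hg1 sL sR gX hl3 hl4 hr3 hr4 FL FR sR' hl1 hr1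
                grind [ccw_nonneg, ccw_lt_one]
              have := ccw_pos.2 hne.symm
              have := ccw_base (g^[k] b) z ζ'
              clear HL HR has hbs hgi hgt hg1 sL sR gX hl3 hl4 hr3 hr4 FL FR sR' hl1 hr1
              unfold Sb
              grind [ccw_nonneg, ccw_lt_one]
            have hab : ccw b ζ' ≤ ccw a ζ' := by
              have := ccw_base a b ζ'
              have := h3.1
              have := h3.2
              clear HL HR has hbs hat hbt hgi hgt hg1 sL sR gX hl3 hl4 hr3 hr4 FL FR sR' hl1 hr1
              grind [ccw_nonneg, ccw_lt_one]
            have k0 := HR _ (gX k b hb) z zX hz0 ((sR k).2.trans hab)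
            rw [hgz, ← Function.iterate_succ_apply' g] at k0
            have := ccw_base (g^[k + 1] b) z ζ'
            unfold Sb at *
            clear HL HR has hbs hgi hgt hg1 sL sR gX hl3 hl4 hr3 hr4 FL FR sR' hl1 hr1
            grind [ccw_nonneg, ccw_lt_one]
      have := hr3 _ this
      have := ccw_base ζ (ζ + (l : Angle)) z
      have := ccw_base ζ (ζ + (l : Angle)) (ζ' - (r : Angle))
      have := ccw_base ζ (ζ' - (r : Angle)) ζ'
      have := ccw_base ζ b ζ'
      have := ccw_base ζ z ζ'
      unfold Sb at *
      clear HL HR has hbs hgi hgt hg1 sL sR gX hl3 hl4 hr3 hr4 FL FR sR' hl1 hr1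
      grind [ccw_nonneg, ccw_lt_one]
    have := ccw_base ζ (ζ + (l : Angle)) z
    have := ccw_base ζ (ζ + (l : Angle)) (ζ' - (r : Angle))
    have := ccw_base ζ (ζ' - (r : Angle)) ζ'
    have := ccw_base ζ b ζ'
    have := ccw_base ζ z ζ'
    have := ccw_base ζ a z
    have := ccw_base ζ a b
    unfold Sb at *
    clear HL HR has hbs hgi hgt hg1 sL sR gX hl3 hl4 hr3 hr4 FL FR sR' hl1 hr1
    grind [ccw_nonneg, ccw_lt_one]

/-! ### Parameter leaves from arcs of fixed points -/

/-- Two shifts of a periodic sequence that agree on all but one place of a period agree. -/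
lemma eq_shift_of_window {t j : ℕ} {u : ℕ → Bool} (hu : ∀ i, u (i + t) = u i)
    (h : ∀ i < t - 1, u (i + j) = u i) (ht : 0 < t) (i : ℕ) : u (i + j) = u i := by
  -- The number of symbols `true` in a window of length `t` does not depend on the position of the
  -- window, so the last symbols in the windows agree as well.
  set F : ℕ → ℕ := fun k => ∑ i ∈ Finset.range t, (u (i + k)).toNat with hF
  have hF0 : ∀ k, F k = F 0 := by
    intro k
    induction k with
    | zero => rfl
    | succ k ih =>
      rw [← ih]
      have h1 := Finset.sum_range_succ (fun i => (u (i + k)).toNat) t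
      have h2 := Finset.sum_range_succ' (fun i => (u (i + k)).toNat) t
      rw [h1, add_comm t k, hu] at h2
      simp only [hF]
      simp only [zero_add, add_assoc, add_comm 1 k] at h2
      lia
  have h3 := hF0 j
  simp only [hF] at h3
  obtain ⟨n, rfl⟩ : ∃ n, t = n + 1 := ⟨t - 1, by lia⟩
  rw [Finset.sum_range_succ, Finset.sum_range_succ,
    Finset.sum_congr rfl (fun i hi => by rw [h i (by simpa using hi)])] at h3
  simp only [add_zero, Nat.add_left_cancel_iff] at h3
  have h4 : u (n + j) = u n := by
    revert h3; cases u (n + j) <;> cases u n <;> simp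
  have hp : Function.Periodic u (n + 1) := hu
  have hp' : Function.Periodic (fun i => u (i + j)) (n + 1) := fun i => by
    simp only [show i + (n + 1) + j = i + j + (n + 1) by ring, hu]
  have e1 := hp'.map_mod_nat i
  have e2 := hp.map_mod_nat i
  rw [← e1, ← e2]
  have := Nat.mod_lt i (Nat.succ_pos n)
  rcases Nat.lt_or_ge (i % (n + 1)) n with h5 | h5
  · exact h _ (by simpa using h5)
  · rw [show i % (n + 1) = n by simp only [Nat.succ_eq_add_one] at this; lia]; exact h4

/-- Crossing chords that avoid the diameter of `β` lie on the same side. -/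
lemma side_eq_of_crosses {β x y z w : Angle} {s t : Bool} (hx : x ∈ symbolArc β s)
    (hy : y ∈ symbolArc β s) (hz : z ∈ symbolArc β t) (hw : w ∈ symbolArc β t)
    (h : Crosses s(x, y) s(z, w)) : s = t := by
  by_contra hst
  have : t = !s := by revert hst; cases s <;> cases t <;> simp
  subst this
  rw [mem_symbolArc_iff] at hx hy hz hw
  rw [sideBase_not] at hz hw
  have h0 := ccw_self_add_oneHalf (sideBase β s)
  generalize sideBase β s = o at *
  have h1 := ccw_base o (o + oneHalf) z
  have h2 := ccw_base o (o + oneHalf) w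
  rw [h0] at h1 h2
  rw [crosses_mk] at h
  simp only [Sb] at h
  have := ccw_base o x y
  have := ccw_base o x z
  have := ccw_base o x w
  have := ccw_base o y x
  have := ccw_base o y z
  have := ccw_base o y w
  clear hst h0
  grind (splits := 20) [ccw_nonneg, ccw_lt_one]

/-- A chord on one side whose image is not longer is mapped to a chord behind which `β` lies. -/
lemma sb_dbl_of_length_le {β x y : Angle} {s : Bool} (hx : x ∈ symbolArc β s)
    (hy : y ∈ symbolArc β s) (hpos : x ≠ y)
    (h : chordLength s(dbl x, dbl y) ≤ chordLength s(x, y)) :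
    (Sb (dbl x) β (dbl y) ∧ ccw (dbl x) (dbl y) = chordLength s(dbl x, dbl y)) ∨
    (Sb (dbl y) β (dbl x) ∧ ccw (dbl y) (dbl x) = chordLength s(dbl x, dbl y)) := by
  rw [mem_symbolArc_iff] at hx hy
  rw [chordLength_mk, chordLength_mk] at *
  have hpos' : ccw (sideBase β s) x ≠ ccw (sideBase β s) y := fun h => hpos (ccw_inj h)
  have h1 := ccw_dbl (sideBase β s) x
  have h2 := ccw_dbl (sideBase β s) y
  rw [dbl_sideBase] at h1 h2
  have := ccw_base (sideBase β s) x y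
  have := ccw_base β (dbl x) (dbl y)
  have := ccw_base β (dbl y) (dbl x)
  have h3 := ccw_base β (dbl x) β
  have h4 := ccw_base β (dbl y) β
  rw [ccw_self] at h3 h4
  unfold Sb
  grind (splits := 20) [ccw_nonneg, ccw_lt_one]

/-- An arc around `β` whose ends are fixed by `h^t` and have the itinerary `u`, and which contains
no other such point, is bounded by a parameter leaf. The point `a` between `c` and `β`
shadows `c` for all but one place of the period. -/
theorem exists_isParamLeaf_of_fixed_arc {β a c d : Angle} {t : ℕ} {u : ℕ → Bool} (ht : 0 < t)
    (hu : ∀ i, u (i + t) = u i) (hc : dbl^[t] c = c) (hd : dbl^[t] d = d)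
    (hcs : ∀ i, dbl^[i] c ∈ symbolArc β (u i)) (hds : ∀ i, dbl^[i] d ∈ symbolArc β (u i))
    (hlt : ccw c d < 1 / 2) (hca : Sb c a β) (hβ : Sb c β d)
    (has : ∀ i < t - 1, dbl^[i] a ∈ symbolArc β (u i)) (hat : dbl^[t] a ≠ a)
    (hno : ∀ z, dbl^[t] z = z → ¬ Sb a z β)
    (hmin : ∀ z, dbl^[t] z = z → (∀ i, dbl^[i] z ∈ symbolArc β (u i)) → ¬ Sb c z d) :
    ∃ r ≤ t, IsParamLeaf r s(c, d) := by
  have hpc : Function.IsPeriodicPt dbl t c := hc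
  have hpd : Function.IsPeriodicPt dbl t d := hd
  have hcd : c ≠ d := by
    rintro rfl
    have := hβ.2; rw [ccw_self] at this; linarith [hβ.1]
  have hfix : ∀ i x, dbl^[t] x = x → dbl^[t] (dbl^[i] x) = dbl^[i] x := fun i x hx => by
    rw [← Function.iterate_add_apply, add_comm, Function.iterate_add_apply, hx]
  -- the iterates with the same itinerary do not end behind the chord
  have hsame : ∀ x, x = c ∨ x = d → ∀ j, (∀ i, u (i + j) = u i) → ¬ Sb c (dbl^[j] x) d := by
    intro x hx j hj
    have hxt : dbl^[t] x = x := by rcases hx with rfl | rfl <;> assumption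
    refine hmin _ (hfix j x hxt) fun i => ?_
    rw [← Function.iterate_add_apply, ← hj]
    rcases hx with rfl | rfl
    exacts [hcs _, hds _]
  have hcr : ∀ j, ¬ Crosses s(c, d) s(dbl^[j] c, dbl^[j] d) := by
    intro j hj
    have key : ∀ n, Crosses s(dbl^[n] c, dbl^[n] d) s(dbl^[n + j] c, dbl^[n + j] d) := by
      intro n
      induction n with
      | zero => simpa using hj
      | succ n ih =>
        rw [Nat.succ_add]
        simp only [Function.iterate_succ_apply']
        exact crosses_dbl (hcs _) (hds _) (hcs _) (hds _) ih
    have hsh : ∀ n, u (n + j) = u n := fun n =>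
      (side_eq_of_crosses (hcs _) (hds _) (hcs _) (hds _) (key n)).symm
    rw [crosses_mk] at hj
    rcases hj with h | h
    · exact hsame c (Or.inl rfl) j hsh h.1
    · exact hsame d (Or.inr rfl) j hsh h.1
  -- a shortest iterate
  obtain ⟨j, -, hj⟩ := Finset.exists_min_image (Finset.range t)
    (fun i => chordLength s(dbl^[i] c, dbl^[i] d)) ⟨0, by simpa using ht⟩
  have hj' : ∀ i, chordLength s(dbl^[j] c, dbl^[j] d) ≤ chordLength s(dbl^[i] c, dbl^[i] d) := by
    intro i
    rw [← hpc.iterate_mod_apply i, ← hpd.iterate_mod_apply i]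
    exact hj _ (by simpa using Nat.mod_lt _ ht)
  obtain ⟨c', d', hcd', hβ', hlen⟩ : ∃ c' d',
      ((c' = dbl^[j] c ∧ d' = dbl^[j] d) ∨ (c' = dbl^[j] d ∧ d' = dbl^[j] c)) ∧ Sb c' β d' ∧
        ccw c' d' = chordLength s(dbl^[j] c, dbl^[j] d) := by
    have e : ∀ x, dbl^[t] x = x → dbl^[j] x = dbl (dbl^[j + t - 1] x) := by
      intro x hx
      rw [← Function.iterate_succ_apply' dbl, show (j + t - 1).succ = j + t by lia,
        Function.iterate_add_apply, hx]
    have h1 := hj' (j + t - 1)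
    have hne : dbl^[j + t - 1] c ≠ dbl^[j + t - 1] d := fun h => hcd (iter_injOn ht hc hd h)
    rw [e c hc, e d hd] at h1 ⊢
    rcases sb_dbl_of_length_le (hcs _) (hds _) hne h1 with h | h
    · exact ⟨_, _, Or.inl ⟨rfl, rfl⟩, h⟩
    · exact ⟨_, _, Or.inr ⟨rfl, rfl⟩, h⟩
  have hcr' : ¬ Crosses s(c, d) s(c', d') := by
    rcases hcd' with ⟨rfl, rfl⟩ | ⟨rfl, rfl⟩
    · exact hcr j
    · rw [Sym2.eq_swap (a := dbl^[j] d)]; exact hcr j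
  have hle : ccw c' d' ≤ ccw c d := by
    rw [hlen]
    refine (hj' 0).trans ?_
    rw [Function.iterate_zero, chordLength_mk]
    exact min_le_left _ _
  have hc't : dbl^[t] c' = c' := by
    rcases hcd' with ⟨rfl, rfl⟩ | ⟨rfl, rfl⟩
    exacts [hfix j c hc, hfix j d hd]
  have hd't : dbl^[t] d' = d' := by
    rcases hcd' with ⟨rfl, rfl⟩ | ⟨rfl, rfl⟩
    exacts [hfix j d hd, hfix j c hc]
  have hc's : ∀ i, dbl^[i] c' ∈ symbolArc β (u (i + j)) := by
    intro i
    rcases hcd' with ⟨rfl, rfl⟩ | ⟨rfl, rfl⟩ <;> rw [← Function.iterate_add_apply]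
    exacts [hcs _, hds _]
  have hd's : ∀ i, dbl^[i] d' ∈ symbolArc β (u (i + j)) := by
    intro i
    rcases hcd' with ⟨rfl, rfl⟩ | ⟨rfl, rfl⟩ <;> rw [← Function.iterate_add_apply]
    exacts [hds _, hcs _]
  have horder : ccw c c' < ccw c β ∧ ccw c β < ccw c d' ∧ ccw c d' ≤ ccw c d := by
    rw [crosses_mk] at hcr'
    have := ccw_base c c' β
    have := ccw_base c c' d'
    have := ccw_base c d c'
    have := ccw_base c d d'
    have h5 := ccw_base c d c
    rw [ccw_self] at h5
    unfold Sb at *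
    clear hmin hno has hcs hds hu hj' hc's hd's hsame hfix hcd' hj hlen hca
    grind (splits := 20) [ccw_nonneg, ccw_lt_one]
  have hend : (∀ i, u (i + j) = u i) → c' = c := by
    intro hs
    have := hsame
    by_contra hne
    have h1 := ccw_pos.2 hne
    refine hmin c' hc't (fun i => ?_) ⟨h1, by linarith [horder.1, hβ.2]⟩
    rw [← hs]; exact hc's i
  -- The shortest iterate `s(c', d')`, behind which `β` lies, is `s(c, d)` itself: if `c'` were
  -- before `a`, then the chord `s(c, a)` would cross it for `t - 1` iterates, so that the
  -- itineraries of `c` and `c'` would agree.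
  have hc'c : c' = c := by
    rcases lt_trichotomy (ccw c c') (ccw c a) with h | h | h
    · by_contra hne
      have h1 := ccw_pos.2 hne
      apply hne
      apply hend
      refine eq_shift_of_window hu (fun n hn => ?_) ht
      have key : ∀ n, n ≤ t - 1 → Crosses s(dbl^[n] c, dbl^[n] a) s(dbl^[n] c', dbl^[n] d') := by
        intro n
        induction n with
        | zero =>
          intro _
          rw [crosses_mk]
          left
          have := ccw_base c a d'
          have h5 := ccw_base c a c
          rw [ccw_self] at h5
          have := hca.2
          have := hca.1
          simp only [Function.iterate_zero, id, Sb]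
          clear hmin hno has hcs hds hu hj' hc's hd's hsame hfix hcd' hj hlen hca hcr
          grind [ccw_nonneg, ccw_lt_one]
        | succ n ih =>
          intro hn
          simp only [Function.iterate_succ_apply']
          exact crosses_dbl (hcs _) (has _ (by lia)) (hc's _) (hd's _) (ih (by lia))
      exact (side_eq_of_crosses (hcs _) (has _ (by lia)) (hc's _) (hd's _) (key n hn.le)).symm
    · exact absurd (ccw_inj h ▸ hc't) hat
    · exfalso
      apply hno c' hc't
      have := ccw_base c a c'
      have := ccw_base c a β
      have := horder.1
      have := hca.2
      clear hmin hno has hcs hds hu hj' hc's hd's hsame hfix hcd' hj hlen hcr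
      unfold Sb
      grind
  have hshift : ∀ i, u (i + j) = u i := fun i => by
    have := hc's i
    rw [hc'c] at this
    exact symbolArc_unique this (hcs i)
  have hd'd : d' = d := by
    by_contra hne
    refine hmin d' hd't (fun i => ?_) ⟨by linarith [horder.2.1, hβ.1], lt_of_le_of_ne horder.2.2
      fun h => hne (ccw_inj h)⟩
    rw [← hshift]; exact hd's i
  rw [hc'c, hd'd] at hlen
  have hout : ∀ i, ¬ Sb c (dbl^[i] c) d ∧ ¬ Sb c (dbl^[i] d) d := by
    intro i
    have h1 := hj' i
    rw [← hlen] at h1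
    have h2 := hcr i
    constructor
    · intro h
      exact absurd (chordLength_lt_of_sb hlt h h2) (not_lt.2 h1)
    · intro h
      rw [Sym2.eq_swap (a := dbl^[i] c)] at h1 h2
      exact absurd (chordLength_lt_of_sb hlt h h2) (not_lt.2 h1)
  -- the two ends have the same period
  have hper1 : dbl^[Function.minimalPeriod dbl c] d = d := by
    set r := Function.minimalPeriod dbl c with hr
    have hcr : dbl^[r] c = c := iterate_of_minimalPeriod hr.symm
    have hs : ∀ i, u (i + r) = u i := fun i => by
      have := hcs (i + r)
      rw [Function.iterate_add_apply, hcr] at this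
      exact symbolArc_unique this (hcs i)
    refine (eq_of_subset_iterate ht hc hd hcs hds hs ?_ ?_).2
    · rw [hcr, ccw_self]; exact ccw_nonneg _ _
    · rw [hcr]
      have h1 := (hout r).2
      have h2 : dbl^[r] d ≠ c := fun h => hcd (iter_injOn ht hc hd (hcr.trans h.symm))
      have h3 := ccw_pos.2 h2
      by_contra h
      exact h1 ⟨h3, not_le.1 h⟩
  have hper2 : dbl^[Function.minimalPeriod dbl d] c = c := by
    set r := Function.minimalPeriod dbl d with hr
    have hdr : dbl^[r] d = d := iterate_of_minimalPeriod hr.symm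
    have hs : ∀ i, u (i + r) = u i := fun i => by
      have := hds (i + r)
      rw [Function.iterate_add_apply, hdr] at this
      exact symbolArc_unique this (hds i)
    have h1 := (hout r).1
    have h2 : dbl^[r] c ≠ d := fun h => hcd (iter_injOn ht hc hd (h.trans hdr.symm))
    have h3 : ccw (dbl^[r] c) d ≠ 0 := fun h => h2 (ccw_eq_zero.1 h).symm
    refine (eq_of_subset_iterate ht hc hd hcs hds hs ?_ ?_).1
    · by_contra h
      apply h1
      have := ccw_base c (dbl^[r] c) d
      have h5 := ccw_base c (dbl^[r] c) c
      rw [ccw_self] at h5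
      clear hmin hno has hcs hds hu hj' hc's hd's hsame hfix hcd' hj hlen hcr hs hout h1
      unfold Sb
      grind [ccw_nonneg, ccw_lt_one]
    · rw [hdr]
  have hpereq : Function.minimalPeriod dbl d = Function.minimalPeriod dbl c := by
    apply Nat.dvd_antisymm
    · exact Function.IsPeriodicPt.minimalPeriod_dvd hper1
    · exact Function.IsPeriodicPt.minimalPeriod_dvd hper2
  refine ⟨Function.minimalPeriod dbl c, hpc.minimalPeriod_le ht, ?_⟩
  refine isParamLeaf_of_sides ?_ hβ rfl hpereq (fun i => (hout i).1) (fun i => (hout i).2) hcs hds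
  have h1 := hpc.minimalPeriod_pos ht
  by_contra h2
  have h3 : Function.minimalPeriod dbl c = 1 := by lia
  have e : ∀ x, Function.minimalPeriod dbl x = 1 → x = 0 := fun x hx => by
    have : dbl x = x := Function.minimalPeriod_eq_one_iff_isFixedPt.1 hx
    rw [dbl] at this
    simpa using this
  exact hcd ((e c h3).trans (e d (hpereq.trans h3)).symm)

/-! ### The tuned itinerary -/

/-- The itinerary `v e v e …`, where `v (!e)` is the itinerary of a leaf of period `m` during one
period. -/
def tuned (m : ℕ) (e : Bool) (κ : ℕ → Bool) (i : ℕ) : Bool := if (i + 1) % m = 0 then e else κ i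

/-- Two points of one half circle are not separated by two points of the other one. -/
lemma sb_iff_of_inHalf {β a b z w : Angle} {s : Bool} (ha : InHalf β (!s) a)
    (hb : InHalf β (!s) b) (hz : InHalf β s z) (hw : InHalf β s w) : Sb a z b ↔ Sb a w b := by
  unfold InHalf at *
  rw [sideBase_not] at *
  generalize sideBase β s = o at *
  have k1 := ccw_base o (o + oneHalf) a
  have k2 := ccw_base o (o + oneHalf) b
  rw [ccw_self_add_oneHalf] at k1 k2
  have := ccw_base o a b
  have := ccw_base o a z
  have := ccw_base o a w
  unfold Sb
  grind [ccw_nonneg, ccw_lt_one]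

lemma sb_left_iff_of_inHalf {β x y z w : Angle} {s : Bool} (hx : InHalf β s x)
    (hy : InHalf β s y) (hz : InHalf β (!s) z) (hw : InHalf β (!s) w) :
    Sb z x y ↔ Sb w x y := by
  unfold InHalf at *
  rw [sideBase_not] at *
  generalize sideBase β s = o at *
  have k1 := ccw_base o (o + oneHalf) z
  have k2 := ccw_base o (o + oneHalf) w
  rw [ccw_self_add_oneHalf] at k1 k2
  have := ccw_base o z x
  have := ccw_base o z y
  have := ccw_base o w x
  have := ccw_base o w y
  unfold Sb
  grind [ccw_nonneg, ccw_lt_one]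

lemma sb_right_iff_of_inHalf {β x y z w : Angle} {s : Bool} (hx : InHalf β s x)
    (hy : InHalf β s y) (hz : InHalf β (!s) z) (hw : InHalf β (!s) w) :
    Sb x y z ↔ Sb x y w := by
  unfold InHalf at *
  rw [sideBase_not] at *
  generalize sideBase β s = o at *
  have k1 := ccw_base o (o + oneHalf) z
  have k2 := ccw_base o (o + oneHalf) w
  rw [ccw_self_add_oneHalf] at k1 k2
  have := ccw_base o x y
  have := ccw_base o x z
  have := ccw_base o x w
  unfold Sb
  grind [ccw_nonneg, ccw_lt_one]

lemma sb_br_left {β x y w : Angle} {s : Bool} (hw : InHalf β (!s) w) (h : Sb β x y) :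
    Sb w (br β s x) (br β s y) := by
  have h1 := ccw_br β s x
  have h2 := ccw_br β s y
  unfold InHalf at *
  rw [sideBase_not] at *
  generalize sideBase β s = o at *
  have k1 := ccw_base o (o + oneHalf) w
  rw [ccw_self_add_oneHalf] at k1
  have k2 := ccw_base o w (br β s x)
  have k3 := ccw_base o w (br β s y)
  rw [h1] at k2
  rw [h2] at k3
  clear h1 h2
  unfold Sb at *
  grind [ccw_nonneg, ccw_lt_one]

lemma sb_br_right {β x y w : Angle} {s : Bool} (hw : InHalf β (!s) w) (h : Sb x y β) :
    Sb (br β s x) (br β s y) w := by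
  have h1 := ccw_br β s x
  have h2 := ccw_br β s y
  unfold InHalf at *
  rw [sideBase_not] at *
  generalize sideBase β s = o at *
  have k1 := ccw_base o (o + oneHalf) w
  rw [ccw_self_add_oneHalf] at k1
  have k2 := ccw_base o (br β s x) w
  have k3 := ccw_base o (br β s x) (br β s y)
  have k4 := ccw_base β x y
  have k5 := ccw_base β x β
  rw [ccw_self] at k5
  rw [h1] at k2 k3
  rw [h2] at k3
  clear h1 h2
  unfold Sb at *
  grind [ccw_nonneg, ccw_lt_one]

lemma tuned_add (m : ℕ) (e : Bool) {κ : ℕ → Bool} (hκ : ∀ i, κ (i + m) = κ i) (i : ℕ) :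
    tuned m e κ (i + m) = tuned m e κ i := by
  unfold tuned
  rw [show i + m + 1 = i + 1 + m by ring, Nat.add_mod_right, hκ]

lemma tuned_of_lt {m : ℕ} {e : Bool} {κ : ℕ → Bool} {i : ℕ} (hi : i + 1 < m) :
    tuned m e κ i = κ i := by
  rw [tuned, if_neg]; rw [Nat.mod_eq_of_lt hi]; lia

lemma tuned_pred {m : ℕ} {e : Bool} {κ : ℕ → Bool} (hm : 0 < m) :
    tuned m e κ (m - 1) = e := by
  rw [tuned, if_pos]; rw [Nat.sub_add_cancel hm, Nat.mod_self]

namespace Leaf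

variable {m : ℕ} {α γ : Angle} {e : Bool} {κ : ℕ → Bool}

/-- The inverse branch `v e`, restricted to the angles of `[β, γ]`, is a contraction towards `α`. -/
lemma pull_tuned_right (h : Leaf m α γ e κ) {β x : Angle} (hβ : Sb α β γ)
    (h1 : ccw α β ≤ ccw α x) (h2 : ccw α x ≤ ccw α γ) :
    ccw α (pull β (tuned m e κ) m x) = ccw α x / 2 ^ m := by
  have hm := h.one_lt
  have hM : (0 : ℝ) < 2 ^ m := by positivity
  have hM1 : (1 : ℝ) ≤ 2 ^ m := one_le_pow₀ (by norm_num)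
  have h0 := ccw_nonneg α x
  obtain ⟨y, hy⟩ : ∃ y, ccw α y = ccw α x / 2 ^ m := by
    refine ⟨_, ccw_add_of_lt α (by positivity) ?_⟩
    rw [div_lt_iff₀ hM]; linarith [ccw_lt_one α x]
  have hy' : 2 ^ m * ccw α y = ccw α x := by rw [hy]; field_simp
  have e1 : 2 ^ m * ccw α y = 2 * (2 ^ (m - 1) * ccw α y) := by
    rw [← mul_assoc, ← pow_succ', show m - 1 + 1 = m by lia]
  have hym : dbl^[m] y = x := by
    have := ccw_iter_of_lt (n := m) (x := α) (y := y) (by rw [hy']; exact ccw_lt_one _ _)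
    rw [h.iterate_eq (Or.inl rfl), hy'] at this
    exact ccw_inj this
  have : pull β (tuned m e κ) m (dbl^[m] y) = y := by
    apply pull_iter
    intro i hi
    rcases Nat.lt_or_ge (i + 1) m with h3 | h3
    · rw [tuned_of_lt h3]
      exact .of_mem (h.mem_of_near_left hβ (by linarith) h3)
    · have hi' : i = m - 1 := by lia
      rw [hi', tuned_pred (by lia), InHalf]
      have h4 := ccw_iter_of_lt (n := m - 1) (x := α) (y := y) (by linarith [ccw_lt_one α x])
      rw [sideBase_add (h.rep_le hβ.2.le), h.letter]
      have h5 := ccw_add_of_lt (dbl^[m - 1] α) (t := ccw α β / 2) (by linarith [ccw_nonneg α β])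
        (by linarith [ccw_lt_one α β])
      have h6 := ccw_base (dbl^[m - 1] α) (dbl^[m - 1] α + ((ccw α β / 2 : ℝ) : Angle))
        (dbl^[m - 1] y)
      rw [h5, h4, if_pos (by linarith)] at h6
      rw [h6]
      linarith [ccw_lt_one α x, ccw_nonneg α β]
  rw [hym] at this
  rw [this, hy]

/-- The inverse branch `v e`, restricted to the angles of `[α, β[`, is a contraction towards `γ`. -/
lemma pull_tuned_left (h : Leaf m α γ e κ) {β x : Angle} (hβ : Sb α β γ)
    (h1 : ccw α x < ccw α β) :
    ccw (pull β (tuned m e κ) m x) γ = ccw x γ / 2 ^ m := by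
  have hm := h.one_lt
  have hM : (0 : ℝ) < 2 ^ m := by positivity
  have hM1 : (1 : ℝ) ≤ 2 ^ m := one_le_pow₀ (by norm_num)
  have h0 := ccw_nonneg x γ
  obtain ⟨y, hy⟩ : ∃ y, ccw y γ = ccw x γ / 2 ^ m := by
    have := ccw_add_of_lt (γ - ((ccw x γ / 2 ^ m : ℝ) : Angle)) (t := ccw x γ / 2 ^ m)
      (by positivity) (by rw [div_lt_iff₀ hM]; linarith [ccw_lt_one x γ])
    rw [sub_add_cancel] at this
    exact ⟨_, this⟩
  have hy' : 2 ^ m * ccw y γ = ccw x γ := by rw [hy]; field_simp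
  have e1 : 2 ^ m * ccw y γ = 2 * (2 ^ (m - 1) * ccw y γ) := by
    rw [← mul_assoc, ← pow_succ', show m - 1 + 1 = m by lia]
  have hxg : ccw x γ = ccw α γ - ccw α x := by
    have := ccw_base α x γ
    rw [if_pos (by linarith [hβ.2])] at this
    exact this
  have hym : dbl^[m] y = x := by
    have := ccw_iter_of_lt (n := m) (x := y) (y := γ) (by rw [hy']; exact ccw_lt_one _ _)
    rw [h.iterate_eq (Or.inr rfl), hy'] at this
    have h3 := add_ccw (dbl^[m] y) γ
    have h4 := add_ccw x γ
    rw [this] at h3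
    exact add_right_cancel (h3.trans h4.symm)
  have : pull β (tuned m e κ) m (dbl^[m] y) = y := by
    apply pull_iter
    intro i hi
    rcases Nat.lt_or_ge (i + 1) m with h3 | h3
    · rw [tuned_of_lt h3]
      exact .of_mem (h.mem_of_near_right hβ (by linarith [ccw_nonneg α x]) h3)
    · have hi' : i = m - 1 := by lia
      rw [hi', tuned_pred (by lia)]
      have h4 := ccw_iter_of_lt (n := m - 1) (x := y) (y := γ) (by linarith [ccw_lt_one x γ])
      apply InHalf.of_mem
      rw [h.mem_letter hβ.2.le]
      have h5 := h.pred
      have h6 := ccw_base (dbl^[m - 1] α) (dbl^[m - 1] y) (dbl^[m - 1] γ)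
      rw [h5, h4] at h6
      have h7 : 2 ^ (m - 1) * ccw y γ = (ccw α γ - ccw α x) / 2 := by linarith
      rw [h7] at h6
      have := h.lt
      have := hβ.1
      have := hβ.2
      have := ccw_nonneg α x
      have := ccw_lt_one (dbl^[m - 1] α) (dbl^[m - 1] y)
      clear h hxg hym h4 e1 hy'
      grind
  rw [hym] at this
  rw [this, hy]

end Leaf

/-- An angle `β` after `a`, so close to `a` that no angle in `]a, β]` is fixed by `h^t`. -/
lemma exists_near {a b : Angle} {t p : ℕ} (hab : 0 < ccw a b) (hat : dbl^[t] a ≠ a) (htp : t ≤ p) :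
    ∃ β, Sb a β b ∧ 2 ^ p * ccw a β ≤ ccw a b ∧ ∀ z, dbl^[t] z = z → ¬ Sb a z β ∧ z ≠ β := by
  have hM : (0 : ℝ) < 2 ^ p := by positivity
  have hM1 : (1 : ℝ) ≤ 2 ^ p := one_le_pow₀ (by norm_num)
  have hρ := ccw_pos.2 hat
  have hρ1 := ccw_lt_one a (dbl^[t] a)
  set δ := min ((1 - ccw a (dbl^[t] a)) / 2) (ccw a b / 2) with hδ
  have hδ0 : 0 < δ := lt_min (by linarith) (by linarith)
  have hδ1 : δ ≤ (1 - ccw a (dbl^[t] a)) / 2 := min_le_left _ _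
  have hδ2 : δ ≤ ccw a b / 2 := min_le_right _ _
  have hδ3 : δ / 2 ^ p ≤ δ := div_le_self hδ0.le hM1
  have hβ := ccw_add_of_lt a (t := δ / 2 ^ p) (by positivity) (by linarith)
  have key : ∀ z, dbl^[t] z = z → 0 < ccw a z → ccw a z ≤ δ / 2 ^ p → False := by
    intro z hz h0 h1
    rw [le_div_iff₀ hM] at h1
    have h2 : (2 : ℝ) ^ t ≤ 2 ^ p := pow_le_pow_right₀ (by norm_num) htp
    have h3 : 2 ^ t * ccw a z ≤ δ := by nlinarith
    have h4 : (1 : ℝ) ≤ 2 ^ t := one_le_pow₀ (by norm_num)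
    have h5 : ccw a z ≤ 2 ^ t * ccw a z := by nlinarith
    have h6 : z = a + ((ccw a (dbl^[t] a) + 2 ^ t * ccw a z : ℝ) : Angle) := by
      conv_lhs => rw [← hz, ← add_ccw a z, iter_add]
      nth_rewrite 1 [← add_ccw a (dbl^[t] a)]
      rw [AddCircle.coe_add, add_assoc]
    have h7 := ccw_add_of_lt a (t := ccw a (dbl^[t] a) + 2 ^ t * ccw a z) (by linarith)
      (by linarith)
    rw [← h6] at h7
    linarith
  refine ⟨a + ((δ / 2 ^ p : ℝ) : Angle), ⟨?_, ?_⟩, ?_, fun z hz => ⟨fun h => ?_, ?_⟩⟩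
  · rw [hβ]; positivity
  · rw [hβ]; linarith
  · rw [hβ, mul_div_cancel₀ _ hM.ne']; linarith
  · exact key z hz h.1 (by rw [← hβ]; exact h.2.le)
  · rintro rfl
    exact key _ hz (by rw [hβ]; positivity) (by rw [hβ])

/-! ### Leaves of smaller period that separate two leaves -/

namespace Leaf

variable {m p : ℕ} {α γ a b : Angle} {e e' : Bool} {κ κ' : ℕ → Bool}

/-- The image of an angle between `a` and `b` under the inverse branch `v e` does not lie between
`a` and `b`, if `a`, `b` are the ends of another leaf. -/
lemma not_sb_pull_tuned (hS : Leaf m α γ e κ) (hD : Leaf p a b e' κ') {β x : Angle}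
    (hβ : Sb a β b) (hab : ccw α a < ccw α b) (hb : ccw α b < ccw α γ) (ha : 0 < ccw α a)
    (hx : Sb a x b) : ¬ Sb a (pull β (tuned m e κ) m x) b := by
  intro hf
  have hm := hS.one_lt
  have hM : (0 : ℝ) < 2 ^ m := by positivity
  have hM1 : (1 : ℝ) < 2 ^ m := one_lt_pow₀ (by norm_num) (by lia)
  have tr : ∀ z, Sb a z b ↔ ccw α a < ccw α z ∧ ccw α z < ccw α b := by
    intro z
    have := ccw_base α a z
    have := ccw_base α a b
    unfold Sb
    clear hS hD
    grind [ccw_nonneg, ccw_lt_one]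
  have hβ' : Sb α β γ := by
    have := (tr β).1 hβ
    exact ⟨by linarith, by linarith⟩
  rw [tr] at hx hf
  have hgl := ccw_lt_one α γ
  rcases le_or_gt (ccw α β) (ccw α x) with h | h
  · rw [hS.pull_tuned_right hβ' h (by linarith)] at hf
    have h1 : 2 ^ m * ccw α a < ccw α x := by
      have := hf.1; rw [lt_div_iff₀ hM] at this; linarith
    have h2 := ccw_iter_of_lt (n := m) (x := α) (y := a) (by linarith)
    rw [hS.iterate_eq (Or.inl rfl)] at h2
    apply hD.out a (Or.inl rfl) m
    rw [tr, h2]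
    exact ⟨by nlinarith, by linarith⟩
  · have h0 := hS.pull_tuned_left hβ' h
    set f := pull β (tuned m e κ) m x
    have k : ∀ z, ccw α z ≤ ccw α γ → ccw z γ = ccw α γ - ccw α z := fun z hz => by
      rw [ccw_base α z γ, if_pos hz]
    have k1 := k x (by linarith)
    have k2 := k f (by linarith)
    have k3 := k b hb.le
    have h1 : 2 ^ m * ccw b γ < ccw x γ := by
      have : ccw b γ < ccw x γ / 2 ^ m := by rw [← h0]; linarith
      rw [lt_div_iff₀ hM] at this; linarith
    have h2 := ccw_iter_of_lt (n := m) (x := b) (y := γ) (by linarith [ccw_lt_one x γ])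
    rw [hS.iterate_eq (Or.inr rfl)] at h2
    have h3 : ccw b γ < 2 ^ m * ccw b γ := by nlinarith
    apply hD.out b (Or.inr rfl) m
    rw [tr]
    have h4 := ccw_base α (dbl^[m] b) γ
    rw [h2] at h4
    have := ccw_nonneg α (dbl^[m] b)
    have := ccw_lt_one α (dbl^[m] b)
    clear hS hD h2 h0
    grind

/-- The iterated images of `α` under the inverse branch `v e` have the itinerary `v e v e …`. -/
lemma inHalf_iterate_pull (hS : Leaf m α γ e κ) {β : Angle} (hβ : Sb α β γ) (j : ℕ) :
    ∀ i < j * m + (m - 1), InHalf β (tuned m e κ i)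
      (dbl^[i] ((pull β (tuned m e κ) m)^[j] α)) := by
  induction j with
  | zero =>
    intro i hi
    rw [tuned_of_lt (by lia)]
    exact .of_mem (hS.mem hβ (Or.inl rfl) i)
  | succ j ih =>
    intro i hi
    rw [Function.iterate_succ_apply']
    rcases Nat.lt_or_ge i m with h | h
    · exact inHalf_pull _ _ _ _ h
    · obtain ⟨n, rfl⟩ := Nat.exists_eq_add_of_le' h
      rw [Function.iterate_add_apply, iter_pull, tuned_add m e hS.sym_add]
      refine ih n ?_
      rw [Nat.succ_mul] at hi; lia

lemma iter_iterate_pull (β : Angle) (u : ℕ → Bool) (m : ℕ) (x : Angle) (j k : ℕ) :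
    dbl^[k * m] ((pull β u m)^[j + k] x) = (pull β u m)^[j] x := by
  induction k with
  | zero => simp
  | succ k ih =>
    rw [← add_assoc, Function.iterate_succ_apply', Nat.succ_mul, Function.iterate_add_apply,
      iter_pull, ih]

/-- The iterated images of `α` under the inverse branch `v e` are mapped to `α`, so they are not
ends of a leaf behind `s(α, γ)`. -/
lemma iterate_pull_ne (hS : Leaf m α γ e κ) (hD : Leaf p a b e' κ') (hab : ccw α a < ccw α b)
    (hb : ccw α b < ccw α γ) (ha : 0 < ccw α a) (β : Angle) {x : Angle} (hx : x = a ∨ x = b)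
    (j : ℕ) : (pull β (tuned m e κ) m)^[j] α ≠ x := by
  intro h
  have h1 := iter_iterate_pull β (tuned m e κ) m α 0 j
  rw [zero_add, h] at h1
  have h2 : Function.IsPeriodicPt dbl p x := hD.iterate_eq hx
  have h3 : j * m ≤ j * m * p := Nat.le_mul_of_pos_right _ (by have := hD.one_lt; lia)
  have h4 : dbl^[j * m * p - j * m] α = x := by
    have h5 := congrArg (dbl^[j * m * p - j * m]) h1
    rw [← Function.iterate_add_apply, Nat.sub_add_cancel h3, (h2.const_mul _).eq] at h5
    exact h5.symm
  apply hS.out α (Or.inl rfl) (j * m * p - j * m)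
  rw [h4]
  rcases hx with rfl | rfl
  · exact ⟨ha, by linarith⟩
  · exact ⟨by linarith, hb⟩

/-- Base points for `exists_fixed_arc`, if the order `t` is not a multiple of `m`: iterated
preimages of `α` under the inverse branch `v e`. -/
lemma exists_base_points (hS : Leaf m α γ e κ) (hD : Leaf p a b e' κ') {β : Angle}
    (hβ : Sb a β b) (hab : ccw α a < ccw α b) (hb : ccw α b < ccw α γ) (ha : 0 < ccw α a) {t : ℕ}
    (ht : 0 < t) (hmt : ¬ m ∣ t)
    (hs : ∀ i < t - 1, κ' i = tuned m e κ i) (hs' : κ' (t - 1) = !tuned m e κ (t - 1)) :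
    ∃ ζ ζ', (ccw α ζ < ccw α a ∧ ccw α b < ccw α ζ' ∧ ccw α ζ' ≤ ccw α γ) ∧
      (∀ i < t, InHalf β (tuned m e κ i) (dbl^[i] ζ)) ∧
      (∀ i < t, InHalf β (tuned m e κ i) (dbl^[i] ζ')) ∧
      ¬ Sb α (dbl^[t] ζ) γ ∧ ¬ Sb α (dbl^[t] ζ') γ := by
  have hm := hS.one_lt
  have hM : (0 : ℝ) < 2 ^ m := by positivity
  have hM1 : (1 : ℝ) < 2 ^ m := one_lt_pow₀ (by norm_num) (by lia)
  have tr : ∀ z, Sb a z b ↔ ccw α a < ccw α z ∧ ccw α z < ccw α b := by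
    intro z
    have := ccw_base α a z
    have := ccw_base α a b
    unfold Sb
    clear hS hD hs hs'
    grind [ccw_nonneg, ccw_lt_one]
  have hβ' : Sb α β γ := by
    have := (tr β).1 hβ
    exact ⟨by linarith, by linarith⟩
  -- For `t < m` the points `α` and `γ` are suitable.
  rcases Nat.lt_or_ge t m with htm | htm
  · have base : ∀ x, x = α ∨ x = γ → ∀ i < m - 1, InHalf β (tuned m e κ i) (dbl^[i] x) := by
      intro x hx i hi
      rw [tuned_of_lt (by lia)]
      exact .of_mem (hS.mem hβ' hx i)
    refine ⟨α, γ, ⟨by rwa [ccw_self], hb, le_rfl⟩, fun i hi => base α (Or.inl rfl) i (by lia),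
      fun i hi => base γ (Or.inr rfl) i (by lia), hS.out α (Or.inl rfl) t, hS.out γ (Or.inr rfl) t⟩
  set f := pull β (tuned m e κ) m with hf
  set L := t / m with hL
  set r := t % m with hr
  have htL : t = L * m + r := by rw [hL, hr, Nat.div_add_mod']
  have hr0 : 0 < r := Nat.pos_of_ne_zero fun h => hmt (Nat.dvd_of_mod_eq_zero h)
  have hrm : r < m := Nat.mod_lt _ (by lia)
  have hL1 : 1 ≤ L := (Nat.one_le_div_iff (by lia)).2 htm
  have zfol := hS.inHalf_iterate_pull hβ'
  -- All other points `f^j(α)` are close to `α` or `γ`, so they stay out of `]α, γ[` for `r < m`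
  -- iterates.
  have fin : ∀ x, ccw α x ≤ ccw α γ → (2 ^ m * ccw α (f x) ≤ ccw α γ ∨
      (2 ^ m * ccw (f x) γ ≤ ccw α γ ∧ ccw α (f x) ≤ ccw α γ)) ∧
      ccw α (f x) ≤ ccw α γ := by
    intro x hx
    rcases le_or_gt (ccw α β) (ccw α x) with h | h
    · have h1 := hS.pull_tuned_right hβ' h hx
      have h2 : 2 ^ m * ccw α (f x) = ccw α x := by rw [h1]; field_simp
      have h3 := ccw_nonneg α (f x)
      exact ⟨Or.inl (by linarith), by nlinarith⟩
    · have h1 := hS.pull_tuned_left hβ' h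
      have h2 : 2 ^ m * ccw (f x) γ = ccw x γ := by rw [h1]; field_simp
      have h3 := ccw_nonneg (f x) γ
      have h4 := ccw_base α x γ
      rw [if_pos hx] at h4
      have h5 : 2 ^ m * ccw (f x) γ ≤ ccw α γ := by linarith [ccw_nonneg α x]
      have h6 : ccw α (f x) ≤ ccw α γ := by
        have h7 : ccw (f x) γ ≤ ccw α γ := by nlinarith
        have h8 := ccw_base γ (f x) γ
        have h9 := ccw_base γ α γ
        have h10 := ccw_base γ α (f x)
        rw [ccw_self] at h8 h9
        clear hS hD hs hs' h1 h2 zfol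
        grind [ccw_nonneg, ccw_lt_one]
      exact ⟨Or.inr ⟨h5, h6⟩, h6⟩
  have zin : ∀ j, ccw α (f^[j] α) ≤ ccw α γ := by
    intro j
    induction j with
    | zero => simp only [Function.iterate_zero, id, ccw_self]; exact ccw_nonneg _ _
    | succ j ih => rw [Function.iterate_succ_apply']; exact (fin _ ih).2
  have zit := iter_iterate_pull β (tuned m e κ) m α
  have zout : ∀ j, ¬ Sb α (dbl^[t] (f^[j + L] α)) γ := by
    intro j
    rw [htL, add_comm (L * m), Function.iterate_add_apply, zit]
    cases j with
    | zero => exact hS.out α (Or.inl rfl) r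
    | succ j =>
      rw [Function.iterate_succ_apply']
      rcases (fin _ (zin j)).1 with h | h
      · exact hS.not_sb_of_near_left h hr0 hrm
      · exact hS.not_sb_of_near_right h.1 hr0 hrm
  have zfol' : ∀ j, ∀ i < t, InHalf β (tuned m e κ i) (dbl^[i] (f^[j + L] α)) := by
    intro j i hi
    apply zfol
    rw [Nat.add_mul]; lia
  -- Either all points `f^j(α)` with `j ≥ L` lie in `]a, b[`, or none does; two successive ones
  -- cannot both do.
  have allout : ∀ j k, Sb a (f^[j + L] α) b ↔ Sb a (f^[k + L] α) b := by
    intro j k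
    have hDa : ∀ x, x = a ∨ x = b → ∀ i < t - 1, InHalf β (tuned m e κ i) (dbl^[i] x) := by
      intro x hx i hi
      rw [← hs i hi]; exact .of_mem (hD.mem hβ hx i)
    rw [← sb_iter_half (n := t - 1) (hDa a (Or.inl rfl)) (fun i hi => zfol' j i (by lia))
      (hDa b (Or.inr rfl)), ← sb_iter_half (n := t - 1) (hDa a (Or.inl rfl))
      (fun i hi => zfol' k i (by lia)) (hDa b (Or.inr rfl))]
    apply sb_iff_of_inHalf _ _ (zfol' j (t - 1) (by lia)) (zfol' k (t - 1) (by lia))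
    · rw [← hs']; exact .of_mem (hD.mem hβ (Or.inl rfl) _)
    · rw [← hs']; exact .of_mem (hD.mem hβ (Or.inr rfl) _)
  have zab : ∀ j, ¬ Sb a (f^[j + L] α) b := by
    intro j h
    have h0 := (allout j 0).1 h
    have h1 := (allout j 1).1 h
    rw [add_comm 1, Function.iterate_succ_apply', ] at h1
    rw [zero_add] at h0
    exact hS.not_sb_pull_tuned hD hβ hab hb ha h0 h1
  have zne : ∀ x, x = a ∨ x = b → ∀ j, f^[j] α ≠ x := fun x hx =>
    hS.iterate_pull_ne hD hab hb ha β hx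
  have zcase : ∀ j, ccw α (f^[j + L] α) < ccw α a ∨ ccw α b < ccw α (f^[j + L] α) := by
    intro j
    have h := zab j
    rw [tr] at h
    rcases lt_trichotomy (ccw α (f^[j + L] α)) (ccw α a) with h1 | h1 | h1
    · exact Or.inl h1
    · exact absurd (ccw_inj h1) (zne a (Or.inl rfl) _)
    · right
      refine lt_of_le_of_ne (not_lt.1 fun h2 => h ⟨h1, h2⟩) fun h2 => ?_
      exact zne b (Or.inr rfl) _ (ccw_inj h2.symm)
  have hβab := (tr β).1 hβ
  -- the orbit cannot stay on one side of `]a, b[`, since it would converge to `α` or `γ`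
  have exL : ∃ j, ccw α (f^[j + L] α) < ccw α a := by
    by_contra hcon
    push Not at hcon
    have h1 : ∀ j, ccw α b < ccw α (f^[j + L] α) := fun j =>
      (zcase j).resolve_left (not_lt.2 (hcon j))
    have h2 : ∀ j, ccw α (f^[j + L] α) ≤ (1 / 2 ^ m) ^ j := by
      intro j
      induction j with
      | zero => simpa using (ccw_lt_one _ _).le
      | succ j ih =>
        rw [Nat.succ_add, Function.iterate_succ_apply',
          hS.pull_tuned_right hβ' (by linarith [h1 j]) (zin _), pow_succ, div_eq_mul_one_div]
        gcongr
    obtain ⟨j, hj⟩ := exists_pow_lt_of_lt_one (show 0 < ccw α b by linarith)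
      (show (1 / 2 ^ m : ℝ) < 1 by rw [div_lt_one hM]; exact hM1)
    linarith [h1 j, h2 j]
  have exR : ∃ j, ccw α b < ccw α (f^[j + L] α) := by
    by_contra hcon
    push Not at hcon
    have h1 : ∀ j, ccw α (f^[j + L] α) < ccw α a := fun j =>
      (zcase j).resolve_right (not_lt.2 (hcon j))
    have h2 : ∀ j, ccw (f^[j + L] α) γ ≤ (1 / 2 ^ m) ^ j := by
      intro j
      induction j with
      | zero => simpa using (ccw_lt_one _ _).le
      | succ j ih =>
        rw [Nat.succ_add, Function.iterate_succ_apply',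
          hS.pull_tuned_left hβ' (by linarith [h1 j]), pow_succ, div_eq_mul_one_div]
        gcongr
    obtain ⟨j, hj⟩ := exists_pow_lt_of_lt_one (show 0 < ccw α γ - ccw α b by linarith)
      (show (1 / 2 ^ m : ℝ) < 1 by rw [div_lt_one hM]; exact hM1)
    have h3 := ccw_base α (f^[j + L] α) γ
    rw [if_pos (zin _)] at h3
    linarith [h1 j, h2 j]
  obtain ⟨j, hj⟩ := exL
  obtain ⟨k, hk⟩ := exR
  exact ⟨_, _, ⟨hj, hk, zin _⟩, zfol' j, zfol' k, zout j, zout k⟩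

end Leaf

namespace Leaf

variable {m p : ℕ} {α γ a b : Angle} {e e' : Bool} {κ κ' : ℕ → Bool}

/-- If the order `t` is a multiple of `m`, then the composition of the branches preserves the order
of the images of the branch `v e`, as seen from an end of the leaf. -/
lemma sb_pull_tuned_of_dvd (hS : Leaf m α γ e κ) {β : Angle} (hβ : Sb α β γ) {t : ℕ} (hmt : m ∣ t)
    (ht : m ≤ t)
    (hs : ∀ i < t - 1, InHalf β (tuned m e κ i) (dbl^[i] β))
    (hs' : InHalf β (!tuned m e κ (t - 1)) (dbl^[t - 1] β)) {z : Angle} (hz : z = α ∨ z = γ)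
    {x y : Angle} (hx : pull β (tuned m e κ) m (dbl^[m] x) = x)
    (hy : pull β (tuned m e κ) m (dbl^[m] y) = y) :
    (Sb z x y → Sb z (pull β (tuned m e κ) t x) (pull β (tuned m e κ) t y)) ∧
    (Sb x y z → Sb (pull β (tuned m e κ) t x) (pull β (tuned m e κ) t y) z) := by
  have hm := hS.one_lt
  set ω := tuned m e κ with hω
  set g := pull β ω t with hg
  have hωm : ω (m - 1) = e := tuned_pred (by lia)
  have hωt : ∀ i, ω (t - m + i) = ω i := by
    obtain ⟨n, rfl⟩ := hmt
    have : Function.Periodic ω m := tuned_add m e hS.sym_add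
    intro i
    have h1 := this.nsmul (n - 1) i
    rw [← h1]; congr 1
    cases n with
    | zero => lia
    | succ n => simp; lia
  have hfx : ∀ x, pull β ω m (dbl^[m] x) = x → ∀ i < m, InHalf β (ω i) (dbl^[i] x) := by
    intro x hx i hi
    rw [← hx]; exact inHalf_pull _ _ _ _ hi
  have hz1 : ∀ i < m - 1, InHalf β (ω i) (dbl^[i] z) := by
    intro i hi
    rw [hω, tuned_of_lt (by lia)]
    exact .of_mem (hS.mem hβ hz i)
  have hz2 : InHalf β (!ω (m - 1)) (dbl^[m - 1] z) := by
    rw [hωm, ← hS.last]; exact .of_mem (hS.mem hβ hz _)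
  have hk1 : ∀ i < m - 1, InHalf β (ω i) (dbl^[i] (dbl^[t - m] β)) := by
    intro i hi
    rw [← Function.iterate_add_apply, ← hωt i, add_comm (t - m)]
    exact hs _ (by lia)
  have hk2 : InHalf β (!ω (m - 1)) (dbl^[m - 1] (dbl^[t - m] β)) := by
    rw [← Function.iterate_add_apply, ← hωt (m - 1), show m - 1 + (t - m) = t - 1 by lia,
      show t - m + (m - 1) = t - 1 by lia]
    exact hs'
  have hgi : ∀ x, ∀ i < t, InHalf β (ω i) (dbl^[i] (g x)) := fun x i hi =>
    inHalf_pull _ _ _ _ hi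
  have hgt : ∀ x, dbl^[t - m] (dbl^[m] (g x)) = x := fun x => by
    rw [← Function.iterate_add_apply, Nat.sub_add_cancel ht, iter_pull]
  have hg' : ∀ x, ∀ i < t - m, InHalf β (ω i) (dbl^[i] (dbl^[m] (g x))) := fun x i hi => by
    rw [← Function.iterate_add_apply, show ω i = ω (i + m) from (tuned_add m e hS.sym_add i).symm]
    exact hgi x _ (by lia)
  have hgm : ∀ x, dbl^[m - 1] (g x) = br β e (dbl^[m] (g x)) := fun x => by
    have h1 := hgi x (m - 1) (by lia)
    rw [hωm] at h1
    apply h1.eq (inHalf_br _ _ _)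
    rw [dbl_br, ← Function.iterate_succ_apply' dbl, show (m - 1).succ = m by lia]
  have hβ' : ∀ i < t - m, InHalf β (ω i) (dbl^[i] β) := fun i hi => hs i (by lia)
  have hx' := hfx x hx
  have hy' := hfx y hy
  rw [hωm] at hz2
  have hx1 : ∀ i < m - 1, InHalf β (ω i) (dbl^[i] x) := fun i hi => hx' i (by lia)
  have hy1 : ∀ i < m - 1, InHalf β (ω i) (dbl^[i] y) := fun i hi => hy' i (by lia)
  have hgx1 : ∀ i < m - 1, InHalf β (ω i) (dbl^[i] (g x)) := fun i hi => hgi x i (by lia)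
  have hgy1 : ∀ i < m - 1, InHalf β (ω i) (dbl^[i] (g y)) := fun i hi => hgi y i (by lia)
  have hxm := hx' (m - 1) (by lia)
  have hym := hy' (m - 1) (by lia)
  rw [hωm] at hxm hym hk2
  constructor
  · intro h
    rw [← sb_iter_half hz1 hx1 hy1, sb_left_iff_of_inHalf hxm hym hz2 hk2,
      sb_iter_half hk1 hx1 hy1] at h
    rw [← hgt x, ← hgt y, sb_iter_half hβ' (hg' x) (hg' y)] at h
    rw [← sb_iter_half hz1 hgx1 hgy1, hgm, hgm]
    exact sb_br_left hz2 h
  · intro h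
    rw [← sb_iter_half hx1 hy1 hz1, sb_right_iff_of_inHalf hxm hym hz2 hk2,
      sb_iter_half hx1 hy1 hk1] at h
    rw [← hgt x, ← hgt y, sb_iter_half (hg' x) (hg' y) hβ'] at h
    rw [← sb_iter_half hgx1 hgy1 hz1, hgm, hgm]
    exact sb_br_right hz2 h

/-- Let `v (!e)` be the itinerary of `s(α, γ)`. A leaf `s(a, b)` strictly behind `s(α, γ)` either
has the itinerary `v e v e …` up to its last but one entry, or is separated from `s(α, γ)` by a leaf
of smaller period. -/
theorem tuned_or_exists_separating (hS : Leaf m α γ e κ) (hD : Leaf p a b e' κ')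
    (ha : 0 < ccw α a) (hab : ccw α a < ccw α b) (hb : ccw α b < ccw α γ) :
    (∀ i < p - 1, κ' i = tuned m e κ i) ∨
    ∃ r c d, r < p ∧ IsParamLeaf r s(c, d) ∧ 0 < ccw α c ∧ ccw α c < ccw α a ∧
      ccw α b < ccw α d ∧ ccw α d < ccw α γ := by
  classical
  by_cases hall : ∀ i < p - 1, κ' i = tuned m e κ i
  · exact Or.inl hall
  right
  push Not at hall
  have hm := hS.one_lt
  -- `t - 1` is the first place where the itineraries differ.
  obtain ⟨t, ht, htp, hs, hs'⟩ : ∃ t, 0 < t ∧ t < p ∧ (∀ i < t - 1, κ' i = tuned m e κ i) ∧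
      κ' (t - 1) = !tuned m e κ (t - 1) := by
    refine ⟨Nat.find hall + 1, by lia, by have := (Nat.find_spec hall).1; lia, fun i hi => ?_, ?_⟩
    · have := Nat.find_min hall (m := i) (by lia)
      by_contra h
      exact this ⟨by have := (Nat.find_spec hall).1; lia, h⟩
    · have := (Nat.find_spec hall).2
      simp only [Nat.add_sub_cancel]
      revert this
      cases κ' (Nat.find hall) <;> cases tuned m e κ (Nat.find hall) <;> simp
  have hat : dbl^[t] a ≠ a := by
    intro h
    have := Function.IsPeriodicPt.minimalPeriod_le (f := dbl) ht h
    rw [hD.per a (Or.inl rfl)] at this; lia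
  have hDab : 0 < ccw a b := hD.pos
  obtain ⟨β, hβ, hβA, hβt⟩ := exists_near hDab hat htp.le
  have tr : ∀ z, Sb a z b ↔ ccw α a < ccw α z ∧ ccw α z < ccw α b := by
    intro z
    have := ccw_base α a z
    have := ccw_base α a b
    unfold Sb
    clear hS hD hs hs'
    grind [ccw_nonneg, ccw_lt_one]
  have hβab := (tr β).1 hβ
  have hβ' : Sb α β γ := ⟨by linarith, by linarith⟩
  have hβs : ∀ i < p - 1, dbl^[i] β ∈ symbolArc β (κ' i) := fun i hi =>
    hD.mem_of_near_left hβ hβA (by lia)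
  -- For `t = m` the itinerary of `β` relative to itself would be that of `s(α, γ)`.
  have hmt : t ≠ m := by
    rintro rfl
    refine hS.not_mem_self hβ' fun i hi => ?_
    have h1 := hβs i (by lia)
    rcases Nat.lt_or_ge i (t - 1) with h | h
    · rwa [hs i h, tuned_of_lt (by lia)] at h1
    · rw [show i = t - 1 by lia] at h1 ⊢
      rwa [hs', tuned_pred ht, ← hS.last] at h1
  -- `u` is the periodic continuation of the first `t` symbols of `v e v e …`; the last one of them
  -- is wrong for `a` and `b`, as `exists_fixed_arc` requires.
  set u : ℕ → Bool := fun i => tuned m e κ (i % t) with hu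
  have hut : ∀ i < t, u i = tuned m e κ i := fun i hi => by simp only [hu, Nat.mod_eq_of_lt hi]
  have hup : ∀ i, u (i + t) = u i := fun i => by simp only [hu, Nat.add_mod_right]
  have hpull : ∀ y, pull β u t y = pull β (tuned m e κ) t y := fun y => pull_congr hut
  have hDu : ∀ x, x = a ∨ x = b → ∀ i < t - 1, dbl^[i] x ∈ symbolArc β (u i) := by
    intro x hx i hi
    rw [hut i (by lia), ← hs i hi]; exact hD.mem hβ hx i
  have hDu' : ∀ x, x = a ∨ x = b → InHalf β (!u (t - 1)) (dbl^[t - 1] x) := by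
    intro x hx
    rw [hut _ (by lia), ← hs']; exact .of_mem (hD.mem hβ hx _)
  have hββ : dbl^[t] β ≠ β := fun h => (hβt β h).2 rfl
  obtain ⟨c, d, hc, hd, hcs, hds, hc1, hc2, hd1, hd2, hmin⟩ : ∃ c d, dbl^[t] c = c ∧
      dbl^[t] d = d ∧ (∀ i, dbl^[i] c ∈ symbolArc β (u i)) ∧
      (∀ i, dbl^[i] d ∈ symbolArc β (u i)) ∧ 0 ≤ ccw α c ∧ ccw α c < ccw α a ∧
      ccw α b < ccw α d ∧ ccw α d ≤ ccw α γ ∧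
      ∀ z, dbl^[t] z = z → (∀ i, dbl^[i] z ∈ symbolArc β (u i)) → ¬ Sb c z d := by
    by_cases hdvd : m ∣ t
    · have hmt' : m < t := lt_of_le_of_ne (Nat.le_of_dvd ht hdvd) (Ne.symm hmt)
      -- The base points are `α` and `γ`. Their symbol at the place `m - 1` is not that of `u`, so
      -- the order is preserved only on the image `X` of the branch `v e`.
      set X : Set Angle := {x | pull β (tuned m e κ) m (dbl^[m] x) = x} with hX
      have hDX : ∀ x, x = a ∨ x = b → x ∈ X := by
        intro x hx
        apply pull_iter
        intro i hi
        rw [← hut i (by lia)]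
        exact .of_mem (hDu x hx i (by lia))
      have main : ∀ z, z = α ∨ z = γ → ∀ x ∈ X, ∀ y ∈ X, _ := fun z hz x hx y hy =>
        hS.sb_pull_tuned_of_dvd hβ' hdvd hmt'.le
        (fun i hi => by rw [← hs i hi]; exact .of_mem (hβs i (by lia)))
        (by rw [← hs']; exact .of_mem (hβs _ (by lia))) hz hx hy
      obtain ⟨c, d, hc, hd, hcs, hds, h1, h2, h3⟩ := exists_fixed_arc (ζ := α) (ζ' := γ) (X := X)
        ht hup hβ
        (fun i hi => .of_mem (hDu a (Or.inl rfl) i hi))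
        (fun i hi => .of_mem (hDu b (Or.inr rfl) i hi)) (hDu' a (Or.inl rfl)) (hDu' b (Or.inr rfl))
        (hDX a (Or.inl rfl)) (hDX b (Or.inr rfl))
        (fun y => by
          rw [hpull]
          exact pull_iter fun i hi => inHalf_pull _ _ _ _ (by lia))
        ⟨ha, hab⟩ ⟨by linarith, hb⟩
        (fun x hx y hy h _ => by
          rw [hpull, hpull]; exact (main α (Or.inl rfl) x hx y hy).1 h)
        (fun x hx y hy h _ => by
          rw [hpull, hpull]; exact (main γ (Or.inr rfl) x hx y hy).2 h)
        hββ
      have h4 : ccw α b < ccw α d ∧ ccw α d ≤ ccw α γ := by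
        have := ccw_base γ b γ
        have h5 := ccw_base γ d γ
        have := ccw_base γ α b
        have := ccw_base γ α d
        have h6 := ccw_base γ α γ
        rw [ccw_self] at *
        clear hS hD hs hs' hcs hds main h3 hDu hDu' hβs hβt tr hup hpull hut
        grind [ccw_nonneg, ccw_lt_one]
      exact ⟨c, d, hc, hd, hcs, hds, ccw_nonneg _ _, h1, h4.1, h4.2, h3⟩
    · obtain ⟨ζ, ζ', ⟨hz1, hz2, hz3⟩, hzs, hzs', hzt, hzt'⟩ :=
        hS.exists_base_points hD hβ hab hb ha ht hdvd hs hs'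
      have tz : ∀ x, ccw α ζ ≤ ccw α x → ccw ζ x = ccw α x - ccw α ζ := fun x hx => by
        rw [ccw_base α ζ x, if_pos hx]
      have tz' : ∀ x, ccw α x ≤ ccw α ζ' → ccw x ζ' = ccw α ζ' - ccw α x := fun x hx => by
        rw [ccw_base α x ζ', if_pos hx]
      have hgi : ∀ x, ∀ i < t, InHalf β (tuned m e κ i) (dbl^[i] (pull β (tuned m e κ) t x)) :=
        fun x i hi => inHalf_pull _ _ _ _ hi
      have hgt : ∀ x, dbl^[t] (pull β (tuned m e κ) t x) = x := fun x => iter_pull _ _ _ _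
      obtain ⟨c, d, hc, hd, hcs, hds, h1, h2, h3⟩ := exists_fixed_arc (ζ := ζ) (ζ' := ζ')
        (X := Set.univ) ht hup hβ
        (fun i hi => .of_mem (hDu a (Or.inl rfl) i hi))
        (fun i hi => .of_mem (hDu b (Or.inr rfl) i hi)) (hDu' a (Or.inl rfl)) (hDu' b (Or.inr rfl))
        (Set.mem_univ _) (Set.mem_univ _) (fun y => Set.mem_univ _)
        (by
          rw [Sb, tz a hz1.le, tz b (by linarith)]; constructor <;> linarith)
        (by
          rw [Sb, tz b (by linarith), tz ζ' (by linarith)]; constructor <;> linarith)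
        (fun x _ y _ h h' => by
          rw [hpull, hpull, ← sb_iter_half hzs (hgi x) (hgi y), hgt, hgt]
          have q1 := tz b (by linarith)
          have := ccw_base α ζ x
          have := ccw_base α ζ y
          have := ccw_base α (dbl^[t] ζ) x
          have := ccw_base α (dbl^[t] ζ) y
          unfold Sb at *
          clear hS hD hs hs' hDu hDu' hβs hβt tr hup hpull hut hzs hzs' hgi hgt tz tz' hzt'
          grind [ccw_nonneg, ccw_lt_one])
        (fun x _ y _ h h' => by
          rw [hpull, hpull, ← sb_iter_half (hgi x) (hgi y) hzs', hgt, hgt]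
          have q1 := tz' a (by linarith)
          have := ccw_base α x y
          have := ccw_base α x ζ'
          have := ccw_base α x (dbl^[t] ζ')
          unfold Sb at *
          clear hS hD hs hs' hDu hDu' hβs hβt tr hup hpull hut hzs hzs' hgi hgt tz tz' hzt
          grind [ccw_nonneg, ccw_lt_one])
        hββ
      have h4 : ccw α c < ccw α a ∧ ccw α b < ccw α d ∧ ccw α d ≤ ccw α γ := by
        rw [tz a hz1.le] at h1
        rw [tz' b hz2.le] at h2
        have := ccw_base α ζ c
        have := ccw_base α d ζ'
        clear hS hD hs hs' hcs hds h3 hDu hDu' hβs hβt tr hup hpull hut hzs hzs' hgi hgt tz tz'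
        grind [ccw_nonneg, ccw_lt_one]
      exact ⟨c, d, hc, hd, hcs, hds, ccw_nonneg _ _, h4.1, h4.2.1, h4.2.2, h3⟩
  -- the new arc does not end at an end of the leaf `s(α, γ)`
  have hend : ∀ x, x = α ∨ x = γ → dbl^[t] x = x →
      ¬ ∀ i, dbl^[i] x ∈ symbolArc β (u i) := by
    intro x hx hxt hxs
    have h1 := Function.IsPeriodicPt.minimalPeriod_dvd (f := dbl) (x := x) hxt
    rw [hS.per x hx] at h1
    have h2 := Nat.le_of_dvd ht h1
    have h3 := hxs (m - 1)
    rw [hut _ (by lia), tuned_pred (by lia)] at h3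
    have h4 := hS.mem hβ' hx (m - 1)
    rw [hS.last] at h4
    have := symbolArc_unique h3 h4
    revert this; cases e <;> simp
  have hcα : 0 < ccw α c := ccw_pos.2 fun h => hend α (Or.inl rfl) (h ▸ hc) (h ▸ hcs)
  have hdγ : ccw α d < ccw α γ := lt_of_le_of_ne hd2 fun h => by
    have := ccw_inj h
    exact hend γ (Or.inr rfl) (this ▸ hd) (this ▸ hds)
  have hcd : ccw c d = ccw α d - ccw α c := by rw [ccw_base α c d, if_pos (by linarith)]
  have hca : ccw c a = ccw α a - ccw α c := by rw [ccw_base α c a, if_pos (by linarith)]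
  have hcβ : ccw c β = ccw α β - ccw α c := by rw [ccw_base α c β, if_pos (by linarith)]
  obtain ⟨r, hr, hleaf⟩ := exists_isParamLeaf_of_fixed_arc ht hup hc hd hcs hds
    (by linarith [hS.lt]) (a := a) ⟨by linarith, by linarith⟩ ⟨by linarith, by linarith⟩
    (hDu a (Or.inl rfl)) hat (fun z hz => (hβt z hz).1) hmin
  exact ⟨r, c, d, by lia, hleaf, hcα, hc2, hd1, hdγ⟩

end Leaf

/-! ### Chords that are nested -/

lemma behind_mk {x x' y y' : Angle} (h : ccw x x' < 1 / 2) :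
    Behind s(y, y') s(x, x') ↔ (ccw x y ≤ ccw x x' ∧ ccw x y' ≤ ccw x x') ∧
      (Sb x y x' ∨ Sb x y' x') := by
  have e : ccw x' x < 1 / 2 → x' = x := by
    intro h'
    by_contra hne
    have := ccw_rev (x := x) (y := x') (fun h => hne h.symm)
    linarith
  constructor
  · rintro ⟨a, b, hab, h1, h2, h3⟩
    simp only [Sym2.mem_iff, mem_closedArc, mem_openArc] at h2 h3
    rw [Sym2.eq_iff] at hab
    unfold Sb
    grind
  · rintro ⟨h1, h2⟩
    refine ⟨x, x', rfl, h, ?_, ?_⟩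
    · simp only [Sym2.mem_iff, mem_closedArc]; grind
    · rcases h2 with h2 | h2
      exacts [⟨y, by simp, h2⟩, ⟨y', by simp, h2⟩]

lemma sym2_ne_iff {a b c d : Angle} : s(a, b) ≠ s(c, d) ↔ ¬ ((a = c ∧ b = d) ∨ (a = d ∧ b = c)) := by
  rw [Ne, Sym2.eq_iff]

/-- A chord that runs between two nested chords separates them. -/
lemma separates_of_nested {o x x' y y' z z' : Angle} (h1 : ccw o x ≤ ccw o z)
    (h2 : ccw o z ≤ ccw o y) (h3 : ccw o y < ccw o y') (h4 : ccw o y' ≤ ccw o z')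
    (h5 : ccw o z' ≤ ccw o x') (hzx : s(z, z') ≠ s(x, x')) (hzy : s(z, z') ≠ s(y, y')) :
    Separates s(z, z') s(x, x') s(y, y') := by
  have inj : ∀ v w : Angle, ccw o v = ccw o w → v = w := fun v w => ccw_inj
  have hxy : s(x, x') ≠ s(y, y') := by
    rw [sym2_ne_iff] at *
    rintro (⟨rfl, rfl⟩ | ⟨rfl, rfl⟩)
    · exact hzx (Or.inl ⟨inj _ _ (by linarith), inj _ _ (by linarith)⟩)
    · linarith
  refine ⟨⟨hzx, hzy, hxy, x, x', y', y, rfl, Sym2.eq_swap, ?_⟩, ?_⟩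
  · simp only [mem_closedArc, Sym2.mem_iff]
    have := ccw_base o x x'
    have := ccw_base o x y
    have := ccw_base o x y'
    have := ccw_base o x z
    have := ccw_base o x z'
    have := ccw_base o y' y
    have := ccw_base o y' x
    have := ccw_base o y' x'
    have := ccw_base o y' z
    have := ccw_base o y' z'
    have e1 : ccw y' x ≤ ccw y' y := by grind [ccw_nonneg, ccw_lt_one]
    have e2 : ccw y' x' ≤ ccw y' y := by grind [ccw_nonneg, ccw_lt_one]
    have e3 : ccw y' z ≤ ccw y' y := by grind [ccw_nonneg, ccw_lt_one]
    have e4 : ccw y' z' ≤ ccw y' y := by grind [ccw_nonneg, ccw_lt_one]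
    have e5 : ccw x y ≤ ccw x x' := by grind [ccw_nonneg, ccw_lt_one]
    have e6 : ccw x y' ≤ ccw x x' := by grind [ccw_nonneg, ccw_lt_one]
    have e7 : ccw x z ≤ ccw x x' := by grind [ccw_nonneg, ccw_lt_one]
    have e8 : ccw x z' ≤ ccw x x' := by grind [ccw_nonneg, ccw_lt_one]
    refine ⟨e6, e5, e1, e2, ?_⟩
    rintro w (rfl | rfl)
    exacts [⟨e7, e3⟩, ⟨e8, e4⟩]
  · rintro ⟨-, -, -, a, b, c, d, ha, hc, k1, k2, k3, k4, k5⟩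
    have k6 := k5 y (by simp)
    have k7 := k5 y' (by simp)
    simp only [mem_closedArc] at k1 k2 k3 k4 k6 k7
    rw [Sym2.eq_iff] at ha hc
    rw [sym2_ne_iff] at hzx hzy
    have q1 : ∀ v w, ccw o v < ccw o w → ccw w v = ccw o v - ccw o w + 1 := fun v w h => by
      rw [ccw_base o w v, if_neg (by linarith)]
    have q2 : ∀ v w, ccw o v ≤ ccw o w → ccw v w = ccw o w - ccw o v := fun v w h => by
      rw [ccw_base o v w, if_pos h]
    have hzz : ccw o z < ccw o z' := by linarith
    have hxx : ccw o x < ccw o x' := by linarith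
    rcases ha with ⟨rfl, rfl⟩ | ⟨rfl, rfl⟩
    · rcases hc with ⟨rfl, rfl⟩ | ⟨rfl, rfl⟩
      · -- the side `[z, z']` does not contain both ends of `s(x, x')`
        apply hzx
        left
        rw [q2 _ _ hzz.le] at k3 k4
        have r1 : ccw o x = ccw o z := by
          by_contra hne
          rw [q1 x z (lt_of_le_of_ne h1 hne)] at k3
          linarith [ccw_nonneg o x, ccw_lt_one o z']
        rw [q2 z x' (by linarith)] at k4
        exact ⟨(inj _ _ r1).symm, inj _ _ (by linarith)⟩
      · apply hzy
        left
        rw [q1 z z' hzz] at k6 k7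
        have r1 : ccw o y' = ccw o z' := by
          by_contra hne
          rw [q1 y' z' (lt_of_le_of_ne h4 hne)] at k7
          linarith
        rw [q1 y z' (by linarith)] at k6
        exact ⟨inj _ _ (by linarith), (inj _ _ r1).symm⟩
    · have k8 := k1
      have k9 := k2
      rcases hc with ⟨rfl, rfl⟩ | ⟨rfl, rfl⟩
      · apply hzx
        left
        rw [q1 _ _ hxx] at k8 k9
        have r1 : ccw o z' = ccw o x' := by
          by_contra hne
          rw [q1 z' x' (lt_of_le_of_ne h5 hne)] at k9
          linarith
        rw [q1 z x' (by linarith)] at k8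
        exact ⟨inj _ _ (by linarith), inj _ _ r1⟩
      · apply hzx
        left
        rw [q1 _ _ hxx] at k8 k9
        have r1 : ccw o z' = ccw o x' := by
          by_contra hne
          rw [q1 z' x' (lt_of_le_of_ne h5 hne)] at k8
          linarith
        rw [q1 z x' (by linarith)] at k9
        exact ⟨inj _ _ (by linarith), inj _ _ r1⟩

/-- The chord `s(y, y')` is between `s(x, x')` and every chord that runs beside it in the arc from
`x` to `x'`. -/
lemma between_of_beside {o x x' y y' z z' : Angle} (h1 : ccw o x ≤ ccw o y)
    (h2 : ccw o y < ccw o y') (h3 : ccw o y' ≤ ccw o x') (hzx : s(z, z') ≠ s(x, x'))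
    (hzy : s(z, z') ≠ s(y, y')) (hxy : s(x, x') ≠ s(y, y')) (hz : ccw o z < ccw o z')
    (h : (ccw o x ≤ ccw o z ∧ ccw o z' ≤ ccw o y) ∨ (ccw o y' ≤ ccw o z ∧ ccw o z' ≤ ccw o x')) :
    Between s(y, y') s(x, x') s(z, z') := by
  refine ⟨hxy.symm, hzy.symm, hzx.symm, x, x', z', z, rfl, Sym2.eq_swap, ?_⟩
  simp only [mem_closedArc, Sym2.mem_iff]
  have := ccw_base o x x'
  have := ccw_base o x y
  have := ccw_base o x y'
  have := ccw_base o x z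
  have := ccw_base o x z'
  have := ccw_base o z' y
  have := ccw_base o z' y'
  have := ccw_base o z' x
  have := ccw_base o z' x'
  have := ccw_base o z' z
  clear hzx hzy hxy
  have e1 : ccw z' x ≤ ccw z' z := by grind [ccw_nonneg, ccw_lt_one]
  have e2 : ccw z' x' ≤ ccw z' z := by grind [ccw_nonneg, ccw_lt_one]
  have e3 : ccw z' y ≤ ccw z' z := by grind [ccw_nonneg, ccw_lt_one]
  have e4 : ccw z' y' ≤ ccw z' z := by grind [ccw_nonneg, ccw_lt_one]
  have e5 : ccw x y ≤ ccw x x' := by grind [ccw_nonneg, ccw_lt_one]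
  have e6 : ccw x y' ≤ ccw x x' := by grind [ccw_nonneg, ccw_lt_one]
  have e7 : ccw x z ≤ ccw x x' := by grind [ccw_nonneg, ccw_lt_one]
  have e8 : ccw x z' ≤ ccw x x' := by grind [ccw_nonneg, ccw_lt_one]
  refine ⟨e8, e7, e1, e2, ?_⟩
  rintro w (rfl | rfl)
  exacts [⟨e5, e3⟩, ⟨e6, e4⟩]

/-- The case of `nested_of_separates` where `z` comes before `z'`. -/
lemma nested_of_separates_aux {o x x' y y' z z' : Angle} (h1 : ccw o x ≤ ccw o y)
    (h2 : ccw o y < ccw o y') (h3 : ccw o y' ≤ ccw o x') (hz : ccw o z < ccw o z')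
    (h : Separates s(z, z') s(x, x') s(y, y')) :
    ccw o x ≤ ccw o z ∧ ccw o z ≤ ccw o y ∧ ccw o y' ≤ ccw o z' ∧ ccw o z' ≤ ccw o x' := by
  obtain ⟨⟨hzx, hzy, hxy, a, b, c, d, ha, hc, k1, k2, k3, k4, k5⟩, hnot⟩ := h
  have k6 := k5 z (by simp)
  have k7 := k5 z' (by simp)
  have hnot' := fun h => hnot (between_of_beside h1 h2 h3 hzx hzy hxy hz h)
  simp only [mem_closedArc] at k1 k2 k3 k4 k6 k7
  clear k5 hnot hzx hzy
  have inj : ∀ v w : Angle, ccw o v = ccw o w → v = w := fun v w => ccw_inj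
  have q1 : ∀ v w, ccw o v < ccw o w → ccw w v = ccw o v - ccw o w + 1 := fun v w h => by
    rw [ccw_base o w v, if_neg (by linarith)]
  have q2 : ∀ v w, ccw o v ≤ ccw o w → ccw v w = ccw o w - ccw o v := fun v w h => by
    rw [ccw_base o v w, if_pos h]
  have hxx : ccw o x < ccw o x' := by linarith
  rw [Sym2.eq_iff] at ha hc
  rw [sym2_ne_iff] at hxy
  have hxy' : ¬ (ccw o x = ccw o y ∧ ccw o x' = ccw o y') := fun h =>
    hxy (Or.inl ⟨inj _ _ h.1, inj _ _ h.2⟩)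
  rcases ha with ⟨rfl, rfl⟩ | ⟨rfl, rfl⟩
  · rcases hc with ⟨rfl, rfl⟩ | ⟨rfl, rfl⟩
    · exfalso
      apply hxy'
      rw [q2 _ _ h2.le] at k3 k4
      have := ccw_base o y x
      have := ccw_base o y x'
      clear q1 q2 inj hxy hxy' hnot'
      grind [ccw_nonneg, ccw_lt_one]
    · rw [q2 _ _ hxx.le] at k6 k7
      rw [q1 _ _ h2] at k6 k7
      have := ccw_base o x z
      have := ccw_base o x z'
      have := ccw_base o y' z
      have := ccw_base o y' z'
      clear q1 q2 inj hxy hxy'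
      grind [ccw_nonneg, ccw_lt_one]
  · exfalso
    apply hxy'
    rw [q1 _ _ hxx] at k1 k2
    have := ccw_base o x' y
    have := ccw_base o x' y'
    clear q1 q2 inj hxy hxy' hnot' k3 k4 k6 k7
    grind [ccw_nonneg, ccw_lt_one]

/-- The ends of a chord that separates two nested chords. -/
lemma nested_of_separates {o x x' y y' z z' : Angle} (h1 : ccw o x ≤ ccw o y)
    (h2 : ccw o y < ccw o y') (h3 : ccw o y' ≤ ccw o x') (hz : z ≠ z')
    (h : Separates s(z, z') s(x, x') s(y, y')) :
    (ccw o x ≤ ccw o z ∧ ccw o z ≤ ccw o y ∧ ccw o y' ≤ ccw o z' ∧ ccw o z' ≤ ccw o x') ∨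
    (ccw o x ≤ ccw o z' ∧ ccw o z' ≤ ccw o y ∧ ccw o y' ≤ ccw o z ∧ ccw o z ≤ ccw o x') := by
  rcases lt_trichotomy (ccw o z) (ccw o z') with h' | h' | h'
  · exact Or.inl (nested_of_separates_aux h1 h2 h3 h' h)
  · exact absurd (ccw_inj h') hz
  · rw [Sym2.eq_swap] at h
    exact Or.inr (nested_of_separates_aux h1 h2 h3 h' h)

/-! ### Leaves that are immediately visible -/

lemma ccw_le_iter_half {β x y z : Angle} {n : ℕ} {κ : ℕ → Bool}
    (hx : ∀ i < n, InHalf β (κ i) (dbl^[i] x)) (hy : ∀ i < n, InHalf β (κ i) (dbl^[i] y))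
    (hz : ∀ i < n, InHalf β (κ i) (dbl^[i] z)) :
    ccw (dbl^[n] x) (dbl^[n] y) ≤ ccw (dbl^[n] x) (dbl^[n] z) ↔ ccw x y ≤ ccw x z := by
  induction n with
  | zero => rfl
  | succ n ih =>
    simp only [Function.iterate_succ_apply']
    rw [ccw_le_dbl_iff (hx n (by lia)) (hy n (by lia)) (hz n (by lia))]
    exact ih (fun i hi => hx i (by lia)) (fun i hi => hy i (by lia)) (fun i hi => hz i (by lia))

namespace Leaf

section
variable {p : ℕ} {c d : Angle} {e : Bool} {κ : ℕ → Bool}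

/-- An angle outside the smaller arc of the leaf which has the itinerary of the leaf up to the order
`p - 2` has it up to the order `p - 1`. -/
lemma mem_pred_of_outside (h : Leaf p c d e κ) {z β : Angle} (hβ : Sb c β d) (hz : Sb c d z)
    (hs : ∀ i < p - 1, InHalf β (κ i) (dbl^[i] z)) {β' : Angle} (hβ' : ccw c β' ≤ ccw c d) :
    dbl^[p - 1] z ∈ symbolArc β' (!e) := by
  rw [← sb_iter_half (β := β) (n := p - 1) (κ := κ) (fun i _ => .of_mem (h.mem hβ (Or.inl rfl) i))
    (fun i _ => .of_mem (h.mem hβ (Or.inr rfl) i)) hs, Sb, h.pred] at hz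
  rw [h.mem_not_letter hβ']
  right
  linarith [hz.2]

end

variable {m p : ℕ} {α γ a b : Angle} {e e' : Bool} {κ κ' : ℕ → Bool}

lemma ne_of_period_ne (hS : Leaf m α γ e κ) (hD : Leaf p a b e' κ') (hmp : p ≠ m) {x y : Angle}
    (hx : x = α ∨ x = γ) (hy : y = a ∨ y = b) : x ≠ y := by
  rintro rfl
  exact hmp ((hD.per x hy).symm.trans (hS.per x hx))

lemma order_of_behind (hS : Leaf m α γ e κ) (hD : Leaf p a b e' κ') (hmp : p ≠ m)
    (h : Behind s(a, b) s(α, γ)) :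
    0 < ccw α a ∧ ccw α a < ccw α b ∧ ccw α b < ccw α γ := by
  rw [behind_mk hS.lt] at h
  have h1 := hS.ne_of_period_ne hD hmp (Or.inl rfl) (Or.inl rfl)
  have h2 := hS.ne_of_period_ne hD hmp (Or.inl rfl) (Or.inr rfl)
  have h3 := hS.ne_of_period_ne hD hmp (Or.inr rfl) (Or.inl rfl)
  have h4 := hS.ne_of_period_ne hD hmp (Or.inr rfl) (Or.inr rfl)
  have h5 := ccw_pos.2 h1.symm
  have h6 : ccw α b ≠ ccw α γ := fun h => h4 (ccw_inj h).symm
  have h7 := hD.lt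
  have h8 := hS.lt
  have h9 := ccw_base α a b
  have h10 := hD.pos
  have h11 : ccw α a ≠ ccw α γ := fun h => h3 (ccw_inj h).symm
  obtain ⟨⟨h12, h13⟩, -⟩ := h
  clear hS hD h1 h2 h3 h4
  grind [ccw_nonneg, ccw_lt_one]

lemma separates_of_order (hS : Leaf m α γ e κ) (hD : Leaf p a b e' κ') {c d : Angle}
    (h1 : 0 < ccw α c) (h2 : ccw α c < ccw α a) (h3 : ccw α a < ccw α b) (h4 : ccw α b < ccw α d)
    (h5 : ccw α d < ccw α γ) : Separates s(c, d) s(α, γ) s(a, b) := by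
  refine separates_of_nested (o := α) (by rw [ccw_self]; exact h1.le) h2.le h3 h4.le h5.le ?_ ?_
  · rw [sym2_ne_iff]
    rintro (⟨rfl, rfl⟩ | ⟨rfl, rfl⟩)
    · linarith
    · linarith
  · rw [sym2_ne_iff]
    rintro (⟨rfl, rfl⟩ | ⟨rfl, rfl⟩)
    · linarith
    · linarith

/-- A visible leaf has the itinerary `v e v e …` up to its last but one entry. -/
theorem tuned_of_visible (hS : Leaf m α γ e κ) (hD : Leaf p a b e' κ') (hmp : p ≠ m)
    (h : Visible s(α, γ) p s(a, b)) : ∀ i < p - 1, κ' i = tuned m e κ i := by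
  obtain ⟨h1, h2, h3⟩ := hS.order_of_behind hD hmp h.1
  rcases hS.tuned_or_exists_separating hD h1 h2 h3 with h4 | ⟨r, c, d, hr, hcd, k1, k2, k3, k4⟩
  · exact h4
  · exact absurd (hS.separates_of_order hD k1 k2 h2 k3 k4) (h.2 r _ hcd hr)

/-- The itinerary of an immediately visible leaf of period `q * m` is `v e v e …`. -/
theorem tuned_of_immediatelyVisible {q : ℕ} (hq : 2 ≤ q) (hS : Leaf m α γ e κ)
    (hD : Leaf (q * m) a b e' κ') (h : ImmediatelyVisible s(α, γ) s(a, b)) (i : ℕ) :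
    κ' i = tuned m e κ i := by
  have hm := hS.one_lt
  have hqm : q * m ≠ m := by nlinarith
  have hqm' : m ≤ q * m := by nlinarith
  obtain ⟨h1, h2, h3⟩ := hS.order_of_behind hD hqm h.1
  have hlt := hS.tuned_of_visible hD hqm ⟨h.1, fun p C hC _ => h.2 p C hC⟩
  have hωp : Function.Periodic (tuned m e κ) m := tuned_add m e hS.sym_add
  have hωl : tuned m e κ (q * m - 1) = e := by
    rw [tuned, if_pos]
    rw [Nat.sub_add_cancel (by lia), Nat.mul_mod_left]
  -- a common point of the itinerary outside `[a, b]`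
  obtain ⟨β, hβ, -, -⟩ := exists_near (t := 1) (p := 1) hD.pos (by
    intro h
    have := Function.IsPeriodicPt.minimalPeriod_le (f := dbl) one_pos h
    rw [hD.per a (Or.inl rfl)] at this; lia) le_rfl
  have tr : ∀ z, Sb a z b ↔ ccw α a < ccw α z ∧ ccw α z < ccw α b := by
    intro z
    have := ccw_base α a z
    have := ccw_base α a b
    unfold Sb
    clear hS hD hlt
    grind [ccw_nonneg, ccw_lt_one]
  have hβ' : Sb α β γ := by
    have := (tr β).1 hβ
    exact ⟨by linarith, by linarith⟩
  have key : ∃ j, q ≤ j ∧ ¬ Sb a ((pull β (tuned m e κ) m)^[j] α) b := by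
    by_contra hcon
    push Not at hcon
    have k1 := hcon q le_rfl
    have k2 := hcon (q + 1) (by lia)
    rw [Function.iterate_succ_apply'] at k2
    exact hS.not_sb_pull_tuned hD hβ h2 h3 h1 k1 k2
  obtain ⟨j, hj, hz⟩ := key
  have hza := hS.iterate_pull_ne hD h2 h3 h1 β (Or.inl rfl) j
  have hzb := hS.iterate_pull_ne hD h2 h3 h1 β (Or.inr rfl) j
  have hfol := hS.inHalf_iterate_pull hβ' j
  generalize (pull β (tuned m e κ) m)^[j] α = z at *
  have hz' : Sb a b z := by
    have q1 := ccw_pos.2 hza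
    have q2 : ccw a z ≠ ccw a b := fun h => hzb (ccw_inj h)
    refine ⟨hD.pos, lt_of_le_of_ne (not_lt.1 fun h => hz ⟨q1, h⟩) q2.symm⟩
  have hjm : q * m ≤ j * m := Nat.mul_le_mul_right m hj
  -- The point `z` outside `[a, b]` has the same first `q * m - 1` symbols as `a` and `b`; its next
  -- symbol determines `!e'`.
  have k1 := hD.mem_pred_of_outside hβ hz' (fun i hi => by rw [hlt i hi]; exact hfol i (by lia))
    hβ.2.le
  have k2 := hfol (q * m - 1) (by lia)
  have k3 : tuned m e κ (q * m - 1) = !e' := by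
    by_contra hne
    have : tuned m e κ (q * m - 1) = !(!e') := by
      revert hne; cases tuned m e κ (q * m - 1) <;> cases e' <;> simp
    rw [this] at k2
    exact not_inHalf_not (.of_mem k1) k2
  have hall : ∀ i < q * m, κ' i = tuned m e κ i := by
    intro i hi
    rcases Nat.lt_or_ge i (q * m - 1) with h | h
    · exact hlt i h
    · rw [show i = q * m - 1 by lia, hD.last, k3]
  have e1 : Function.Periodic κ' (q * m) := hD.sym_add
  have e2 : Function.Periodic (tuned m e κ) (q * m) := by
    simpa using hωp.nsmul q
  rw [← e1.map_mod_nat, ← e2.map_mod_nat]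
  exact hall _ (Nat.mod_lt _ (by lia))

/-- An angle behind the leaf `s(a, b)` of itinerary `v e v e …` that has this itinerary up to the
order `l * m - 2` lies on the side `e` at the order `l * m - 1`. -/
theorem mem_of_tuned {q : ℕ} (hS : Leaf m α γ e κ) (hD : Leaf (q * m) a b e' κ')
    (h1 : 0 < ccw α a) (h2 : ccw α a < ccw α b) (h3 : ccw α b < ccw α γ)
    (hκ : ∀ i, κ' i = tuned m e κ i) {l : ℕ} (hl : 0 < l) (hlq : l < q) {β β' y : Angle}
    (hβ : Sb a β b) (hβ' : Sb a β' b) (hy : ccw a y ≤ ccw a b)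
    (hys : ∀ i < l * m - 1, InHalf β (tuned m e κ i) (dbl^[i] y)) :
    dbl^[l * m - 1] y ∈ symbolArc β' e := by
  have hm := hS.one_lt
  have hlm : 0 < l * m := by positivity
  have hlm' : l * m < q * m := by nlinarith
  have hω : ∀ i, tuned m e κ (i + l * m) = tuned m e κ i := by
    have hωp : Function.Periodic (tuned m e κ) m := tuned_add m e hS.sym_add
    simpa using hωp.nsmul l
  have hωl : tuned m e κ (l * m - 1) = e := by
    rw [tuned, if_pos]
    rw [Nat.sub_add_cancel (by lia), Nat.mul_mod_left]
  have hne : dbl^[l * m] a ≠ a := by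
    intro h
    have := Function.IsPeriodicPt.minimalPeriod_le (f := dbl) hlm h
    rw [hD.per a (Or.inl rfl)] at this; lia
  have tr : ∀ z, ccw a z ≤ ccw a b ↔ ccw α a ≤ ccw α z ∧ ccw α z ≤ ccw α b := by
    intro z
    have := ccw_base α a z
    have := ccw_base α a b
    clear hS hD hκ hys hω
    grind [ccw_nonneg, ccw_lt_one]
  have side : ∀ x, x = a ∨ x = b → ∀ β', Sb a β' b →
      dbl^[l * m - 1] x ∈ symbolArc β' e := by
    intro x hx β' hβ'
    have := hD.mem hβ' hx (l * m - 1)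
    rwa [hκ, hωl] at this
  -- the ends of the iterate of order `l * m - 1`, in the coordinate of `s(α, γ)`
  have loc : ∀ x, x = a ∨ x = b → ccw α b / 2 ≤ ccw (dbl^[m - 1] α) (dbl^[l * m - 1] x) ∧
      ccw (dbl^[m - 1] α) (dbl^[l * m - 1] x) ≤ ccw α a / 2 + 1 / 2 := by
    intro x hx
    have key : ∀ r, ccw α a < r → r < ccw α b →
        r / 2 < ccw (dbl^[m - 1] α) (dbl^[l * m - 1] x) ∧
        ccw (dbl^[m - 1] α) (dbl^[l * m - 1] x) < r / 2 + 1 / 2 := by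
      intro r hr1 hr2
      have hr := ccw_add_of_lt α (t := r) (by linarith) (by linarith [ccw_lt_one α b])
      have hs : Sb a (α + (r : Angle)) b := by
        have := ccw_base α a (α + (r : Angle))
        have := ccw_base α a b
        rw [hr] at *
        rw [Sb]
        clear hS hD hκ hys hω tr side
        grind [ccw_nonneg, ccw_lt_one]
      have := side x hx _ hs
      rwa [hS.mem_letter (by rw [hr]; linarith), hr] at this
    constructor
    · by_contra hcon
      have k1 := key (max (2 * ccw (dbl^[m - 1] α) (dbl^[l * m - 1] x))
        ((ccw α a + ccw α b) / 2)) (lt_max_of_lt_right (by linarith))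
        (max_lt (by linarith) (by linarith))
      linarith [k1.1, le_max_left (2 * ccw (dbl^[m - 1] α) (dbl^[l * m - 1] x))
        ((ccw α a + ccw α b) / 2)]
    · by_contra hcon
      have k1 := key (min (2 * ccw (dbl^[m - 1] α) (dbl^[l * m - 1] x) - 1)
        ((ccw α a + ccw α b) / 2)) (lt_min (by linarith) (by linarith))
        (min_lt_of_right_lt (by linarith))
      linarith [k1.2, min_le_left (2 * ccw (dbl^[m - 1] α) (dbl^[l * m - 1] x) - 1)
        ((ccw α a + ccw α b) / 2)]
  have hβα := (tr β').1 hβ'.2.le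
  have hβa : ccw α β' ≠ ccw α a := fun h => ccw_pos.1 hβ'.1 (ccw_inj h)
  have hβb : ccw α β' ≠ ccw α b := fun h => by
    have := hβ'.2
    rw [ccw_inj h] at this
    exact lt_irrefl _ this
  have hyord : ccw (dbl^[l * m - 1] a) (dbl^[l * m - 1] y) ≤
      ccw (dbl^[l * m - 1] a) (dbl^[l * m - 1] b) := by
    rw [ccw_le_iter_half (β := β) (κ := tuned m e κ) _ hys]
    · exact hy
    · intro i _
      rw [← hκ]; exact .of_mem (hD.mem hβ (Or.inr rfl) i)
    · intro i _
      rw [← hκ]; exact .of_mem (hD.mem hβ (Or.inl rfl) i)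
  have hx := loc a (Or.inl rfl)
  have hx' := loc b (Or.inr rfl)
  rcases le_or_gt (ccw (dbl^[m - 1] α) (dbl^[l * m - 1] a))
    (ccw (dbl^[m - 1] α) (dbl^[l * m - 1] b)) with hle | hgt
  · rw [hS.mem_letter (by linarith)]
    have := ccw_base (dbl^[m - 1] α) (dbl^[l * m - 1] a) (dbl^[l * m - 1] y)
    have := ccw_base (dbl^[m - 1] α) (dbl^[l * m - 1] a) (dbl^[l * m - 1] b)
    clear hS hD hκ hys hω tr side loc
    grind [ccw_nonneg, ccw_lt_one]
  · exfalso
    -- In the other order, the iterate of order `l * m` would map `[a, b]` to an arc around it.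
    apply hne
    have e0 : ∀ x, dbl^[l * m] x = dbl (dbl^[l * m - 1] x) := fun x => by
      rw [← Function.iterate_succ_apply' dbl, Nat.succ_eq_add_one, Nat.sub_add_cancel hlm]
    refine (eq_of_subset_iterate (β := β) (σ := tuned m e κ) (P := q * m) (by lia)
      (hD.iterate_eq (Or.inl rfl)) (hD.iterate_eq (Or.inr rfl))
      (fun i => by rw [← hκ]; exact hD.mem hβ (Or.inl rfl) i)
      (fun i => by rw [← hκ]; exact hD.mem hβ (Or.inr rfl) i) hω ?_ ?_).1
    all_goals
      rw [e0 a]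
      try rw [e0 b]
      have d1 := ccw_dbl (dbl^[m - 1] α) (dbl^[l * m - 1] a)
      have d2 := ccw_dbl (dbl^[m - 1] α) (dbl^[l * m - 1] b)
      rw [hS.dbl_pred] at d1 d2
      have := ccw_base α (dbl (dbl^[l * m - 1] a)) a
      have := ccw_base α (dbl (dbl^[l * m - 1] a)) b
      have := ccw_base α (dbl (dbl^[l * m - 1] a)) (dbl (dbl^[l * m - 1] b))
      clear hS hD hκ hys hω tr side loc e0 hyord
      grind [ccw_nonneg, ccw_lt_one]

end Leaf

lemma ccw_inj_iff' (o x y : Angle) : x = y ↔ ccw o x = ccw o y := ⟨fun h => h ▸ rfl, ccw_inj⟩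

/-- Crossing chords, in a coordinate in which the ends of one of them are different. -/
lemma crosses_coord {o x y z w : Angle} (hxy : ccw o x ≠ ccw o y) : Crosses s(x, y) s(z, w) ↔
    ((min (ccw o x) (ccw o y) < ccw o z ∧ ccw o z < max (ccw o x) (ccw o y)) ∧
      (ccw o w < min (ccw o x) (ccw o y) ∨ max (ccw o x) (ccw o y) < ccw o w)) ∨
    ((min (ccw o x) (ccw o y) < ccw o w ∧ ccw o w < max (ccw o x) (ccw o y)) ∧
      (ccw o z < min (ccw o x) (ccw o y) ∨ max (ccw o x) (ccw o y) < ccw o z)) := by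
  rw [crosses_mk]
  unfold Sb
  rw [ccw_base o x z, ccw_base o x y, ccw_base o y w, ccw_base o y x, ccw_base o x w,
    ccw_base o y z]
  have hx0 := ccw_nonneg o x
  have hx1 := ccw_lt_one o x
  have hy0 := ccw_nonneg o y
  have hy1 := ccw_lt_one o y
  have hz0 := ccw_nonneg o z
  have hz1 := ccw_lt_one o z
  have hw0 := ccw_nonneg o w
  have hw1 := ccw_lt_one o w
  generalize ccw o x = a at *
  generalize ccw o y = b at *
  generalize ccw o z = c at *
  generalize ccw o w = d at *
  rcases lt_or_gt_of_ne hxy with h | h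
  · rw [min_eq_left h.le, max_eq_right h.le, if_pos h.le, if_neg (not_le.2 h)]
    grind
  · rw [min_eq_right h.le, max_eq_left h.le, if_neg (not_le.2 h), if_pos h.le]
    grind

/-! ### The pieces of the disk cut out by the two preimages of a leaf -/

/-- The closed arc with symbol `t` that is cut off by one of the two long preimages of `s(α, γ)`; it
is mapped onto `[γ, α]`. -/
def Lobe (α γ : Angle) (t : Bool) (x : Angle) : Prop :=
  ccw (sideBase γ t) x ≤ 1 / 2 - ccw α γ / 2

/-- The open arc with symbol `t` between the two preimages of `s(α, γ)`; it is mapped onto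
`]α, γ[`. -/
def Strip (α γ : Angle) (t : Bool) (x : Angle) : Prop :=
  0 < ccw (sideBase α t) x ∧ ccw (sideBase α t) x < ccw α γ / 2

/-- The closure of `Strip α γ t`. -/
def ClosedStrip (α γ : Angle) (t : Bool) (x : Angle) : Prop :=
  ccw (sideBase α t) x ≤ ccw α γ / 2

/-- The points `x` and `y` lie in the same one of the pieces with symbol `t`. -/
def Piece (α γ : Angle) (t : Bool) (x y : Angle) : Prop :=
  (Lobe α γ t x ∧ Lobe α γ t y) ∨ (Strip α γ t x ∧ Strip α γ t y)

/-- The points `x` and `y` lie in the closure of one of the pieces with symbol `t`. -/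
def ClosedPiece (α γ : Angle) (t : Bool) (x y : Angle) : Prop :=
  (Lobe α γ t x ∧ Lobe α γ t y) ∨ (ClosedStrip α γ t x ∧ ClosedStrip α γ t y)

lemma Strip.closed {α γ x : Angle} {t : Bool} (h : Strip α γ t x) : ClosedStrip α γ t x := h.2.le

lemma Piece.closed {α γ x y : Angle} {t : Bool} (h : Piece α γ t x y) : ClosedPiece α γ t x y :=
  h.imp id fun h => ⟨h.1.closed, h.2.closed⟩

namespace Leaf

variable {m : ℕ} {α γ : Angle} {e : Bool} {κ : ℕ → Bool}

lemma ccw_sideBase (hS : Leaf m α γ e κ) (t : Bool) :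
    ccw (sideBase α t) (sideBase γ t) = ccw α γ / 2 := by
  rw [sideBase_add (hS.rep_le le_rfl)]
  exact ccw_add_of_lt _ (by linarith [hS.pos]) (by linarith [hS.lt])

lemma ccw_sideBase_not (hS : Leaf m α γ e κ) (t : Bool) :
    ccw (sideBase α t) (sideBase γ (!t)) = ccw α γ / 2 + 1 / 2 := by
  rw [sideBase_not, ccw_add_oneHalf, hS.ccw_sideBase, if_pos (by linarith [hS.lt])]

lemma lobe_iff (hS : Leaf m α γ e κ) {t : Bool} {x : Angle} :
    Lobe α γ t x ↔ ccw α γ / 2 ≤ ccw (sideBase α t) x ∧ ccw (sideBase α t) x ≤ 1 / 2 := by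
  have h1 := hS.ccw_sideBase t
  have h2 := ccw_base (sideBase α t) (sideBase γ t) x
  rw [h1] at h2
  have := hS.lt
  have := hS.pos
  unfold Lobe
  clear hS h1
  grind [ccw_nonneg, ccw_lt_one]

lemma lobe_not_iff (hS : Leaf m α γ e κ) {t : Bool} {x : Angle} :
    Lobe α γ (!t) x ↔ ccw (sideBase α t) x = 0 ∨ 1 / 2 + ccw α γ / 2 ≤ ccw (sideBase α t) x := by
  have h1 := hS.ccw_sideBase_not t
  have h2 := ccw_base (sideBase α t) (sideBase γ (!t)) x
  rw [h1] at h2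
  have := hS.lt
  have := hS.pos
  unfold Lobe
  clear hS h1
  grind [ccw_nonneg, ccw_lt_one]

lemma strip_not_iff (hS : Leaf m α γ e κ) {t : Bool} {x : Angle} :
    Strip α γ (!t) x ↔ 1 / 2 < ccw (sideBase α t) x ∧
      ccw (sideBase α t) x < 1 / 2 + ccw α γ / 2 := by
  have h2 := ccw_base (sideBase α t) (sideBase α t + oneHalf) x
  rw [ccw_self_add_oneHalf] at h2
  have := hS.lt
  have := hS.pos
  unfold Strip
  rw [sideBase_not]
  clear hS
  grind [ccw_nonneg, ccw_lt_one]

lemma closedStrip_not_iff (hS : Leaf m α γ e κ) {t : Bool} {x : Angle} :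
    ClosedStrip α γ (!t) x ↔ 1 / 2 ≤ ccw (sideBase α t) x ∧
      ccw (sideBase α t) x ≤ 1 / 2 + ccw α γ / 2 := by
  have h2 := ccw_base (sideBase α t) (sideBase α t + oneHalf) x
  rw [ccw_self_add_oneHalf] at h2
  have := hS.lt
  have := hS.pos
  unfold ClosedStrip
  rw [sideBase_not]
  clear hS
  grind [ccw_nonneg, ccw_lt_one]

/-- Every angle behind the leaf sees the lobes on their sides. -/
lemma mem_of_lobe (hS : Leaf m α γ e κ) {t : Bool} {x β : Angle} (hβ : Sb α β γ)
    (h : Lobe α γ t x) : x ∈ symbolArc β t := by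
  rw [hS.lobe_iff] at h
  rw [mem_symbolArc_iff, sideBase_add (hS.rep_le hβ.2.le)]
  have h1 := ccw_add_of_lt (sideBase α t) (t := ccw α β / 2) (by linarith [ccw_nonneg α β])
    (by linarith [ccw_lt_one α β])
  have h2 := ccw_base (sideBase α t) (sideBase α t + ((ccw α β / 2 : ℝ) : Angle)) x
  rw [h1] at h2
  have := hβ.1
  have := hβ.2
  clear hS h1
  grind [ccw_nonneg, ccw_lt_one]

lemma lobe_iterate (hS : Leaf m α γ e κ) {x : Angle} (hx : x = α ∨ x = γ) (i : ℕ) :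
    Lobe α γ (κ i) (dbl^[i] x) := by
  by_cases h : κ i = e
  · rw [h, hS.lobe_iff, hS.letter]
    exact hS.side_eq x hx i h
  · have h1 := hS.side_ne x hx i h
    have : κ i = !e := by revert h; cases κ i <;> cases e <;> simp
    rw [this, hS.lobe_not_iff, hS.letter]
    exact h1

lemma pred_left (hS : Leaf m α γ e κ) : dbl^[m - 1] α = sideBase α e := hS.letter.symm

lemma pred_right (hS : Leaf m α γ e κ) : dbl^[m - 1] γ = sideBase γ (!e) := by
  apply ccw_inj (a := sideBase α e)
  rw [hS.ccw_sideBase_not, hS.letter, hS.pred]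

/-- The two longer chords among those that join preimages of `α` and `γ` are the chords that bound
the lobes; the one with the end `sideBase α e` is the iterate of order `m - 1`. -/
lemma dotLeaf_eq (hS : Leaf m α γ e κ) :
    dotLeaf m s(α, γ) = s(sideBase α e, sideBase γ (!e)) := by
  rw [dotLeaf, dblC_iter, hS.pred_left, hS.pred_right]

lemma ddotLeaf_eq (hS : Leaf m α γ e κ) :
    ddotLeaf m s(α, γ) = s(sideBase α (!e), sideBase γ e) := by
  rw [ddotLeaf, hS.dotLeaf_eq, Sym2.map_mk, sideBase_not, sideBase_not]
  simp

/-- The conditions on the iterates in the definition of the dynamic lamination. -/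
lemma piece_iff (hS : Leaf m α γ e κ) {x y : Angle} (hxy : x ≠ y) :
    (chordLength s(x, y) ≤ chordLength (dotLeaf m s(α, γ)) ∧
    chordLength s(x, y) ≤ chordLength (ddotLeaf m s(α, γ)) ∧
    ¬ Crosses s(x, y) (dotLeaf m s(α, γ)) ∧ ¬ Crosses s(x, y) (ddotLeaf m s(α, γ)) ∧
    (Between s(x, y) (dotLeaf m s(α, γ)) (ddotLeaf m s(α, γ)) →
      ∀ z ∈ s(x, y), z ∉ dotLeaf m s(α, γ) ∧ z ∉ ddotLeaf m s(α, γ))) ↔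
    ∃ t, Piece α γ t x y := by
  have hp : (∃ t, Piece α γ t x y) ↔ Piece α γ e x y ∨ Piece α γ (!e) x y := by
    constructor
    · rintro ⟨t, h⟩
      by_cases ht : t = e
      · exact Or.inl (ht ▸ h)
      · right
        have : t = !e := by revert ht; cases t <;> cases e <;> simp
        exact this ▸ h
    · rintro (h | h)
      exacts [⟨_, h⟩, ⟨_, h⟩]
  rw [hp, Piece, Piece, hS.lobe_iff, hS.lobe_iff, hS.lobe_not_iff, hS.lobe_not_iff,
    hS.strip_not_iff, hS.strip_not_iff, Strip, Strip, hS.dotLeaf_eq, hS.ddotLeaf_eq]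
  have h1 := hS.ccw_sideBase e
  have h2 := hS.ccw_sideBase_not e
  have h3 : ccw (sideBase α e) (sideBase α (!e)) = 1 / 2 := by
    rw [sideBase_not, ccw_self_add_oneHalf]
  have hlt := hS.lt
  have hpos := hS.pos
  generalize sideBase α e = o at *
  generalize sideBase α (!e) = o' at *
  generalize sideBase γ e = w at *
  generalize sideBase γ (!e) = w' at *
  generalize ccw α γ = s at *
  clear hS hp
  have hxy' : ccw o x ≠ ccw o y := fun h => hxy (ccw_inj h)
  have l1 : chordLength s(o, w') = 1 / 2 - s / 2 := by
    rw [chordLength_mk, h2, min_eq_right (by linarith)]; ring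
  have l2 : chordLength s(o', w) = 1 / 2 - s / 2 := by
    have := ccw_base o o' w
    rw [h3, h1, if_neg (by linarith)] at this
    rw [chordLength_mk, this, min_eq_right (by linarith)]; ring
  rw [l1, l2]
  have hx0 := ccw_nonneg o x
  have hx1 := ccw_lt_one o x
  have hy0 := ccw_nonneg o y
  have hy1 := ccw_lt_one o y
  have h4 := ccw_base o x y
  have hoo : ccw o o = 0 := ccw_self o
  constructor
  · rintro ⟨k1, -, k2, k3, k4⟩
    have k5 := (crosses_coord (o := o) (z := o) (w := w') hxy').not.1 k2
    have k6 := (crosses_coord (o := o) (z := o') (w := w) hxy').not.1 k3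
    rw [chordLength_mk] at k1
    rw [h2, hoo] at k5
    rw [h3, h1] at k6
    have k7 : (ccw o x ≤ s / 2 ∨ 1 / 2 ≤ ccw o x ∧ ccw o x ≤ s / 2 + 1 / 2) →
        (ccw o y ≤ s / 2 ∨ 1 / 2 ≤ ccw o y ∧ ccw o y ≤ s / 2 + 1 / 2) → 
        s(x, y) = s(o, w') ∨ s(x, y) = s(o', w) ∨ ((x ≠ o ∧ x ≠ w') ∧ x ≠ o' ∧ x ≠ w) ∧ 
          (y ≠ o ∧ y ≠ w') ∧ y ≠ o' ∧ y ≠ w := by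
      intro hx hy
      by_cases e1 : s(x, y) = s(o, w')
      · exact Or.inl e1
      by_cases e2 : s(x, y) = s(o', w)
      · exact Or.inr (Or.inl e2)
      right; right
      have := k4 ⟨e1, e2, ?_, o, w', o', w, rfl, rfl, ?_, ?_, ?_, ?_, ?_⟩
      · have h5 := this x (by simp)
        have h6 := this y (by simp)
        simpa [not_or] using And.intro h5 h6
      · rw [Ne, Sym2.eq_iff]
        rintro (⟨h, -⟩ | ⟨h, -⟩)
        · rw [h, ccw_self] at h3; linarith
        · rw [h, ccw_self] at h1; linarith
      · rw [mem_closedArc, h3, h2]; linarith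
      · rw [mem_closedArc, h1, h2]; linarith
      all_goals have h7 : ccw o' w = 1 / 2 + s / 2 := by
                  rw [ccw_base o, h1, h3, if_neg (by linarith)]; ring
      · rw [mem_closedArc, h7, ccw_base o, h3, hoo, if_neg (by linarith)]; linarith
      · rw [mem_closedArc, h7, ccw_base o, h3, h2, if_pos (by linarith)]; linarith
      · intro z hz
        have hz' : ccw o z ≤ s / 2 ∨ 1 / 2 ≤ ccw o z ∧ ccw o z ≤ s / 2 + 1 / 2 := by
          rcases Sym2.mem_iff.1 hz with rfl | rfl <;> assumption
        have := ccw_base o o' z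
        rw [h3] at this
        have := ccw_nonneg o z
        rw [mem_closedArc, mem_closedArc, h2, h7]
        grind
    have q1 := ccw_inj_iff' o x o
    have q2 := ccw_inj_iff' o x w'
    have q3 := ccw_inj_iff' o x o'
    have q4 := ccw_inj_iff' o x w
    have q5 := ccw_inj_iff' o y o
    have q6 := ccw_inj_iff' o y w'
    have q7 := ccw_inj_iff' o y o'
    have q8 := ccw_inj_iff' o y w
    rw [Sym2.eq_iff, Sym2.eq_iff] at k7
    rw [ne_eq, ne_eq, ne_eq, ne_eq, ne_eq, ne_eq, ne_eq, ne_eq, q1, q2, q3, q4, q5, q6, q7, q8,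
      h1, h2, h3, hoo] at k7
    clear k4 k2 k3 q1 q2 q3 q4 q5 q6 q7 q8 h1 h2 h3 l1 l2 hxy
    generalize ccw o x = a at *
    generalize ccw o y = b at *
    rcases lt_or_gt_of_ne hxy' with h | h
    · rw [min_eq_left h.le, max_eq_right h.le] at k5 k6
      rw [if_pos h.le] at h4
      grind (splits := 30)
    · rw [min_eq_right h.le, max_eq_left h.le] at k5 k6
      rw [if_neg (not_le.2 h)] at h4
      grind (splits := 30)
  · intro k
    have k1 : chordLength s(x, y) ≤ 1 / 2 - s / 2 := by
      rw [chordLength_mk, h4]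
      clear h4 h1 h2 h3 l1 l2 hxy
      grind (splits := 30)
    have k2 : ¬ Crosses s(x, y) s(o, w') := by
      rw [crosses_coord (o := o) hxy', h2, hoo]
      clear h4 h1 h2 h3 l1 l2 hxy
      grind (splits := 30)
    have k3 : ¬ Crosses s(x, y) s(o', w) := by
      rw [crosses_coord (o := o) hxy', h1, h3]
      clear h4 h1 h2 h3 l1 l2 hxy
      grind (splits := 30)
    refine ⟨k1, k1, k2, k3, fun hb => ?_⟩
    obtain ⟨e1, e2, -, a, b, c, d, hab, hcd, n1, n2, n3, n4, n5⟩ := hb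
    have n6 := n5 x (by simp)
    have n7 := n5 y (by simp)
    clear n5
    rw [Ne, Sym2.eq_iff] at e1 e2
    have h7 : ccw o' w = 1 / 2 + s / 2 := by
      rw [ccw_base o, h1, h3, if_neg (by linarith)]; ring
    have g1 := ccw_base o o' x
    have g2 := ccw_base o o' y
    rw [h3] at g1 g2
    simp only [mem_closedArc] at n1 n2 n3 n4 n6 n7
    have h8 : a = o ∧ b = w' := by
      rcases Sym2.eq_iff.1 hab with ⟨h, h'⟩ | ⟨h, h'⟩
      · exact ⟨h.symm, h'.symm⟩
      · exfalso
        subst h h'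
        have m1 : ccw w' o' = 1 - s / 2 := by
          rw [ccw_base o, h2, h3, if_neg (by linarith)]; ring
        have m2 : ccw w' o = 1 / 2 - s / 2 := by
          rw [ccw_base o, h2, hoo, if_neg (by linarith)]; ring
        rcases Sym2.eq_iff.1 hcd with ⟨h, h'⟩ | ⟨h, h'⟩ <;> subst h h'
        · rw [m1, m2] at n1; linarith
        · rw [m1, m2] at n2; linarith
    obtain ⟨rfl, rfl⟩ := h8
    have h8 : c = o' ∧ d = w := by
      rcases Sym2.eq_iff.1 hcd with ⟨h, h'⟩ | ⟨h, h'⟩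
      · exact ⟨h.symm, h'.symm⟩
      · exfalso
        subst h h'
        have m1 : ccw w a = 1 - s / 2 := by
          rw [ccw_base a, h1, hoo, if_neg (by linarith)]; ring
        have m2 : ccw w o' = 1 / 2 - s / 2 := by
          rw [ccw_base a, h1, h3, if_pos (by linarith)]
        rw [m1, m2] at n3; linarith
    obtain ⟨rfl, rfl⟩ := h8
    rw [h2, h7] at n6 n7
    simp only [ccw_inj_iff' a x, ccw_inj_iff' a y, h1, h2, h3, hoo] at e1 e2
    have hs : ((0 < ccw a x ∧ ccw a x < s / 2) ∨ 1 / 2 < ccw a x ∧ ccw a x < 1 / 2 + s / 2) ∧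
       ((0 < ccw a y ∧ ccw a y < s / 2) ∨ 1 / 2 < ccw a y ∧ ccw a y < 1 / 2 + s / 2) := by
      clear h1 h2 h3 l1 l2 hxy n1 n2 n3 n4 hab hcd k1 k2 k3 h4
      generalize ccw a x = i at *
      generalize ccw a y = j at *
      grind (splits := 30)
    intro z hz
    have hz' : (0 < ccw a z ∧ ccw a z < s / 2) ∨ 1 / 2 < ccw a z ∧ ccw a z < 1 / 2 + s / 2 := by
      rcases Sym2.mem_iff.1 hz with rfl | rfl
      exacts [hs.1, hs.2]
    simp only [Sym2.mem_iff, ccw_inj_iff' a z, h1, h2, h3, hoo]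
    clear * - hz' hpos hlt
    grind

end Leaf

/-! ### Half circles and the lamination generated by a leaf -/

/-- The half-open half circle with symbol `t` that contains its end point but not its initial point,
contrary to `InHalf`. With this choice it contains the closed lobe with symbol `t`, so that the
symbols of a chord determine its pull-backs. -/
def Half (α : Angle) (t : Bool) (x : Angle) : Prop :=
  0 < ccw (sideBase α t) x ∧ ccw (sideBase α t) x ≤ 1 / 2

lemma half_or (α : Angle) (t : Bool) (x : Angle) : Half α t x ∨ Half α (!t) x := by
  have h := ccw_base (sideBase α t) (sideBase α t + oneHalf) x
  rw [ccw_self_add_oneHalf] at h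
  unfold Half
  rw [sideBase_not, h]
  grind [ccw_nonneg, ccw_lt_one]

lemma Half.not {α x : Angle} {t : Bool} (hx : Half α t x) : ¬ Half α (!t) x := by
  have h := ccw_base (sideBase α t) (sideBase α t + oneHalf) x
  rw [ccw_self_add_oneHalf] at h
  unfold Half at *
  rw [sideBase_not, h]
  grind [ccw_nonneg, ccw_lt_one]

lemma Half.unique {α x : Angle} {s t : Bool} (hs : Half α s x) (ht : Half α t x) : s = t := by
  by_contra h
  have : t = !s := by revert h; cases s <;> cases t <;> simp
  subst this
  exact hs.not ht

lemma Half.eq {α x y : Angle} {t : Bool} (hx : Half α t x) (hy : Half α t y)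
    (h : dbl x = dbl y) : x = y := by
  have h1 := ccw_dbl (sideBase α t) x
  have h2 := ccw_dbl (sideBase α t) y
  rw [h] at h1
  unfold Half at *
  apply ccw_inj (a := sideBase α t)
  grind [ccw_nonneg, ccw_lt_one]

lemma exists_half (α : Angle) (t : Bool) (y : Angle) : ∃ x, dbl x = y ∧ Half α t x := by
  have h : dbl (br α t y) = y := dbl_br ..
  rcases half_or α t (br α t y) with h1 | h1
  · exact ⟨_, h, h1⟩
  · refine ⟨br α t y + oneHalf, by rw [dbl_add_oneHalf, h], ?_⟩
    have h2 := inHalf_br α t y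
    unfold InHalf at h2
    unfold Half at *
    have h := ccw_base (sideBase α t) (sideBase α t + oneHalf) (br α t y)
    rw [ccw_self_add_oneHalf] at h
    rw [sideBase_not, h] at h1
    rw [ccw_add_oneHalf]
    grind [ccw_nonneg, ccw_lt_one]

lemma Half.of_mem {α x : Angle} {t : Bool} (h : x ∈ symbolArc α t) : Half α t x :=
  ⟨(mem_symbolArc_iff.1 h).1, (mem_symbolArc_iff.1 h).2.le⟩

/-- Doubling preserves the cyclic order on each half-open half circle. -/
lemma ccw_le_dbl_iff_half {α x y z : Angle} {t : Bool} (hx : Half α t x) (hy : Half α t y)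
    (hz : Half α t z) :
    ccw (dbl x) (dbl y) ≤ ccw (dbl x) (dbl z) ↔ ccw x y ≤ ccw x z := by
  unfold Half at *
  generalize sideBase α t = o at *
  have h1 := ccw_dbl o x
  have h2 := ccw_dbl o y
  have h3 := ccw_dbl o z
  have := ccw_base (dbl o) (dbl x) (dbl y)
  have := ccw_base (dbl o) (dbl x) (dbl z)
  have := ccw_base o x y
  have := ccw_base o x z
  grind

lemma sb_dbl_half {α x y z : Angle} {t : Bool} (hx : Half α t x) (hy : Half α t y)
    (hz : Half α t z) : Sb (dbl x) (dbl y) (dbl z) ↔ Sb x y z := by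
  have h1 := ccw_le_dbl_iff_half hx hz hy
  unfold Sb
  rw [ccw_pos, ccw_pos, ← not_le, h1, not_le]
  refine and_congr_left fun _ => not_congr ⟨fun h => hy.eq hx h, fun h => by rw [h]⟩

lemma ccw_le_iter_iff_half {α x y z : Angle} {n : ℕ} {κ : ℕ → Bool}
    (hx : ∀ i < n, Half α (κ i) (dbl^[i] x)) (hy : ∀ i < n, Half α (κ i) (dbl^[i] y))
    (hz : ∀ i < n, Half α (κ i) (dbl^[i] z)) :
    ccw (dbl^[n] x) (dbl^[n] y) ≤ ccw (dbl^[n] x) (dbl^[n] z) ↔ ccw x y ≤ ccw x z := by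
  induction n with
  | zero => rfl
  | succ n ih =>
    rw [← ih (fun i hi => hx i (by lia)) (fun i hi => hy i (by lia)) (fun i hi => hz i (by lia)),
      Function.iterate_succ_apply', Function.iterate_succ_apply', Function.iterate_succ_apply']
    exact ccw_le_dbl_iff_half (hx n (by lia)) (hy n (by lia)) (hz n (by lia))

lemma eq_of_half {α x y : Angle} {n : ℕ} {κ : ℕ → Bool}
    (hx : ∀ i < n, Half α (κ i) (dbl^[i] x)) (hy : ∀ i < n, Half α (κ i) (dbl^[i] y))
    (h : dbl^[n] x = dbl^[n] y) : x = y := by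
  induction n with
  | zero => exact h
  | succ n ih =>
    apply ih (fun i hi => hx i (by lia)) (fun i hi => hy i (by lia))
    rw [Function.iterate_succ_apply', Function.iterate_succ_apply'] at h
    exact (hx n (by lia)).eq (hy n (by lia)) h

namespace Leaf

variable {m : ℕ} {α γ : Angle} {e : Bool} {κ : ℕ → Bool}

lemma lobe_iff_half (hS : Leaf m α γ e κ) {t : Bool} {x : Angle} :
    Lobe α γ t x ↔ Half α t x ∧ ¬ Sb α (dbl x) γ := by
  rw [hS.lobe_iff]
  have h1 := ccw_dbl (sideBase α t) x
  rw [dbl_sideBase] at h1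
  have := hS.lt
  have := hS.pos
  unfold Half Sb
  rw [h1]
  clear hS h1
  grind [ccw_nonneg, ccw_lt_one]

lemma strip_iff_half (hS : Leaf m α γ e κ) {t : Bool} {x : Angle} :
    Strip α γ t x ↔ Half α t x ∧ Sb α (dbl x) γ := by
  have h1 := ccw_dbl (sideBase α t) x
  rw [dbl_sideBase] at h1
  have := hS.lt
  have := hS.pos
  unfold Half Sb Strip
  rw [h1]
  clear hS h1
  grind [ccw_nonneg, ccw_lt_one]

lemma piece_iff_half (hS : Leaf m α γ e κ) {t : Bool} {x y : Angle} :
    Piece α γ t x y ↔ Half α t x ∧ Half α t y ∧ (Sb α (dbl x) γ ↔ Sb α (dbl y) γ) := by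
  unfold Piece
  rw [hS.lobe_iff_half, hS.lobe_iff_half, hS.strip_iff_half, hS.strip_iff_half]
  tauto

/-- The iterates of a chord that is mapped to `s(α, γ)` are not degenerate, since the iterates of
`s(α, γ)` are not. -/
lemma iterate_ne (hS : Leaf m α γ e κ) {x y : Angle} {N : ℕ}
    (h : s(dbl^[N] x, dbl^[N] y) = s(α, γ)) (i : ℕ) : dbl^[i] x ≠ dbl^[i] y := by
  intro hi
  have h1 : dbl^[i] α = dbl^[i] γ := by
    have : dbl^[i] (dbl^[N] x) = dbl^[i] (dbl^[N] y) := by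
      rw [← Function.iterate_add_apply, ← Function.iterate_add_apply, Nat.add_comm,
        Function.iterate_add_apply, Function.iterate_add_apply, hi]
    rcases Sym2.eq_iff.1 h with ⟨h1, h2⟩ | ⟨h1, h2⟩
    · rwa [h1, h2] at this
    · rw [h1, h2] at this; exact this.symm
  have := hS.one_lt
  exact hS.ne (iter_injOn (p := m) (by lia) (hS.iterate_eq (Or.inl rfl))
    (hS.iterate_eq (Or.inr rfl)) h1)

/-- Chords of the lamination are characterized by the pieces in which their iterates lie. -/
lemma mem_genLam (hS : Leaf m α γ e κ) {x y : Angle} : s(x, y) ∈ genLam m s(α, γ) ↔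
    (∃ N, s(dbl^[N] x, dbl^[N] y) = s(α, γ)) ∧
      ∀ i, ∃ t, Piece α γ t (dbl^[i] x) (dbl^[i] y) := by
  unfold genLam
  simp only [Set.mem_ofPred_eq, dblC_iter]
  refine and_congr_right fun ⟨N, hN⟩ => forall_congr' fun i => ?_
  exact hS.piece_iff (hS.iterate_ne hN i)

/-- It suffices to check the iterates before the chord is mapped to `s(α, γ)`. -/
lemma mem_genLam_of (hS : Leaf m α γ e κ) {x y : Angle} {N : ℕ}
    (hN : s(dbl^[N] x, dbl^[N] y) = s(α, γ))
    (h : ∀ i < N, ∃ t, Piece α γ t (dbl^[i] x) (dbl^[i] y)) : s(x, y) ∈ genLam m s(α, γ) := by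
  refine hS.mem_genLam.2 ⟨⟨N, hN⟩, fun i => ?_⟩
  by_cases hi : i < N
  · exact h i hi
  · obtain ⟨k, rfl⟩ := Nat.exists_eq_add_of_le (not_lt.1 hi)
    refine ⟨κ k, Or.inl ?_⟩
    rw [Nat.add_comm, Function.iterate_add_apply, Function.iterate_add_apply]
    rcases Sym2.eq_iff.1 hN with ⟨h1, h2⟩ | ⟨h1, h2⟩ <;> rw [h1, h2]
    · exact ⟨hS.lobe_iterate (Or.inl rfl) k, hS.lobe_iterate (Or.inr rfl) k⟩
    · exact ⟨hS.lobe_iterate (Or.inr rfl) k, hS.lobe_iterate (Or.inl rfl) k⟩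

lemma self_mem_genLam (hS : Leaf m α γ e κ) : s(α, γ) ∈ genLam m s(α, γ) :=
  hS.mem_genLam_of (N := 0) rfl (by simp)

lemma genLam_iterate (hS : Leaf m α γ e κ) {x y : Angle} (h : s(x, y) ∈ genLam m s(α, γ)) (i : ℕ) :
    s(dbl^[i] x, dbl^[i] y) ∈ genLam m s(α, γ) := by
  rw [hS.mem_genLam] at *
  obtain ⟨⟨N, hN⟩, h⟩ := h
  refine ⟨⟨N + i * (m - 1), ?_⟩, fun j => ?_⟩
  · have hm := hS.one_lt
    have e1 : ∀ z, dbl^[N + i * (m - 1)] (dbl^[i] z) = dbl^[i * m] (dbl^[N] z) := by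
      intro z
      rw [← Function.iterate_add_apply, ← Function.iterate_add_apply]
      congr 1
      obtain ⟨k, rfl⟩ : ∃ k, m = k + 1 := ⟨m - 1, by lia⟩
      rw [Nat.add_sub_cancel]; ring
    have e2 : ∀ z, z = α ∨ z = γ → dbl^[i * m] z = z := by
      intro z hz
      exact ((show Function.IsPeriodicPt dbl m z from hS.iterate_eq hz).const_mul i).eq
    rw [e1, e1]
    rcases Sym2.eq_iff.1 hN with ⟨h1, h2⟩ | ⟨h1, h2⟩ <;> rw [h1, h2, e2 _ (by simp), e2 _ (by simp)]
    exact Sym2.eq_swap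
  · rw [← Function.iterate_add_apply, ← Function.iterate_add_apply]
    exact h _

/-- A chord with ends on different sides of a chord in a lobe lies in the same lobe. -/
lemma lobe_of_separated (hS : Leaf m α γ e κ) {s t : Bool} {a c x y : Angle} (ha : Lobe α γ s a)
    (hc : Lobe α γ s c) (h : Piece α γ t x y) (h1 : Sb a x c) (h2 : ¬ Sb a y c) :
    Lobe α γ s x ∧ Lobe α γ s y := by
  rw [hS.lobe_iff] at ha hc
  rw [hS.lobe_iff, hS.lobe_iff]
  have hp : Piece α γ s x y ∨ Piece α γ (!s) x y := by
    by_cases hst : t = s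
    · exact Or.inl (hst ▸ h)
    · have : t = !s := by revert hst; cases s <;> cases t <;> simp
      exact Or.inr (this ▸ h)
  rw [Piece, Piece, hS.lobe_iff, hS.lobe_iff, hS.lobe_not_iff, hS.lobe_not_iff,
    hS.strip_not_iff, hS.strip_not_iff, Strip, Strip] at hp
  unfold Sb at h1 h2
  rw [ccw_base (sideBase α s) a x, ccw_base (sideBase α s) a c] at h1
  rw [ccw_base (sideBase α s) a y, ccw_base (sideBase α s) a c] at h2
  have hlt := hS.lt
  have hpos := hS.pos
  clear hS h
  generalize ccw α γ = l at *
  generalize sideBase α s = o at *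
  have := ccw_nonneg o x
  have := ccw_nonneg o y
  have := ccw_lt_one o x
  have := ccw_lt_one o y
  generalize ccw o a = a at *
  generalize ccw o c = c at *
  generalize ccw o x = x at *
  generalize ccw o y = y at *
  grind (splits := 30)

/-- No chord in a piece crosses the iterate of order `m - 1` of `s(α, γ)`. -/
lemma not_piece_of_sb_dot (hS : Leaf m α γ e κ) {t : Bool} {x y : Angle} (h : Piece α γ t x y)
    (h1 : Sb (sideBase α e) x (sideBase γ (!e))) (h2 : ¬ Sb (sideBase α e) y (sideBase γ (!e))) :
    False := by
  have hp : Piece α γ e x y ∨ Piece α γ (!e) x y := by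
    by_cases hst : t = e
    · exact Or.inl (hst ▸ h)
    · have : t = !e := by revert hst; cases e <;> cases t <;> simp
      exact Or.inr (this ▸ h)
  rw [Piece, Piece, hS.lobe_iff, hS.lobe_iff, hS.lobe_not_iff, hS.lobe_not_iff,
    hS.strip_not_iff, hS.strip_not_iff, Strip, Strip] at hp
  unfold Sb at h1 h2
  rw [hS.ccw_sideBase_not] at h1 h2
  have hlt := hS.lt
  have hpos := hS.pos
  clear hS h
  generalize ccw α γ = l at *
  generalize sideBase α e = o at *
  have := ccw_nonneg o x
  have := ccw_nonneg o y
  have := ccw_lt_one o x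
  have := ccw_lt_one o y
  generalize ccw o x = x at *
  generalize ccw o y = y at *
  grind (splits := 30)

/-- The two ends of a chord of the lamination lie on the same side of `s(α, γ)`. -/
lemma sb_iff_of_mem (hS : Leaf m α γ e κ) {x y : Angle} (h : s(x, y) ∈ genLam m s(α, γ)) :
    Sb α x γ ↔ Sb α y γ := by
  have key : ∀ x y : Angle, s(x, y) ∈ genLam m s(α, γ) → Sb α x γ → ¬ Sb α y γ → False := by
    intro x y h h1 h2
    have h3 := (hS.mem_genLam.1 h).2
    have : ∀ i ≤ m - 1, Sb (dbl^[i] α) (dbl^[i] x) (dbl^[i] γ) ∧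
        ¬ Sb (dbl^[i] α) (dbl^[i] y) (dbl^[i] γ) := by
      intro i
      induction i with
      | zero => exact fun _ => ⟨h1, h2⟩
      | succ i ih =>
        intro hi
        obtain ⟨k1, k2⟩ := ih (by lia)
        obtain ⟨t, ht⟩ := h3 i
        have l1 := hS.lobe_iterate (Or.inl rfl) i
        have l2 := hS.lobe_iterate (Or.inr rfl) i
        obtain ⟨l3, l4⟩ := hS.lobe_of_separated l1 l2 ht k1 k2
        simp only [Function.iterate_succ_apply']
        rw [hS.lobe_iff_half] at l1 l2 l3 l4
        rw [sb_dbl_half l1.1 l3.1 l2.1, sb_dbl_half l1.1 l4.1 l2.1]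
        exact ⟨k1, k2⟩
    obtain ⟨k1, k2⟩ := this (m - 1) le_rfl
    obtain ⟨t, ht⟩ := h3 (m - 1)
    rw [hS.pred_left, hS.pred_right] at k1 k2
    exact hS.not_piece_of_sb_dot ht k1 k2
  by_cases hx : Sb α x γ <;> by_cases hy : Sb α y γ
  · exact iff_of_true hx hy
  · exact (key x y h hx hy).elim
  · exact (key y x (by rw [Sym2.eq_swap (a := y)]; exact h) hy hx).elim
  · exact iff_of_false hx hy

end Leaf

/-! ### The branches of the lamination -/

namespace Leaf

variable {m : ℕ} {α γ : Angle} {e : Bool} {κ : ℕ → Bool}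

lemma mem_sideArc_iff (hS : Leaf m α γ e κ) {t : Bool} {y : Angle} :
    y ∈ sideArc s(α, γ) t ↔ y ∈ symbolArc α t := by
  have := hS.rep_lt
  constructor
  · rintro ⟨a, b, h, hab, hy⟩
    rcases Sym2.eq_iff.1 h with ⟨rfl, rfl⟩ | ⟨rfl, rfl⟩
    · exact hy
    · linarith
  · exact fun h => ⟨α, γ, rfl, this.le, h⟩

lemma exists_piece (hS : Leaf m α γ e κ) {x y : Angle} (h : s(x, y) ∈ genLam m s(α, γ)) :
    ∃ t, Piece α γ t x y := (hS.mem_genLam.1 h).2 0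

lemma ne_of_mem (hS : Leaf m α γ e κ) {x y : Angle} (h : s(x, y) ∈ genLam m s(α, γ)) : x ≠ y := by
  obtain ⟨N, hN⟩ := (hS.mem_genLam.1 h).1
  exact hS.iterate_ne hN 0

lemma exists_mem_sideArc_iff (hS : Leaf m α γ e κ) {t : Bool} {x y : Angle}
    (h : s(x, y) ∈ genLam m s(α, γ)) :
    (∃ z ∈ s(x, y), z ∈ sideArc s(α, γ) t) ↔ Half α t x ∧ Half α t y := by
  obtain ⟨t', ht⟩ := hS.exists_piece h
  rw [hS.piece_iff_half] at ht
  constructor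
  · rintro ⟨z, hz, hz'⟩
    rw [hS.mem_sideArc_iff] at hz'
    have hz' := Half.of_mem hz'
    have : t' = t := by
      rcases Sym2.mem_iff.1 hz with rfl | rfl
      exacts [ht.1.unique hz', ht.2.1.unique hz']
    exact this ▸ ⟨ht.1, ht.2.1⟩
  · rintro ⟨hx, hy⟩
    by_contra hcon
    push Not at hcon
    have h1 := hcon x (by simp)
    have h2 := hcon y (by simp)
    rw [hS.mem_sideArc_iff, mem_symbolArc_iff] at h1 h2
    apply hS.ne_of_mem h
    apply ccw_inj (a := sideBase α t)
    unfold Half at hx hy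
    grind

/-- The word of a branch lists the half circles in which the iterates of the chord lie. Both ends
may be required to lie there, because chords of the lamination lie in one piece. -/
lemma isL_iff (hS : Leaf m α γ e κ) {w : List Bool} {R R' : Chord} (hR : R ∈ genLam m s(α, γ)) :
    IsL m s(α, γ) w R R' ↔ dblC^[w.length] R' = R ∧ R' ∈ genLam m s(α, γ) ∧
      ∀ i t, w[i]? = some t → ∀ z ∈ dblC^[i] R', Half α t z := by
  induction w generalizing R' with
  | nil =>
    simp only [IsL, List.length_nil, Function.iterate_zero_apply]
    exact ⟨fun h => ⟨h, h ▸ hR, by simp⟩, fun h => h.1⟩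
  | cons s w ih =>
    simp only [IsL, List.length_cons, Function.iterate_succ_apply]
    constructor
    · rintro ⟨R₁, h1, h2, rfl, h3⟩
      obtain ⟨k1, k2, k3⟩ := ih.1 h1
      refine ⟨k1, h2, ?_⟩
      induction R' using Sym2.ind with | _ x y
      rw [hS.exists_mem_sideArc_iff h2] at h3
      rintro (_ | i) t ht
      · simp only [List.getElem?_cons_zero, Option.some.injEq] at ht
        subst ht
        intro z hz
        rcases Sym2.mem_iff.1 hz with rfl | rfl
        exacts [h3.1, h3.2]
      · rw [List.getElem?_cons_succ] at ht
        exact k3 i t ht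
    · rintro ⟨h1, h2, h3⟩
      refine ⟨dblC R', ih.2 ⟨h1, ?_, fun i t ht => ?_⟩, h2, rfl, ?_⟩
      · induction R' using Sym2.ind with | _ x y
        exact hS.genLam_iterate h2 1
      · exact h3 (i + 1) t (by simpa using ht)
      · induction R' using Sym2.ind with | _ x y
        rw [hS.exists_mem_sideArc_iff h2]
        have := h3 0 s (by simp)
        exact ⟨this x (by simp), this y (by simp)⟩

lemma half_iterate (hS : Leaf m α γ e κ) {x : Angle} (hx : x = α ∨ x = γ) (i : ℕ) :
    Half α (κ i) (dbl^[i] x) := (hS.lobe_iff_half.1 (hS.lobe_iterate hx i)).1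

lemma isWordV_iff (hS : Leaf m α γ e κ) {v : List Bool} :
    IsWordV m s(α, γ) v ↔ v.length = m - 1 ∧ ∀ i < m - 1, v[i]? = some (κ i) := by
  have hd : dotLeaf m s(α, γ) ∈ genLam m s(α, γ) := by
    rw [dotLeaf, dblC_iter]; exact hS.genLam_iterate hS.self_mem_genLam _
  rw [IsWordV, hS.isL_iff hd]
  refine and_congr_right fun hl => ⟨fun h i hi => ?_, fun h => ⟨by rw [hl]; rfl, hS.self_mem_genLam, fun i t ht => ?_⟩⟩
  · have h1 : v[i]? = some v[i] := List.getElem?_eq_getElem (by lia)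
    have h2 := h.2.2 i _ h1 (dbl^[i] α) (by rw [dblC_iter]; simp)
    rw [h1, h2.unique (hS.half_iterate (Or.inl rfl) i)]
  · obtain ⟨hi, -⟩ := List.getElem?_eq_some_iff.1 ht
    rw [h i (by lia)] at ht
    have ht : κ i = t := by simpa using ht
    rw [dblC_iter, ← ht]
    intro z hz
    rcases Sym2.mem_iff.1 hz with rfl | rfl
    exacts [hS.half_iterate (Or.inl rfl) i, hS.half_iterate (Or.inr rfl) i]

lemma half_sideBase_right (hS : Leaf m α γ e κ) (t : Bool) : Half α t (sideBase γ t) := by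
  have := hS.lt
  have := hS.pos
  rw [Half, hS.ccw_sideBase]
  constructor <;> linarith

lemma half_sideBase_left (α : Angle) (t : Bool) : Half α (!t) (sideBase α t) := by
  rw [Half]
  nth_rw 2 4 [← Bool.not_not t]
  rw [sideBase_not α (!t), ccw_self_add_oneHalf]
  norm_num

lemma eq_of_isSymbolE (hS : Leaf m α γ e κ) {e' : Bool} (h : IsSymbolE m s(α, γ) e') : e' = e := by
  have h1 := ((hS.isL_iff hS.self_mem_genLam).1 h).2.2 0 e' (by simp) (sideBase γ e)
    (by rw [hS.ddotLeaf_eq]; simp)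
  exact h1.unique (hS.half_sideBase_right e)

/-- Chords that cross each other do so after doubling. -/
lemma crosses_dbl_of_closedPiece (hS : Leaf m α γ e κ) {s t : Bool} {x y z w : Angle}
    (h1 : ClosedPiece α γ s x y) (h2 : ClosedPiece α γ t z w) (h : Crosses s(x, y) s(z, w)) :
    Crosses s(dbl x, dbl y) s(dbl z, dbl w) := by
  have hxy : ccw (sideBase α s) x ≠ ccw (sideBase α s) y := by
    intro h'
    rw [ccw_inj h', crosses_mk] at h
    unfold Sb at h
    rw [ccw_self] at h
    grind [ccw_nonneg]
  have hc := (crosses_coord (o := sideBase α s) hxy).1 h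
  have hp : ClosedPiece α γ s z w ∨ ClosedPiece α γ (!s) z w := by
    by_cases hst : t = s
    · exact Or.inl (hst ▸ h2)
    · have : t = !s := by revert hst; cases s <;> cases t <;> simp
      exact Or.inr (this ▸ h2)
  -- Crossing chords lie in the same closed piece, which is shorter than a half circle.
  have hall : (∀ p, p = x ∨ p = y ∨ p = z ∨ p = w → ccw (sideBase γ s) p < 1 / 2) ∨
      (∀ p, p = x ∨ p = y ∨ p = z ∨ p = w → ccw (sideBase α s) p < 1 / 2) := by
    have hlt := hS.lt
    have hpos := hS.pos
    have : (Lobe α γ s x ∧ Lobe α γ s y ∧ Lobe α γ s z ∧ Lobe α γ s w) ∨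
        (ClosedStrip α γ s x ∧ ClosedStrip α γ s y ∧ ClosedStrip α γ s z ∧
          ClosedStrip α γ s w) := by
      rw [ClosedPiece, ClosedPiece, hS.lobe_iff, hS.lobe_iff, hS.lobe_not_iff, hS.lobe_not_iff,
        hS.closedStrip_not_iff, hS.closedStrip_not_iff, ClosedStrip, ClosedStrip] at hp
      rw [ClosedPiece, hS.lobe_iff, hS.lobe_iff, ClosedStrip, ClosedStrip] at h1
      rw [hS.lobe_iff, hS.lobe_iff, hS.lobe_iff, hS.lobe_iff, ClosedStrip, ClosedStrip,
        ClosedStrip, ClosedStrip]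
      clear hS h h2
      generalize ccw α γ = l at *
      generalize sideBase α s = o at *
      have := ccw_nonneg o x
      have := ccw_nonneg o y
      have := ccw_nonneg o z
      have := ccw_nonneg o w
      have := ccw_lt_one o x
      have := ccw_lt_one o y
      generalize ccw o z = z at *
      generalize ccw o w = w at *
      generalize ccw o x = x at *
      generalize ccw o y = y at *
      rcases lt_or_gt_of_ne hxy with h | h
      · rw [min_eq_left h.le, max_eq_right h.le] at hc
        grind (splits := 30)
      · rw [min_eq_right h.le, max_eq_left h.le] at hc
        grind (splits := 30)
    refine this.imp (fun h p hp => ?_) (fun h p hp => ?_)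
    · have : Lobe α γ s p := by rcases hp with rfl | rfl | rfl | rfl <;> tauto
      unfold Lobe at this; linarith
    · have : ClosedStrip α γ s p := by rcases hp with rfl | rfl | rfl | rfl <;> tauto
      unfold ClosedStrip at this; linarith
  have sb : ∀ p q r, (p = x ∨ p = y ∨ p = z ∨ p = w) → (q = x ∨ q = y ∨ q = z ∨ q = w) →
      (r = x ∨ r = y ∨ r = z ∨ r = w) → (Sb (dbl p) (dbl q) (dbl r) ↔ Sb p q r) := by
    intro p q r hp hq hr
    rcases hall with h | h
    · exact sb_dbl_iff (h p hp) (h q hq) (h r hr)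
    · exact sb_dbl_iff (h p hp) (h q hq) (h r hr)
  rw [crosses_mk] at h ⊢
  rwa [sb _ _ _ (by simp) (by simp) (by simp), sb _ _ _ (by simp) (by simp) (by simp),
    sb _ _ _ (by simp) (by simp) (by simp), sb _ _ _ (by simp) (by simp) (by simp)]

/-- No chord in a closed piece crosses the iterate of order `m - 1` of `s(α, γ)`. -/
lemma not_crosses_dot (hS : Leaf m α γ e κ) {t : Bool} {x y : Angle}
    (h : ClosedPiece α γ t x y) : ¬ Crosses s(x, y) s(sideBase α e, sideBase γ (!e)) := by
  intro hc
  have hxy : ccw (sideBase α e) x ≠ ccw (sideBase α e) y := by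
    intro h'
    rw [ccw_inj h', crosses_mk] at hc
    unfold Sb at hc
    rw [ccw_self] at hc
    grind [ccw_nonneg]
  rw [crosses_coord (o := sideBase α e) hxy, hS.ccw_sideBase_not, ccw_self] at hc
  have hp : ClosedPiece α γ e x y ∨ ClosedPiece α γ (!e) x y := by
    by_cases hst : t = e
    · exact Or.inl (hst ▸ h)
    · have : t = !e := by revert hst; cases e <;> cases t <;> simp
      exact Or.inr (this ▸ h)
  rw [ClosedPiece, ClosedPiece, hS.lobe_iff, hS.lobe_iff, hS.lobe_not_iff, hS.lobe_not_iff,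
    hS.closedStrip_not_iff, hS.closedStrip_not_iff, ClosedStrip, ClosedStrip] at hp
  have hlt := hS.lt
  have hpos := hS.pos
  clear hS h
  generalize ccw α γ = l at *
  generalize sideBase α e = o at *
  have := ccw_nonneg o x
  have := ccw_nonneg o y
  have := ccw_lt_one o x
  have := ccw_lt_one o y
  generalize ccw o x = x at *
  generalize ccw o y = y at *
  grind (splits := 30)

/-- A chord of the closed lamination crosses no chord of the lamination. -/
lemma not_crosses_of_mem (hS : Leaf m α γ e κ) {x y z w : Angle}
    (h : ∀ i, ∃ t, ClosedPiece α γ t (dbl^[i] x) (dbl^[i] y)) (hz : s(z, w) ∈ genLam m s(α, γ)) :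
    ¬ Crosses s(x, y) s(z, w) := by
  intro hc
  obtain ⟨⟨N, hN⟩, h2⟩ := hS.mem_genLam.1 hz
  have key : ∀ i, Crosses s(dbl^[i] x, dbl^[i] y) s(dbl^[i] z, dbl^[i] w) := by
    intro i
    induction i with
    | zero => exact hc
    | succ i ih =>
      obtain ⟨t, ht⟩ := h i
      obtain ⟨t', ht'⟩ := h2 i
      simp only [Function.iterate_succ_apply']
      exact hS.crosses_dbl_of_closedPiece ht ht'.closed ih
  have h3 := key (m - 1 + N)
  rw [← dblC_iter _ z, Function.iterate_add_apply dblC, dblC_iter N, hN, dblC_iter, hS.pred_left,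
    hS.pred_right] at h3
  obtain ⟨t, ht⟩ := h (m - 1 + N)
  exact hS.not_crosses_dot ht h3

end Leaf

/-! ### Leaves of the closed lamination -/

/-- The points `z₁`, `y₁`, `y₂`, `z₂`, `x₂` follow each other counter-clockwise, starting from
`x₁`, and `y₁ ≠ y₂`: the chord `s(z₁, z₂)` runs between the nested chords `s(x₁, x₂)` and
`s(y₁, y₂)`. -/
def Chain (x₁ z₁ y₁ y₂ z₂ x₂ : Angle) : Prop :=
  ccw x₁ z₁ ≤ ccw x₁ y₁ ∧ ccw x₁ y₁ < ccw x₁ y₂ ∧ ccw x₁ y₂ ≤ ccw x₁ z₂ ∧ ccw x₁ z₂ ≤ ccw x₁ x₂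

/-- The four points lie in the closure of one of the pieces with symbol `s`; in the case of a strip,
`x₁` comes before `x₂`, and these points are not mapped to the ends of `s(α, γ)`. -/
def Together (α γ : Angle) (s : Bool) (x₁ x₂ y₁ y₂ : Angle) : Prop :=
  (Lobe α γ s x₁ ∧ Lobe α γ s x₂ ∧ Lobe α γ s y₁ ∧ Lobe α γ s y₂) ∨
  ((ClosedStrip α γ s x₁ ∧ ClosedStrip α γ s x₂ ∧ ClosedStrip α γ s y₁ ∧ ClosedStrip α γ s y₂) ∧
    ccw (sideBase α s) x₁ ≤ ccw (sideBase α s) x₂ ∧ s(dbl x₁, dbl x₂) ≠ s(α, γ))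

namespace Leaf

variable {m : ℕ} {α γ : Angle} {e : Bool} {κ : ℕ → Bool}

/-- Every chord of the closed lamination is a limit of chords of the lamination, and not degenerate. -/
lemma exists_seq_of_mem_entireLam (hS : Leaf m α γ e κ) {x y : Angle}
    (h : s(x, y) ∈ entireLam m s(α, γ)) : x ≠ y ∧ ∃ u : ℕ → Angle × Angle,
      (∀ n, s((u n).1, (u n).2) ∈ genLam m s(α, γ)) ∧ Tendsto u atTop (𝓝 (x, y)) := by
  rcases h with h | ⟨u, c, d, hcd, hne, h1, -, h2⟩
  · exact ⟨hS.ne_of_mem h, fun _ => (x, y), fun _ => h, tendsto_const_nhds⟩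
  · rcases Sym2.eq_iff.1 hcd with ⟨rfl, rfl⟩ | ⟨rfl, rfl⟩
    · exact ⟨hne, u, h1, h2⟩
    · refine ⟨hne.symm, fun n => (u n).swap, fun n => ?_, ?_⟩
      · show s((u n).2, (u n).1) ∈ _
        rw [Sym2.eq_swap (a := (u n).2)]; exact h1 n
      · exact (continuous_swap.tendsto _).comp h2

lemma isClosed_lobe (hS : Leaf m α γ e κ) (t : Bool) : IsClosed {x | Lobe α γ t x} :=
  isClosed_arc _ (by linarith [hS.pos])

lemma isClosed_closedStrip (hS : Leaf m α γ e κ) (t : Bool) : IsClosed {x | ClosedStrip α γ t x} :=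
  isClosed_arc _ (by linarith [hS.lt])

/-- The iterates of a chord of the closed lamination lie in closed pieces, by a passage to the
limit. -/
lemma closedPiece_of_mem_entireLam (hS : Leaf m α γ e κ) {x y : Angle}
    (h : s(x, y) ∈ entireLam m s(α, γ)) (i : ℕ) :
    ∃ t, ClosedPiece α γ t (dbl^[i] x) (dbl^[i] y) := by
  obtain ⟨-, u, h1, h2⟩ := hS.exists_seq_of_mem_entireLam h
  have hcl : IsClosed {p : Angle × Angle | ∃ t, ClosedPiece α γ t p.1 p.2} := by
    have : {p : Angle × Angle | ∃ t, ClosedPiece α γ t p.1 p.2} = ⋃ t : Bool,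
        ({x | Lobe α γ t x} ×ˢ {x | Lobe α γ t x} ∪
          {x | ClosedStrip α γ t x} ×ˢ {x | ClosedStrip α γ t x}) := by
      ext p
      simp [ClosedPiece]
    rw [this]
    exact isClosed_iUnion_of_finite fun t => ((hS.isClosed_lobe t).prod (hS.isClosed_lobe t)).union
      ((hS.isClosed_closedStrip t).prod (hS.isClosed_closedStrip t))
  have hf : Continuous fun p : Angle × Angle => (dbl^[i] p.1, dbl^[i] p.2) := by
    have := continuous_dbl.iterate i
    fun_prop
  refine hcl.mem_of_tendsto ((hf.tendsto _).comp h2) (Eventually.of_forall fun n => ?_)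
  obtain ⟨t, ht⟩ := (hS.mem_genLam.1 (h1 n)).2 i
  exact ⟨t, ht.closed⟩

/-- The other two chords that are mapped to `s(α, γ)` are not limits of the lamination. -/
lemma not_strip_of_mem_entireLam (hS : Leaf m α γ e κ) {x y : Angle} {N : ℕ} {t : Bool}
    (h : s(x, y) ∈ entireLam m s(α, γ)) (hx : dbl^[N] x = sideBase α t)
    (hy : dbl^[N] y = sideBase γ t) : False := by
  obtain ⟨-, u, h1, h2⟩ := hS.exists_seq_of_mem_entireLam h
  have hlt := hS.lt
  have hpos := hS.pos
  have hm := hS.one_lt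
  set l := ccw α γ with hl
  have hM : (1 : ℝ) ≤ 2 ^ m := one_le_pow₀ (by norm_num)
  obtain ⟨c, hc⟩ : ∃ c, c = l / (4 * 2 ^ m) := ⟨_, rfl⟩
  have hc2 : 2 ^ m * c = l / 4 := by rw [hc]; field_simp
  have hc0 : 0 < c := by rw [hc]; positivity
  have hcl : c ≤ l / 4 := by nlinarith only [hc2, hM, hc0]
  have hto : ccw (sideBase α t) (sideBase γ t) = l / 2 := hS.ccw_sideBase t
  have tx : Tendsto (fun n => dbl^[N] (u n).1) atTop (𝓝 (sideBase α t)) := by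
    rw [← hx]
    exact (((continuous_dbl.iterate N).comp continuous_fst).tendsto _).comp h2
  have ty : Tendsto (fun n => dbl^[N] (u n).2) atTop (𝓝 (sideBase γ t)) := by
    rw [← hy]
    exact (((continuous_dbl.iterate N).comp continuous_snd).tendsto _).comp h2
  have ev : ∀ (z : Angle) (v : ℕ → Angle), Tendsto v atTop (𝓝 z) → ∀ (o : Angle) (r : ℝ), r < 1 →
      r < ccw o z → ∀ᶠ n in atTop, r < ccw o (v n) := by
    intro z v hv o r hr hz
    have := (isClosed_arc o hr).isOpen_compl.mem_nhds (show z ∈ {x | ccw o x ≤ r}ᶜ by simpa using hz)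
    filter_upwards [hv this] with n hn
    simpa using hn
  have b1 := ccw_base (sideBase α t) (sideBase α t + (c : Angle)) (sideBase α t)
  rw [ccw_add_of_lt _ hc0.le (by linarith), ccw_self, if_neg (by linarith)] at b1
  have b2 := ccw_base (sideBase α t) (sideBase α (!t)) (sideBase α t)
  rw [sideBase_not, ccw_self_add_oneHalf, ccw_self, if_neg (by linarith)] at b2
  have b3 := ccw_base (sideBase α t) (sideBase α (!t)) (sideBase γ t)
  rw [sideBase_not, ccw_self_add_oneHalf, hto, if_neg (by linarith)] at b3
  have b4 := ccw_base (sideBase α t) (sideBase γ t) (sideBase α t)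
  rw [hto, ccw_self, if_neg (by linarith)] at b4
  have b5 := ccw_base (sideBase α t) (sideBase γ (!t)) (sideBase γ t)
  rw [hS.ccw_sideBase_not, hto, if_neg (by linarith)] at b5
  have ex := ((ev _ _ tx (sideBase α t + (c : Angle)) (l / 2 - c) (by linarith) (by linarith)).and
    ((ev _ _ tx (sideBase α t + oneHalf) (l / 2) (by linarith) (by linarith)).and
    (ev _ _ tx (sideBase γ t) (1 / 2 - l / 2) (by linarith) (by linarith)))).and
    ((ev _ _ ty (sideBase α t) (l / 2 - c) (by linarith) (by linarith)).and
    ((ev _ _ ty (sideBase α t + oneHalf) (l / 2) (by linarith) (by linarith)).and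
    (ev _ _ ty (sideBase γ (!t)) (1 / 2 - l / 2) (by linarith) (by linarith))))
  obtain ⟨n, ⟨k1, k2, k3⟩, k4, k5, k6⟩ := ex.exists
  have hp := (hS.mem_genLam.1 (h1 n)).2
  generalize (u n).1 = X at *
  generalize (u n).2 = Y at *
  -- The approximating chord has its ends in a strip, close to the ends of the strip. After `m` more
  -- iterates, the ends are inside the two different strips.
  have hst : Strip α γ t (dbl^[N] X) ∧ Strip α γ t (dbl^[N] Y) := by
    obtain ⟨s, hs⟩ := hp N
    by_cases hst : s = t
    · subst hst
      rcases hs with hs | hs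
      · have := hs.1
        unfold Lobe at this
        linarith
      · exact hs
    · have : s = !t := by revert hst; cases s <;> cases t <;> simp
      subst this
      rcases hs with hs | hs
      · have := hs.2
        unfold Lobe at this
        linarith
      · have := hs.1.2
        rw [sideBase_not] at this
        linarith
  obtain ⟨⟨p1, p2⟩, p3, p4⟩ := hst
  have q1 : ccw (sideBase α t) (dbl^[N] X) < c := by
    have := ccw_base (sideBase α t) (sideBase α t + (c : Angle)) (dbl^[N] X)
    rw [ccw_add_of_lt _ hc0.le (by linarith)] at this
    by_contra hcon
    rw [if_pos (by linarith)] at this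
    linarith
  have q2 : ccw (dbl^[N] Y) (sideBase γ t) = l / 2 - ccw (sideBase α t) (dbl^[N] Y) := by
    rw [ccw_base (sideBase α t), hto, if_pos (by linarith)]
  have q3 : 0 < ccw (dbl^[N] Y) (sideBase γ t) := by linarith
  have d1 : ∀ β : Angle, dbl^[m] (sideBase β t) = dbl^[m - 1] β := by
    intro β
    obtain ⟨k, rfl⟩ : ∃ k, m = k + 1 := ⟨m - 1, by lia⟩
    rw [Function.iterate_succ_apply, dbl_sideBase, Nat.add_sub_cancel]
  have hM0 : (0 : ℝ) < 2 ^ m := by positivity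
  have q4 := mul_lt_mul_of_pos_left q1 hM0
  have q5 := mul_lt_mul_of_pos_left (show ccw (dbl^[N] Y) (sideBase γ t) < c by linarith) hM0
  have q6 := mul_pos hM0 p1
  have q7 := mul_pos hM0 q3
  rw [hc2] at q4 q5
  have r1 := ccw_iter_of_lt (n := m) (x := sideBase α t) (y := dbl^[N] X) (by linarith)
  have r2 := ccw_iter_of_lt (n := m) (x := dbl^[N] Y) (y := sideBase γ t) (by linarith)
  rw [d1, ← Function.iterate_add_apply, hS.pred_left] at r1
  rw [d1, ← Function.iterate_add_apply, hS.pred_right] at r2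
  have u1 : Strip α γ e (dbl^[m + N] X) := by
    unfold Strip
    rw [r1]
    exact ⟨q6, by linarith⟩
  have u2 : Strip α γ (!e) (dbl^[m + N] Y) := by
    rw [hS.strip_not_iff]
    have h3 := hS.ccw_sideBase_not e
    have h4 := ccw_base (sideBase α e) (dbl^[m + N] Y) (sideBase γ (!e))
    have h5 : 0 < ccw (dbl^[m + N] Y) (sideBase γ !e) := by rw [r2]; exact q7
    have h6 : ccw (dbl^[m + N] Y) (sideBase γ !e) < l / 4 := by rw [r2]; exact q5
    rw [h3] at h4
    clear * - h4 h5 h6 hlt hpos hl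
    grind [ccw_nonneg, ccw_lt_one]
  obtain ⟨s, hs⟩ := hp (m + N)
  rw [hS.piece_iff_half] at hs
  rw [hS.strip_iff_half] at u1 u2
  have := (hs.1.unique u1.1).symm.trans (hs.2.1.unique u2.1)
  revert this; cases e <;> simp

/-- A chord between the images of two nested chords lifts to a chord between them, if the nested
chords lie in the same piece. -/
lemma exists_lift_between (hS : Leaf m α γ e κ) {s : Bool} {x₁ x₂ y₁ y₂ z₁ z₂ : Angle}
    (hz : s(z₁, z₂) ∈ genLam m s(α, γ)) (hL : Together α γ s x₁ x₂ y₁ y₂)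
    (hc : Chain (dbl x₁) z₁ (dbl y₁) (dbl y₂) z₂ (dbl x₂)) :
    ∃ w₁ w₂, dbl w₁ = z₁ ∧ dbl w₂ = z₂ ∧ Piece α γ s w₁ w₂ ∧ Chain x₁ w₁ y₁ y₂ w₂ x₂ := by
  have hsb := hS.sb_iff_of_mem hz
  obtain ⟨w₁, rfl, g1⟩ := exists_half α s z₁
  obtain ⟨w₂, rfl, g2⟩ := exists_half α s z₂
  refine ⟨w₁, w₂, rfl, rfl, hS.piece_iff_half.2 ⟨g1, g2, hsb⟩, ?_⟩
  unfold Chain at *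
  rcases hL with ⟨l1, l2, l3, l4⟩ | ⟨⟨l1, l2, l3, l4⟩, l5, l6⟩
  · rw [hS.lobe_iff_half] at l1 l2 l3 l4
    rwa [← ccw_le_dbl_iff_half l1.1 g1 l3.1, ← not_le, ← ccw_le_dbl_iff_half l1.1 l4.1 l3.1, not_le,
      ← ccw_le_dbl_iff_half l1.1 l4.1 g2, ← ccw_le_dbl_iff_half l1.1 g2 l2.1]
  · have hlt := hS.lt
    have hpos := hS.pos
    unfold ClosedStrip at l1 l2 l3 l4
    have a1 := ccw_dbl (sideBase α s) x₁
    have a2 := ccw_dbl (sideBase α s) x₂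
    have a3 := ccw_dbl (sideBase α s) y₁
    have a4 := ccw_dbl (sideBase α s) y₂
    have a5 := ccw_dbl (sideBase α s) w₁
    have a6 := ccw_dbl (sideBase α s) w₂
    rw [dbl_sideBase] at a1 a2 a3 a4 a5 a6
    rw [if_pos (by linarith)] at a1 a2 a3 a4
    have b1 := ccw_base α (dbl x₁) (dbl w₁)
    have b2 := ccw_base α (dbl x₁) (dbl w₂)
    have b3 := ccw_base α (dbl x₁) (dbl y₁)
    have b4 := ccw_base α (dbl x₁) (dbl y₂)
    have b5 := ccw_base α (dbl x₁) (dbl x₂)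
    have hne : ¬ (ccw α (dbl x₁) = 0 ∧ ccw α (dbl x₂) = ccw α γ) := fun h =>
      l6 (by rw [ccw_eq_zero.1 h.1, ccw_inj h.2])
    have hw : ccw (sideBase α s) w₁ < 1 / 2 ∧ ccw (sideBase α s) w₂ < 1 / 2 := by
      unfold Sb at hsb
      rw [a1, a2] at hne
      rw [a1] at b1 b2 b3 b4 b5
      rw [a2] at b5
      rw [a3] at b3
      rw [a4] at b4
      unfold Half at g1 g2
      have := ccw_nonneg α (dbl w₁)
      have := ccw_nonneg α (dbl w₂)
      have := ccw_lt_one α (dbl w₁)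
      have := ccw_lt_one α (dbl w₂)
      have := ccw_nonneg (sideBase α s) x₁
      clear hS hz a1 a2 a3 a4 l6
      generalize ccw α (dbl w₁) = W₁ at *
      generalize ccw α (dbl w₂) = W₂ at *
      generalize ccw (sideBase α s) x₁ = X₁ at *
      generalize ccw (sideBase α s) x₂ = X₂ at *
      rw [if_pos (by linarith)] at b5
      have hx : ccw (dbl x₁) (dbl w₁) ≤ 2 * X₂ - 2 * X₁ ∧ 
        ccw (dbl x₁) (dbl w₂) ≤ 2 * X₂ - 2 * X₁ ∧ ccw (dbl x₁) (dbl w₁) < ccw (dbl x₁) (dbl w₂) := by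
        refine ⟨?_, ?_, ?_⟩ <;> linarith
      rw [b1, b2] at hx
      clear b1 b2 b3 b4 b5 hc
      grind (splits := 30)
    have h1 := hw.1
    have h2 := hw.2
    rwa [← ccw_le_dbl_iff (o := sideBase α s) (by linarith) h1 (by linarith),
      ← not_le, ← ccw_le_dbl_iff (o := sideBase α s) (x := x₁) (y := y₂) (by linarith) (by linarith)
        (by linarith), not_le,
      ← ccw_le_dbl_iff (o := sideBase α s) (by linarith) (by linarith) h2,
      ← ccw_le_dbl_iff (o := sideBase α s) (by linarith) h2 (by linarith)]

/-- A chord of the lamination between the iterates of order `N` of two nested chords pulls back to a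
chord of the lamination between them, if the nested chords have been together in a piece up to that
time. -/
lemma exists_pull_between (hS : Leaf m α γ e κ) {N : ℕ} {s : ℕ → Bool} {x₁ x₂ y₁ y₂ z₁ z₂ : Angle}
    (hz : s(z₁, z₂) ∈ genLam m s(α, γ))
    (hL : ∀ i < N, Together α γ (s i) (dbl^[i] x₁) (dbl^[i] x₂) (dbl^[i] y₁) (dbl^[i] y₂))
    (hc : Chain (dbl^[N] x₁) z₁ (dbl^[N] y₁) (dbl^[N] y₂) z₂ (dbl^[N] x₂)) :
    ∃ w₁ w₂, s(w₁, w₂) ∈ genLam m s(α, γ) ∧ dbl^[N] w₁ = z₁ ∧ dbl^[N] w₂ = z₂ ∧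
      (∀ i < N, Piece α γ (s i) (dbl^[i] w₁) (dbl^[i] w₂)) ∧ Chain x₁ w₁ y₁ y₂ w₂ x₂ := by
  induction N generalizing s x₁ x₂ y₁ y₂ with
  | zero => exact ⟨z₁, z₂, hz, rfl, rfl, by simp, hc⟩
  | succ N ih =>
    obtain ⟨v₁, v₂, h1, rfl, rfl, h2, h3⟩ := ih (s := fun i => s (i + 1))
      (fun i hi => hL (i + 1) (by lia)) hc
    obtain ⟨w₁, w₂, rfl, rfl, h4, h5⟩ := hS.exists_lift_between h1 (hL 0 (by lia)) h3
    have h6 : ∀ i < N + 1, Piece α γ (s i) (dbl^[i] w₁) (dbl^[i] w₂) := by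
      rintro (_ | i) hi
      · exact h4
      · exact h2 i (by lia)
    refine ⟨w₁, w₂, ?_, rfl, rfl, h6, h5⟩
    rw [hS.mem_genLam] at h1 ⊢
    obtain ⟨⟨M, hM⟩, h1⟩ := h1
    refine ⟨⟨M + 1, hM⟩, ?_⟩
    rintro (_ | i)
    · exact ⟨_, h4⟩
    · exact h1 i

end Leaf

/-! ### Dynamic pairs as pairs of arcs -/

/-- The arcs `[c₁, c₂]` and `[d₁, d₂]` that are mapped onto the closed strips with the symbols `x`
and `!x` by `h^n`, in such a way that the arcs follow the word `ω₀ … ω_(n-1)`. The chords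
`s(c₁, d₂)` and `s(c₂, d₁)` are the two chords of the dynamic pair for this word. -/
structure StripPair (α γ : Angle) (n : ℕ) (ω : ℕ → Bool) (x : Bool) (c₁ c₂ d₁ d₂ : Angle) :
    Prop where
  c₁_iter : dbl^[n] c₁ = sideBase α x
  c₂_iter : dbl^[n] c₂ = sideBase γ x
  d₁_iter : dbl^[n] d₁ = sideBase α (!x)
  d₂_iter : dbl^[n] d₂ = sideBase γ (!x)
  ccw_c : ccw c₁ c₂ = ccw α γ / 2 ^ (n + 1)
  ccw_d : ccw d₁ d₂ = ccw α γ / 2 ^ (n + 1)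
  lt_d₁ : ccw c₁ c₂ < ccw c₁ d₁
  lt_d₂ : ccw c₁ d₁ < ccw c₁ d₂
  piece : ∀ i < n,
    (∀ p, p = c₁ ∨ p = c₂ ∨ p = d₁ ∨ p = d₂ → Lobe α γ (ω i) (dbl^[i] p)) ∨
    (∀ p, p = c₁ ∨ p = c₂ ∨ p = d₁ ∨ p = d₂ → Strip α γ (ω i) (dbl^[i] p))

/-- The word `κ₀ … κ_(m-2)` is a suffix of `ω₀ … ω_(n-1)`. -/
def EndsWith (m n : ℕ) (κ ω : ℕ → Bool) : Prop :=
  m - 1 ≤ n ∧ ∀ i < m - 1, ω (n - (m - 1) + i) = κ i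

lemma StripPair.symm {α γ : Angle} {n : ℕ} {ω : ℕ → Bool} {x : Bool} {c₁ c₂ d₁ d₂ : Angle}
    (hpos : 0 < ccw α γ) (h : StripPair α γ n ω x c₁ c₂ d₁ d₂) :
    StripPair α γ n ω (!x) d₁ d₂ c₁ c₂ := by
  have h1 := h.lt_d₁
  have h2 := h.lt_d₂
  have h3 : 0 < ccw c₁ c₂ := by rw [h.ccw_c]; positivity
  have b1 := ccw_base c₁ d₁ d₂
  have b2 := ccw_base c₁ d₁ c₁
  have b3 := ccw_base c₁ d₁ c₂
  rw [ccw_self, if_neg (by linarith)] at b2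
  rw [if_neg (by linarith)] at b3
  rw [if_pos (by linarith)] at b1
  have := ccw_lt_one c₁ d₂
  refine ⟨h.d₁_iter, h.d₂_iter, by rw [Bool.not_not]; exact h.c₁_iter,
    by rw [Bool.not_not]; exact h.c₂_iter, h.ccw_d, h.ccw_c, by linarith, by linarith,
    fun i hi => ?_⟩
  exact (h.piece i hi).imp (fun h p hp => h p (by tauto)) (fun h p hp => h p (by tauto))

namespace Leaf

variable {m : ℕ} {α γ : Angle} {e : Bool} {κ : ℕ → Bool}

lemma not_strip_of_lobe (hS : Leaf m α γ e κ) {s t : Bool} {x : Angle} (h : Lobe α γ s x) :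
    ¬ Strip α γ t x := by
  rw [hS.lobe_iff_half] at h
  rw [hS.strip_iff_half]
  exact fun h' => h.2 h'.2

lemma lobe_left (hS : Leaf m α γ e κ) (t : Bool) : Lobe α γ (!t) (sideBase α t) := by
  rw [hS.lobe_not_iff, ccw_self]; simp

lemma lobe_right (hS : Leaf m α γ e κ) (t : Bool) : Lobe α γ t (sideBase γ t) := by
  rw [Lobe, ccw_self]
  linarith [hS.lt]

/-- The chord `s(c₁, d₂)` is mapped to the chord that bounds a lobe, and so belongs to the
lamination. -/
lemma mem_stripPair (hS : Leaf m α γ e κ) {n : ℕ} {ω : ℕ → Bool} {x : Bool} {c₁ c₂ d₁ d₂ : Angle}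
    (h : StripPair α γ n ω x c₁ c₂ d₁ d₂) : s(c₁, d₂) ∈ genLam m s(α, γ) := by
  apply hS.mem_genLam_of (N := n + 1)
  · rw [Function.iterate_succ_apply', Function.iterate_succ_apply', h.c₁_iter, h.d₂_iter,
      dbl_sideBase, dbl_sideBase]
  · intro i hi
    by_cases hi' : i < n
    · refine ⟨ω i, (h.piece i hi').imp ?_ ?_⟩
      all_goals exact fun h => ⟨h _ (by simp), h _ (by simp)⟩
    · obtain rfl : i = n := by lia
      refine ⟨!x, Or.inl ?_⟩
      rw [h.c₁_iter, h.d₂_iter]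
      exact ⟨hS.lobe_left x, hS.lobe_right _⟩

lemma mem_stripPair' (hS : Leaf m α γ e κ) {n : ℕ} {ω : ℕ → Bool} {x : Bool} {c₁ c₂ d₁ d₂ : Angle}
    (h : StripPair α γ n ω x c₁ c₂ d₁ d₂) : s(c₂, d₁) ∈ genLam m s(α, γ) := by
  rw [Sym2.eq_swap (a := c₂)]
  exact hS.mem_stripPair (h.symm hS.pos)

/-- If a pull-back of a strip is divided by an end of `s(α, γ)`, then the word ends with `v`: the
only possibility is `c₁ = α`. -/
lemma endsWith_of_stripPair (hS : Leaf m α γ e κ) {n : ℕ} {ω : ℕ → Bool} {x : Bool}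
    {c₁ c₂ d₁ d₂ : Angle} (h : StripPair α γ n ω x c₁ c₂ d₁ d₂) (h1 : ¬ Sb α c₁ γ)
    (h2 : Sb α c₂ γ) : EndsWith m n κ ω := by
  have hlt := hS.lt
  have hpos := hS.pos
  have hM : (1 : ℝ) ≤ 2 ^ n := one_le_pow₀ (by norm_num)
  have hc := h.ccw_c
  have hc1 : 2 ^ n * ccw c₁ c₂ = ccw α γ / 2 := by rw [hc, pow_succ]; field_simp
  have hc2 : ccw c₁ c₂ ≤ ccw α γ / 2 := by nlinarith only [hc1, hM, ccw_nonneg c₁ c₂]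
  have k1 : ccw c₁ α < ccw c₁ c₂ := by
    have b1 := ccw_base α c₁ c₂
    have b2 := ccw_base α c₁ α
    rw [ccw_self] at b2
    unfold Sb at h1 h2
    clear hS h hc hc1
    grind [ccw_nonneg, ccw_lt_one]
  have k2 := mul_lt_mul_of_pos_left k1 (show (0 : ℝ) < 2 ^ n by positivity)
  rw [hc1] at k2
  have k3 := ccw_iter_of_lt (n := n) (x := c₁) (y := α) (by linarith)
  rw [h.c₁_iter] at k3
  have k4 : c₁ = α := by
    by_contra hne
    have : Strip α γ x (dbl^[n] α) := by
      unfold Strip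
      rw [k3]
      exact ⟨mul_pos (by positivity) (ccw_pos.2 (Ne.symm hne)), k2⟩
    exact hS.not_strip_of_lobe (hS.lobe_iterate (Or.inl rfl) n) this
  subst k4
  have k5 : dbl^[n + 1] c₁ = c₁ := by
    rw [Function.iterate_succ_apply', h.c₁_iter, dbl_sideBase]
  have k6 : m ∣ n + 1 := by
    rw [← hS.per c₁ (Or.inl rfl)]
    exact (show Function.IsPeriodicPt dbl (n + 1) c₁ from k5).minimalPeriod_dvd
  obtain ⟨j, hj⟩ := k6
  have hj0 : j ≠ 0 := by rintro rfl; lia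
  obtain ⟨j, rfl⟩ := Nat.exists_eq_succ_of_ne_zero hj0
  have hm := hS.one_lt
  have hn : n = (m - 1) + m * j := by rw [Nat.mul_succ] at hj; lia
  refine ⟨by lia, fun i hi => ?_⟩
  have h3 : n - (m - 1) + i = i + j * m := by rw [hn, Nat.mul_comm]; lia
  have h4 : κ (i + j * m) = κ i := by
    have : Function.Periodic κ m := hS.sym_add
    exact this.nat_mul j i
  rw [h3, ← h4]
  have h5 : i + j * m < n := by rw [hn, Nat.mul_comm]; lia
  have h6 : Half c₁ (ω (i + j * m)) (dbl^[i + j * m] c₁) := by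
    rcases h.piece _ h5 with h | h
    · exact (hS.lobe_iff_half.1 (h c₁ (by simp))).1
    · exact (hS.strip_iff_half.1 (h c₁ (by simp))).1
  exact h6.unique (hS.half_iterate (Or.inl rfl) _)

/-- If the image of an arc with ends in one piece is shorter than half of `s(α, γ)`, then the arc is
half as long as its image. -/
lemma ccw_lift (hS : Leaf m α γ e κ) {t : Bool} {x y : Angle} (h : Piece α γ t x y)
    (hlen : ccw (dbl x) (dbl y) ≤ ccw α γ / 2) : ccw x y = ccw (dbl x) (dbl y) / 2 := by
  have b1 := ccw_dbl x y
  have b2 := ccw_base (sideBase α t) x y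
  rw [Piece, hS.lobe_iff, hS.lobe_iff, Strip, Strip] at h
  have hlt := hS.lt
  have hpos := hS.pos
  clear hS
  grind [ccw_nonneg, ccw_lt_one]

/-- A word that does not end with `κ₀ … κ_(m-2)` defines a pair of arcs. -/
lemma exists_stripPair (hS : Leaf m α γ e κ) {n : ℕ} {ω : ℕ → Bool} (hω : ¬ EndsWith m n κ ω) :
    ∃ x c₁ c₂ d₁ d₂, StripPair α γ n ω x c₁ c₂ d₁ d₂ := by
  have hlt := hS.lt
  have hpos := hS.pos
  induction n generalizing ω with
  | zero =>
    refine ⟨false, sideBase α false, sideBase γ false, sideBase α (!false), sideBase γ (!false),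
      rfl, rfl, rfl, rfl, ?_, ?_, ?_, ?_, by simp⟩
    · rw [hS.ccw_sideBase]; norm_num
    · rw [hS.ccw_sideBase]; norm_num
    · rw [hS.ccw_sideBase, sideBase_not, ccw_self_add_oneHalf]; linarith
    · rw [hS.ccw_sideBase_not, sideBase_not, ccw_self_add_oneHalf]; linarith
  | succ n ih =>
    have hω' : ¬ EndsWith m n κ (fun i => ω (i + 1)) := by
      rintro ⟨h1, h2⟩
      refine hω ⟨by lia, fun i hi => ?_⟩
      rw [← h2 i hi]
      congr 1
      lia
    obtain ⟨x, c₁, c₂, d₁, d₂, h⟩ := ih hω'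
    have e1 := hS.sb_iff_of_mem (hS.mem_stripPair h)
    have e2 := hS.sb_iff_of_mem (hS.mem_stripPair' h)
    -- All four points are on the same side of `s(α, γ)`, so their preimages lie in one piece.
    have e3 : Sb α c₁ γ ↔ Sb α c₂ γ := by
      by_contra hcon
      by_cases h1 : Sb α c₁ γ
      · refine hω' (hS.endsWith_of_stripPair (h.symm hpos) ?_ ?_) <;> tauto
      · refine hω' (hS.endsWith_of_stripPair h ?_ ?_) <;> tauto
    have h1 := h.lt_d₁
    have h2 := h.lt_d₂
    have hc := h.ccw_c
    have hd := h.ccw_d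
    have hlen : ccw α γ / 2 ^ (n + 1) ≤ ccw α γ / 2 := by
      apply div_le_div_of_nonneg_left hpos.le (by norm_num)
      calc (2 : ℝ) = 2 ^ 1 := by norm_num
        _ ≤ 2 ^ (n + 1) := pow_le_pow_right₀ (by norm_num) (by lia)
    have i1 := h.c₁_iter
    have i2 := h.c₂_iter
    have i3 := h.d₁_iter
    have i4 := h.d₂_iter
    have hp := h.piece
    clear h
    obtain ⟨c₁, rfl, g1⟩ := exists_half α (ω 0) c₁
    obtain ⟨c₂, rfl, g2⟩ := exists_half α (ω 0) c₂
    obtain ⟨d₁, rfl, g3⟩ := exists_half α (ω 0) d₁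
    obtain ⟨d₂, rfl, g4⟩ := exists_half α (ω 0) d₂
    refine ⟨x, c₁, c₂, d₁, d₂, i1, i2, i3, i4, ?_, ?_, ?_, ?_, ?_⟩
    · rw [hS.ccw_lift (hS.piece_iff_half.2 ⟨g1, g2, e3⟩) (by linarith), hc, pow_succ _ (n + 1)]
      field_simp
    · rw [hS.ccw_lift (hS.piece_iff_half.2 ⟨g3, g4, by tauto⟩) (by linarith), hd, pow_succ _ (n + 1)]
      field_simp
    · rw [← not_le] at h1 ⊢
      rwa [← ccw_le_dbl_iff_half g1 g3 g2]
    · rw [← not_le] at h2 ⊢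
      rwa [← ccw_le_dbl_iff_half g1 g4 g3]
    · rintro (_ | i) hi
      · simp only [Function.iterate_zero_apply]
        by_cases hsb : Sb α (dbl c₁) γ
        · right
          rintro p (rfl | rfl | rfl | rfl) <;> rw [hS.strip_iff_half] <;> tauto
        · left
          rintro p (rfl | rfl | rfl | rfl) <;> rw [hS.lobe_iff_half] <;> tauto
      · simp only [Function.iterate_succ_apply]
        refine (hp i (by lia)).imp ?_ ?_
        · rintro h p (rfl | rfl | rfl | rfl) <;> exact h _ (by simp)
        · rintro h p (rfl | rfl | rfl | rfl) <;> exact h _ (by simp)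

/-- `EndsWith` in terms of lists. -/
lemma endsWith_iff (hS : Leaf m α γ e κ) {v w : List Bool} (hv : IsWordV m s(α, γ) v) {ω : ℕ → Bool}
    (hω : ∀ i < w.length, w[i]? = some (ω i)) : EndsWith m w.length κ ω ↔ v <:+ w := by
  rw [hS.isWordV_iff] at hv
  obtain ⟨hl, hv⟩ := hv
  constructor
  · rintro ⟨h1, h2⟩
    have : v = w.drop (w.length - (m - 1)) := by
      apply List.ext_getElem?
      intro i
      rw [List.getElem?_drop]
      by_cases hi : i < m - 1
      · rw [hv i hi, hω _ (by lia), h2 i hi]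
      · rw [List.getElem?_eq_none (by lia), List.getElem?_eq_none (by lia)]
    rw [this]
    exact List.drop_suffix _ _
  · rintro ⟨u, rfl⟩
    rw [List.length_append, hl]
    refine ⟨by lia, fun i hi => ?_⟩
    have h1 := hω (u.length + i) (by rw [List.length_append]; lia)
    rw [List.getElem?_append_right (by lia), Nat.add_sub_cancel_left, hv i hi] at h1
    rw [Nat.add_sub_cancel]
    exact (Option.some.inj h1).symm

lemma isL_unique (hS : Leaf m α γ e κ) {w : List Bool} {R R₁ R₂ : Chord} (hR : R ∈ genLam m s(α, γ))
    (h1 : IsL m s(α, γ) w R R₁) (h2 : IsL m s(α, γ) w R R₂) : R₁ = R₂ := by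
  rw [hS.isL_iff hR] at h1 h2
  obtain ⟨h1, -, k1⟩ := h1
  obtain ⟨h2, -, k2⟩ := h2
  induction R₁ using Sym2.ind with | _ a b
  induction R₂ using Sym2.ind with | _ c d
  have hw : ∀ i < w.length, w[i]? = some (w.getD i false) := by
    intro i hi
    rw [List.getD_eq_getElem?_getD, List.getElem?_eq_getElem hi]; rfl
  have g : ∀ p q, (p = a ∨ p = b) → (q = c ∨ q = d) → dbl^[w.length] p = dbl^[w.length] q → p = q := by
    intro p q hp hq h
    refine eq_of_half (α := α) (κ := fun i => w.getD i false) (fun i hi => ?_) (fun i hi => ?_) h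
    · apply k1 i _ (hw i hi)
      rw [dblC_iter]
      rcases hp with rfl | rfl <;> simp
    · apply k2 i _ (hw i hi)
      rw [dblC_iter]
      rcases hq with rfl | rfl <;> simp
  rw [← h2, dblC_iter, dblC_iter, Sym2.eq_iff] at h1
  rw [Sym2.eq_iff]
  rcases h1 with ⟨h3, h4⟩ | ⟨h3, h4⟩
  · exact Or.inl ⟨g _ _ (by simp) (by simp) h3, g _ _ (by simp) (by simp) h4⟩
  · exact Or.inr ⟨g _ _ (by simp) (by simp) h3, g _ _ (by simp) (by simp) h4⟩

lemma isL_stripPair (hS : Leaf m α γ e κ) {w : List Bool} {ω : ℕ → Bool} {x : Bool}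
    {c₁ c₂ d₁ d₂ : Angle} (h : StripPair α γ w.length ω x c₁ c₂ d₁ d₂)
    (hω : ∀ i < w.length, w[i]? = some (ω i)) :
    IsL m s(α, γ) (w ++ [!x]) s(α, γ) s(c₁, d₂) := by
  rw [hS.isL_iff hS.self_mem_genLam]
  refine ⟨?_, hS.mem_stripPair h, fun i t ht => ?_⟩
  · rw [List.length_append, List.length_singleton, dblC_iter, Function.iterate_succ_apply',
      Function.iterate_succ_apply', h.c₁_iter, h.d₂_iter, dbl_sideBase, dbl_sideBase]
  · rw [dblC_iter]
    by_cases hi : i < w.length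
    · rw [List.getElem?_append_left hi, hω i hi] at ht
      obtain rfl : ω i = t := by simpa using ht
      intro z hz
      have hz : ∃ p, (p = c₁ ∨ p = d₂) ∧ z = dbl^[i] p := by
        rcases Sym2.mem_iff.1 hz with rfl | rfl
        exacts [⟨c₁, by simp, rfl⟩, ⟨d₂, by simp, rfl⟩]
      obtain ⟨p, hp, rfl⟩ := hz
      rcases h.piece i hi with h | h
      · exact (hS.lobe_iff_half.1 (h p (by tauto))).1
      · exact (hS.strip_iff_half.1 (h p (by tauto))).1
    · have hi' := (List.getElem?_eq_some_iff.1 ht).1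
      rw [List.length_append, List.length_singleton] at hi'
      obtain rfl : i = w.length := by lia
      rw [List.getElem?_append_right le_rfl, Nat.sub_self] at ht
      obtain rfl : (!x) = t := by simpa using ht
      rw [h.c₁_iter, h.d₂_iter]
      intro z hz
      rcases Sym2.mem_iff.1 hz with rfl | rfl
      exacts [half_sideBase_left α x, hS.half_sideBase_right _]

lemma isL_stripPair' (hS : Leaf m α γ e κ) {w : List Bool} {ω : ℕ → Bool} {x : Bool}
    {c₁ c₂ d₁ d₂ : Angle} (h : StripPair α γ w.length ω x c₁ c₂ d₁ d₂)
    (hω : ∀ i < w.length, w[i]? = some (ω i)) :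
    IsL m s(α, γ) (w ++ [x]) s(α, γ) s(c₂, d₁) := by
  have := hS.isL_stripPair (h.symm hS.pos) hω
  rwa [Bool.not_not, Sym2.eq_swap (a := d₁)] at this

/-- A pair of arcs for a word of length `n` has the Step `n + 1`. -/
lemma isStep_stripPair (hS : Leaf m α γ e κ) {n : ℕ} {ω : ℕ → Bool} {x : Bool}
    {c₁ c₂ d₁ d₂ : Angle} (h : StripPair α γ n ω x c₁ c₂ d₁ d₂) :
    IsStep s(α, γ) s(c₁, d₂) s(c₂, d₁) (n + 1) := by
  constructor
  · simp only [Set.mem_ofPred_eq, dblC_iter, Function.iterate_succ_apply', h.c₁_iter, h.d₂_iter,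
      h.c₂_iter, h.d₁_iter, dbl_sideBase, true_and]
    exact Sym2.eq_swap
  · rintro i ⟨h1, h2⟩
    by_contra hcon
    have h3 : dblC^[n - i] (dblC^[i] s(c₁, d₂)) = dblC^[n - i] (dblC^[i] s(c₂, d₁)) := by rw [h1, h2]
    rw [← Function.iterate_add_apply, ← Function.iterate_add_apply, Nat.sub_add_cancel (by lia),
      dblC_iter, dblC_iter, h.c₁_iter, h.d₂_iter, h.c₂_iter, h.d₁_iter, Sym2.eq_iff] at h3
    have e1 := hS.ccw_sideBase x
    have e2 : ccw (sideBase α x) (sideBase α (!x)) = 1 / 2 := by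
      rw [sideBase_not, ccw_self_add_oneHalf]
    have := hS.pos
    rcases h3 with ⟨h3, -⟩ | ⟨h3, -⟩
    · rw [← h3, ccw_self] at e1; linarith
    · rw [← h3, ccw_self] at e2; linarith

/-- Every dynamic pair consists of the two chords spanned by a pair of arcs. -/
lemma exists_stripPair_of_isDynamicPair (hS : Leaf m α γ e κ) {v : List Bool} {S₁ S₂ : Chord}
    {n : ℕ} (hv : IsWordV m s(α, γ) v) (h : IsDynamicPair m s(α, γ) v S₁ S₂)
    (hn : IsStep s(α, γ) S₁ S₂ (n + 1)) :
    ∃ ω x c₁ c₂ d₁ d₂, ¬ EndsWith m n κ ω ∧ StripPair α γ n ω x c₁ c₂ d₁ d₂ ∧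
      S₁ = s(c₁, d₂) ∧ S₂ = s(c₂, d₁) ∧ chordLength s(c₂, d₁) ≤ chordLength s(c₁, d₂) := by
  obtain ⟨hlen, w, b, h1, h2, h3⟩ := h
  have hw : ∀ i < w.length, w[i]? = some (w.getD i false) := by
    intro i hi
    rw [List.getD_eq_getElem?_getD, List.getElem?_eq_getElem hi]; rfl
  have hω : ¬ EndsWith m w.length κ (fun i => w.getD i false) := by
    rwa [hS.endsWith_iff hv hw]
  have key : ∃ x c₁ c₂ d₁ d₂, StripPair α γ w.length (fun i => w.getD i false) x c₁ c₂ d₁ d₂ ∧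
      S₁ = s(c₁, d₂) ∧ S₂ = s(c₂, d₁) := by
    obtain ⟨x, c₁, c₂, d₁, d₂, hp⟩ := hS.exists_stripPair hω
    by_cases hb : x = b
    · subst hb
      refine ⟨!x, d₁, d₂, c₁, c₂, hp.symm hS.pos, ?_, ?_⟩
      · rw [Sym2.eq_swap]
        exact hS.isL_unique hS.self_mem_genLam h2 (hS.isL_stripPair' hp hw)
      · rw [Sym2.eq_swap]
        exact hS.isL_unique hS.self_mem_genLam h3 (hS.isL_stripPair hp hw)
    · have hb : b = !x := by revert hb; cases b <;> cases x <;> simp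
      subst hb
      rw [Bool.not_not] at h3
      exact ⟨x, c₁, c₂, d₁, d₂, hp, hS.isL_unique hS.self_mem_genLam h2 (hS.isL_stripPair hp hw),
        hS.isL_unique hS.self_mem_genLam h3 (hS.isL_stripPair' hp hw)⟩
  obtain ⟨x, c₁, c₂, d₁, d₂, hp, rfl, rfl⟩ := key
  have := (hS.isStep_stripPair hp).unique hn
  obtain rfl : w.length = n := by lia
  exact ⟨_, x, c₁, c₂, d₁, d₂, hω, hp, rfl, rfl, hlen⟩

/-- Conversely, a pair of arcs whose word does not end with `v` is a dynamic pair. -/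
lemma isDynamicPair_stripPair (hS : Leaf m α γ e κ) {v : List Bool} {n : ℕ} {ω : ℕ → Bool} {x : Bool}
    {c₁ c₂ d₁ d₂ : Angle} (hv : IsWordV m s(α, γ) v) (h : StripPair α γ n ω x c₁ c₂ d₁ d₂)
    (hω : ¬ EndsWith m n κ ω) (hlen : chordLength s(c₂, d₁) ≤ chordLength s(c₁, d₂)) :
    IsDynamicPair m s(α, γ) v s(c₁, d₂) s(c₂, d₁) := by
  obtain ⟨w, hw1, hw⟩ : ∃ w : List Bool, w.length = n ∧ ∀ i < w.length, w[i]? = some (ω i) := by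
    refine ⟨(List.range n).map ω, by simp, fun i hi => ?_⟩
    rw [List.length_map, List.length_range] at hi
    simp [hi]
  subst hw1
  refine ⟨hlen, w, !x, ?_, hS.isL_stripPair h hw, ?_⟩
  · rwa [← hS.endsWith_iff hv hw]
  · rw [Bool.not_not]
    exact hS.isL_stripPair' h hw

end Leaf

/-! ### The boundary leaves of the critical value gap -/

/-- No chord of the lamination runs between `s(α, γ)` and `s(x, y)`. -/
def NothingBetween (m : ℕ) (α γ x y : Angle) : Prop :=
  ∀ z₁ z₂, s(z₁, z₂) ∈ genLam m s(α, γ) → Chain α z₁ x y z₂ γ →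
    s(z₁, z₂) = s(α, γ) ∨ s(z₁, z₂) = s(x, y)

/-- The orbit of a boundary leaf of the critical value gap that is mapped to `s(α, γ)` after
`(q - 1) * m` iterates. -/
structure BoundaryOrbit (m q : ℕ) (α γ : Angle) (e : Bool) (κ : ℕ → Bool) (r₁ r₂ : Angle) :
    Prop where
  order : ∀ l < q - 1, ccw α (dbl^[l * m] r₁) < ccw α (dbl^[l * m] r₂) ∧
    ccw α (dbl^[l * m] r₂) ≤ ccw α γ
  ne : ∀ l < q - 1, s(dbl^[l * m] r₁, dbl^[l * m] r₂) ≠ s(α, γ)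
  lobe : ∀ l < q - 1, ∀ i < m - 1, Lobe α γ (κ i) (dbl^[i] (dbl^[l * m] r₁)) ∧
    Lobe α γ (κ i) (dbl^[i] (dbl^[l * m] r₂))
  strip : ∀ l, l + 1 < q - 1 → ∃ t, ClosedStrip α γ t (dbl^[m - 1] (dbl^[l * m] r₁)) ∧
    ClosedStrip α γ t (dbl^[m - 1] (dbl^[l * m] r₂)) ∧
    ccw (sideBase α t) (dbl^[m - 1] (dbl^[l * m] r₁)) ≤
      ccw (sideBase α t) (dbl^[m - 1] (dbl^[l * m] r₂))
  last_left : dbl^[m - 1] (dbl^[(q - 2) * m] r₁) = sideBase γ e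
  last_right : dbl^[m - 1] (dbl^[(q - 2) * m] r₂) = sideBase α (!e)

lemma Chain.left_ne {α γ x y z : Angle} (h : Chain α γ x y α z) : False := by
  obtain ⟨h1, h2, h3, h4⟩ := h
  rw [ccw_self] at h3
  linarith [ccw_nonneg α x]

namespace Leaf

variable {m : ℕ} {α γ : Angle} {e : Bool} {κ : ℕ → Bool}

/-- The chord that bounds the lobe with symbol `t` belongs to the lamination. -/
lemma mem_genLam_pred (hS : Leaf m α γ e κ) (t : Bool) :
    s(sideBase α (!t), sideBase γ t) ∈ genLam m s(α, γ) := by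
  apply hS.mem_genLam_of (N := 1)
  · rw [Function.iterate_one, dbl_sideBase, dbl_sideBase]
  · intro i hi
    obtain rfl : i = 0 := by lia
    refine ⟨t, Or.inl ⟨?_, hS.lobe_right t⟩⟩
    have := hS.lobe_left (!t)
    rwa [Bool.not_not] at this

/-- If a chord `s(x, y)` outside the lobe with symbol `s` lies behind a chord `s(A, C)` in this lobe,
then the chord that bounds the lobe runs between them. -/
lemma chain_of_not_lobe (hS : Leaf m α γ e κ) {s t : Bool} {A C x y : Angle} (k1 : Lobe α γ s A)
    (k2 : Lobe α γ s C) (ht : ClosedPiece α γ t x y) (o1 : ccw A x < ccw A y)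
    (o2 : ccw A y ≤ ccw A C) (hcon : ¬ (Lobe α γ s x ∧ Lobe α γ s y)) :
    Chain A (sideBase α (!s)) x y (sideBase γ s) C := by
  have hp : ClosedPiece α γ s x y ∨ ClosedPiece α γ (!s) x y := by
    by_cases hst : t = s
    · exact Or.inl (hst ▸ ht)
    · have : t = !s := by revert hst; cases t <;> cases s <;> simp
      exact Or.inr (this ▸ ht)
  have hlt := hS.lt
  have hpos := hS.pos
  have e1 := hS.ccw_sideBase s
  have e2 : ccw (sideBase α s) (sideBase α (!s)) = 1 / 2 := by
    rw [sideBase_not, ccw_self_add_oneHalf]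
  rw [hS.lobe_iff] at k1 k2
  rw [hS.lobe_iff, hS.lobe_iff] at hcon
  rw [ClosedPiece, ClosedPiece, hS.lobe_iff, hS.lobe_iff, hS.lobe_not_iff, hS.lobe_not_iff,
      hS.closedStrip_not_iff, hS.closedStrip_not_iff, ClosedStrip, ClosedStrip] at hp
  generalize sideBase α s = o at *
  have b1 := ccw_base o A x
  have b2 := ccw_base o A y
  have b3 := ccw_base o A C
  have b4 := ccw_base o A (sideBase α (!s))
  have b5 := ccw_base o A (sideBase γ s)
  rw [e2] at b4
  rw [e1] at b5
  unfold Chain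
  rw [b1, b2, b3, b4, b5]
  rw [b1, b2] at o1
  rw [b2, b3] at o2
  have := ccw_nonneg o x
  have := ccw_nonneg o y
  have := ccw_lt_one o x
  have := ccw_lt_one o y
  clear hS b1 b2 b3 b4 b5 e1 e2 ht
  generalize ccw o x = x at *
  generalize ccw o y = y at *
  generalize ccw o A = A at *
  generalize ccw o C = C at *
  generalize ccw α γ = l at *
  have hCA : C < A := by grind (splits := 30)
  rw [if_neg (not_le.2 hCA)] at *
  grind (splits := 30)

/-- A chord that is weakly behind `s(α, γ)` stays in the lobes of `s(α, γ)` as long as no chord of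
the lamination runs between them. -/
lemma lobe_of_nothingBetween (hS : Leaf m α γ e κ) {x y : Angle} (h1 : ccw α x < ccw α y)
    (h2 : ccw α y ≤ ccw α γ) (hcp : ∀ i, ∃ t, ClosedPiece α γ t (dbl^[i] x) (dbl^[i] y))
    (hB : NothingBetween m α γ x y) : ∀ i < m - 1, Lobe α γ (κ i) (dbl^[i] x) ∧
      Lobe α γ (κ i) (dbl^[i] y) := by
  intro i
  induction i using Nat.strong_induction_on with | _ i ih
  intro hi
  have lα := fun i => hS.lobe_iterate (Or.inl rfl : α = α ∨ α = γ) i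
  have lγ := fun i => hS.lobe_iterate (Or.inr rfl : γ = α ∨ γ = γ) i
  have o1 : ccw (dbl^[i] α) (dbl^[i] x) < ccw (dbl^[i] α) (dbl^[i] y) := by
    rw [← not_le] at h1 ⊢
    rwa [ccw_le_iter_iff_half (κ := κ) (fun j hj => hS.half_iterate (Or.inl rfl) j)
      (fun j hj => (hS.lobe_iff_half.1 (ih j hj (by lia)).2).1)
      (fun j hj => (hS.lobe_iff_half.1 (ih j hj (by lia)).1).1)]
  have o2 : ccw (dbl^[i] α) (dbl^[i] y) ≤ ccw (dbl^[i] α) (dbl^[i] γ) := by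
    rwa [ccw_le_iter_iff_half (κ := κ) (fun j hj => hS.half_iterate (Or.inl rfl) j)
      (fun j hj => (hS.lobe_iff_half.1 (ih j hj (by lia)).2).1)
      (fun j hj => hS.half_iterate (Or.inr rfl) j)]
  by_contra hcon
  obtain ⟨t, ht⟩ := hcp i
  have hch := hS.chain_of_not_lobe (lα i) (lγ i) ht o1 o2 hcon
  -- If the chord leaves the lobe, then the chord that bounds the lobe pulls back to a chord between
  -- `s(α, γ)` and `s(x, y)`; it is neither of these chords.
  obtain ⟨w₁, w₂, hw, hw1, hw2, -, hch'⟩ := hS.exists_pull_between (s := κ) (hS.mem_genLam_pred (κ i))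
    (fun j hj => Or.inl ⟨lα j, lγ j, ih j hj (by lia)⟩) hch
  rcases hB _ _ hw hch' with h | h
  · rcases Sym2.eq_iff.1 h with ⟨rfl, rfl⟩ | ⟨rfl, rfl⟩
    · have k : dbl^[i + 1] w₁ = w₁ := by rw [Function.iterate_succ_apply', hw1, dbl_sideBase]
      have := (show Function.IsPeriodicPt dbl (i + 1) w₁ from k).minimalPeriod_le (by lia)
      rw [hS.per _ (Or.inl rfl)] at this
      lia
    · exact hch'.left_ne
  · have k1 := hS.lobe_left (!κ i)
    rw [Bool.not_not, ← hw1] at k1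
    have k2 := hS.lobe_right (κ i)
    rw [← hw2] at k2
    rcases Sym2.eq_iff.1 h with ⟨rfl, rfl⟩ | ⟨rfl, rfl⟩
    · exact hcon ⟨k1, k2⟩
    · exact hcon ⟨k2, k1⟩

/-- After `m - 1` iterates, such a chord lies in a strip, or is the second preimage of
`s(α, γ)`. -/
lemma strip_of_nothingBetween (hS : Leaf m α γ e κ) {x y : Angle} (h1 : ccw α x < ccw α y)
    (h2 : ccw α y ≤ ccw α γ) (hcp : ∀ i, ∃ t, ClosedPiece α γ t (dbl^[i] x) (dbl^[i] y))
    (hne : s(x, y) ≠ s(α, γ)) (hB : NothingBetween m α γ x y) :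
    (∃ t, ClosedStrip α γ t (dbl^[m - 1] x) ∧ ClosedStrip α γ t (dbl^[m - 1] y) ∧
      ccw (sideBase α t) (dbl^[m - 1] x) < ccw (sideBase α t) (dbl^[m - 1] y)) ∨
    (dbl^[m - 1] x = sideBase γ e ∧ dbl^[m - 1] y = sideBase α (!e)) := by
  have hL := hS.lobe_of_nothingBetween h1 h2 hcp hB
  have lα := fun i => hS.lobe_iterate (Or.inl rfl : α = α ∨ α = γ) i
  have lγ := fun i => hS.lobe_iterate (Or.inr rfl : γ = α ∨ γ = γ) i
  have hxh := fun j hj => (hS.lobe_iff_half.1 (hL j hj).1).1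
  have hyh := fun j hj => (hS.lobe_iff_half.1 (hL j hj).2).1
  have o1 : ccw (dbl^[m - 1] α) (dbl^[m - 1] x) < ccw (dbl^[m - 1] α) (dbl^[m - 1] y) := by
    rw [← not_le] at h1 ⊢
    rwa [ccw_le_iter_iff_half (κ := κ) (fun j hj => hS.half_iterate (Or.inl rfl) j) hyh hxh]
  have o2 : ccw (dbl^[m - 1] α) (dbl^[m - 1] y) ≤ ccw (dbl^[m - 1] α) (dbl^[m - 1] γ) := by
    rwa [ccw_le_iter_iff_half (κ := κ) (fun j hj => hS.half_iterate (Or.inl rfl) j) hyh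
      (fun j hj => hS.half_iterate (Or.inr rfl) j)]
  have hlt := hS.lt
  have hpos := hS.pos
  rw [hS.pred_left] at o1 o2
  rw [hS.pred_right, hS.ccw_sideBase_not] at o2
  obtain ⟨t, ht⟩ := hcp (m - 1)
  have hp : ClosedPiece α γ e (dbl^[m - 1] x) (dbl^[m - 1] y) ∨
      ClosedPiece α γ (!e) (dbl^[m - 1] x) (dbl^[m - 1] y) := by
    by_cases hst : t = e
    · exact Or.inl (hst ▸ ht)
    · have : t = !e := by revert hst; cases t <;> cases e <;> simp
      exact Or.inr (this ▸ ht)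
  rcases hp with (hp | hp) | (hp | hp)
  · right
    rw [hS.lobe_iff, hS.lobe_iff] at hp
    obtain ⟨w₁, w₂, hw, hw1, hw2, -, hch'⟩ := hS.exists_pull_between (s := κ) (N := m - 1)
      (x₁ := α) (x₂ := γ) (y₁ := x) (y₂ := y) (z₁ := sideBase γ e) (z₂ := sideBase α (!e))
      (by rw [Sym2.eq_swap (a := sideBase γ e)]; exact hS.mem_genLam_pred e)
      (fun j hj => Or.inl ⟨lα j, lγ j, hL j hj⟩) (by
        rw [hS.pred_left, hS.pred_right]
        unfold Chain
        rw [hS.ccw_sideBase, hS.ccw_sideBase_not, sideBase_not, ccw_self_add_oneHalf]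
        refine ⟨?_, o1, ?_, ?_⟩ <;> linarith)
    rcases hB _ _ hw hch' with h | h
    · rcases Sym2.eq_iff.1 h with ⟨rfl, rfl⟩ | ⟨rfl, rfl⟩
      · rw [hS.pred_left] at hw1
        have := hS.ccw_sideBase e
        rw [← hw1, ccw_self] at this
        linarith
      · exact hch'.left_ne.elim
    · rcases Sym2.eq_iff.1 h with ⟨rfl, rfl⟩ | ⟨rfl, rfl⟩
      · exact ⟨hw1, hw2⟩
      · have := hch'.1
        linarith
  · left
    exact ⟨e, hp.1, hp.2, o1⟩
  · exfalso
    rw [hS.lobe_not_iff, hS.lobe_not_iff] at hp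
    have k1 : ccw (sideBase α e) (dbl^[m - 1] x) = 0 := by
      rcases hp.1 with h | h
      · exact h
      · linarith
    have k2 : ccw (sideBase α e) (dbl^[m - 1] y) = ccw (sideBase α e) (sideBase γ (!e)) := by
      rw [hS.ccw_sideBase_not]
      rcases hp.2 with h | h <;> linarith
    have k1 := ccw_eq_zero.1 k1
    have k2 := ccw_inj k2
    rw [← hS.pred_left] at k1
    rw [← hS.pred_right] at k2
    rw [eq_of_half (κ := κ) hxh (fun j hj => hS.half_iterate (Or.inl rfl) j) k1,
      eq_of_half (κ := κ) hyh (fun j hj => hS.half_iterate (Or.inr rfl) j) k2] at hne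
    exact hne rfl
  · left
    refine ⟨!e, hp.1, hp.2, ?_⟩
    rw [hS.closedStrip_not_iff, hS.closedStrip_not_iff] at hp
    have e1 : ccw (sideBase α e) (sideBase α (!e)) = 1 / 2 := by
      rw [sideBase_not, ccw_self_add_oneHalf]
    have b1 := ccw_base (sideBase α e) (sideBase α (!e)) (dbl^[m - 1] x)
    have b2 := ccw_base (sideBase α e) (sideBase α (!e)) (dbl^[m - 1] y)
    rw [e1, if_pos (by linarith)] at b1 b2
    linarith

/-- The property of having nothing in between is inherited by the next return. -/
lemma nothingBetween_iterate (hS : Leaf m α γ e κ) {x y : Angle} {t : Bool} (h1 : ccw α x < ccw α y)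
    (h2 : ccw α y ≤ ccw α γ) (hcp : ∀ i, ∃ t, ClosedPiece α γ t (dbl^[i] x) (dbl^[i] y))
    (hB : NothingBetween m α γ x y) (ht1 : ClosedStrip α γ t (dbl^[m - 1] x))
    (ht2 : ClosedStrip α γ t (dbl^[m - 1] y))
    (ht3 : ccw (sideBase α t) (dbl^[m - 1] x) < ccw (sideBase α t) (dbl^[m - 1] y)) :
    ccw α (dbl^[m] x) < ccw α (dbl^[m] y) ∧ ccw α (dbl^[m] y) ≤ ccw α γ ∧
    (s(dbl^[m] x, dbl^[m] y) = s(α, γ) → dbl^[m - 1] x = sideBase α t ∧ dbl^[m - 1] y = sideBase γ t) ∧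
    NothingBetween m α γ (dbl^[m] x) (dbl^[m] y) := by
  have hL := hS.lobe_of_nothingBetween h1 h2 hcp hB
  have lα := fun i => hS.lobe_iterate (Or.inl rfl : α = α ∨ α = γ) i
  have lγ := fun i => hS.lobe_iterate (Or.inr rfl : γ = α ∨ γ = γ) i
  have hlt := hS.lt
  have hpos := hS.pos
  have hm : ∀ z, dbl^[m] z = dbl (dbl^[m - 1] z) := by
    intro z
    have := hS.one_lt
    rw [← Function.iterate_succ_apply' dbl]
    congr 1
    lia
  unfold ClosedStrip at ht1 ht2
  have a1 := ccw_dbl (sideBase α t) (dbl^[m - 1] x)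
  have a2 := ccw_dbl (sideBase α t) (dbl^[m - 1] y)
  rw [dbl_sideBase, if_pos (by linarith), ← hm] at a1 a2
  refine ⟨by linarith, by linarith, fun h => ?_, ?_⟩
  · rcases Sym2.eq_iff.1 h with ⟨h, h'⟩ | ⟨h, h'⟩
    · rw [h, ccw_self] at a1
      rw [h'] at a2
      refine ⟨ccw_eq_zero.1 (by linarith), ccw_inj (a := sideBase α t) ?_⟩
      rw [hS.ccw_sideBase]
      linarith
    · rw [h', ccw_self] at a2
      linarith [ccw_nonneg (sideBase α t) (dbl^[m - 1] x)]
  · intro z₁ z₂ hz hc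
    have hsb := hS.sb_iff_of_mem hz
    obtain ⟨c1, c2, c3, c4⟩ := hc
    by_cases hsb1 : Sb α z₁ γ
    · right
      have hsb2 := hsb.1 hsb1
      -- A chord between `s(α, γ)` and the return of `s(x, y)` lifts to the strip of the latter, and
      -- then to a chord between `s(α, γ)` and `s(x, y)`.
      obtain ⟨u₁, rfl, g1⟩ := exists_half α t z₁
      obtain ⟨u₂, rfl, g2⟩ := exists_half α t z₂
      have s1 := hS.strip_iff_half.2 ⟨g1, hsb1⟩
      have s2 := hS.strip_iff_half.2 ⟨g2, hsb2⟩
      have a3 := ccw_dbl (sideBase α t) u₁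
      have a4 := ccw_dbl (sideBase α t) u₂
      rw [dbl_sideBase, if_pos (by linarith [s1.2])] at a3
      rw [dbl_sideBase, if_pos (by linarith [s2.2])] at a4
      have hu : s(u₁, u₂) ∈ genLam m s(α, γ) := by
        rw [hS.mem_genLam] at hz ⊢
        obtain ⟨⟨M, hM⟩, hz⟩ := hz
        refine ⟨⟨M + 1, hM⟩, ?_⟩
        rintro (_ | i)
        · exact ⟨t, Or.inr ⟨s1, s2⟩⟩
        · exact hz i
      have hch : Chain (dbl^[m - 1] α) u₁ (dbl^[m - 1] x) (dbl^[m - 1] y) u₂ (dbl^[m - 1] γ) := by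
        rw [hS.pred_left, hS.pred_right]
        unfold Chain
        rw [hS.ccw_sideBase_not]
        have s11 := s1.1
        have s22 := s2.2
        by_cases hte : t = e
        · subst hte
          refine ⟨?_, ?_, ?_, ?_⟩ <;> linarith
        · have hte : t = !e := by revert hte; cases t <;> cases e <;> simp
          subst hte
          have e1 : ∀ z, ccw (sideBase α (!e)) z < 1 / 2 → ccw (sideBase α e) z =
              ccw (sideBase α (!e)) z + 1 / 2 := by
            intro z hz
            have := ccw_base (sideBase α (!e)) (sideBase α e) z
            rw [show sideBase α e = sideBase α (!e) + oneHalf by rw [sideBase_not]; simp,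
              ccw_self_add_oneHalf, if_neg (by linarith)] at this
            rw [show sideBase α e = sideBase α (!e) + oneHalf by rw [sideBase_not]; simp]
            linarith
          rw [e1 _ (by linarith), e1 _ (by linarith), e1 _ (by linarith), e1 _ (by linarith)]
          refine ⟨?_, ?_, ?_, ?_⟩ <;> linarith
      obtain ⟨w₁, w₂, hw, rfl, rfl, -, hch'⟩ := hS.exists_pull_between (s := κ) hu
        (fun j hj => Or.inl ⟨lα j, lγ j, hL j hj⟩) hch
      rw [← hm, ← hm]
      rcases hB _ _ hw hch' with h | h
      · exfalso
        rcases Sym2.eq_iff.1 h with ⟨rfl, rfl⟩ | ⟨rfl, rfl⟩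
        · exact hS.not_strip_of_lobe (lα (m - 1)) s1
        · exact hS.not_strip_of_lobe (lα (m - 1)) s2
      · rw [← dblC_iter, h, dblC_iter]
    · left
      have hsb2 := hsb.not.1 hsb1
      have k1 : ccw α z₁ = 0 := by
        unfold Sb at hsb1
        have := ccw_nonneg α z₁
        grind
      have k2 : ccw α z₂ = ccw α γ := by
        unfold Sb at hsb2
        have := ccw_nonneg α z₂
        have := ccw_nonneg α z₁
        grind
      rw [ccw_eq_zero.1 k1, ccw_inj k2]

/-- The orbit of the boundary leaf of the critical value gap that is first mapped to `s(α, γ)` after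
`(q - 1) * m` iterates: it lies in the lobes of `s(α, γ)` between the returns, in a strip before
each return but the last one, and on the chord that bounds the other lobe before the last return. -/
theorem boundaryOrbit (hS : Leaf m α γ e κ) {q : ℕ} (hq : 2 ≤ q) {x y : Angle}
    (hR : s(x, y) ∈ entireLam m s(α, γ)) (h1 : ccw α x < ccw α y) (h2 : ccw α y ≤ ccw α γ)
    (hB : NothingBetween m α γ x y) (hlast : dblC^[(q - 1) * m] s(x, y) = s(α, γ))
    (hfirst : ∀ i < (q - 1) * m, dblC^[i] s(x, y) ≠ s(α, γ)) :
    BoundaryOrbit m q α γ e κ x y := by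
  have hm := hS.one_lt
  have hcp := hS.closedPiece_of_mem_entireLam hR
  have hcp' : ∀ l i, ∃ t, ClosedPiece α γ t (dbl^[i] (dbl^[l * m] x)) (dbl^[i] (dbl^[l * m] y)) := by
    intro l i
    rw [← Function.iterate_add_apply, ← Function.iterate_add_apply]
    exact hcp _
  have hsucc : ∀ l z, dbl^[(l + 1) * m] z = dbl^[m] (dbl^[l * m] z) := by
    intro l z
    rw [← Function.iterate_add_apply, Nat.add_mul, Nat.one_mul, Nat.add_comm]
  have hne : ∀ l < q - 1, s(dbl^[l * m] x, dbl^[l * m] y) ≠ s(α, γ) := by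
    intro l hl
    rw [← dblC_iter]
    exact hfirst _ (Nat.mul_lt_mul_of_pos_right hl (by lia))
  have key : ∀ l < q - 1, (ccw α (dbl^[l * m] x) < ccw α (dbl^[l * m] y) ∧
      ccw α (dbl^[l * m] y) ≤ ccw α γ) ∧ NothingBetween m α γ (dbl^[l * m] x) (dbl^[l * m] y) := by
    intro l
    induction l with
    | zero => intro _; simpa using ⟨⟨h1, h2⟩, hB⟩
    | succ l ih =>
      intro hl
      obtain ⟨⟨k1, k2⟩, k3⟩ := ih (by lia)
      rcases hS.strip_of_nothingBetween k1 k2 (hcp' l) (hne l (by lia)) k3 with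
        ⟨t, t1, t2, t3⟩ | ⟨t1, t2⟩
      · obtain ⟨g1, g2, -, g3⟩ := hS.nothingBetween_iterate k1 k2 (hcp' l) k3 t1 t2 t3
        rw [hsucc, hsucc]
        exact ⟨⟨g1, g2⟩, g3⟩
      · exfalso
        apply hne (l + 1) hl
        rw [hsucc, hsucc, show m = m - 1 + 1 by lia, Function.iterate_succ_apply',
          Function.iterate_succ_apply']
        rw [show m - 1 + 1 = m by lia, t1, t2, dbl_sideBase, dbl_sideBase]
        exact Sym2.eq_swap
  have hl : q - 2 < q - 1 := by lia
  have hfin : dbl^[m - 1] (dbl^[(q - 2) * m] x) = sideBase γ e ∧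
      dbl^[m - 1] (dbl^[(q - 2) * m] y) = sideBase α (!e) := by
    obtain ⟨⟨k1, k2⟩, k3⟩ := key (q - 2) hl
    rcases hS.strip_of_nothingBetween k1 k2 (hcp' _) (hne _ hl) k3 with
        ⟨t, t1, t2, t3⟩ | h
    · exfalso
      obtain ⟨-, -, g, -⟩ := hS.nothingBetween_iterate k1 k2 (hcp' _) k3 t1 t2 t3
      rw [← hsucc, ← hsucc, show q - 2 + 1 = q - 1 by lia, ← dblC_iter] at g
      obtain ⟨g1, g2⟩ := g hlast
      rw [← Function.iterate_add_apply] at g1 g2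
      exact hS.not_strip_of_mem_entireLam hR g1 g2
    · exact h
  refine ⟨fun l hl => (key l hl).1, hne, fun l hl => ?_, fun l hl => ?_, hfin.1, hfin.2⟩
  · obtain ⟨⟨k1, k2⟩, k3⟩ := key l hl
    exact hS.lobe_of_nothingBetween k1 k2 (hcp' l) k3
  · obtain ⟨⟨k1, k2⟩, k3⟩ := key l (by lia)
    rcases hS.strip_of_nothingBetween k1 k2 (hcp' l) (hne l (by lia)) k3 with
        ⟨t, t1, t2, t3⟩ | ⟨t1, t2⟩
    · exact ⟨t, t1, t2, t3.le⟩
    · exfalso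
      apply hne (l + 1) hl
      rw [hsucc, hsucc, show m = m - 1 + 1 by lia, Function.iterate_succ_apply',
        Function.iterate_succ_apply']
      rw [show m - 1 + 1 = m by lia, t1, t2, dbl_sideBase, dbl_sideBase]
      exact Sym2.eq_swap

end Leaf

/-! ### The pair of arcs follows the boundary leaf -/

/-- The position of the `i`-th iterates `x₁`, `x₂` of the ends of a boundary leaf, where `t` is the
symbol of these iterates. -/
def Location (m q : ℕ) (α γ : Angle) (e : Bool) (κ : ℕ → Bool) (i : ℕ) (t : Bool) (x₁ x₂ : Angle) :
    Prop :=
  ((i + 1) % m ≠ 0 ∧ t = κ i ∧ Lobe α γ t x₁ ∧ Lobe α γ t x₂) ∨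
  ((i + 1) % m = 0 ∧ t = e ∧ x₁ = sideBase γ e ∧ x₂ = sideBase α (!e)) ∨
  ((i + 1) % m = 0 ∧ i + 1 < (q - 1) * m ∧ ClosedStrip α γ t x₁ ∧ ClosedStrip α γ t x₂ ∧
    ccw (sideBase α t) x₁ ≤ ccw (sideBase α t) x₂ ∧ s(dbl x₁, dbl x₂) ≠ s(α, γ))

/-- The points `c₁`, `c₂`, `d₁`, `d₂` follow each other in the arc from `x₁` to `x₂`. -/
def Inside (x₁ x₂ c₁ c₂ d₁ d₂ : Angle) : Prop :=
  ccw x₁ c₁ < ccw x₁ c₂ ∧ ccw x₁ c₂ < ccw x₁ d₁ ∧ ccw x₁ d₁ < ccw x₁ d₂ ∧ ccw x₁ d₂ ≤ ccw x₁ x₂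

/-- If `p`, `q`, `y` follow each other starting from `x`, and `x`, `y` do so starting from `o`, then
`p`, `q`, `y` follow each other starting from `o`. -/
lemma ccw_le_of_ccw_le {o x y p q : Angle} (h1 : ccw o x ≤ ccw o y) (h2 : ccw x p ≤ ccw x q)
    (h3 : ccw x q ≤ ccw x y) : ccw o p ≤ ccw o q ∧ ccw o q ≤ ccw o y := by
  have b1 := ccw_base o x y
  have b2 := ccw_base o x p
  have b3 := ccw_base o x q
  grind [ccw_nonneg, ccw_lt_one]

namespace Leaf

variable {m : ℕ} {α γ : Angle} {e : Bool} {κ : ℕ → Bool}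

lemma κ_mod (hS : Leaf m α γ e κ) (l i : ℕ) : κ (l * m + i) = κ i := by
  have : Function.Periodic κ m := hS.sym_add
  rw [Nat.add_comm]
  exact this.nat_mul l i

lemma exists_location (hS : Leaf m α γ e κ) {q : ℕ} (hq : 2 ≤ q) {r₁ r₂ : Angle}
    (h : BoundaryOrbit m q α γ e κ r₁ r₂) {i : ℕ} (hi : i < q * m - 1) :
    ∃ t, Location m q α γ e κ i t (dbl^[i] r₁) (dbl^[i] r₂) := by
  have hm := hS.one_lt
  obtain ⟨l, r, hr, rfl⟩ : ∃ l r, r < m ∧ i = l * m + r :=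
    ⟨i / m, i % m, Nat.mod_lt _ (by lia), by rw [Nat.mul_comm]; exact (Nat.div_add_mod i m).symm⟩
  have hl : l < q := by
    by_contra hcon
    have : q * m ≤ l * m := Nat.mul_le_mul_right _ (by lia)
    lia
  have hmod : (l * m + r + 1) % m = (r + 1) % m := by
    rw [Nat.add_assoc, Nat.mul_add_mod']
  unfold Location
  rw [hmod, hS.κ_mod, Nat.add_comm (l * m) r, Function.iterate_add_apply,
    Function.iterate_add_apply]
  have hlast : dbl^[(q - 1) * m] r₁ = γ ∧ dbl^[(q - 1) * m] r₂ = α := by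
    have e1 : (q - 1) * m = 1 + (m - 1) + (q - 2) * m := by
      obtain ⟨q, rfl⟩ : ∃ k, q = k + 2 := ⟨q - 2, by lia⟩
      rw [show q + 2 - 1 = q + 1 by lia, Nat.add_sub_cancel, Nat.add_mul]
      lia
    rw [e1, Nat.add_assoc, Function.iterate_add_apply, Function.iterate_add_apply _ (m - 1),
      Function.iterate_add_apply _ 1, Function.iterate_add_apply _ (m - 1), h.last_left,
      h.last_right]
    simp
  by_cases hr' : r + 1 < m
  · refine ⟨κ r, Or.inl ⟨by rw [Nat.mod_eq_of_lt hr']; lia, rfl, ?_⟩⟩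
    by_cases hl' : l < q - 1
    · exact h.lobe l hl' r (by lia)
    · obtain rfl : l = q - 1 := by lia
      rw [hlast.1, hlast.2]
      exact ⟨hS.lobe_iterate (Or.inr rfl) r, hS.lobe_iterate (Or.inl rfl) r⟩
  · obtain rfl : r = m - 1 := by lia
    have hl' : l + 1 < q := by
      by_contra hcon
      obtain rfl : l = q - 1 := by lia
      have : q * m = (q - 1) * m + m := by
        obtain ⟨q, rfl⟩ : ∃ k, q = k + 1 := ⟨q - 1, by lia⟩
        rw [Nat.add_sub_cancel, Nat.add_mul, Nat.one_mul]
      lia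
    have hmm : m - 1 + 1 = m := by lia
    by_cases hl'' : l + 1 < q - 1
    · obtain ⟨t, t1, t2, t3⟩ := h.strip l hl''
      refine ⟨t, Or.inr (Or.inr ⟨by rw [hmm, Nat.mod_self], ?_, t1, t2, t3, ?_⟩)⟩
      · have : (l + 1) * m < (q - 1) * m := Nat.mul_lt_mul_of_pos_right hl'' (by lia)
        rw [Nat.add_mul] at this
        lia
      · have := h.ne (l + 1) hl''
        rwa [Nat.add_mul, Nat.one_mul, Nat.add_comm (l * m), Function.iterate_add_apply,
          Function.iterate_add_apply, ← hmm, Function.iterate_succ_apply',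
          Function.iterate_succ_apply', hmm] at this
    · obtain rfl : l = q - 2 := by lia
      exact ⟨e, Or.inr (Or.inl ⟨by rw [hmm, Nat.mod_self], rfl, h.last_left, h.last_right⟩)⟩

/-- A point of `[a, b]` that lies in the lobes at the proper times has the itinerary `v e v e …`. -/
lemma mem_tuned_of_lobe (hS : Leaf m α γ e κ) {q : ℕ} {a b : Angle} {e' : Bool} {κ' : ℕ → Bool}
    (hD : Leaf (q * m) a b e' κ') (h1 : 0 < ccw α a) (h2 : ccw α a < ccw α b)
    (h3 : ccw α b < ccw α γ) (hκ : ∀ i, κ' i = tuned m e κ i) {N : ℕ} (hN : N ≤ q * m - 1)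
    {β y : Angle} (hβ : Sb a β b) (hy : ccw a y ≤ ccw a b)
    (hL : ∀ i < N, (i + 1) % m ≠ 0 → Lobe α γ (κ i) (dbl^[i] y)) :
    ∀ i < N, dbl^[i] y ∈ symbolArc β (tuned m e κ i) := by
  have hβ' : Sb α β γ := by
    have := ccw_base α a β
    have := ccw_base α a b
    unfold Sb at *
    clear hS hD
    grind [ccw_nonneg, ccw_lt_one]
  intro i
  induction i using Nat.strong_induction_on with | _ i ih
  intro hi
  by_cases hmod : (i + 1) % m = 0
  · obtain ⟨l, hl⟩ := Nat.dvd_of_mod_eq_zero hmod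
    rw [Nat.mul_comm] at hl
    rw [tuned, if_pos hmod]
    obtain rfl : i = l * m - 1 := by lia
    refine hS.mem_of_tuned hD h1 h2 h3 hκ (l := l) ?_ ?_ hβ hβ hy ?_
    · rcases Nat.eq_zero_or_pos l with rfl | h
      · simp at hl
      · exact h
    · by_contra hcon
      have : q * m ≤ l * m := Nat.mul_le_mul_right _ (by lia)
      lia
    · intro j hj
      exact InHalf.of_mem (ih j hj (by lia))
  · rw [tuned, if_neg hmod]
    exact hS.mem_of_lobe hβ' (hL i hi hmod)

/-- The itinerary of a boundary leaf does not end with the word `v` at other times than its returns: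
otherwise the itinerary of `s(α, γ)` or of `s(a, b)` would be invariant under a shift, and a return
of the arc to itself would have to fix the ends. -/
lemma not_endsWith_of_location (hS : Leaf m α γ e κ) {q : ℕ} {a b : Angle} {e' : Bool}
    {κ' : ℕ → Bool} (hD : Leaf (q * m) a b e' κ') (h1 : 0 < ccw α a) (h2 : ccw α a < ccw α b)
    (h3 : ccw α b < ccw α γ) (hκ : ∀ i, κ' i = tuned m e κ i) {r₁ r₂ : Angle}
    (h : BoundaryOrbit m q α γ e κ r₁ r₂) (hr1 : ccw a r₁ ≤ ccw a r₂) (hr2 : ccw a r₂ ≤ ccw a b)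
    {ρ : ℕ → Bool} {i : ℕ} (hi : i < q * m - 1) (himod : (i + 1) % m ≠ 0)
    (hρ : ∀ j ≤ i, Location m q α γ e κ j (ρ j) (dbl^[j] r₁) (dbl^[j] r₂))
    (hret1 : ccw (dbl^[i + 1] r₁) α ≤ ccw (dbl^[i + 1] r₁) γ)
    (hret2 : ccw (dbl^[i + 1] r₁) γ ≤ ccw (dbl^[i + 1] r₁) (dbl^[i + 1] r₂)) :
    ¬ EndsWith m i κ ρ := by
  rintro ⟨k1, k2⟩
  have hm := hS.one_lt
  obtain ⟨l, r, hr, rfl⟩ : ∃ l r, r < m ∧ i = l * m + r :=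
    ⟨i / m, i % m, Nat.mod_lt _ (by lia), by rw [Nat.mul_comm]; exact (Nat.div_add_mod i m).symm⟩
  rw [Nat.add_assoc, Nat.mul_add_mod'] at himod
  have hr' : r + 1 < m := by
    by_contra hcon
    obtain rfl : r = m - 1 := by lia
    rw [show m - 1 + 1 = m by lia, Nat.mod_self] at himod
    exact himod rfl
  obtain ⟨l, rfl⟩ : ∃ k, l = k + 1 := by
    refine ⟨l - 1, ?_⟩
    rcases Nat.eq_zero_or_pos l with rfl | h
    · lia
    · lia
  have hlm : (l + 1) * m = l * m + m := by rw [Nat.add_mul, Nat.one_mul]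
  obtain ⟨f, hf⟩ : ∃ f, f = ρ (l * m + (m - 1)) := ⟨_, rfl⟩
  have hκ0 : ∀ j ≤ (l + 1) * m + r, (j + 1) % m ≠ 0 → ρ j = κ j := by
    intro j hj hmod
    rcases hρ j hj with h | h | h
    · exact h.2.1
    · exact absurd h.1 hmod
    · exact absurd h.1 hmod
  -- The last `m + r + 1` symbols belong to the sequence `v f v f …`, where `f` is the symbol before
  -- the last return.
  have hσ : ∀ u < m + r + 1, ρ (l * m + u) = tuned m f κ u := by
    intro u hu
    rw [tuned]
    by_cases hmod : (u + 1) % m = 0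
    · rw [if_pos hmod, hf]
      have : u = m - 1 := by
        obtain ⟨c, hc⟩ := Nat.dvd_of_mod_eq_zero hmod
        have : c = 1 := by
          rcases c with _ | _ | c
          · lia
          · rfl
          · exfalso
            rw [show m * (c + 1 + 1) = m * c + m + m by ring] at hc
            lia
        subst this
        lia
      rw [this]
    · rw [if_neg hmod, hκ0 _ (by lia) (by rwa [Nat.add_assoc, Nat.mul_add_mod']), hS.κ_mod]
  have hper : ∀ j, tuned m f κ (j + m) = tuned m f κ j := tuned_add m f hS.sym_add
  have hshift : ∀ j, tuned m f κ (j + (r + 1)) = tuned m f κ j := by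
    refine eq_shift_of_window hper (fun u hu => ?_) (by lia)
    rw [← hσ _ (by lia), tuned_of_lt (by lia), ← k2 u hu]
    congr 1
    lia
  -- For `f = e` the sequence `v e v e …` of `s(a, b)` would be invariant under the shift, and for
  -- `f = !e` that of `s(α, γ)`. In both cases the arc of this leaf would return to an arc around
  -- itself.
  by_cases hfe : f = e
  · rw [hfe] at hshift hper
    obtain ⟨β, hβ, -, -⟩ := exists_near (t := 1) (p := 1) hD.pos (by
      intro h
      have := Function.IsPeriodicPt.minimalPeriod_le (f := dbl) one_pos h
      rw [hD.per a (Or.inl rfl)] at this; lia) le_rfl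
    have hshift' : ∀ j, tuned m e κ (j + ((l + 1) * m + r + 1)) = tuned m e κ j := by
      intro j
      have hp : Function.Periodic (tuned m e κ) m := hper
      rw [show j + ((l + 1) * m + r + 1) = (j + (r + 1)) + (l + 1) * m by lia, ← hshift j]
      exact hp.nat_mul (l + 1) _
    have hD1 := fun j => hκ j ▸ hD.mem hβ (Or.inl rfl) j
    have hD2 := fun j => hκ j ▸ hD.mem hβ (Or.inr rfl) j
    have hlobe : ∀ j < (l + 1) * m + r + 1, (j + 1) % m ≠ 0 → Lobe α γ (κ j) (dbl^[j] r₁) ∧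
        Lobe α γ (κ j) (dbl^[j] r₂) := by
      intro j hj hmod
      rcases hρ j (by lia) with ⟨-, h, h'⟩ | h | h
      · exact h ▸ h'
      · exact absurd h.1 hmod
      · exact absurd h.1 hmod
    have hr1' := hS.mem_tuned_of_lobe hD h1 h2 h3 hκ (N := (l + 1) * m + r + 1) (by lia) hβ
      (hr1.trans hr2) (fun j hj hmod => (hlobe j hj hmod).1)
    have hr2' := hS.mem_tuned_of_lobe hD h1 h2 h3 hκ (N := (l + 1) * m + r + 1) (by lia) hβ
      hr2 (fun j hj hmod => (hlobe j hj hmod).2)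
    have o1 := (ccw_le_iter_iff (fun j _ => hD1 j) hr1' hr2').2 hr1
    have o2 := (ccw_le_iter_iff (fun j _ => hD1 j) hr2' (fun j _ => hD2 j)).2 hr2
    obtain ⟨g1, g2⟩ := ccw_le_of_ccw_le o1 hret1 hret2
    have b1 : ccw α a ≤ ccw α b := h2.le
    obtain ⟨g3, g4⟩ := ccw_le_of_ccw_le g1 b1 h3.le
    have key := eq_of_subset_iterate (β := β) (x := a) (y := b) (σ := tuned m e κ)
      (t := (l + 1) * m + r + 1) (P := q * m) (by lia) (hD.iterate_eq (Or.inl rfl))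
      (hD.iterate_eq (Or.inr rfl)) hD1 hD2 hshift' g3 (g4.trans (g2.trans o2))
    have := (show Function.IsPeriodicPt dbl ((l + 1) * m + r + 1) a from
      key.1).minimalPeriod_le (by lia)
    rw [hD.per _ (Or.inl rfl)] at this
    lia
  · have hfe : f = !e := by revert hfe; cases f <;> cases e <;> simp
    rw [hfe] at hshift
    have hκt : ∀ j, tuned m (!e) κ j = κ j := by
      intro j
      rw [tuned]
      split_ifs with hmod
      · obtain ⟨c, hc⟩ := Nat.dvd_of_mod_eq_zero hmod
        rcases c with _ | c
        · lia
        · have : j = c * m + (m - 1) := by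
            rw [Nat.mul_add, Nat.mul_comm m c] at hc
            lia
          rw [this, hS.κ_mod, hS.last]
      · rfl
    simp only [hκt] at hshift
    have hl' : l + 1 < q - 1 := by
      rcases hρ (l * m + (m - 1)) (by lia) with h | h | h
      · exfalso
        apply h.1
        rw [show l * m + (m - 1) + 1 = (l + 1) * m by lia, Nat.mul_mod_left]
      · have := h.2.1
        rw [← hf, hfe] at this
        revert this; cases e <;> simp
      · have := h.2.1
        rw [show l * m + (m - 1) + 1 = (l + 1) * m by lia] at this
        exact lt_of_mul_lt_mul_right this (Nat.zero_le _)
    obtain ⟨b1, b2⟩ := h.order (l + 1) hl'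
    have hlobe := h.lobe (l + 1) hl'
    have hα := fun j => hS.half_iterate (Or.inl rfl : α = α ∨ α = γ) j
    have hγ := fun j => hS.half_iterate (Or.inr rfl : γ = α ∨ γ = γ) j
    have hr1' : ∀ j < r + 1, Half α (κ j) (dbl^[j] (dbl^[(l + 1) * m] r₁)) := fun j hj =>
      (hS.lobe_iff_half.1 (hlobe j (by lia)).1).1
    have hr2' : ∀ j < r + 1, Half α (κ j) (dbl^[j] (dbl^[(l + 1) * m] r₂)) := fun j hj =>
      (hS.lobe_iff_half.1 (hlobe j (by lia)).2).1
    have o1 := (ccw_le_iter_iff_half (fun j _ => hα j) hr1' hr2').2 b1.le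
    have o2 := (ccw_le_iter_iff_half (fun j _ => hα j) hr2' (fun j _ => hγ j)).2 b2
    rw [← Function.iterate_add_apply, ← Function.iterate_add_apply] at o1
    rw [← Function.iterate_add_apply] at o2
    rw [show (l + 1) * m + r + 1 = r + 1 + (l + 1) * m by lia] at hret1 hret2
    obtain ⟨g1, g2⟩ := ccw_le_of_ccw_le o1 hret1 hret2
    obtain ⟨β, hβ, -, -⟩ := exists_near (t := 1) (p := 1) hS.pos (by
      intro h
      have := Function.IsPeriodicPt.minimalPeriod_le (f := dbl) one_pos h
      rw [hS.per α (Or.inl rfl)] at this; lia) le_rfl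
    have key := eq_of_subset_iterate (β := β) (x := α) (y := γ) (σ := κ)
      (t := r + 1) (P := m) (by lia) (hS.iterate_eq (Or.inl rfl))
      (hS.iterate_eq (Or.inr rfl)) (hS.mem hβ (Or.inl rfl)) (hS.mem hβ (Or.inr rfl)) hshift g1
      (g2.trans o2)
    have := (show Function.IsPeriodicPt dbl (r + 1) α from key.1).minimalPeriod_le (by lia)
    rw [hS.per _ (Or.inl rfl)] at this
    lia

end Leaf

/-- The analogue of `Together` for six points. -/
def SixTogether (α γ : Angle) (s : Bool) (x₁ x₂ c₁ c₂ d₁ d₂ : Angle) : Prop :=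
  (∀ p, (p = x₁ ∨ p = x₂ ∨ p = c₁ ∨ p = c₂ ∨ p = d₁ ∨ p = d₂) → Lobe α γ s p) ∨
  ((∀ p, (p = x₁ ∨ p = x₂ ∨ p = c₁ ∨ p = c₂ ∨ p = d₁ ∨ p = d₂) → ClosedStrip α γ s p) ∧
    ccw (sideBase α s) x₁ ≤ ccw (sideBase α s) x₂ ∧ s(dbl x₁, dbl x₂) ≠ s(α, γ))

lemma SixTogether.together {α γ : Angle} {s : Bool} {x₁ x₂ c₁ c₂ d₁ d₂ : Angle}
    (h : SixTogether α γ s x₁ x₂ c₁ c₂ d₁ d₂) : Together α γ s x₁ x₂ c₁ d₂ := by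
  rcases h with h | ⟨h, h'⟩
  · exact Or.inl ⟨h _ (by simp), h _ (by simp), h _ (by simp), h _ (by simp)⟩
  · exact Or.inr ⟨⟨h _ (by simp), h _ (by simp), h _ (by simp), h _ (by simp)⟩, h'⟩

namespace Leaf

variable {m : ℕ} {α γ : Angle} {e : Bool} {κ : ℕ → Bool}

/-- Doubling preserves the order of points in one closed piece. -/
lemma inside_dbl (hS : Leaf m α γ e κ) {s : Bool} {x₁ x₂ c₁ c₂ d₁ d₂ : Angle}
    (h : SixTogether α γ s x₁ x₂ c₁ c₂ d₁ d₂) (hin : Inside x₁ x₂ c₁ c₂ d₁ d₂) :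
    Inside (dbl x₁) (dbl x₂) (dbl c₁) (dbl c₂) (dbl d₁) (dbl d₂) := by
  have hlt := hS.lt
  have hpos := hS.pos
  have key : ∀ p r, (p = x₁ ∨ p = x₂ ∨ p = c₁ ∨ p = c₂ ∨ p = d₁ ∨ p = d₂) →
      (r = x₁ ∨ r = x₂ ∨ r = c₁ ∨ r = c₂ ∨ r = d₁ ∨ r = d₂) →
      (ccw (dbl x₁) (dbl p) ≤ ccw (dbl x₁) (dbl r) ↔ ccw x₁ p ≤ ccw x₁ r) := by
    intro p r hp hr
    rcases h with h | ⟨h, -⟩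
    · exact ccw_le_dbl_iff_half (hS.lobe_iff_half.1 (h _ (by simp))).1
        (hS.lobe_iff_half.1 (h _ hp)).1 (hS.lobe_iff_half.1 (h _ hr)).1
    · have h1 := h x₁ (by simp)
      have h2 := h p hp
      have h3 := h r hr
      unfold ClosedStrip at h1 h2 h3
      exact ccw_le_dbl_iff (o := sideBase α s) (by linarith) (by linarith) (by linarith)
  unfold Inside at *
  rwa [← not_le, ← not_le, ← not_le, key _ _ (by simp) (by simp), key _ _ (by simp) (by simp),
    key _ _ (by simp) (by simp), key _ _ (by simp) (by simp), not_le, not_le, not_le]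

/-- The points between the ends of the boundary leaf lie in the same piece when this piece is a
strip, or when the leaf is the second preimage of `s(α, γ)`. -/
lemma sixTogether_of_mod (hS : Leaf m α γ e κ) {q i : ℕ} {t : Bool} {x₁ x₂ c₁ c₂ d₁ d₂ : Angle}
    (h : Location m q α γ e κ i t x₁ x₂) (hmod : (i + 1) % m = 0)
    (hin : Inside x₁ x₂ c₁ c₂ d₁ d₂) : SixTogether α γ t x₁ x₂ c₁ c₂ d₁ d₂ := by
  have hlt := hS.lt
  have hpos := hS.pos
  obtain ⟨k1, k2, k3, k4⟩ := hin
  have hle : ∀ p, (p = x₁ ∨ p = x₂ ∨ p = c₁ ∨ p = c₂ ∨ p = d₁ ∨ p = d₂) → ccw x₁ p ≤ ccw x₁ x₂ := by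
    rintro p (rfl | rfl | rfl | rfl | rfl | rfl)
    · rw [ccw_self]; exact ccw_nonneg _ _
    all_goals linarith
  rcases h with h | ⟨-, rfl, rfl, rfl⟩ | ⟨-, -, h1, h2, h3, h4⟩
  · exact absurd hmod h.1
  · refine Or.inl fun p hp => ?_
    have h1 := hle p hp
    rw [ccw_base (sideBase α t) _ (sideBase α !t), hS.ccw_sideBase, sideBase_not,
      ccw_self_add_oneHalf, if_pos (by linarith)] at h1
    exact h1
  · refine Or.inr ⟨fun p hp => ?_, h3, h4⟩
    have h5 := hle p hp
    unfold ClosedStrip at *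
    have b1 := ccw_base (sideBase α t) x₁ p
    have b2 := ccw_base (sideBase α t) x₁ x₂
    rw [if_pos h3] at b2
    have := ccw_nonneg (sideBase α t) x₁
    have := ccw_nonneg (sideBase α t) p
    clear hS hle
    grind

/-- A pair of arcs that is visible from the boundary leaf follows this leaf: otherwise the chord
that bounds the lobe which the pair leaves first would pull back to a chord that hides the pair. -/
theorem sixTogether_of_visible (hS : Leaf m α γ e κ) {q : ℕ} {a b : Angle} {e' : Bool}
    {κ' : ℕ → Bool} (hD : Leaf (q * m) a b e' κ') (h1 : 0 < ccw α a) (h2 : ccw α a < ccw α b)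
    (h3 : ccw α b < ccw α γ) (hκ : ∀ i, κ' i = tuned m e κ i) {r₁ r₂ : Angle}
    (h : BoundaryOrbit m q α γ e κ r₁ r₂) (hr1 : ccw a r₁ ≤ ccw a r₂) (hr2 : ccw a r₂ ≤ ccw a b)
    {v : List Bool} (hv : IsWordV m s(α, γ) v) {n : ℕ} (hn : n < q * m - 1) {ω : ℕ → Bool}
    {x : Bool} {c₁ c₂ d₁ d₂ : Angle} (hV : StripPair α γ n ω x c₁ c₂ d₁ d₂)
    (hin : Inside r₁ r₂ c₁ c₂ d₁ d₂)
    (hvis : ¬ ∃ Q₁ Q₂ i, IsDynamicPair m s(α, γ) v Q₁ Q₂ ∧ IsStep s(α, γ) Q₁ Q₂ i ∧ i < n + 1 ∧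
      (Q₁ = s(r₁, r₂) ∨ Separates Q₁ s(r₁, r₂) s(c₁, d₂)))
    {ρ : ℕ → Bool} (hρ : ∀ j < q * m - 1, Location m q α γ e κ j (ρ j) (dbl^[j] r₁) (dbl^[j] r₂)) :
    ∀ i ≤ n, Inside (dbl^[i] r₁) (dbl^[i] r₂) (dbl^[i] c₁) (dbl^[i] c₂) (dbl^[i] d₁) (dbl^[i] d₂) ∧
      ∀ j < i, SixTogether α γ (ρ j) (dbl^[j] r₁) (dbl^[j] r₂) (dbl^[j] c₁) (dbl^[j] c₂)
        (dbl^[j] d₁) (dbl^[j] d₂) := by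
  have hlt := hS.lt
  have hpos := hS.pos
  intro i
  induction i with
  | zero => exact fun _ => ⟨hin, by simp⟩
  | succ i ih =>
    intro hi
    obtain ⟨ih1, ih2⟩ := ih (by lia)
    suffices hsix : SixTogether α γ (ρ i) (dbl^[i] r₁) (dbl^[i] r₂) (dbl^[i] c₁) (dbl^[i] c₂)
        (dbl^[i] d₁) (dbl^[i] d₂) by
      simp only [Function.iterate_succ_apply']
      refine ⟨hS.inside_dbl hsix ih1, fun j hj => ?_⟩
      rcases Nat.lt_succ_iff_lt_or_eq.1 hj with hj | rfl
      · exact ih2 j hj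
      · exact hsix
    have hloc := hρ i (by lia)
    by_cases hmod : (i + 1) % m = 0
    · exact hS.sixTogether_of_mod hloc hmod ih1
    obtain ⟨-, hρi, l1, l2⟩ : (i + 1) % m ≠ 0 ∧ ρ i = κ i ∧ Lobe α γ (ρ i) (dbl^[i] r₁) ∧
        Lobe α γ (ρ i) (dbl^[i] r₂) := by
      rcases hloc with h | h | h
      · exact h
      · exact absurd h.1 hmod
      · exact absurd h.1 hmod
    by_contra hcon
    -- the pair leaves the lobe of the boundary leaf at the time `i`
    have hout : ∀ p, (p = c₁ ∨ p = c₂ ∨ p = d₁ ∨ p = d₂) → ¬ Lobe α γ (ρ i) (dbl^[i] p) := by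
      intro p hp hL
      have hall : ∀ z, (z = c₁ ∨ z = c₂ ∨ z = d₁ ∨ z = d₂) → Lobe α γ (ρ i) (dbl^[i] z) := by
        rcases hV.piece i (by lia) with h | h
        · have : ω i = ρ i :=
            ((hS.lobe_iff_half.1 (h p hp)).1).unique (hS.lobe_iff_half.1 hL).1
          exact this ▸ h
        · exact absurd (h p hp) (hS.not_strip_of_lobe hL)
      apply hcon
      left
      rintro z (rfl | rfl | rfl | rfl | rfl | rfl)
      · exact l1
      · exact l2
      all_goals exact hall _ (by simp)
    obtain ⟨i1, i2, i3, i4⟩ := ih1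
    have hpc : ∃ t, ClosedPiece α γ t (dbl^[i] c₁) (dbl^[i] d₂) := by
      rcases hV.piece i (by lia) with h | h
      · exact ⟨ω i, Or.inl ⟨h _ (by simp), h _ (by simp)⟩⟩
      · exact ⟨ω i, Or.inr ⟨(h _ (by simp)).closed, (h _ (by simp)).closed⟩⟩
    obtain ⟨t, ht⟩ := hpc
    have hch := hS.chain_of_not_lobe l1 l2 ht (i1.trans (i2.trans i3)) i4
      (fun h => hout c₁ (by simp) h.1)
    -- `s(w₁, w₂)` is the pull-back of the chord that bounds the lobe.
    obtain ⟨w₁, w₂, hw, hw1, hw2, hwp, hch'⟩ := hS.exists_pull_between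
      (hS.mem_genLam_pred (ρ i)) (fun j hj => (ih2 j hj).together) hch
    have hret : ccw (dbl^[i + 1] r₁) α ≤ ccw (dbl^[i + 1] r₁) γ ∧
        ccw (dbl^[i + 1] r₁) γ ≤ ccw (dbl^[i + 1] r₁) (dbl^[i + 1] r₂) := by
      have g1 := (hS.lobe_iff_half.1 l1).1
      have g2 := (hS.lobe_iff_half.1 l2).1
      have g3 : Half α (ρ i) (sideBase α (!ρ i)) := by
        have := half_sideBase_left α (!ρ i)
        rwa [Bool.not_not] at this
      have g4 := hS.half_sideBase_right (ρ i)
      have f1 := ccw_le_dbl_iff_half g1 g3 g4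
      have f2 := ccw_le_dbl_iff_half g1 g4 g2
      rw [dbl_sideBase, dbl_sideBase] at f1
      rw [dbl_sideBase] at f2
      rw [Function.iterate_succ_apply', Function.iterate_succ_apply', f1, f2]
      exact ⟨hch.1.trans (hch.2.1.le.trans hch.2.2.1), hch.2.2.2⟩
    have hE : ¬ EndsWith m i κ ρ := hS.not_endsWith_of_location hD h1 h2 h3 hκ h hr1 hr2
      (by lia) hmod (fun j hj => hρ j (by lia)) hret.1 hret.2
    obtain ⟨C₁, C₂, D₁, D₂, hP⟩ : ∃ C₁ C₂ D₁ D₂, StripPair α γ i ρ (!ρ i) C₁ C₂ D₁ D₂ := by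
      obtain ⟨x', C₁, C₂, D₁, D₂, hP⟩ := hS.exists_stripPair hE
      by_cases hx : x' = !ρ i
      · exact ⟨C₁, C₂, D₁, D₂, hx ▸ hP⟩
      · refine ⟨D₁, D₂, C₁, C₂, ?_⟩
        have : (!x') = !ρ i := by revert hx; cases x' <;> cases ρ i <;> simp
        exact this ▸ hP.symm hpos
    have hhalf : ∀ p, (p = C₁ ∨ p = C₂ ∨ p = D₁ ∨ p = D₂) → ∀ j < i, Half α (ρ j) (dbl^[j] p) := by
      intro p hp j hj
      rcases hP.piece j hj with h | h
      · exact (hS.lobe_iff_half.1 (h p hp)).1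
      · exact (hS.strip_iff_half.1 (h p hp)).1
    -- It is the longer chord of the dynamic pair for the word `ρ₀ … ρ_(i-1)`, of Step `i + 1 ≤ n`.
    have e1 : w₁ = C₁ := eq_of_half (fun j hj => (hS.piece_iff_half.1 (hwp j hj)).1)
      (hhalf C₁ (by simp)) (by rw [hw1, hP.c₁_iter])
    have e2 : w₂ = D₂ := eq_of_half (fun j hj => (hS.piece_iff_half.1 (hwp j hj)).2.1)
      (hhalf D₂ (by simp)) (by rw [hw2, hP.d₂_iter, Bool.not_not])
    subst e1 e2
    have hr : ccw r₁ r₂ < 1 / 2 := by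
      have := ccw_base a r₁ r₂
      rw [if_pos hr1] at this
      linarith [hD.lt, ccw_nonneg a r₁]
    obtain ⟨f1, f2, f3, f4⟩ := hch'
    have hlen : chordLength s(C₂, D₁) ≤ chordLength s(w₁, w₂) := by
      have b1 := ccw_base r₁ w₁ w₂
      have b2 := ccw_base w₁ C₂ D₁
      have g1 := hP.lt_d₁
      have g2 := hP.lt_d₂
      rw [if_pos (by linarith)] at b1 b2
      have := ccw_nonneg r₁ w₁
      have := ccw_nonneg w₁ C₂
      rw [chordLength_mk, chordLength_mk, min_eq_left (by linarith), min_eq_left (by linarith)]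
      linarith
    refine hvis ⟨s(w₁, w₂), s(C₂, D₁), i + 1, hS.isDynamicPair_stripPair hv hP hE hlen,
      hS.isStep_stripPair hP, by lia, ?_⟩
    by_cases hR : s(w₁, w₂) = s(r₁, r₂)
    · exact Or.inl hR
    · refine Or.inr (separates_of_nested (o := r₁) ?_ f1 f2 f3 f4 hR ?_)
      · rw [ccw_self]; exact ccw_nonneg _ _
      · intro hne
        have k := hS.lobe_left (!ρ i)
        rw [Bool.not_not, ← hw1] at k
        rcases Sym2.eq_iff.1 hne with ⟨rfl, -⟩ | ⟨rfl, -⟩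
        · exact hout _ (by simp) k
        · exact hout _ (by simp) k

end Leaf

/-! ### The last return -/

namespace Leaf

variable {m : ℕ} {α γ : Angle} {e : Bool} {κ : ℕ → Bool}

/-- The closed pieces with points in both closed strips are lobes, and these points are the ends of
the chord that bounds the lobe. -/
lemma eq_of_closedPiece_of_strips (hS : Leaf m α γ e κ) {t x : Bool} {p p' : Angle}
    (h : ClosedStrip α γ x p) (h' : ClosedStrip α γ (!x) p') (hp : ClosedPiece α γ t p p') :
    (p = sideBase α x ∧ p' = sideBase γ (!x)) ∨ (p = sideBase γ x ∧ p' = sideBase α (!x)) := by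
  have hlt := hS.lt
  have hpos := hS.pos
  have e1 := hS.ccw_sideBase x
  have e2 : ccw (sideBase α x) (sideBase α (!x)) = 1 / 2 := by
    rw [sideBase_not, ccw_self_add_oneHalf]
  have e3 := hS.ccw_sideBase_not x
  have hp : ClosedPiece α γ x p p' ∨ ClosedPiece α γ (!x) p p' := by
    by_cases hst : t = x
    · exact Or.inl (hst ▸ hp)
    · have : t = !x := by revert hst; cases t <;> cases x <;> simp
      exact Or.inr (this ▸ hp)
  rw [ccw_inj_iff' (sideBase α x) p, ccw_inj_iff' (sideBase α x) p',
    ccw_inj_iff' (sideBase α x) p, ccw_inj_iff' (sideBase α x) p', e1, e2, e3, ccw_self]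
  rw [hS.closedStrip_not_iff] at h'
  rw [ClosedPiece, ClosedPiece, hS.lobe_iff, hS.lobe_iff, hS.lobe_not_iff, hS.lobe_not_iff,
        hS.closedStrip_not_iff, hS.closedStrip_not_iff, ClosedStrip, ClosedStrip] at hp
  unfold ClosedStrip at h
  have := ccw_nonneg (sideBase α x) p
  clear hS
  grind

/-- The lengths of the arcs of a pair, and of their images under `h^n`. -/
lemma two_pow_mul_ccw (hS : Leaf m α γ e κ) {n : ℕ} {ω : ℕ → Bool} {x : Bool}
    {c₁ c₂ d₁ d₂ : Angle} (h : StripPair α γ n ω x c₁ c₂ d₁ d₂) :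
    2 ^ n * ccw c₁ c₂ = ccw α γ / 2 ∧ 0 < ccw c₁ c₂ ∧ ccw c₁ c₂ ≤ ccw α γ / 2 := by
  have hpos := hS.pos
  have hM : (1 : ℝ) ≤ 2 ^ n := one_le_pow₀ (by norm_num)
  have hc1 : 2 ^ n * ccw c₁ c₂ = ccw α γ / 2 := by rw [h.ccw_c, pow_succ]; field_simp
  refine ⟨hc1, by rw [h.ccw_c]; positivity, ?_⟩
  nlinarith only [hc1, hM, ccw_nonneg c₁ c₂]

/-- `h^n` maps the arc `[c₁, c₂]` linearly onto the closed strip. -/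
lemma mem_arc_of_stripPair (hS : Leaf m α γ e κ) {n : ℕ} {ω : ℕ → Bool} {x : Bool}
    {c₁ c₂ d₁ d₂ y : Angle} (h : StripPair α γ n ω x c₁ c₂ d₁ d₂) (hy : ccw c₁ y ≤ ccw c₁ c₂) :
    ccw (sideBase α x) (dbl^[n] y) = 2 ^ n * ccw c₁ y ∧ ClosedStrip α γ x (dbl^[n] y) := by
  have hlt := hS.lt
  obtain ⟨h1, h2, h3⟩ := hS.two_pow_mul_ccw h
  have h4 : 2 ^ n * ccw c₁ y ≤ ccw α γ / 2 := by
    rw [← h1]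
    exact mul_le_mul_of_nonneg_left hy (by positivity)
  have := ccw_iter_of_lt (n := n) (x := c₁) (y := y) (by linarith)
  rw [h.c₁_iter] at this
  exact ⟨this, by unfold ClosedStrip; rw [this]; exact h4⟩

/-- A dynamic pair is visible from a leaf only if its arcs lie in the arc behind the leaf. -/
lemma inside_of_behind (hS : Leaf m α γ e κ) {n : ℕ} {ω : ℕ → Bool} {x : Bool}
    {c₁ c₂ d₁ d₂ r₁ r₂ : Angle} (h : StripPair α γ n ω x c₁ c₂ d₁ d₂) (hr : ccw r₁ r₂ < 1 / 2)
    (hcp : ∀ i, ∃ t, ClosedPiece α γ t (dbl^[i] r₁) (dbl^[i] r₂))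
    (hb : Behind s(c₂, d₁) s(r₁, r₂)) (hlen : chordLength s(c₂, d₁) ≤ chordLength s(c₁, d₂)) :
    Inside r₁ r₂ c₁ c₂ d₁ d₂ := by
  have hlt := hS.lt
  obtain ⟨h1, h2, h3⟩ := hS.two_pow_mul_ccw h
  have hd : ccw d₁ d₂ = ccw c₁ c₂ := by rw [h.ccw_c, h.ccw_d]
  have k1 := h.lt_d₁
  have k2 := h.lt_d₂
  have hx := hS.not_crosses_of_mem hcp (hS.mem_stripPair h)
  rw [behind_mk hr] at hb
  obtain ⟨⟨b1, b2⟩, b3⟩ := hb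
  have hne : ¬ (r₁ = c₂ ∧ r₂ = d₁) := by
    rintro ⟨rfl, rfl⟩
    unfold Sb at b3
    rw [ccw_self] at b3
    rcases b3 with b3 | b3 <;> linarith [b3.1, b3.2]
  have f0 := ccw_base c₁ d₁ d₂
  have f1 := ccw_base c₁ c₂ d₁
  have f2 := ccw_base c₁ r₁ r₂
  have f3 := ccw_base c₁ r₁ c₂
  have f4 := ccw_base c₁ r₁ d₁
  have f5 := ccw_base c₁ r₁ d₂
  have f6 := ccw_base c₁ r₁ c₁
  rw [ccw_self] at f6
  rw [chordLength_mk, chordLength_mk] at hlen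
  rw [if_pos k1.le] at f1
  rw [if_pos k2.le, hd] at f0
  by_cases hq : ccw c₁ r₁ ≤ ccw c₁ c₂ ∧ ccw c₁ d₁ ≤ ccw c₁ r₂ ∧ ccw c₁ r₂ ≤ ccw c₁ d₂
  · obtain ⟨q1, q2, q3⟩ := hq
    have g1 := (hS.mem_arc_of_stripPair h q1).2
    have f7 := ccw_base c₁ d₁ r₂
    rw [if_pos q2] at f7
    have g2 := (hS.mem_arc_of_stripPair (h.symm hS.pos) (y := r₂) (by linarith)).2
    obtain ⟨t, ht⟩ := hcp n
    have hlast : r₁ = c₁ ∧ r₂ = d₂ := by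
      have g3 := (hS.mem_arc_of_stripPair h q1).1
      have g4 := (hS.mem_arc_of_stripPair (h.symm hS.pos) (y := r₂) (by linarith)).1
      have hM : (2 : ℝ) ^ n ≠ 0 := by positivity
      rcases hS.eq_of_closedPiece_of_strips g1 g2 ht with ⟨g5, g6⟩ | ⟨g5, g6⟩
      · rw [g5, ccw_self, eq_comm, mul_eq_zero_iff_left hM, ccw_eq_zero] at g3
        rw [g6, hS.ccw_sideBase, ← h1] at g4
        have g4 := mul_left_cancel₀ hM g4
        exact ⟨g3, ccw_inj (a := d₁) (by rw [← g4, hd])⟩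
      · exfalso
        apply hne
        rw [g6, ccw_self, eq_comm, mul_eq_zero_iff_left hM, ccw_eq_zero] at g4
        rw [g5, hS.ccw_sideBase, ← h1] at g3
        exact ⟨(ccw_inj (mul_left_cancel₀ hM g3)).symm, g4⟩
    obtain ⟨rfl, rfl⟩ := hlast
    unfold Inside
    rw [ccw_self]
    exact ⟨h2, k1, k2, le_rfl⟩
  · unfold Inside
    have hxc : ccw c₁ r₁ ≠ ccw c₁ r₂ := by
      intro he
      rw [ccw_inj he] at hne b3
      unfold Sb at b3
      rw [ccw_self] at b3
      rcases b3 with b3 | b3 <;> linarith [b3.1, b3.2]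
    rw [crosses_coord (o := c₁) hxc, ccw_self] at hx
    have := ccw_nonneg c₁ r₁
    have := ccw_nonneg c₁ r₂
    have := ccw_lt_one c₁ r₁
    have := ccw_lt_one c₁ r₂
    have := ccw_lt_one c₁ d₂
    unfold Sb at b3
    have hg : ccw c₁ d₁ - ccw c₁ c₂ ≤ 1 / 2 - ccw c₁ c₂ := by
      rw [f1] at hlen
      clear hS h hx f2 f3 f4 f5 f6 b1 b2 b3
      grind
    clear hS h hlen hcp h1 hne
    rw [f2, f3, f4, f5, f6]
    rw [f2, f3] at b1
    rw [f2, f4] at b2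
    rw [f2, f3, f4] at b3
    rw [f2] at hr
    clear f2 f3 f4 f5 f6
    generalize ccw c₁ r₁ = X at *
    generalize ccw c₁ r₂ = Y at *
    generalize ccw c₁ d₁ = D at *
    generalize ccw c₁ d₂ = D' at *
    generalize ccw c₁ c₂ = C at *
    rcases lt_or_gt_of_ne hxc with h | h
    · rw [min_eq_left h.le, max_eq_right h.le] at hx
      grind (splits := 40)
    · rw [min_eq_right h.le, max_eq_left h.le] at hx
      grind (splits := 40)

/-- In a lobe, the property of being at least as long as `s(α, γ)` is preserved. -/
lemma le_ccw_dbl_of_lobe (hS : Leaf m α γ e κ) {t : Bool} {x y : Angle} (hx : Lobe α γ t x)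
    (hy : Lobe α γ t y) (h : ccw α γ ≤ ccw x y) : ccw α γ ≤ ccw (dbl x) (dbl y) := by
  have b1 := ccw_dbl x y
  have b2 := ccw_base (sideBase γ t) x y
  have hlt := hS.lt
  have hpos := hS.pos
  unfold Lobe at *
  clear hS
  grind [ccw_nonneg, ccw_lt_one]

/-- If the pair of arcs follows the boundary leaf until it is mapped onto the strips, then this
happens neither at a return, nor before the last but one return period. -/
lemma last_return (hS : Leaf m α γ e κ) {q : ℕ} {r₁ r₂ : Angle}
    (h : BoundaryOrbit m q α γ e κ r₁ r₂) {n j k : ℕ} {ω : ℕ → Bool} {x : Bool}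
    {c₁ c₂ d₁ d₂ : Angle} (hV : StripPair α γ n ω x c₁ c₂ d₁ d₂) (hn : n + 1 = j * m + k)
    (hk : k < m) {t : Bool} (hρ : Location m q α γ e κ n t (dbl^[n] r₁) (dbl^[n] r₂))
    (hin : Inside (dbl^[n] r₁) (dbl^[n] r₂) (dbl^[n] c₁) (dbl^[n] c₂) (dbl^[n] d₁) (dbl^[n] d₂)) :
    k ≠ 0 ∧ q ≤ j + 2 := by
  have hlt := hS.lt
  have hpos := hS.pos
  have hm := hS.one_lt
  have e2 : ccw (sideBase α x) (sideBase α (!x)) = 1 / 2 := by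
    rw [sideBase_not, ccw_self_add_oneHalf]
  -- At a return, all points lie in one closed piece, which cannot contain both points above `α`.
  have hk0 : k ≠ 0 := by
    rintro rfl
    have hsix := hS.sixTogether_of_mod hρ (by rw [hn]; simp) hin
    rw [hV.c₁_iter, hV.d₁_iter] at hsix
    have hp : (Lobe α γ x (sideBase α x) ∧ Lobe α γ x (sideBase α (!x)) ∨
        Lobe α γ (!x) (sideBase α x) ∧ Lobe α γ (!x) (sideBase α (!x))) ∨
        (ClosedStrip α γ x (sideBase α x) ∧ ClosedStrip α γ x (sideBase α (!x)) ∨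
        ClosedStrip α γ (!x) (sideBase α x) ∧ ClosedStrip α γ (!x) (sideBase α (!x))) := by
      by_cases hst : t = x
      · subst hst
        rcases hsix with h | ⟨h, -⟩
        · exact Or.inl (Or.inl ⟨h _ (by simp), h _ (by simp)⟩)
        · exact Or.inr (Or.inl ⟨h _ (by simp), h _ (by simp)⟩)
      · obtain rfl : t = !x := by revert hst; cases t <;> cases x <;> simp
        rcases hsix with h | ⟨h, -⟩
        · exact Or.inl (Or.inr ⟨h _ (by simp), h _ (by simp)⟩)
        · exact Or.inr (Or.inr ⟨h _ (by simp), h _ (by simp)⟩)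
    rw [hS.lobe_iff, hS.lobe_iff, hS.lobe_not_iff, hS.lobe_not_iff, ClosedStrip, ClosedStrip,
      hS.closedStrip_not_iff, hS.closedStrip_not_iff, e2, ccw_self] at hp
    grind
  refine ⟨hk0, ?_⟩
  by_contra hq
  have hj : j + 1 < q - 1 := by lia
  -- The boundary leaf is around the strips at the time `n`, so it is longer than `s(α, γ)`. It
  -- stays so until the next return; but a strip is shorter.
  obtain ⟨t', t1, t2, t3⟩ := h.strip j hj
  have key : ∀ u, k - 1 + u ≤ m - 1 → ccw α γ ≤
      ccw (dbl^[k - 1 + u] (dbl^[j * m] r₁)) (dbl^[k - 1 + u] (dbl^[j * m] r₂)) := by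
    intro u
    induction u with
    | zero =>
      intro _
      rw [← Function.iterate_add_apply, ← Function.iterate_add_apply, Nat.add_zero,
        show k - 1 + j * m = n by lia]
      rw [hV.c₁_iter, hV.c₂_iter, hV.d₁_iter, hV.d₂_iter] at hin
      obtain ⟨i1, i2, i3, i4⟩ := hin
      have b := ccw_base (dbl^[n] r₁) (sideBase α x) (sideBase γ (!x))
      rw [hS.ccw_sideBase_not, if_pos (by linarith)] at b
      linarith [ccw_nonneg (dbl^[n] r₁) (sideBase α x)]
    | succ u ih =>
      intro hu
      have hl := h.lobe j (by lia) (k - 1 + u) (by lia)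
      rw [← Nat.add_assoc, Function.iterate_succ_apply', Function.iterate_succ_apply']
      exact hS.le_ccw_dbl_of_lobe hl.1 hl.2 (ih (by lia))
  have h1 := key (m - 1 - (k - 1)) (by lia)
  rw [show k - 1 + (m - 1 - (k - 1)) = m - 1 by lia,
    ccw_base (sideBase α t') (dbl^[m - 1] (dbl^[j * m] r₁)), if_pos t3] at h1
  unfold ClosedStrip at t2
  linarith [ccw_nonneg (sideBase α t') (dbl^[m - 1] (dbl^[j * m] r₁))]

end Leaf

/-! ### Visible dynamic pairs -/

/-- The data of a dynamic pair, with arcs `[c₁, c₂]` and `[d₁, d₂]`, that is visible from the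
boundary leaf `s(r₁, r₂)` assigned to the leaf `s(a, b)` which is immediately visible from
`s(α, γ)`. The sequence `ρ` consists of the symbols of the iterates of the boundary leaf; by `six`
the pair stays in the same closed pieces until it is mapped onto the strips. -/
structure VisiblePair (m q n : ℕ) (α γ a b r₁ r₂ c₁ c₂ d₁ d₂ : Angle) (e e' x : Bool)
    (κ κ' ω ρ : ℕ → Bool) : Prop where
  leaf : Leaf m α γ e κ
  leafB : Leaf (q * m) a b e' κ'
  a_pos : 0 < ccw α a
  b_lt : ccw α b < ccw α γ
  tuned_eq : ∀ i, κ' i = tuned m e κ i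
  a_le : ccw α a ≤ ccw α r₁
  r_lt : ccw α r₁ < ccw α r₂
  le_b : ccw α r₂ ≤ ccw α b
  loc : ∀ i < q * m - 1, Location m q α γ e κ i (ρ i) (dbl^[i] r₁) (dbl^[i] r₂)
  pair : StripPair α γ n ω x c₁ c₂ d₁ d₂
  lt : n < q * m - 1
  mod_ne : (n + 1) % m ≠ 0
  inside : ∀ i ≤ n, Inside (dbl^[i] r₁) (dbl^[i] r₂) (dbl^[i] c₁) (dbl^[i] c₂) (dbl^[i] d₁)
    (dbl^[i] d₂)
  six : ∀ i < n, SixTogether α γ (ρ i) (dbl^[i] r₁) (dbl^[i] r₂) (dbl^[i] c₁) (dbl^[i] c₂)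
    (dbl^[i] d₁) (dbl^[i] d₂)

/-- The coordinates of a leaf, an immediately visible leaf, its boundary leaf and a visible dynamic
pair, and the bounds for the Step of the latter. -/
theorem exists_visiblePair {m q j k : ℕ} {S B R S₁ S₂ : Chord} {v : List Bool}
    (hS₀ : IsParamLeaf m S) (hv : IsWordV m S v) (hq : 2 ≤ q) (hB : IsParamLeaf (q * m) B)
    (hBS : ImmediatelyVisible S B) (hR : IsRB m S q B R) (hpair : IsDynamicPair m S v S₁ S₂)
    (hstep : IsStep S S₁ S₂ (j * m + k)) (hvis : PairVisible m S v R S₁ S₂ (j * m + k))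
    (hn : 2 ≤ j * m + k) (hj : j < q) (hk : k < m) :
    (k ≠ 0 ∧ q ≤ j + 2) ∧ ∃ n α γ a b r₁ r₂ c₁ c₂ d₁ d₂ e e' x κ κ' ω ρ, n + 1 = j * m + k ∧
      S = s(α, γ) ∧ B = s(a, b) ∧ S₁ = s(c₁, d₂) ∧ S₂ = s(c₂, d₁) ∧
      VisiblePair m q n α γ a b r₁ r₂ c₁ c₂ d₁ d₂ e e' x κ κ' ω ρ := by
  obtain ⟨α, γ, e, κ, rfl, hS⟩ := exists_leaf hS₀
  obtain ⟨a, b, e', κ', rfl, hD⟩ := exists_leaf hB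
  have hm := hS.one_lt
  have hqm : q * m ≠ m := by nlinarith
  obtain ⟨h1, h2, h3⟩ := hS.order_of_behind hD hqm hBS.1
  have hκ := hS.tuned_of_immediatelyVisible hq hD hBS
  obtain ⟨⟨hRe, -, hRsep⟩, ⟨hRlast, hRfirst⟩, hRB, -⟩ := hR
  -- the ends of the boundary leaf
  obtain ⟨r₁, r₂, rfl, hr1, hr2⟩ : ∃ r₁ r₂, R = s(r₁, r₂) ∧ ccw a r₁ < ccw a r₂ ∧
      ccw a r₂ ≤ ccw a b := by
    induction R using Sym2.ind with | _ x y
    have hne := (hS.exists_seq_of_mem_entireLam hRe).1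
    rw [behind_mk hD.lt] at hRB
    rcases lt_trichotomy (ccw a x) (ccw a y) with h | h | h
    · exact ⟨x, y, rfl, h, hRB.1.2⟩
    · exact absurd (ccw_inj h) hne
    · exact ⟨y, x, Sym2.eq_swap, h, hRB.1.1⟩
  obtain ⟨g1, g2⟩ := ccw_le_of_ccw_le h2.le hr1.le hr2
  obtain ⟨g0, -⟩ := ccw_le_of_ccw_le (p := a) (q := r₁) h2.le (by rw [ccw_self]; exact ccw_nonneg _ _)
    (hr1.le.trans hr2)
  have g1' : ccw α r₁ < ccw α r₂ := lt_of_le_of_ne g1 fun h => by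
    rw [ccw_inj h] at hr1; exact lt_irrefl _ hr1
  -- A chord between `s(α, γ)` and the boundary leaf would separate them.
  have hNB : NothingBetween m α γ r₁ r₂ := by
    intro z₁ z₂ hz hc
    by_contra hcon
    rw [not_or] at hcon
    obtain ⟨f1, f2, f3, f4⟩ := hc
    exact hRsep _ (Or.inl hz) (separates_of_nested (o := α) (by rw [ccw_self]; exact ccw_nonneg _ _)
      f1 f2 f3 f4 hcon.1 hcon.2)
  have hO := hS.boundaryOrbit hq hRe g1' (by linarith) hNB hRlast hRfirst
  have hrlt : ccw r₁ r₂ < 1 / 2 := by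
    have := ccw_base a r₁ r₂
    rw [if_pos hr1.le] at this
    linarith [hD.lt, ccw_nonneg a r₁]
  obtain ⟨n, hn'⟩ : ∃ n, n + 1 = j * m + k := ⟨j * m + k - 1, by lia⟩
  have hnq : n < q * m - 1 := by
    have : (j + 1) * m ≤ q * m := Nat.mul_le_mul_right _ (by lia)
    rw [Nat.add_mul, Nat.one_mul] at this
    lia
  rw [← hn'] at hstep hvis
  obtain ⟨ω, x, c₁, c₂, d₁, d₂, -, hP, rfl, rfl, hlen⟩ :=
    hS.exists_stripPair_of_isDynamicPair hv hpair hstep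
  have hin := hS.inside_of_behind hP hrlt (hS.closedPiece_of_mem_entireLam hRe) hvis.1 hlen
  have hloc : ∃ ρ : ℕ → Bool, ∀ i < q * m - 1,
      Location m q α γ e κ i (ρ i) (dbl^[i] r₁) (dbl^[i] r₂) := by
    have : ∀ i, ∃ t, i < q * m - 1 → Location m q α γ e κ i t (dbl^[i] r₁) (dbl^[i] r₂) := by
      intro i
      by_cases hi : i < q * m - 1
      · obtain ⟨t, ht⟩ := hS.exists_location hq hO hi
        exact ⟨t, fun _ => ht⟩
      · exact ⟨false, fun h => absurd h hi⟩
    choose ρ hρ using this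
    exact ⟨ρ, hρ⟩
  obtain ⟨ρ, hρ⟩ := hloc
  have hfol := hS.sixTogether_of_visible hD h1 h2 h3 hκ hO hr1.le hr2 hv hnq hP hin hvis.2 hρ
  have hlast := hS.last_return hO hP hn' hk (hρ n hnq) (hfol n le_rfl).1
  refine ⟨hlast, n, α, γ, a, b, r₁, r₂, c₁, c₂, d₁, d₂, e, e', x, κ, κ', ω, ρ, hn', rfl, rfl, rfl,
    rfl, hS, hD, h1, h3, hκ, g0, g1', g2, hρ, hP, hnq, ?_, fun i hi => (hfol i hi).1,
    fun i hi => (hfol n le_rfl).2 i hi⟩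
  rw [hn', Nat.mul_add_mod', Nat.mod_eq_of_lt hk]
  exact hlast.1

/-- Coordinates of a leaf whose smaller arc is known to be `[c, d]`. -/
lemma exists_leaf_of_lt {p : ℕ} {c d : Angle} (h : IsParamLeaf p s(c, d)) (hlt : ccw c d < 1 / 2) :
    ∃ e κ, Leaf p c d e κ := by
  obtain ⟨c', d', e, κ, h', hD⟩ := exists_leaf h
  rcases Sym2.eq_iff.1 h' with ⟨rfl, rfl⟩ | ⟨rfl, rfl⟩
  · exact ⟨e, κ, hD⟩
  · have := ccw_rev hD.ne
    linarith [hD.lt]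

/-- The arc `[c₁, c₂]`, mapped onto `[α, γ]` by the iterate of order `N`, contains a fixed point of
this iterate. -/
lemma exists_fixed_of_arc {α γ c₁ c₂ : Angle} {N : ℕ} (hN : 0 < N)
    (hc : dbl^[N] c₁ = α) (hlen : ccw c₁ c₂ = ccw α γ / 2 ^ N) (h1 : 0 < ccw α c₁)
    (h2 : ccw α c₁ < ccw α c₂) (h3 : ccw α c₂ < ccw α γ) :
    ∃ y, dbl^[N] y = y ∧ 0 < ccw c₁ y ∧ ccw c₁ y < ccw c₁ c₂ := by
  have hM : (2 : ℝ) ≤ 2 ^ N := by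
    calc (2 : ℝ) = 2 ^ 1 := by norm_num
      _ ≤ 2 ^ N := pow_le_pow_right₀ (by norm_num) hN
  have b := ccw_base α c₁ c₂
  rw [if_pos h2.le] at b
  have hlen' : 2 ^ N * ccw c₁ c₂ = ccw α γ := by rw [hlen]; field_simp
  have ht : ccw α c₁ / (2 ^ N - 1) < ccw c₁ c₂ := by
    rw [div_lt_iff₀ (by linarith)]
    nlinarith
  have ht0 : 0 < ccw α c₁ / (2 ^ N - 1) := div_pos h1 (by linarith)
  have hcc := ccw_add_of_lt c₁ ht0.le (by linarith [ccw_lt_one c₁ c₂])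
  -- The distance `t` of the fixed point from `c₁` is the solution of `2 ^ N * t = ccw α c₁ + t`.
  refine ⟨c₁ + ((ccw α c₁ / (2 ^ N - 1) : ℝ) : Angle), ?_, ?_, ?_⟩
  · have : (2 : ℝ) ^ N * (ccw α c₁ / (2 ^ N - 1)) = ccw α c₁ + ccw α c₁ / (2 ^ N - 1) := by
      have : (2 : ℝ) ^ N - 1 ≠ 0 := by linarith
      field_simp
      ring
    rw [iter_add, hc, this, AddCircle.coe_add, ← add_assoc, add_ccw]
  · rwa [hcc]
  · rwa [hcc]

/-- On an arc where the iterate of order `N` is linear with slope `2 ^ N`, it has at most one fixed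
point. -/
lemma eq_of_fixed_of_arc {α c₁ c₂ y y' : Angle} {N : ℕ} (hN : 0 < N)
    (h : ∀ z, ccw c₁ z ≤ ccw c₁ c₂ → ccw α (dbl^[N] z) = 2 ^ N * ccw c₁ z)
    (h2 : ccw α c₁ ≤ ccw α c₂) (hy : ccw c₁ y ≤ ccw c₁ c₂)
    (hy' : ccw c₁ y' ≤ ccw c₁ c₂) (hf : dbl^[N] y = y) (hf' : dbl^[N] y' = y') : y = y' := by
  have hM : (2 : ℝ) ≤ 2 ^ N := by
    calc (2 : ℝ) = 2 ^ 1 := by norm_num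
      _ ≤ 2 ^ N := pow_le_pow_right₀ (by norm_num) hN
  have k1 := h y hy
  have k2 := h y' hy'
  rw [hf] at k1
  rw [hf'] at k2
  apply ccw_inj (a := c₁)
  have b0 := ccw_base α c₁ c₂
  have b1 := ccw_base α c₁ y
  have b2 := ccw_base α c₁ y'
  rw [if_pos h2] at b0
  have g1 : ccw c₁ y = ccw α y - ccw α c₁ := by grind [ccw_nonneg, ccw_lt_one]
  have g2 : ccw c₁ y' = ccw α y' - ccw α c₁ := by grind [ccw_nonneg, ccw_lt_one]
  have g3 : (2 ^ N - 1) * (ccw c₁ y - ccw c₁ y') = 0 := by linear_combination k2 - k1 + g2 - g1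
  rcases mul_eq_zero.1 g3 with h | h <;> linarith

namespace Leaf

variable {m : ℕ} {α γ : Angle} {e : Bool} {κ : ℕ → Bool}

/-- A point inside `]α, γ[` that is mapped to an end of the leaf is not periodic. -/
lemma iterate_ne_self (hS : Leaf m α γ e κ) {y : Angle} (hy : Sb α y γ) {N : ℕ}
    (hN : dbl^[N] y = α ∨ dbl^[N] y = γ) {t : ℕ} (ht : 0 < t) : dbl^[t] y ≠ y := by
  intro h
  have h1 : dbl^[N * t] y = y := by
    rw [Nat.mul_comm, Function.iterate_mul]
    exact Function.iterate_fixed h N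
  have h2 : N * t = (N * t - N) + N := by
    have : N * 1 ≤ N * t := Nat.mul_le_mul_left _ ht
    lia
  rw [h2, Function.iterate_add_apply] at h1
  refine hS.out _ hN (N * t - N) ?_
  rwa [h1]

/-- A short arc with both ends in a lobe is contained in the lobe. -/
lemma lobe_of_arc (hS : Leaf m α γ e κ) {t : Bool} {p p' y : Angle} (hp : Lobe α γ t p)
    (hp' : Lobe α γ t p') (hlt : ccw p p' < 1 / 2) (hy : ccw p y ≤ ccw p p') : Lobe α γ t y := by
  have b1 := ccw_base (sideBase γ t) p p'
  have b2 := ccw_base (sideBase γ t) p y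
  have := hS.pos
  unfold Lobe at *
  clear hS
  grind [ccw_nonneg, ccw_lt_one]

/-- The side of a point `y` of a closed strip depends on the position of `dbl y` relative to `β`. -/
lemma mem_of_closedStrip (hS : Leaf m α γ e κ) {t : Bool} {y β : Angle}
    (hy : ClosedStrip α γ t y) (hβ : ccw α β ≤ ccw α γ) :
    (ccw α β < ccw α (dbl y) → y ∈ symbolArc β t) ∧
      (ccw α (dbl y) < ccw α β → y ∈ symbolArc β (!t)) := by
  have hpos := hS.pos
  have hlt := hS.lt
  have h1 := sideBase_add (hS.rep_le hβ) t
  have h2 := ccw_dbl (sideBase α t) y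
  have h3 := ccw_add_of_lt (sideBase α t) (t := ccw α β / 2) (by linarith [ccw_nonneg α β])
    (by linarith)
  rw [← h1] at h3
  rw [dbl_sideBase] at h2
  unfold ClosedStrip at hy
  rw [if_pos (by linarith)] at h2
  have b := ccw_base (sideBase α t) (sideBase β t) y
  have b' := ccw_add_oneHalf (sideBase β t) y
  have b'' := ccw_base (sideBase β t) (sideBase β t + oneHalf) y
  rw [ccw_self_add_oneHalf] at b''
  rw [mem_symbolArc_iff, mem_symbolArc_iff, sideBase_not]
  clear hS h1
  have := ccw_nonneg α β
  constructor <;> intro h <;> constructor <;> grind [ccw_nonneg, ccw_lt_one]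

end Leaf

namespace VisiblePair

variable {m q n : ℕ} {α γ a b r₁ r₂ c₁ c₂ d₁ d₂ : Angle} {e e' x : Bool} {κ κ' ω ρ : ℕ → Bool}

lemma iter_succ (h : VisiblePair m q n α γ a b r₁ r₂ c₁ c₂ d₁ d₂ e e' x κ κ' ω ρ) :
    dbl^[n + 1] c₁ = α ∧ dbl^[n + 1] c₂ = γ ∧ dbl^[n + 1] d₁ = α ∧ dbl^[n + 1] d₂ = γ := by
  simp only [Function.iterate_succ_apply', h.pair.c₁_iter, h.pair.c₂_iter, h.pair.d₁_iter,
    h.pair.d₂_iter, dbl_sideBase, and_self]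

/-- The order of the points in `[α, γ]`. The inequalities are strict, since `a` and `b` are periodic
and the ends of the arcs are not. -/
lemma order (h : VisiblePair m q n α γ a b r₁ r₂ c₁ c₂ d₁ d₂ e e' x κ κ' ω ρ) :
    (0 < ccw α a ∧ ccw α a < ccw α c₁ ∧ ccw α c₁ < ccw α c₂) ∧
      (ccw α c₂ < ccw α d₁ ∧ ccw α d₁ < ccw α d₂) ∧ ccw α d₂ < ccw α b ∧ ccw α b < ccw α γ := by
  obtain ⟨i1, i2, i3, i4⟩ := h.inside 0 (by lia)
  simp only [Function.iterate_zero_apply] at i1 i2 i3 i4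
  have k1 := h.a_le
  have k2 := h.r_lt
  have k3 := h.le_b
  have k4 := h.b_lt
  have k5 := h.a_pos
  obtain ⟨g1, -, -, g2⟩ := h.iter_succ
  have pa := h.leafB.iterate_eq (Or.inl rfl)
  have pb := h.leafB.iterate_eq (Or.inr rfl)
  have hqm : 0 < q * m := by have := h.leafB.one_lt; lia
  have w : (ccw α r₁ ≤ ccw α c₁ ∧ ccw α c₁ < ccw α c₂) ∧
      (ccw α c₂ < ccw α d₁ ∧ ccw α d₁ < ccw α d₂) ∧ ccw α d₂ ≤ ccw α r₂ := by
    have b1 := ccw_base α r₁ c₁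
    have b2 := ccw_base α r₁ c₂
    have b3 := ccw_base α r₁ d₁
    have b4 := ccw_base α r₁ d₂
    have b5 := ccw_base α r₁ r₂
    rw [if_pos k2.le] at b5
    clear h
    refine ⟨⟨?_, ?_⟩, ⟨?_, ?_⟩, ?_⟩ <;> grind [ccw_nonneg, ccw_lt_one]
  obtain ⟨⟨w1, w2⟩, ⟨w3, w4⟩, w5⟩ := w
  refine ⟨⟨k5, lt_of_le_of_ne (k1.trans w1) fun h' => ?_, w2⟩, ⟨w3, w4⟩,
    lt_of_le_of_ne (w5.trans k3) fun h' => ?_, k4⟩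
  · rw [ccw_inj h'] at pa k5
    exact h.leaf.iterate_ne_self ⟨k5, by linarith⟩ (Or.inl g1) hqm pa
  · rw [← ccw_inj h'] at pb k4
    exact h.leaf.iterate_ne_self ⟨by linarith, k4⟩ (Or.inr g2) hqm pb

/-- Between the returns, the ends of the arcs lie in the lobes of `s(α, γ)`. -/
lemma lobe (h : VisiblePair m q n α γ a b r₁ r₂ c₁ c₂ d₁ d₂ e e' x κ κ' ω ρ) {i : ℕ} (hi : i < n)
    (hmod : (i + 1) % m ≠ 0) {p : Angle} (hp : p = c₁ ∨ p = c₂ ∨ p = d₁ ∨ p = d₂) :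
    Lobe α γ (κ i) (dbl^[i] p) := by
  have hlt := h.lt
  rcases h.loc i (by lia) with ⟨-, h1, h2, h3⟩ | h' | h'
  · rw [← h1]
    rcases h.six i hi with h4 | ⟨h4, -⟩
    · rcases hp with rfl | rfl | rfl | rfl <;> exact h4 _ (by simp)
    · exfalso
      have k1 := h4 _ (Or.inl rfl)
      have k2 := h4 _ (Or.inr (Or.inl rfl))
      rw [h.leaf.lobe_iff] at h2 h3
      unfold ClosedStrip at k1 k2
      have : dbl^[i] r₁ = dbl^[i] r₂ := ccw_inj (a := sideBase α (ρ i)) (by linarith)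
      obtain ⟨i1, i2, i3, i4⟩ := h.inside i (by lia)
      rw [← this, ccw_self] at i4
      linarith [ccw_nonneg (dbl^[i] r₁) (dbl^[i] c₁)]
  · exact absurd h'.1 hmod
  · exact absurd h'.1 hmod

/-- The outer chord of the pair is mapped to the chord that bounds the lobe with symbol `κ n`, in
which the boundary leaf lies. -/
lemma symbol_eq (h : VisiblePair m q n α γ a b r₁ r₂ c₁ c₂ d₁ d₂ e e' x κ κ' ω ρ) :
    x = !κ n := by
  by_contra hx
  have hx : x = κ n := by revert hx; cases x <;> cases κ n <;> simp
  rcases h.loc n h.lt with ⟨-, h1, h2, h3⟩ | h' | h'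
  · rw [h1, ← hx, h.leaf.lobe_iff] at h2 h3
    obtain ⟨i1, i2, i3, i4⟩ := h.inside n le_rfl
    rw [h.pair.c₁_iter, h.pair.c₂_iter] at i1
    rw [h.pair.c₂_iter, h.pair.d₁_iter] at i2
    have e1 := h.leaf.ccw_sideBase x
    have e2 : ccw (sideBase α x) (sideBase α (!x)) = 1 / 2 := by
      rw [sideBase_not, ccw_self_add_oneHalf]
    have b1 := ccw_base (sideBase α x) (dbl^[n] r₁) (sideBase α x)
    have b2 := ccw_base (sideBase α x) (dbl^[n] r₁) (sideBase α (!x))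
    rw [ccw_self, if_neg (by linarith [h.leaf.pos])] at b1
    rw [e2, if_pos h2.2] at b2
    linarith
  · exact h.mod_ne h'.1
  · exact h.mod_ne h'.1

/-- A point in one of the two arcs follows the tuned sequence. -/
lemma mem_tuned (h : VisiblePair m q n α γ a b r₁ r₂ c₁ c₂ d₁ d₂ e e' x κ κ' ω ρ) {y β : Angle}
    (hy : ccw c₁ y ≤ ccw c₁ c₂ ∨ ccw d₁ y ≤ ccw d₁ d₂) (hβ : Sb a β b) :
    ∀ i < n, dbl^[i] y ∈ symbolArc β (tuned m e κ i) := by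
  obtain ⟨⟨o1, o2, o3⟩, ⟨o4, o5⟩, o6, o7⟩ := h.order
  have hlt := h.leaf.lt
  apply h.leaf.mem_tuned_of_lobe h.leafB o1 (by linarith) o7 h.tuned_eq h.lt.le hβ
  · have b1 := ccw_base α c₁ y
    have b2 := ccw_base α c₁ c₂
    have b3 := ccw_base α d₁ y
    have b4 := ccw_base α d₁ d₂
    have b5 := ccw_base α a b
    have b6 := ccw_base α a y
    rw [if_pos (by linarith)] at b2 b4 b5
    clear h hβ
    grind [ccw_nonneg, ccw_lt_one]
  · have key : ∀ {p p' : Angle}, (p = c₁ ∨ p = c₂ ∨ p = d₁ ∨ p = d₂) →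
        (p' = c₁ ∨ p' = c₂ ∨ p' = d₁ ∨ p' = d₂) → ccw p p' = ccw α γ / 2 ^ (n + 1) →
        ccw p y ≤ ccw p p' → ∀ i < n, (i + 1) % m ≠ 0 → Lobe α γ (κ i) (dbl^[i] y) := by
      intro p p' hp hp' hpp hy i hi hmod
      have h1 : 2 ^ i * ccw p p' ≤ ccw α γ := by
        rw [hpp, mul_div_assoc', div_le_iff₀ (by positivity), mul_comm]
        exact mul_le_mul_of_nonneg_left (pow_le_pow_right₀ (by norm_num) (by lia)) (ccw_nonneg _ _)
      have h2 : 2 ^ i * ccw p y ≤ 2 ^ i * ccw p p' := mul_le_mul_of_nonneg_left hy (by positivity)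
      have k1 := ccw_iter_of_lt (n := i) (x := p) (y := p') (by linarith)
      have k2 := ccw_iter_of_lt (n := i) (x := p) (y := y) (by linarith)
      exact h.leaf.lobe_of_arc (h.lobe hi hmod hp) (h.lobe hi hmod hp') (by linarith) (by linarith)
    rcases hy with hy | hy
    · exact key (by simp) (by simp) h.pair.ccw_c hy
    · exact key (by simp) (by simp) h.pair.ccw_d hy

/-- The arc `[c₁, c₂]` is mapped linearly onto `[α, γ]`, passing through the strip with symbol
`!κ n`. -/
lemma iter_left (h : VisiblePair m q n α γ a b r₁ r₂ c₁ c₂ d₁ d₂ e e' x κ κ' ω ρ) {y : Angle}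
    (hy : ccw c₁ y ≤ ccw c₁ c₂) :
    ccw α (dbl^[n + 1] y) = 2 ^ (n + 1) * ccw c₁ y ∧ ClosedStrip α γ (!κ n) (dbl^[n] y) := by
  obtain ⟨h1, h2⟩ := h.leaf.mem_arc_of_stripPair h.pair hy
  refine ⟨?_, by rwa [← h.symbol_eq]⟩
  have h3 := ccw_dbl (sideBase α x) (dbl^[n] y)
  unfold ClosedStrip at h2
  rw [if_pos (by linarith [h.leaf.lt]), dbl_sideBase, ← Function.iterate_succ_apply' dbl] at h3
  rw [h3, h1, pow_succ]
  ring

/-- The arc `[d₁, d₂]` is mapped linearly onto `[α, γ]`, passing through the strip with symbol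
`κ n`. -/
lemma iter_right (h : VisiblePair m q n α γ a b r₁ r₂ c₁ c₂ d₁ d₂ e e' x κ κ' ω ρ) {y : Angle}
    (hy : ccw d₁ y ≤ ccw d₁ d₂) :
    ccw α (dbl^[n + 1] y) = 2 ^ (n + 1) * ccw d₁ y ∧ ClosedStrip α γ (κ n) (dbl^[n] y) := by
  obtain ⟨h1, h2⟩ := h.leaf.mem_arc_of_stripPair (h.pair.symm h.leaf.pos) hy
  rw [h.symbol_eq, Bool.not_not] at h1 h2
  refine ⟨?_, h2⟩
  have h3 := ccw_dbl (sideBase α (κ n)) (dbl^[n] y)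
  unfold ClosedStrip at h2
  rw [if_pos (by linarith [h.leaf.lt]), dbl_sideBase, ← Function.iterate_succ_apply' dbl] at h3
  rw [h3, h1, pow_succ]
  ring

/-- Before their return, the ends of the outer chord lie in the lobe with symbol `κ n`, and those of
the inner chord in the other lobe. -/
lemma left_lobe_last (h : VisiblePair m q n α γ a b r₁ r₂ c₁ c₂ d₁ d₂ e e' x κ κ' ω ρ) :
    Lobe α γ (κ n) (dbl^[n] c₁) ∧ Lobe α γ (κ n) (dbl^[n] d₂) ∧
      Lobe α γ (!κ n) (dbl^[n] c₂) ∧ Lobe α γ (!κ n) (dbl^[n] d₁) := by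
  rw [h.pair.c₁_iter, h.pair.c₂_iter, h.pair.d₁_iter, h.pair.d₂_iter, h.symbol_eq, Bool.not_not]
  have := h.leaf.lobe_left (!κ n)
  rw [Bool.not_not] at this
  exact ⟨this, h.leaf.lobe_right _, h.leaf.lobe_right _, h.leaf.lobe_left _⟩

end VisiblePair

/-! ### Kneading sequences of a dynamic pair -/

lemma kneading_of_mem {x : Angle} {t : Bool} {i : ℕ} (h : dbl^[i] x ∈ symbolArc x t) :
    kneading x i = some t := by
  unfold kneading
  cases t
  · rw [if_pos h]
  · rw [if_neg fun h' => by simpa using symbolArc_unique h h', if_pos h]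

lemma kneading_eq_none {x : Angle} {i : ℕ} (h : ∀ t, dbl^[i] x ∉ symbolArc x t) :
    kneading x i = none := by
  unfold kneading
  rw [if_neg (h _), if_neg (h _)]

lemma kneading_eq {x : Angle} {u p : List Bool}
    (hu : ∀ i < u.length, ∃ t, u[i]? = some t ∧ dbl^[i] x ∈ symbolArc x t)
    (hps : ∀ i, ∃ t, p[i % p.length]? = some t ∧ dbl^[u.length + i] x ∈ symbolArc x t) :
    kneading x = wordThenRepeat (symWord u) (symWord p) := by
  funext i
  have hl : (symWord u).length = u.length := by simp [symWord]
  have hl' : (symWord p).length = p.length := by simp [symWord]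
  unfold wordThenRepeat
  rw [hl, hl']
  by_cases hi : i < u.length
  · obtain ⟨t, h1, h2⟩ := hu i hi
    rw [if_pos hi, kneading_of_mem h2, List.getD_eq_getElem?_getD, symWord, List.getElem?_map, h1]
    rfl
  · obtain ⟨t, h1, h2⟩ := hps (i - u.length)
    rw [Nat.add_sub_cancel' (by lia)] at h2
    rw [if_neg hi, kneading_of_mem h2, List.getD_eq_getElem?_getD, symWord, List.getElem?_map, h1]
    rfl

lemma length_powWord {m : ℕ} {v : List Bool} (hm : 0 < m) (hv : v.length = m - 1) (e : Bool)
    (j : ℕ) : (powWord v e j).length = j * m := by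
  simp [powWord, hv, Nat.sub_add_cancel hm]

/-- The words `(v e)^j v₁ … v_k` are the initial words of the tuned sequence. -/
lemma getElem?_powWord {m : ℕ} {v : List Bool} {e : Bool} {κ : ℕ → Bool} (hm : 0 < m)
    (hv : v.length = m - 1) (hvκ : ∀ i < m - 1, v[i]? = some (κ i)) (hκ : ∀ i, κ (i + m) = κ i)
    {j k : ℕ} (hk : k < m) {i : ℕ} (hi : i < j * m + k) :
    (powWord v e j ++ v.take k)[i]? = some (tuned m e κ i) := by
  induction j generalizing i with
  | zero =>
    have : powWord v e 0 = [] := rfl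
    rw [this, List.nil_append, List.getElem?_take, if_pos (by lia), hvκ i (by lia),
      tuned_of_lt (by lia)]
  | succ j ih =>
    have : powWord v e (j + 1) = (v ++ [e]) ++ powWord v e j := by
      simp [powWord, List.replicate_succ]
    have hl : (v ++ [e]).length = m := by simp [hv, Nat.sub_add_cancel hm]
    rw [this, List.append_assoc]
    by_cases him : i < m
    · rw [List.getElem?_append_left (by lia)]
      by_cases him' : i < m - 1
      · rw [List.getElem?_append_left (by lia), hvκ i him', tuned_of_lt (by lia)]
      · obtain rfl : i = m - 1 := by lia
        rw [List.getElem?_append_right (by lia), hv, Nat.sub_self, tuned_pred hm]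
        rfl
    · obtain ⟨l, rfl⟩ : ∃ l, i = l + m := ⟨i - m, by lia⟩
      rw [Nat.succ_mul] at hi
      rw [List.getElem?_append_right (by lia), hl, Nat.add_sub_cancel, ih (by lia),
        tuned_add m e hκ]

namespace VisiblePair

variable {m q n : ℕ} {α γ a b r₁ r₂ c₁ c₂ d₁ d₂ : Angle} {e e' x : Bool} {κ κ' ω ρ : ℕ → Bool}

lemma tuned_last (h : VisiblePair m q n α γ a b r₁ r₂ c₁ c₂ d₁ d₂ e e' x κ κ' ω ρ) :
    tuned m e κ n = κ n := if_neg h.mod_ne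

/-- An end of the pair follows the tuned sequence until the time `n`, then has the symbol `t` of its
lobe, and then follows the orbit of `s(α, γ)`. -/
lemma kneading_end (h : VisiblePair m q n α γ a b r₁ r₂ c₁ c₂ d₁ d₂ e e' x κ κ' ω ρ) {v : List Bool}
    (hv : IsWordV m s(α, γ) v) {y : Angle} {t : Bool} {u : List Bool}
    (hy : y = c₁ ∨ y = c₂ ∨ y = d₁ ∨ y = d₂) (ht : Lobe α γ t (dbl^[n] y)) (hu : u.length = n + 1)
    (hu1 : ∀ i < n, u[i]? = some (tuned m e κ i)) (hu2 : u[n]? = some t) :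
    kneading y = wordThenRepeat (symWord u) (symWord (v ++ [!e])) := by
  obtain ⟨hl, hv⟩ := h.leaf.isWordV_iff.1 hv
  have hm := h.leaf.one_lt
  obtain ⟨⟨o1, o2, o3⟩, ⟨o4, o5⟩, o6, o7⟩ := h.order
  obtain ⟨j1, j2, j3, j4⟩ := h.iter_succ
  have hyb : Sb a y b := by
    have b1 := ccw_base α a b
    have b2 := ccw_base α a y
    unfold Sb
    rw [if_pos (by linarith)] at b1
    rcases hy with rfl | rfl | rfl | rfl <;> rw [if_pos (by linarith)] at b2 <;>
      constructor <;> linarith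
  have hyγ : Sb α y γ := by
    unfold Sb
    rcases hy with rfl | rfl | rfl | rfl <;> constructor <;> linarith
  have hyi : dbl^[n + 1] y = α ∨ dbl^[n + 1] y = γ := by
    rcases hy with rfl | rfl | rfl | rfl <;> tauto
  have hys : ccw c₁ y ≤ ccw c₁ c₂ ∨ ccw d₁ y ≤ ccw d₁ d₂ := by
    rcases hy with rfl | rfl | rfl | rfl <;> simp [ccw_self, ccw_nonneg]
  have hlp : (v ++ [!e]).length = m := by rw [List.length_append, hl]; simp; lia
  apply kneading_eq
  · intro i hi
    by_cases hin : i < n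
    · exact ⟨_, hu1 i hin, h.mem_tuned hys hyb i hin⟩
    · obtain rfl : i = n := by lia
      exact ⟨_, hu2, h.leaf.mem_of_lobe hyγ ht⟩
  · intro i
    refine ⟨κ i, ?_, ?_⟩
    · have hκ : κ i = κ (i % m) := by
        conv_lhs => rw [← Nat.div_add_mod i m, Nat.mul_comm, h.leaf.κ_mod]
      have := Nat.mod_lt i (show m > 0 by lia)
      rw [hlp, hκ]
      by_cases hi : i % m < m - 1
      · rw [List.getElem?_append_left (by lia), hv _ hi]
      · have : i % m = m - 1 := by lia
        rw [List.getElem?_append_right (by lia), this, hl, Nat.sub_self, h.leaf.last]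
        rfl
    · rw [hu, Nat.add_comm, Function.iterate_add_apply]
      exact h.leaf.mem_of_lobe hyγ (h.leaf.lobe_iterate hyi i)

/-- The kneading sequences of the two chords of a visible dynamic pair. They differ in the last
symbol before the return. -/
theorem kneading_pair (h : VisiblePair m q n α γ a b r₁ r₂ c₁ c₂ d₁ d₂ e e' x κ κ' ω ρ)
    {v : List Bool} (hv : IsWordV m s(α, γ) v) {j k : ℕ} (hn : n + 1 = j * m + k) (hk0 : k ≠ 0)
    (hk : k < m) :
    HasKneading s(c₁, d₂)
        (wordThenRepeat (symWord (powWord v e j ++ v.take k)) (symWord (v ++ [!e]))) ∧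
      HasKneading s(c₂, d₁)
        (wordThenRepeat
          (symWord (powWord v e j ++ v.take (k - 1) ++ [!(v.getD (k - 1) false)]))
          (symWord (v ++ [!e]))) := by
  obtain ⟨hl, hv'⟩ := h.leaf.isWordV_iff.1 hv
  have hm := h.leaf.one_lt
  obtain ⟨w1, w2, w3, w4⟩ := h.left_lobe_last
  have hp := length_powWord (by lia) hl e j
  have hκn : κ n = κ (k - 1) := by
    rw [show n = j * m + (k - 1) by lia, h.leaf.κ_mod]
  have hget : v.getD (k - 1) false = κ n := by
    rw [List.getD_eq_getElem?_getD, hv' _ (by lia), hκn]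
    rfl
  have hu := fun (i : ℕ) (k' : ℕ) (hk : k' < m) (hi : i < j * m + k') =>
    getElem?_powWord (e := e) (show 0 < m by lia) hl hv' h.leaf.sym_add hk hi
  have hl1 : (powWord v e j ++ v.take k).length = n + 1 := by
    rw [List.length_append, hp, List.length_take]; lia
  have hl2 : (powWord v e j ++ v.take (k - 1)).length = n := by
    rw [List.length_append, hp, List.length_take]; lia
  rw [hget]
  constructor
  · intro y hy
    rw [Sym2.mem_iff] at hy
    refine h.kneading_end hv (t := κ n) (by tauto) ?_ hl1 (fun i hi => hu i k hk (by lia)) ?_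
    · rcases hy with rfl | rfl
      exacts [w1, w2]
    · rw [hu n k hk (by lia), h.tuned_last]
  · intro y hy
    rw [Sym2.mem_iff] at hy
    refine h.kneading_end hv (t := !κ n) (by tauto) ?_ ?_ (fun i hi => ?_) ?_
    · rcases hy with rfl | rfl
      exacts [w3, w4]
    · rw [List.length_append, hl2]; rfl
    · rw [List.getElem?_append_left (by lia), hu i (k - 1) (by lia) (by lia)]
    · rw [List.getElem?_append_right (by lia), hl2, Nat.sub_self]
      rfl

end VisiblePair

/-! ### The fixed points in the two arcs -/

/-- `y₁` and `y₂` are fixed points of the iterate of order `N` in the open arcs `]c₁, c₂[` and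
`]d₁, d₂[`. -/
structure FixedPair (N : ℕ) (c₁ c₂ d₁ d₂ y₁ y₂ : Angle) : Prop where
  left : dbl^[N] y₁ = y₁
  right : dbl^[N] y₂ = y₂
  left_mem : Sb c₁ y₁ c₂
  right_mem : Sb d₁ y₂ d₂

namespace VisiblePair

variable {m q n : ℕ} {α γ a b r₁ r₂ c₁ c₂ d₁ d₂ : Angle} {e e' x : Bool} {κ κ' ω ρ : ℕ → Bool}
  {y₁ y₂ : Angle}

/-- Each of the two arcs is contained in its image `[α, γ]`, so it contains a fixed point. -/
lemma exists_fixedPair (h : VisiblePair m q n α γ a b r₁ r₂ c₁ c₂ d₁ d₂ e e' x κ κ' ω ρ) :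
    ∃ y₁ y₂, FixedPair (n + 1) c₁ c₂ d₁ d₂ y₁ y₂ := by
  obtain ⟨⟨o1, o2, o3⟩, ⟨o4, o5⟩, o6, o7⟩ := h.order
  obtain ⟨j1, j2, j3, j4⟩ := h.iter_succ
  obtain ⟨y₁, h1, h2, h3⟩ := exists_fixed_of_arc (N := n + 1) (by lia) j1 h.pair.ccw_c (by linarith) o3
    (by linarith)
  obtain ⟨y₂, k1, k2, k3⟩ := exists_fixed_of_arc (N := n + 1) (by lia) j3 h.pair.ccw_d (by linarith) o5
    (by linarith)
  exact ⟨y₁, y₂, h1, k1, ⟨h2, h3⟩, ⟨k2, k3⟩⟩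

lemma order_fixedPair (h : VisiblePair m q n α γ a b r₁ r₂ c₁ c₂ d₁ d₂ e e' x κ κ' ω ρ)
    (hy : FixedPair (n + 1) c₁ c₂ d₁ d₂ y₁ y₂) :
    (ccw α c₁ < ccw α y₁ ∧ ccw α y₁ < ccw α c₂) ∧ ccw α d₁ < ccw α y₂ ∧ ccw α y₂ < ccw α d₂ := by
  obtain ⟨⟨o1, o2, o3⟩, ⟨o4, o5⟩, o6, o7⟩ := h.order
  have h1 := hy.left_mem
  have h2 := hy.right_mem
  have b1 := ccw_base α c₁ y₁
  have b2 := ccw_base α c₁ c₂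
  have b3 := ccw_base α d₁ y₂
  have b4 := ccw_base α d₁ d₂
  rw [if_pos (by linarith)] at b2 b4
  unfold Sb at h1 h2
  clear h
  refine ⟨⟨?_, ?_⟩, ?_, ?_⟩ <;> grind [ccw_nonneg, ccw_lt_one]

/-- Coordinates of points of the two arcs. -/
lemma mem_arc_iff (h : VisiblePair m q n α γ a b r₁ r₂ c₁ c₂ d₁ d₂ e e' x κ κ' ω ρ) (z : Angle) :
    (ccw c₁ z ≤ ccw c₁ c₂ ↔ ccw α c₁ ≤ ccw α z ∧ ccw α z ≤ ccw α c₂) ∧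
      (ccw d₁ z ≤ ccw d₁ d₂ ↔ ccw α d₁ ≤ ccw α z ∧ ccw α z ≤ ccw α d₂) := by
  obtain ⟨⟨o1, o2, o3⟩, ⟨o4, o5⟩, o6, o7⟩ := h.order
  have b1 := ccw_base α c₁ z
  have b2 := ccw_base α c₁ c₂
  have b3 := ccw_base α d₁ z
  have b4 := ccw_base α d₁ d₂
  rw [if_pos (by linarith)] at b2 b4
  clear h
  constructor <;> grind [ccw_nonneg, ccw_lt_one]

lemma eq_fixed_left (h : VisiblePair m q n α γ a b r₁ r₂ c₁ c₂ d₁ d₂ e e' x κ κ' ω ρ)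
    (hy : FixedPair (n + 1) c₁ c₂ d₁ d₂ y₁ y₂) {z : Angle} (hz : ccw c₁ z ≤ ccw c₁ c₂)
    (hf : dbl^[n + 1] z = z) : z = y₁ :=
  eq_of_fixed_of_arc (N := n + 1) (by lia) (fun _ hw => (h.iter_left hw).1) h.order.1.2.2.le hz
    hy.left_mem.2.le hf hy.left

lemma eq_fixed_right (h : VisiblePair m q n α γ a b r₁ r₂ c₁ c₂ d₁ d₂ e e' x κ κ' ω ρ)
    (hy : FixedPair (n + 1) c₁ c₂ d₁ d₂ y₁ y₂) {z : Angle} (hz : ccw d₁ z ≤ ccw d₁ d₂)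
    (hf : dbl^[n + 1] z = z) : z = y₂ :=
  eq_of_fixed_of_arc (N := n + 1) (by lia) (fun _ hw => (h.iter_right hw).1) h.order.2.1.2.le hz
    hy.right_mem.2.le hf hy.right

/-- The side of the last point before the return, for a point of one of the two arcs. -/
lemma mem_last_iff (h : VisiblePair m q n α γ a b r₁ r₂ c₁ c₂ d₁ d₂ e e' x κ κ' ω ρ) {z β : Angle}
    (hβ : ccw α β ≤ ccw α γ) :
    (ccw c₁ z ≤ ccw c₁ c₂ → (ccw α (dbl^[n + 1] z) < ccw α β → dbl^[n] z ∈ symbolArc β (κ n)) ∧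
      (ccw α β < ccw α (dbl^[n + 1] z) → dbl^[n] z ∈ symbolArc β (!κ n))) ∧
    (ccw d₁ z ≤ ccw d₁ d₂ → (ccw α β < ccw α (dbl^[n + 1] z) → dbl^[n] z ∈ symbolArc β (κ n)) ∧
      (ccw α (dbl^[n + 1] z) < ccw α β → dbl^[n] z ∈ symbolArc β (!κ n))) := by
  rw [Function.iterate_succ_apply']
  constructor <;> intro hz
  · have := h.leaf.mem_of_closedStrip (h.iter_left hz).2 hβ
    rw [Bool.not_not] at this
    exact this.symm
  · exact h.leaf.mem_of_closedStrip (h.iter_right hz).2 hβ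

lemma sb_fixedPair (h : VisiblePair m q n α γ a b r₁ r₂ c₁ c₂ d₁ d₂ e e' x κ κ' ω ρ)
    (hy : FixedPair (n + 1) c₁ c₂ d₁ d₂ y₁ y₂) (β : Angle) :
    (Sb y₁ β y₂ ↔ ccw α y₁ < ccw α β ∧ ccw α β < ccw α y₂) ∧
      (Sb a β b ↔ ccw α a < ccw α β ∧ ccw α β < ccw α b) := by
  obtain ⟨⟨o1, o2, o3⟩, ⟨o4, o5⟩, o6, o7⟩ := h.order
  obtain ⟨⟨p1, p2⟩, p3, p4⟩ := h.order_fixedPair hy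
  have b1 := ccw_base α y₁ β
  have b2 := ccw_base α y₁ y₂
  have b3 := ccw_base α a β
  have b4 := ccw_base α a b
  rw [if_pos (by linarith)] at b2 b4
  clear h
  unfold Sb
  constructor <;> grind [ccw_nonneg, ccw_lt_one]

/-- The fixed points follow the tuned sequence up to the order of the iterate. -/
lemma fixedPair_mem (h : VisiblePair m q n α γ a b r₁ r₂ c₁ c₂ d₁ d₂ e e' x κ κ' ω ρ)
    (hy : FixedPair (n + 1) c₁ c₂ d₁ d₂ y₁ y₂) {β : Angle} (hβ : Sb y₁ β y₂) (i : ℕ) :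
    dbl^[i] y₁ ∈ symbolArc β (tuned m e κ (i % (n + 1))) ∧
      dbl^[i] y₂ ∈ symbolArc β (tuned m e κ (i % (n + 1))) := by
  obtain ⟨⟨o1, o2, o3⟩, ⟨o4, o5⟩, o6, o7⟩ := h.order
  obtain ⟨⟨p1, p2⟩, p3, p4⟩ := h.order_fixedPair hy
  have hβ' := (h.sb_fixedPair hy β).1.1 hβ
  have hβab := (h.sb_fixedPair hy β).2.2 ⟨by linarith, by linarith⟩
  have e1 : dbl^[i] y₁ = dbl^[i % (n + 1)] y₁ :=
    ((show Function.IsPeriodicPt dbl (n + 1) y₁ from hy.left).iterate_mod_apply i).symm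
  have e2 : dbl^[i] y₂ = dbl^[i % (n + 1)] y₂ :=
    ((show Function.IsPeriodicPt dbl (n + 1) y₂ from hy.right).iterate_mod_apply i).symm
  rw [e1, e2]
  have hi := Nat.mod_lt i (show n + 1 > 0 by lia)
  generalize i % (n + 1) = l at hi
  have h1 := hy.left_mem.2.le
  have h2 := hy.right_mem.2.le
  by_cases hl : l < n
  · exact ⟨h.mem_tuned (Or.inl h1) hβab l hl, h.mem_tuned (Or.inr h2) hβab l hl⟩
  · obtain rfl : l = n := by lia
    rw [h.tuned_last]
    refine ⟨((h.mem_last_iff (by linarith)).1 h1).1 ?_, ((h.mem_last_iff (by linarith)).2 h2).1 ?_⟩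
    · rw [hy.left]; exact hβ'.1
    · rw [hy.right]; exact hβ'.2

/-- A periodic leaf with ends in the two arcs whose sequence agrees with the tuned sequence has a
period greater than `n`, since the point `c₂` lies behind the leaf. -/
lemma lt_period (h : VisiblePair m q n α γ a b r₁ r₂ c₁ c₂ d₁ d₂ e e' x κ κ' ω ρ) {p : ℕ}
    {c d : Angle} {f : Bool} {μ : ℕ → Bool} (hD : Leaf p c d f μ) (hc : ccw α c < ccw α c₂)
    (hd : ccw α c₂ < ccw α d) (hμ : ∀ i < p, μ i = tuned m e κ i) : n < p := by
  by_contra hp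
  obtain ⟨⟨o1, o2, o3⟩, ⟨o4, o5⟩, o6, o7⟩ := h.order
  have hsb : Sb c c₂ d := by
    have b1 := ccw_base α c c₂
    have b2 := ccw_base α c d
    rw [if_pos (by linarith)] at b1 b2
    constructor <;> linarith
  have hab : Sb a c₂ b := by
    have b1 := ccw_base α a c₂
    have b2 := ccw_base α a b
    rw [if_pos (by linarith)] at b1 b2
    constructor <;> linarith
  refine hD.not_mem_self hsb fun i hi => ?_
  rw [hμ i hi]
  exact h.mem_tuned (Or.inl le_rfl) hab i (by lia)

/-- The fixed points in the two arcs are the ends of a parameter leaf of period `n + 1`. -/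
theorem isParamLeaf_fixedPair (h : VisiblePair m q n α γ a b r₁ r₂ c₁ c₂ d₁ d₂ e e' x κ κ' ω ρ)
    (hy : FixedPair (n + 1) c₁ c₂ d₁ d₂ y₁ y₂) : IsParamLeaf (n + 1) s(y₁, y₂) := by
  obtain ⟨⟨o1, o2, o3⟩, ⟨o4, o5⟩, o6, o7⟩ := h.order
  obtain ⟨⟨p1, p2⟩, p3, p4⟩ := h.order_fixedPair hy
  obtain ⟨j1, j2, j3, j4⟩ := h.iter_succ
  have hltγ := h.leaf.lt
  have hlt : ccw y₁ y₂ < 1 / 2 := by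
    have b := ccw_base α y₁ y₂
    rw [if_pos (by linarith)] at b
    linarith [ccw_nonneg α y₁]
  have hne : dbl^[n + 1] c₂ ≠ c₂ :=
    h.leaf.iterate_ne_self ⟨by linarith, by linarith⟩ (Or.inr j2) (by lia)
  have hcd : 0 < ccw c₂ d₁ := by
    have b := ccw_base α c₂ d₁
    rw [if_pos (by linarith)] at b
    linarith
  obtain ⟨β, hβ, -, hno⟩ := exists_near (p := n + 1) hcd hne le_rfl
  have hβc : ccw α c₂ < ccw α β ∧ ccw α β < ccw α d₁ := by
    have b1 := ccw_base α c₂ β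
    have b2 := ccw_base α c₂ d₁
    rw [if_pos (by linarith)] at b2
    unfold Sb at hβ
    clear h
    constructor <;> grind [ccw_nonneg, ccw_lt_one]
  have hβy := (h.sb_fixedPair hy β).1.2 ⟨by linarith, by linarith⟩
  have hβab := (h.sb_fixedPair hy β).2.2 ⟨by linarith, by linarith⟩
  have hβγ : Sb α β γ := ⟨by linarith, by linarith⟩
  have hsides := h.fixedPair_mem hy hβy
  have hca : Sb y₁ c₂ β := by
    have b1 := ccw_base α y₁ c₂
    have b2 := ccw_base α y₁ β
    rw [if_pos (by linarith)] at b1 b2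
    constructor <;> linarith
  -- a fixed point between the arcs would have the wrong side before its return
  have hmin : ∀ z, dbl^[n + 1] z = z →
      (∀ i, dbl^[i] z ∈ symbolArc β (tuned m e κ (i % (n + 1)))) → ¬ Sb y₁ z y₂ := by
    intro z hz hzs hsb
    have hz' := (h.sb_fixedPair hy z).1.1 hsb
    have hcm := h.mem_arc_iff z
    rcases le_or_gt (ccw α z) (ccw α c₂) with hc | hc
    · have := h.eq_fixed_left hy (hcm.1.2 ⟨by linarith, hc⟩) hz
      rw [this] at hz'
      exact lt_irrefl _ hz'.1
    rcases le_or_gt (ccw α d₁) (ccw α z) with hd | hd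
    · have := h.eq_fixed_right hy (hcm.2.2 ⟨hd, by linarith⟩) hz
      rw [this] at hz'
      exact lt_irrefl _ hz'.2
    have hord : ccw c₂ z ≤ ccw c₂ d₁ := by
      have b1 := ccw_base α c₂ z
      have b2 := ccw_base α c₂ d₁
      rw [if_pos (by linarith)] at b1 b2
      linarith
    rw [← ccw_le_iter_iff (n := n) (β := β) (κ := tuned m e κ)
      (h.mem_tuned (Or.inl le_rfl) hβab) (fun i hi => ?_)
      (h.mem_tuned (Or.inr (by rw [ccw_self]; exact ccw_nonneg _ _)) hβab)] at hord
    · have hlen : ccw (dbl^[n] c₂) (dbl^[n] d₁) < 1 / 2 := by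
        rw [h.pair.c₂_iter, h.pair.d₁_iter]
        have b := ccw_base (sideBase α x) (sideBase γ x) (sideBase α (!x))
        rw [h.leaf.ccw_sideBase, sideBase_not, ccw_self_add_oneHalf, if_pos (by linarith)] at b
        rw [sideBase_not, b]
        linarith [h.leaf.pos]
      have hL := h.leaf.lobe_of_arc h.left_lobe_last.2.2.1 h.left_lobe_last.2.2.2 hlen hord
      have h1 := h.leaf.mem_of_lobe hβγ hL
      have h2 := hzs n
      rw [Nat.mod_eq_of_lt (by lia), h.tuned_last] at h2
      have := symbolArc_unique h1 h2
      simp at this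
    · have := hzs i
      rwa [Nat.mod_eq_of_lt (by lia)] at this
  obtain ⟨r, hr, hQ⟩ := exists_isParamLeaf_of_fixed_arc (t := n + 1) (a := c₂)
    (u := fun i => tuned m e κ (i % (n + 1))) (by lia) (fun i => by simp) hy.left hy.right
    (fun i => (hsides i).1) (fun i => (hsides i).2) hlt hca hβy
    (fun i hi => by
      rw [Nat.mod_eq_of_lt (by lia)]
      exact h.mem_tuned (Or.inl le_rfl) hβab i (by lia))
    hne (fun z hz => (hno z hz).1) hmin
  have hrn : n < r := by
    obtain ⟨f, μ, hD⟩ := exists_leaf_of_lt hQ hlt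
    refine h.lt_period hD p2 (by linarith) fun i hi => ?_
    have h1 := (hsides i).1
    rw [Nat.mod_eq_of_lt (by lia)] at h1
    exact symbolArc_unique (hD.mem hβy (Or.inl rfl) i) h1
  obtain rfl : r = n + 1 := by lia
  exact hQ

end VisiblePair

/-! ### The leaf between the two chords -/

/-- The preimages of `y` are the ends of its diameter, so they have the symbol `*`. -/
lemma notMem_symbolArc {y z : Angle} (h : dbl z = y) (t : Bool) : z ∉ symbolArc y t := by
  intro hz
  rw [mem_symbolArc_iff] at hz
  have h1 := ccw_dbl (sideBase y t) z
  rw [dbl_sideBase, h, ccw_self, if_pos hz.2] at h1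
  linarith [hz.1]

namespace VisiblePair

variable {m q n : ℕ} {α γ a b r₁ r₂ c₁ c₂ d₁ d₂ : Angle} {e e' x : Bool} {κ κ' ω ρ : ℕ → Bool}
  {y₁ y₂ : Angle}

lemma separates_fixedPair (h : VisiblePair m q n α γ a b r₁ r₂ c₁ c₂ d₁ d₂ e e' x κ κ' ω ρ)
    (hy : FixedPair (n + 1) c₁ c₂ d₁ d₂ y₁ y₂) :
    Separates s(y₁, y₂) s(c₁, d₂) s(c₂, d₁) := by
  obtain ⟨⟨o1, o2, o3⟩, ⟨o4, o5⟩, o6, o7⟩ := h.order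
  obtain ⟨⟨p1, p2⟩, p3, p4⟩ := h.order_fixedPair hy
  refine separates_of_nested (o := α) p1.le p2.le o4 p3.le p4.le ?_ ?_ <;> rw [sym2_ne_iff] <;>
    rintro (⟨h1, h2⟩ | ⟨h1, h2⟩) <;> rw [h1] at p1 p2 <;> linarith

/-- The ends of a chord between the two chords of the pair lie in the two arcs. -/
lemma eq_or_eq_of_between (h : VisiblePair m q n α γ a b r₁ r₂ c₁ c₂ d₁ d₂ e e' x κ κ' ω ρ) {Q : Chord}
    (hQ : Between Q s(c₁, d₂) s(c₂, d₁)) {z : Angle} (hz : z ∈ Q) :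
    ccw c₁ z ≤ ccw c₁ c₂ ∨ ccw d₁ z ≤ ccw d₁ d₂ := by
  obtain ⟨⟨o1, o2, o3⟩, ⟨o4, o5⟩, o6, o7⟩ := h.order
  have hm := h.mem_arc_iff z
  obtain ⟨-, -, -, u, u', w, w', h1, h2, h3, h4, h5, h6, h7⟩ := hQ
  obtain ⟨h7, h8⟩ := h7 z hz
  rw [mem_closedArc] at h3 h4 h5 h6 h7 h8
  rcases Sym2.eq_iff.1 h1 with ⟨rfl, rfl⟩ | ⟨rfl, rfl⟩ <;>
    rcases Sym2.eq_iff.1 h2 with ⟨rfl, rfl⟩ | ⟨rfl, rfl⟩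
  · have b1 := ccw_base α c₂ c₁
    have b2 := ccw_base α c₂ d₁
    rw [if_neg (by linarith)] at b1
    rw [if_pos (by linarith)] at b2
    linarith [ccw_nonneg α c₁, ccw_lt_one α d₁]
  · have b1 := ccw_base α c₁ z
    have b2 := ccw_base α c₁ d₂
    have b3 := ccw_base α d₁ z
    have b4 := ccw_base α d₁ c₂
    rw [hm.1, hm.2]
    clear h
    grind [ccw_nonneg, ccw_lt_one]
  all_goals
    have b1 := ccw_base α d₂ c₂
    have b2 := ccw_base α d₂ c₁
    rw [if_neg (by linarith)] at b1 b2
    linarith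

/-- A leaf of period `n + 1` between the two chords has fixed points of `h^(n+1)` in the two arcs as
its ends, so it is unique. -/
theorem eq_of_between (h : VisiblePair m q n α γ a b r₁ r₂ c₁ c₂ d₁ d₂ e e' x κ κ' ω ρ)
    (hy : FixedPair (n + 1) c₁ c₂ d₁ d₂ y₁ y₂) {Q : Chord} (hQ : IsParamLeaf (n + 1) Q)
    (hQ' : Between Q s(c₁, d₂) s(c₂, d₁)) : Q = s(y₁, y₂) := by
  have key : ∀ z ∈ Q, z = y₁ ∨ z = y₂ := by
    intro z hz
    have hf := iterate_of_minimalPeriod (hQ.2.2 z hz)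
    exact (h.eq_or_eq_of_between hQ' hz).imp (fun h' => h.eq_fixed_left hy h' hf)
      (fun h' => h.eq_fixed_right hy h' hf)
  have hd := hQ.2.1.1
  induction Q using Sym2.ind with | _ z w
  rw [Sym2.mk_isDiag_iff] at hd
  rw [Sym2.eq_iff]
  rcases key z (by simp) with rfl | rfl <;> rcases key w (by simp) with rfl | rfl <;> tauto

/-- The kneading sequence of the leaf between the two chords. At the last place of each period there
is a preimage of the angle. -/
theorem kneading_fixedPair (h : VisiblePair m q n α γ a b r₁ r₂ c₁ c₂ d₁ d₂ e e' x κ κ' ω ρ)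
    (hy : FixedPair (n + 1) c₁ c₂ d₁ d₂ y₁ y₂) {v : List Bool} (hv : IsWordV m s(α, γ) v) {j k : ℕ}
    (hn : n + 1 = j * m + k) (hk0 : k ≠ 0) (hk : k < m) :
    HasKneading s(y₁, y₂)
      (wordThenRepeat [] (symWord (powWord v e j ++ v.take (k - 1)) ++ [none])) := by
  obtain ⟨hl, hv'⟩ := h.leaf.isWordV_iff.1 hv
  have hm := h.leaf.one_lt
  obtain ⟨⟨o1, o2, o3⟩, ⟨o4, o5⟩, o6, o7⟩ := h.order
  obtain ⟨⟨p1, p2⟩, p3, p4⟩ := h.order_fixedPair hy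
  have hlen : (symWord (powWord v e j ++ v.take (k - 1))).length = n := by
    rw [symWord, List.length_map, List.length_append, length_powWord (by lia) hl e j,
      List.length_take]
    lia
  intro y hyQ
  have hyN : dbl^[n + 1] y = y := by
    rcases Sym2.mem_iff.1 hyQ with rfl | rfl
    exacts [hy.left, hy.right]
  have hyarc : ccw c₁ y ≤ ccw c₁ c₂ ∨ ccw d₁ y ≤ ccw d₁ d₂ := by
    rcases Sym2.mem_iff.1 hyQ with rfl | rfl
    exacts [Or.inl hy.left_mem.2.le, Or.inr hy.right_mem.2.le]
  have hyab : Sb a y b := by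
    rw [(h.sb_fixedPair hy y).2]
    rcases Sym2.mem_iff.1 hyQ with rfl | rfl <;> constructor <;> linarith
  funext i
  have hi := Nat.mod_lt i (show n + 1 > 0 by lia)
  have e1 : dbl^[i] y = dbl^[i % (n + 1)] y :=
    ((show Function.IsPeriodicPt dbl (n + 1) y from hyN).iterate_mod_apply i).symm
  have e2 : kneading y i = kneading y (i % (n + 1)) := by unfold kneading; rw [e1]
  have e3 : (symWord (powWord v e j ++ v.take (k - 1)) ++ [none]).length = n + 1 := by
    rw [List.length_append, hlen]; rfl
  rw [e2, wordThenRepeat, if_neg (by simp), e3, List.length_nil, Nat.sub_zero,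
    List.getD_eq_getElem?_getD]
  generalize i % (n + 1) = l at hi
  by_cases hl' : l < n
  · rw [List.getElem?_append_left (by lia), symWord, List.getElem?_map,
      getElem?_powWord (by lia) hl hv' h.leaf.sym_add (by lia) (by lia),
      kneading_of_mem (h.mem_tuned hyarc hyab l hl')]
    rfl
  · obtain rfl : l = n := by lia
    rw [List.getElem?_append_right (by lia), hlen, Nat.sub_self, kneading_eq_none]
    · rfl
    · apply notMem_symbolArc
      rw [← Function.iterate_succ_apply' dbl, hyN]

lemma behind_fixedPair (h : VisiblePair m q n α γ a b r₁ r₂ c₁ c₂ d₁ d₂ e e' x κ κ' ω ρ)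
    (hy : FixedPair (n + 1) c₁ c₂ d₁ d₂ y₁ y₂) : Behind s(y₁, y₂) s(α, γ) := by
  obtain ⟨⟨o1, o2, o3⟩, ⟨o4, o5⟩, o6, o7⟩ := h.order
  obtain ⟨⟨p1, p2⟩, p3, p4⟩ := h.order_fixedPair hy
  rw [behind_mk h.leaf.lt]
  refine ⟨⟨by linarith, by linarith⟩, Or.inl ⟨by linarith, by linarith⟩⟩

end VisiblePair

/-! ### Visibility of the leaf -/

lemma sb_iff_of_lt {o x z : Angle} (h : ccw o x < ccw o z) (y : Angle) :
    Sb x y z ↔ ccw o x < ccw o y ∧ ccw o y < ccw o z := by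
  have b1 := ccw_base o x y
  have b2 := ccw_base o x z
  rw [if_pos h.le] at b2
  unfold Sb
  grind [ccw_nonneg, ccw_lt_one]

/-- The ends of a short chord that separates two nested chords in `[α, γ]`. -/
lemma nested_of_separates_of_lt {o x x' y y' z z' : Angle} (h1 : ccw o x ≤ ccw o y)
    (h2 : ccw o y < ccw o y') (h3 : ccw o y' ≤ ccw o x') (hx' : ccw o x' < 1 / 2)
    (hz : 0 < ccw z z') (hlt : ccw z z' < 1 / 2) (h : Separates s(z, z') s(x, x') s(y, y')) :
    ccw o x ≤ ccw o z ∧ ccw o z ≤ ccw o y ∧ ccw o y' ≤ ccw o z' ∧ ccw o z' ≤ ccw o x' := by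
  rcases nested_of_separates h1 h2 h3 (ccw_pos.1 hz).symm h with h4 | ⟨h4, h5, h6, h7⟩
  · exact h4
  · have b := ccw_base o z z'
    rw [if_neg (by linarith)] at b
    linarith [ccw_nonneg o z']

namespace Leaf

variable {m : ℕ} {α γ : Angle} {e : Bool} {κ : ℕ → Bool}

/-- No point of period dividing `m` behind the leaf has the itinerary of the leaf. -/
lemma not_mem_of_fixed (hS : Leaf m α γ e κ) {y β : Angle} (hβ : Sb α β γ) (hy : Sb α y γ)
    (hf : dbl^[m] y = y) (hs : ∀ i < m, dbl^[i] y ∈ symbolArc β (κ i)) : False := by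
  have hM : (2 : ℝ) ≤ 2 ^ m := by
    calc (2 : ℝ) = 2 ^ 1 := by norm_num
      _ ≤ 2 ^ m := pow_le_pow_right₀ (by norm_num) hS.one_lt.le
  rcases hS.near_of_mem hβ hy hs with h | h
  · have := ccw_iter_of_lt (n := m) (x := α) (y := y) (by linarith [ccw_lt_one α β])
    rw [hf, hS.iterate_eq (Or.inl rfl)] at this
    nlinarith [hy.1]
  · have := ccw_iter_of_lt (n := m) (x := y) (y := γ) (by linarith [ccw_lt_one β γ])
    rw [hf, hS.iterate_eq (Or.inr rfl)] at this
    have h0 : ccw y γ ≠ 0 := by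
      rw [Ne, ccw_eq_zero]
      rintro rfl
      exact lt_irrefl _ hy.2
    have := (ccw_nonneg y γ).lt_of_ne' h0
    nlinarith

end Leaf

namespace VisiblePair

variable {m q n : ℕ} {α γ a b r₁ r₂ c₁ c₂ d₁ d₂ : Angle} {e e' x : Bool} {κ κ' ω ρ : ℕ → Bool}
  {y₁ y₂ : Angle}

/-- The leaf between the two chords is visible from `s(α, γ)`. A leaf of smaller period that
separated them would follow the tuned sequence; it would either separate `s(a, b)` from `s(α, γ)` as
well, or have too small a period by `lt_period`. -/
theorem visible_fixedPair (h : VisiblePair m q n α γ a b r₁ r₂ c₁ c₂ d₁ d₂ e e' x κ κ' ω ρ)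
    (hy : FixedPair (n + 1) c₁ c₂ d₁ d₂ y₁ y₂)
    (hsep : ∀ p C, IsParamLeaf p C → ¬ Separates C s(α, γ) s(a, b)) :
    Visible s(α, γ) (n + 1) s(y₁, y₂) := by
  obtain ⟨⟨o1, o2, o3⟩, ⟨o4, o5⟩, o6, o7⟩ := h.order
  obtain ⟨⟨p1, p2⟩, p3, p4⟩ := h.order_fixedPair hy
  have hltγ := h.leaf.lt
  have hQ := h.isParamLeaf_fixedPair hy
  have hylt : ccw y₁ y₂ < 1 / 2 := by
    have b := ccw_base α y₁ y₂
    rw [if_pos (by linarith)] at b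
    linarith [ccw_nonneg α y₁]
  obtain ⟨g, ν, hQL⟩ := exists_leaf_of_lt hQ hylt
  have hnq := h.lt
  refine ⟨h.behind_fixedPair hy, fun p => ?_⟩
  -- a separating leaf of least period follows the tuned sequence
  induction p using Nat.strong_induction_on with
  | _ p ih =>
    intro C hC hp hCs
    obtain ⟨c, d, f, μ, rfl, hD⟩ := exists_leaf hC
    obtain ⟨-, k2, k3, k4⟩ := nested_of_separates_of_lt (o := α) (by rw [ccw_self]; exact ccw_nonneg _ _)
      (by linarith : ccw α y₁ < ccw α y₂) (by linarith) hltγ hD.pos hD.lt hCs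
    have hne : ∀ {z w : Angle}, (z = c ∨ z = d) → Function.minimalPeriod dbl w ≠ p → z ≠ w := by
      rintro z w hz hw rfl
      exact hw (hD.per z hz)
    have k2' : ccw α c < ccw α y₁ := lt_of_le_of_ne k2 fun h' =>
      hne (Or.inl rfl) (by rw [hQL.per y₁ (Or.inl rfl)]; lia) (ccw_inj h')
    have k3' : ccw α y₂ < ccw α d := lt_of_le_of_ne k3 fun h' =>
      hne (Or.inr rfl) (by rw [hQL.per y₂ (Or.inr rfl)]; lia) (ccw_inj h').symm
    have hβ : Sb c c₂ d := (sb_iff_of_lt (o := α) (by linarith) c₂).2 ⟨by linarith, by linarith⟩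
    have hβab : Sb a c₂ b := (sb_iff_of_lt (o := α) (by linarith) c₂).2 ⟨by linarith, by linarith⟩
    have hβγ : Sb α c₂ γ := ⟨by linarith, by linarith⟩
    -- a leaf that shares an end with `s(α, γ)` has its period and its itinerary
    have hcommon : ∀ z w, (z = c ∨ z = d) → (z = α ∨ z = γ) → (w = c ∨ w = d) → Sb α w γ → False := by
      intro z w hz hz' hw hwγ
      have hpm : p = m := by rw [← hD.per z hz, h.leaf.per z hz']
      subst hpm
      have hμ : ∀ i, μ i = κ i := fun i =>
        symbolArc_unique (hD.mem hβ hz i) (h.leaf.mem hβγ hz' i)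
      exact h.leaf.not_mem_of_fixed hβγ hwγ (hD.iterate_eq hw)
        fun i _ => by rw [← hμ i]; exact hD.mem hβ hw i
    have k1 : 0 < ccw α c := by
      rw [ccw_pos]
      rintro rfl
      rcases k4.lt_or_eq with k5 | k5
      · exact hcommon c d (by simp) (by simp) (by simp) ⟨by linarith, k5⟩
      · rw [ccw_inj k5] at hCs
        exact hCs.1.1 rfl
    have k4 : ccw α d < ccw α γ := by
      refine lt_of_le_of_ne k4 fun k5 => ?_
      rw [ccw_inj k5] at hcommon
      exact hcommon γ c (by simp) (by simp) (by simp) ⟨k1, by linarith⟩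
    rcases h.leaf.tuned_or_exists_separating hD k1 (by linarith) k4 with hμ | ⟨r, c', d', hr, hcd, l1, l2,
      l3, l4⟩
    swap
    · exact ih r hr _ hcd (by lia)
        (h.leaf.separates_of_order hQL l1 (by linarith) (by linarith) (by linarith) l4)
    by_cases hcase : ccw α c ≤ ccw α a ∧ ccw α b ≤ ccw α d
    · refine hsep p _ hC (h.leaf.separates_of_order h.leafB k1 ?_ (by linarith) ?_ k4)
      · exact lt_of_le_of_ne hcase.1 fun h' =>
          hne (Or.inl rfl) (by rw [h.leafB.per a (Or.inl rfl)]; lia) (ccw_inj h')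
      · exact lt_of_le_of_ne hcase.2 fun h' =>
          hne (Or.inr rfl) (by rw [h.leafB.per b (Or.inr rfl)]; lia) (ccw_inj h').symm
    · -- an end of `s(a, b)` outside the leaf determines the last symbol of its sequence
      have key : ∀ z, (z = a ∨ z = b) → Sb c d z → False := by
        intro z hz hcdz
        have hmem : ∀ i, dbl^[i] z ∈ symbolArc c₂ (tuned m e κ i) := fun i => by
          rw [← h.tuned_eq]; exact h.leafB.mem hβab hz i
        have h1 := hD.mem_pred_of_outside hβ hcdz
          (fun i hi => .of_mem (by rw [hμ i hi]; exact hmem i)) hβ.2.le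
        have h2 := symbolArc_unique h1 (hmem (p - 1))
        have := h.lt_period hD (by linarith) (by linarith) fun i hi => by
          by_cases hi' : i < p - 1
          · exact hμ i hi'
          · rw [show i = p - 1 by lia, hD.last, h2]
        lia
      have b1 := ccw_base α c d
      have b2 := ccw_base α c a
      have b3 := ccw_base α c b
      rw [if_pos (by linarith)] at b1
      rw [not_and_or, not_le, not_le] at hcase
      rcases hcase with hcase | hcase
      · refine key a (Or.inl rfl) ⟨hD.pos, ?_⟩
        rw [if_neg (by linarith)] at b2
        linarith [ccw_lt_one α d]
      · refine key b (Or.inr rfl) ⟨hD.pos, ?_⟩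
        rw [if_pos (by linarith)] at b3
        linarith

end VisiblePair

/-! ### Uniqueness among visible leaves -/

/-- A chord `s(X, Y)` that runs between two nested chords on one side of the diameter of `β`, and
does not cross the diameter, lies on the same side. -/
lemma side_eq_of_nested {β A C c d X Y : Angle} {t u : Bool} (hA : A ∈ symbolArc β t)
    (hC : C ∈ symbolArc β t) (hc : c ∈ symbolArc β t) (hd : d ∈ symbolArc β t)
    (hX : X ∈ symbolArc β u) (hY : Y ∈ symbolArc β u) (h1 : ccw A X < ccw A c)
    (h2 : ccw A c < ccw A d) (h3 : ccw A d < ccw A Y) (h4 : ccw A Y ≤ ccw A C) : u = t := by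
  by_contra hne
  have hu : u = !t := by revert hne; cases u <;> cases t <;> simp
  subst hu
  rw [mem_symbolArc_iff] at *
  rw [sideBase_not] at *
  generalize sideBase β t = o at *
  have g1 := ccw_base o (o + oneHalf) X
  have g2 := ccw_base o (o + oneHalf) Y
  rw [ccw_self_add_oneHalf] at g1 g2
  have b1 := ccw_base o A X
  have b2 := ccw_base o A c
  have b3 := ccw_base o A d
  have b4 := ccw_base o A Y
  have b5 := ccw_base o A C
  grind [ccw_nonneg, ccw_lt_one]

/-- Doubling preserves the order of nested chords on one side. -/
lemma nested_dbl {β A C c d X Y : Angle} {t : Bool} (hA : A ∈ symbolArc β t)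
    (hC : C ∈ symbolArc β t) (hc : c ∈ symbolArc β t) (hd : d ∈ symbolArc β t)
    (hX : X ∈ symbolArc β t) (hY : Y ∈ symbolArc β t) (h : (ccw A X < ccw A c ∧ ccw A c < ccw A d) ∧
      ccw A d < ccw A Y ∧ ccw A Y ≤ ccw A C) :
    (ccw (dbl A) (dbl X) < ccw (dbl A) (dbl c) ∧ ccw (dbl A) (dbl c) < ccw (dbl A) (dbl d)) ∧
      ccw (dbl A) (dbl d) < ccw (dbl A) (dbl Y) ∧ ccw (dbl A) (dbl Y) ≤ ccw (dbl A) (dbl C) := by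
  have key : ∀ {y z}, y ∈ symbolArc β t → z ∈ symbolArc β t →
      (ccw (dbl A) (dbl y) ≤ ccw (dbl A) (dbl z) ↔ ccw A y ≤ ccw A z) := fun hy hz =>
    ccw_le_dbl_iff (mem_symbolArc_iff.1 hA).2 (mem_symbolArc_iff.1 hy).2 (mem_symbolArc_iff.1 hz).2
  simp only [← not_le] at h ⊢
  rwa [key hc hX, key hd hc, key hY hd, not_le, not_le, not_le, key hY hC, ← not_le, ← not_le,
    ← not_le]

namespace VisiblePair

variable {m q n : ℕ} {α γ a b r₁ r₂ c₁ c₂ d₁ d₂ : Angle} {e e' x : Bool} {κ κ' ω ρ : ℕ → Bool}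
  {y₁ y₂ : Angle}

/-- The tuned sequence does not have the period of the leaf between the two chords. -/
lemma not_tuned_periodic (h : VisiblePair m q n α γ a b r₁ r₂ c₁ c₂ d₁ d₂ e e' x κ κ' ω ρ)
    (hy : FixedPair (n + 1) c₁ c₂ d₁ d₂ y₁ y₂)
    (hper : ∀ i, tuned m e κ (i + (n + 1)) = tuned m e κ i) : False := by
  obtain ⟨⟨o1, o2, o3⟩, ⟨o4, o5⟩, o6, o7⟩ := h.order
  obtain ⟨⟨p1, p2⟩, p3, p4⟩ := h.order_fixedPair hy
  have hβ := (h.sb_fixedPair hy c₂).1.2 ⟨p2, by linarith⟩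
  have hβab := (h.sb_fixedPair hy c₂).2.2 ⟨by linarith, by linarith⟩
  have hyab := (h.sb_fixedPair hy y₁).2.2 ⟨by linarith, by linarith⟩
  have hylt : ccw y₁ y₂ < 1 / 2 := by
    have b := ccw_base α y₁ y₂
    rw [if_pos (by linarith)] at b
    linarith [ccw_nonneg α y₁, h.leaf.lt]
  obtain ⟨g, ν, hQ⟩ := exists_leaf_of_lt (h.isParamLeaf_fixedPair hy) hylt
  have hP : (1 : ℝ) ≤ 2 ^ (q * m) := one_le_pow₀ (by norm_num)
  have hT : Function.Periodic (tuned m e κ) (n + 1) := hper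
  rcases h.leafB.near_of_mem hβab hyab fun i _ => by
      rw [h.tuned_eq, ← hT.map_mod_nat]; exact (h.fixedPair_mem hy hβ i).1 with h1 | h1
  · have h2 := ccw_iter_of_lt (n := q * m) (x := a) (y := y₁) (by linarith [ccw_lt_one a c₂])
    rw [h.leafB.iterate_eq (Or.inl rfl)] at h2
    have h3 : ccw a y₁ < ccw a (dbl^[q * m] y₁) := by
      refine lt_of_le_of_ne (by nlinarith [ccw_nonneg a y₁]) fun h4 => ?_
      have hqm : (2 : ℝ) ≤ 2 ^ (q * m) := by
        calc (2 : ℝ) = 2 ^ 1 := by norm_num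
          _ ≤ 2 ^ (q * m) := pow_le_pow_right₀ (by norm_num) h.leafB.one_lt.le
      nlinarith [hyab.1]
    refine hQ.out y₁ (Or.inl rfl) (q * m) ?_
    rw [sb_iff_of_lt (o := a)]
    · refine ⟨h3, ?_⟩
      have b1 := ccw_base α a c₂
      have b2 := ccw_base α a y₂
      rw [if_pos (by linarith)] at b1 b2
      linarith
    · have b1 := ccw_base α a y₁
      have b2 := ccw_base α a y₂
      rw [if_pos (by linarith)] at b1 b2
      linarith
  · have b1 := ccw_base α y₁ b
    have b2 := ccw_base α c₂ b
    rw [if_pos (by linarith)] at b1 b2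
    nlinarith [ccw_nonneg y₁ b]

/-- The first return of a visible leaf of greater period whose ends lie in the two arcs. -/
lemma nested_return (h : VisiblePair m q n α γ a b r₁ r₂ c₁ c₂ d₁ d₂ e e' x κ κ' ω ρ) {p : ℕ}
    {c d : Angle} {f : Bool} {μ : ℕ → Bool} (hD : Leaf p c d f μ)
    (hc : ccw α c₁ ≤ ccw α c ∧ ccw α c ≤ ccw α c₂) (hd : ccw α d₁ ≤ ccw α d ∧ ccw α d ≤ ccw α d₂)
    (hp : n + 1 < p) (hμ : μ n = κ n) :
    ccw α (dbl^[n + 1] c) < ccw α c ∧ ccw α d < ccw α (dbl^[n + 1] d) ∧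
      ccw α (dbl^[n + 1] d) ≤ ccw α γ := by
  obtain ⟨⟨o1, o2, o3⟩, ⟨o4, o5⟩, o6, o7⟩ := h.order
  have hca := (h.mem_arc_iff c).1.2 hc
  have hda := (h.mem_arc_iff d).2.2 hd
  have hfix : ∀ {z}, (z = c ∨ z = d) → ccw α (dbl^[n + 1] z) ≠ ccw α z := fun hz h' => by
    have h1 : Function.IsPeriodicPt dbl (n + 1) _ := ccw_inj h'
    have h2 := h1.minimalPeriod_le (by lia)
    rw [hD.per _ hz] at h2
    lia
  -- points of the arc behind the leaf in every position
  have hex : ∀ s, ccw α c < s → s < ccw α d → ∃ β, ccw α β = s := fun s h1 h2 =>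
    ⟨α + (s : Angle), ccw_add_of_lt α (by linarith [ccw_nonneg α c]) (by linarith [ccw_lt_one α d])⟩
  have hside : ∀ β, ccw α c < ccw α β → ccw α β < ccw α d →
      ccw α (dbl^[n + 1] c) ≤ ccw α β ∧ ccw α β ≤ ccw α (dbl^[n + 1] d) := by
    intro β h1 h2
    have hβ : Sb c β d := (sb_iff_of_lt (by linarith) β).2 ⟨h1, h2⟩
    have hl := fun z => h.mem_last_iff (z := z) (β := β) (by linarith)
    constructor <;> by_contra hcon
    · have := symbolArc_unique (((hl c).1 hca).2 (by linarith)) (hD.mem hβ (Or.inl rfl) n)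
      rw [hμ] at this
      simp at this
    · have := symbolArc_unique (((hl d).2 hda).2 (by linarith)) (hD.mem hβ (Or.inr rfl) n)
      rw [hμ] at this
      simp at this
  refine ⟨lt_of_le_of_ne ?_ (hfix (Or.inl rfl)), lt_of_le_of_ne ?_ (hfix (Or.inr rfl)).symm, ?_⟩
  · by_contra hcon
    obtain ⟨s, h1, h2⟩ := exists_between (lt_min (not_le.1 hcon) (show ccw α c < ccw α d by linarith))
    obtain ⟨β, rfl⟩ := hex s h1 (h2.trans_le (min_le_right _ _))
    linarith [(hside β h1 (h2.trans_le (min_le_right _ _))).1, min_le_left (ccw α (dbl^[n + 1] c))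
      (ccw α d)]
  · by_contra hcon
    obtain ⟨s, h1, h2⟩ := exists_between (max_lt (not_le.1 hcon) (show ccw α c < ccw α d by linarith))
    obtain ⟨β, rfl⟩ := hex s ((le_max_right _ _).trans_lt h1) h2
    linarith [(hside β ((le_max_right _ _).trans_lt h1) h2).2, le_max_left (ccw α (dbl^[n + 1] d))
      (ccw α c)]
  · have h1 := mul_le_mul_of_nonneg_left hda (show (0 : ℝ) ≤ 2 ^ (n + 1) by positivity)
    rw [h.pair.ccw_d, mul_div_cancel₀ _ (by positivity)] at h1
    rw [(h.iter_right hda).1]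
    exact h1

/-- A visible leaf that separates the two chords is the leaf between them. If its period were
greater than `n + 1`, then its first return would be a chord between it and `s(α, γ)`, and this
order would persist until either the last iterate of the leaf or the next return of `s(α, γ)`; the
former contradicts the position of the last iterate, the latter makes the tuned sequence invariant
under the shift by `n + 1`. -/
theorem eq_of_visible (h : VisiblePair m q n α γ a b r₁ r₂ c₁ c₂ d₁ d₂ e e' x κ κ' ω ρ)
    (hy : FixedPair (n + 1) c₁ c₂ d₁ d₂ y₁ y₂) {p : ℕ} {Q : Chord} (hQ : IsParamLeaf p Q)
    (hvis : Visible s(α, γ) p Q) (hsep : Separates Q s(c₁, d₂) s(c₂, d₁)) : Q = s(y₁, y₂) := by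
  obtain ⟨⟨o1, o2, o3⟩, ⟨o4, o5⟩, o6, o7⟩ := h.order
  have hltγ := h.leaf.lt
  obtain ⟨c, d, f, μ, rfl, hD⟩ := exists_leaf hQ
  obtain ⟨k1, k2, k3, k4⟩ := nested_of_separates_of_lt (o := α) (by linarith) o4 (by linarith)
    (by linarith) hD.pos hD.lt hsep
  obtain ⟨j1, j2, j3, j4⟩ := h.iter_succ
  have hp0 : 0 < p := by have := hD.one_lt; lia
  have hcne : ∀ {z w}, (z = c ∨ z = d) → Sb α w γ → (dbl^[n + 1] w = α ∨ dbl^[n + 1] w = γ) →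
      ccw α z ≠ ccw α w := by
    intro z w hz hw hwN h'
    rw [ccw_inj h'] at hz
    exact h.leaf.iterate_ne_self hw hwN hp0 (hD.iterate_eq hz)
  have k2' := lt_of_le_of_ne k2 (hcne (Or.inl rfl) ⟨by linarith, by linarith⟩ (Or.inr j2))
  have hcd : ccw α c < ccw α d := by linarith
  have hμ : ∀ i < p - 1, μ i = tuned m e κ i := by
    rcases h.leaf.tuned_or_exists_separating hD (by linarith) hcd (by linarith) with hμ |
      ⟨r, c', d', hr, hcd', l1, l2, l3, l4⟩
    · exact hμ
    · exact absurd (h.leaf.separates_of_order hD l1 l2 hcd l3 l4) (hvis.2 r _ hcd' hr)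
  have hβ : Sb c c₂ d := (sb_iff_of_lt hcd c₂).2 ⟨k2', by linarith⟩
  have hβab : Sb a c₂ b := (sb_iff_of_lt (o := α) (by linarith) c₂).2 ⟨by linarith, by linarith⟩
  have hβγ : Sb α c₂ γ := ⟨by linarith, by linarith⟩
  have hca := (h.mem_arc_iff c).1.2 ⟨k1, k2⟩
  have hμn : ∀ i < n, μ i = tuned m e κ i := fun i hi =>
    symbolArc_unique (hD.mem hβ (Or.inl rfl) i) (h.mem_tuned (Or.inl hca) hβab i hi)
  have hnp : n < p := by
    by_contra hcon
    have := h.lt_period hD k2' (by linarith) fun i hi => hμn i (by lia)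
    lia
  rcases eq_or_ne p (n + 1) with rfl | hpn
  · exact h.eq_of_between hy hQ hsep.1
  exfalso
  obtain ⟨x1, x2, x3⟩ := h.nested_return hD ⟨k1, k2⟩ ⟨k3, k4⟩ (by lia)
    (by rw [hμ n (by lia), h.tuned_last])
  -- the leaf and its first return stay nested as long as `s(α, γ)` and the leaf are together
  have side : ∀ i, i < m - 1 → n + 1 + i ≤ p - 1 →
      (∀ z, (z = α ∨ z = γ ∨ z = c ∨ z = d) → dbl^[i] z ∈ symbolArc c₂ (κ i)) ∧
      ∀ z, (z = c ∨ z = d) → dbl^[i] (dbl^[n + 1] z) ∈ symbolArc c₂ (μ (n + 1 + i)) := by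
    intro i hi hip
    constructor
    · rintro z (hz | hz | hz | hz)
      · exact h.leaf.mem hβγ (Or.inl hz) i
      · exact h.leaf.mem hβγ (Or.inr hz) i
      · rw [← tuned_of_lt (e := e) (κ := κ) (show i + 1 < m by lia), ← hμ i (by lia)]
        exact hD.mem hβ (Or.inl hz) i
      · rw [← tuned_of_lt (e := e) (κ := κ) (show i + 1 < m by lia), ← hμ i (by lia)]
        exact hD.mem hβ (Or.inr hz) i
    · intro z hz
      rw [← Function.iterate_add_apply, Nat.add_comm i]
      exact hD.mem hβ hz _
  have nest : ∀ i, i ≤ m - 1 → n + 1 + i ≤ p →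
      (ccw (dbl^[i] α) (dbl^[i] (dbl^[n + 1] c)) < ccw (dbl^[i] α) (dbl^[i] c) ∧
        ccw (dbl^[i] α) (dbl^[i] c) < ccw (dbl^[i] α) (dbl^[i] d)) ∧
      ccw (dbl^[i] α) (dbl^[i] d) < ccw (dbl^[i] α) (dbl^[i] (dbl^[n + 1] d)) ∧
      ccw (dbl^[i] α) (dbl^[i] (dbl^[n + 1] d)) ≤ ccw (dbl^[i] α) (dbl^[i] γ) := by
    intro i
    induction i with
    | zero => exact fun _ _ => ⟨⟨x1, hcd⟩, x2, x3⟩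
    | succ i ih =>
      intro hi hip
      have hn := ih (by lia) (by lia)
      obtain ⟨s1, s2⟩ := side i (by lia) (by lia)
      have hu := side_eq_of_nested (s1 α (by simp)) (s1 γ (by simp)) (s1 c (by simp))
        (s1 d (by simp)) (s2 c (by simp)) (s2 d (by simp)) hn.1.1 hn.1.2 hn.2.1 hn.2.2
      rw [hu] at s2
      simp only [Function.iterate_succ_apply']
      simp only [← Function.iterate_succ_apply' dbl n]
      exact nested_dbl (s1 α (by simp)) (s1 γ (by simp)) (s1 c (by simp)) (s1 d (by simp))
        (s2 c (by simp)) (s2 d (by simp)) hn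
  have hsame : ∀ i, i < m - 1 → n + 1 + i ≤ p - 1 → μ (n + 1 + i) = κ i := by
    intro i hi hip
    obtain ⟨s1, s2⟩ := side i hi hip
    obtain ⟨⟨n1, n2⟩, n3, n4⟩ := nest i hi.le (by lia)
    exact side_eq_of_nested (s1 α (by simp)) (s1 γ (by simp)) (s1 c (by simp))
      (s1 d (by simp)) (s2 c (by simp)) (s2 d (by simp)) n1 n2 n3 n4
  by_cases hE : p - 1 - (n + 1) < m - 1
  · -- the return is the preimage of the leaf with the last symbol
    obtain ⟨i, hi⟩ : ∃ i, n + 1 + i = p - 1 := ⟨p - 1 - (n + 1), by lia⟩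
    have h1 := hsame i (by lia) (by lia)
    obtain ⟨⟨n1, n2⟩, n3, n4⟩ := nest i (by lia) (by lia)
    rw [hi, hD.last, ← tuned_of_lt (e := e) (κ := κ) (show i + 1 < m by lia), ← hμ i (by lia)] at h1
    simp only [← Function.iterate_add_apply, Nat.add_comm i, hi] at n1 n2 n3
    have h2 := hD.side_ne c (Or.inl rfl) i (by rw [← h1]; simp)
    have h3 := hD.pred
    have b1 := ccw_base (dbl^[i] α) (dbl^[p - 1] c) (dbl^[i] c)
    have b2 := ccw_base (dbl^[i] α) (dbl^[p - 1] c) (dbl^[p - 1] d)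
    rw [if_pos (by linarith)] at b1 b2
    rcases h2 with h2 | h2 <;> linarith
  · refine h.not_tuned_periodic hy (eq_shift_of_window (t := m) (tuned_add m e h.leaf.sym_add)
      (fun i hi => ?_) (by have := h.leaf.one_lt; lia))
    rw [Nat.add_comm, ← hμ _ (by lia), hsame i hi (by lia), tuned_of_lt (by lia)]

end VisiblePair

end QuadLam

open QuadLam in
theorem corollary2 (m q j k : ℕ) (S B R S₁ S₂ : Chord) (v : List Bool) (e : Bool)
    (hS : IsParamLeaf m S) (hv : IsWordV m S v) (he : IsSymbolE m S e)
    (hq : 2 ≤ q) (hB : IsParamLeaf (q * m) B) (hBS : ImmediatelyVisible S B)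
    (hR : IsRB m S q B R)
    (hpair : IsDynamicPair m S v S₁ S₂) (hstep : IsStep S S₁ S₂ (j * m + k))
    (hvis : PairVisible m S v R S₁ S₂ (j * m + k))
    (hn : 2 ≤ j * m + k) (hj : j < q) (hk : k < m) :
    ((j = q - 2 ∨ j = q - 1) ∧ k ≠ 0) ∧
    (HasKneading S₁
        (wordThenRepeat (symWord (powWord v e j ++ v.take k)) (symWord (v ++ [!e]))) ∧
      HasKneading S₂
        (wordThenRepeat
          (symWord (powWord v e j ++ v.take (k - 1) ++ [!(v.getD (k - 1) false)]))
          (symWord (v ++ [!e])))) ∧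
    ∃ Q : Chord,
      (IsParamLeaf (j * m + k) Q ∧ Between Q S₁ S₂) ∧
      (∀ Q', IsParamLeaf (j * m + k) Q' → Between Q' S₁ S₂ → Q' = Q) ∧
      HasKneading Q
        (wordThenRepeat [] (symWord (powWord v e j ++ v.take (k - 1)) ++ [none])) ∧
      (Visible S (j * m + k) Q ∧ Separates Q S₁ S₂) ∧
      ∀ p Q', IsParamLeaf p Q' → Visible S p Q' → Separates Q' S₁ S₂ → Q' = Q := by
  obtain ⟨⟨hk0, hqj⟩, n, α, γ, a, b, r₁, r₂, c₁, c₂, d₁, d₂, e', e'', x, κ, κ', ω, ρ, hn',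
    rfl, rfl, rfl, rfl, h⟩ := exists_visiblePair hS hv hq hB hBS hR hpair hstep hvis hn hj hk
  obtain rfl := h.leaf.eq_of_isSymbolE he
  obtain ⟨y₁, y₂, hy⟩ := h.exists_fixedPair
  rw [← hn']
  refine ⟨⟨by lia, hk0⟩, h.kneading_pair hv hn' hk0 hk, s(y₁, y₂),
    ⟨h.isParamLeaf_fixedPair hy, (h.separates_fixedPair hy).1⟩, fun _ => h.eq_of_between hy,
    h.kneading_fixedPair hy hv hn' hk0 hk,
    ⟨h.visible_fixedPair hy hBS.2, h.separates_fixedPair hy⟩, fun _ _ => h.eq_of_visible hy⟩
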